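/- **Setting.** Let $\mathcal H$ (system) and $\mathcal K$ (reservoir) be complex Hilbert spaces and let $B_1(\cdot)$ denote the trace-class operators with the trace norm $\|\cdot\|_1$. *Coupling.* Let $I$ be countable, $S_\alpha=S_\alpha^\dagger\in B(\mathcal H)$, $R_\alpha=R_\alpha^\dagger\in B(\mathcal K)$ for $\alpha\in I$, with $\sum_\alpha\|S_\alpha\|\|R_\alpha\|<\infty$, and $H_I=\lambda\sum_\alpha S_\alpha\otimes R_\alpha$ with $\lambda\in\mathbb R$. *Reservoir.* Let $H_R$ be a self-adjoint (possibly unbounded) operator on $\mathcal K$, and $\omega$ a density operator on $\mathcal K$ that commutes with $e^{-isH_R}$ for all $s$. Put $R_\alpha(s)=e^{isH_R}R_\alpha e^{-isH_R}$ and $r_{\alpha\beta}(s)=\operatorname{tr}(\omega R_\alpha(s)R_\beta)$. The reservoir satisfies Davies' conditions for the weak-coupling limit: $\operatorname{tr}(\omega R_\alpha)=0$ and $r_{\alpha\beta}\in L^1(\mathbb R)$ for all $\alpha,\beta$; and, with $\mathsf R^{+}_\alpha(s)X=R_\alpha(s)X$, $\mathsf R^{-}_\alpha(s)X=XR_\alpha(s)$,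 $QX=X-\operatorname{tr}(X)\,\omega$ and $$m_n(\theta)=\int_{\theta\ge s_1\ge\dots\ge s_n\ge0=s_{n+1}}\ \sum_{\alpha_1,\dots,\alpha_{n+1}}\ \sum_{e_i=\pm}\Big(\prod_{i=1}^{n+1}\|S_{\alpha_i}\|\Big)\Big|\operatorname{tr}\big(\mathsf R^{e_1}_{\alpha_1}(s_1)\,Q\,\mathsf R^{e_2}_{\alpha_2}(s_2)\,Q\cdots Q\,\mathsf R^{e_{n+1}}_{\alpha_{n+1}}(s_{n+1})\,\omega\big)\Big|\,ds ,$$ there are constants $c_n$ such that $\sum_n c_nz^n$ converges for all $z\in\mathbb R$ and $m_n(\theta)\le c_n\theta^{(n-1)/2}$ for all $n\ge1$, $\theta>0$; and $\theta^{-(n-1)/2}m_n(\theta)\to0$ as $\theta\to\infty$ for all $n\ge2$. *Driven system.* Let $T>0$, $\Omega=2\pi/T$, and let $t\mapsto H_S(t)=H_S(t)^\dagger\in B(\mathcal H)$ be piecewise continuous in norm with $H_S(t+T)=H_S(t)$. Fix $t_0\in\mathbb R$, and let $U_{t,t_0}$ be the propagator: $\frac{d}{dt}U_{t,t_0}=-iH_S(t)U_{t,t_0}$,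 $U_{t_0,t_0}=1$. Assume that the monodromy operator has a logarithm with pure point spectrum: $U_{t_0+T,t_0}=e^{-iT\bar H}$ with $\bar H\in B(\mathcal H)$ and $\bar H\phi_k=\epsilon_k\phi_k$ for an orthonormal basis $(\phi_k)$ and $\epsilon_k\in\mathbb R$ (if $\dim\mathcal H<\infty$, such an $\bar H$ always exists). Assume that the quasifrequencies $\{\omega\}=\{\epsilon_k-\epsilon_l\}$ are non-resonant: $\omega-\omega'+m\Omega\ne0$ for all quasifrequencies $\omega\ne\omega'$ and all $m\in\mathbb Z$. (Below, $\omega$ as a summation variable runs through the quasifrequencies.) Put $P_{t,t_0}=U_{t,t_0}e^{i\bar H(t-t_0)}$, let $S_\alpha(q)=\frac1T\int_{t_0}^{t_0+T}P_{t,t_0}^{-1}S_\alpha P_{t,t_0}\,e^{-iq\Omega(t-t_0)}dt$ for $q\in\mathbb Z$ be the Fourier coefficients of $P_{t,t_0}^{-1}S_\alpha P_{t,t_0}$, and let $S_\alpha(\omega,q)=\sum_{\epsilon_k-\epsilon_l=\omega}|\phi_k\rangle\langle\phi_k|S_\alpha(q)|\phi_l\rangle\langle\phi_l|$, i.e. the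 operator with matrix elements $\langle\phi_k,S_\alpha(\omega,q)\phi_l\rangle=\langle\phi_k,S_\alpha(q)\phi_l\rangle$ if $\epsilon_k-\epsilon_l=\omega$ and $0$ otherwise. Put $$\gamma_{\alpha\beta}(x)=\int_{-\infty}^\infty e^{-ixs}r_{\alpha\beta}(s)\,ds,\quad \Gamma_{\alpha\beta}(x)=\int_0^\infty e^{-ixs}r_{\alpha\beta}(s)\,ds,\quad \sigma_{\alpha\beta}=\tfrac1{2i}\big(\Gamma_{\alpha\beta}-\overline{\Gamma_{\beta\alpha}}\big).$$ Let $\mathcal U_{t,t_0}(\rho)=U_{t,t_0}\rho\,U_{t,t_0}^{-1}$ on $B_1(\mathcal H)$. **Theorem.** The propagator $U_{t,t_0}$ exists and is unitary, and the bounded operators $S_\alpha(\omega,q)$ exist. There are a self-adjoint $\delta H\in B(\mathcal H)$ and a time-independent bounded operator $\tilde{\mathcal L}$ on $B_1(\mathcal H)$ such that the following holds. 1. (GKLS form.) For every $x\in\mathbb R$ the matrix $[\gamma_{\alpha\beta}(x)]$ is positive semidefinite, $\delta H=\sum_{\alpha\beta}\sum_{\omega}\sum_{q\in\mathbb Z}\sigma_{\alpha\beta}(\omega+q\Omega)S_\alpha(\omega,q)^\dagger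 S_\beta(\omega,q)$ (strongly), and, with convergence in trace norm for each $\rho\in B_1(\mathcal H)$, $$\tilde{\mathcal L}(\rho)=-i[\delta H,\rho]+\sum_{\alpha\beta}\sum_{\omega}\sum_{q\in\mathbb Z}\gamma_{\alpha\beta}(\omega+q\Omega)\Big(S_\beta(\omega,q)\rho S_\alpha(\omega,q)^\dagger-\tfrac12\{S_\alpha(\omega,q)^\dagger S_\beta(\omega,q),\rho\}\Big).$$ The maps $e^{s\tilde{\mathcal L}}$, $s\ge0$, are completely positive and trace preserving. 2. (Master equation.) For every $\lambda\in\mathbb R$ put $\mathcal L_t=-i[H_S(t),\cdot\,]+\mathcal D_t$ with $\mathcal D_t=\mathcal U_{t,t_0}\circ\lambda^2\tilde{\mathcal L}\circ\mathcal U_{t,t_0}^{-1}$. The dynamical map generated by $\mathcal L_t$, i.e. the unique norm-continuous solution of $\frac d{dt}\Lambda_{t,t_0}=\mathcal L_t\Lambda_{t,t_0}$ (at the points of continuity of $t\mapsto\mathcal L_t$), $\Lambda_{t_0,t_0}=1$, is $$\Lambda_{t,t_0}=\mathcal U_{t,t_0}\circ e^{(t-t_0)\lambda^2\tilde{\mathcal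 L}} .$$ 3. (Weak-coupling limit.) Let $W^\lambda_{t,t_0}$ be the unitary evolution on $\mathcal H\otimes\mathcal K$ with Hamiltonian $H_S(t)\otimes1+1\otimes H_R+\lambda\sum_\alpha S_\alpha\otimes R_\alpha$ (the Schrödinger equation being understood in the interaction picture). It exists, the reduced dynamics $\Phi^\lambda_{t,t_0}(\rho)=\operatorname{tr}_{\mathcal K}\big(W^\lambda_{t,t_0}(\rho\otimes\omega)(W^{\lambda}_{t,t_0})^{\dagger}\big)$, $t\ge t_0$, is a completely positive trace preserving map on $B_1(\mathcal H)$, and for every $\rho\in B_1(\mathcal H)$ and $\tau>0$ $$\lim_{\lambda\to0,\ \lambda\neq 0}\ \sup_{t\ge t_0,\ \lambda^2(t-t_0)\le\tau}\big\|\Phi^\lambda_{t,t_0}(\rho)-\mathcal U_{t,t_0}\circ e^{(t-t_0)\lambda^2\tilde{\mathcal L}}(\rho)\big\|_1=0 .$$ -/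

import Mathlib

open scoped ENNReal Topology TensorProduct ComplexOrder
open MeasureTheory Filter Complex

noncomputable section

namespace OpenFloquet

/-- Bounded operators on `H`. -/
abbrev Op (H : Type*) [NormedAddCommGroup H] [InnerProductSpace ℂ H] := H →L[ℂ] H

/-! ## Trace-class operators -/

section TraceClass

variable {H : Type*} [NormedAddCommGroup H] [InnerProductSpace ℂ H]

/-- The set of all finite sums `∑ |⟨eᵢ, A fᵢ⟩|`, where `e` and `f` are orthonormal. -/
def traceSums (A : Op H) : Set ℝ :=
  {r | ∃ (n : ℕ) (e f : Fin n → H), Orthonormal ℂ e ∧ Orthonormal ℂ f ∧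
    r = ∑ i, ‖inner ℂ (e i) (A (f i))‖}

lemma zero_mem_traceSums (A : Op H) : 0 ∈ traceSums A :=
  ⟨0, Fin.elim0, Fin.elim0, ⟨fun i => i.elim0, fun i => i.elim0⟩,
    ⟨fun i => i.elim0, fun i => i.elim0⟩, by simp⟩

/-- The trace norm `‖A‖₁ = tr |A|`, as the supremum of `∑ |⟨eᵢ, A fᵢ⟩|` over finite orthonormal
systems (meaningful if `A` is trace class). -/
def traceNorm (A : Op H) : ℝ := sSup (traceSums A)

lemma traceNorm_nonneg (A : Op H) : 0 ≤ traceNorm A := by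
  apply Real.sSup_nonneg
  rintro _ ⟨n, e, f, -, -, rfl⟩
  positivity

lemma traceSums_le_add {A B : Op H} (hA : BddAbove (traceSums A)) (hB : BddAbove (traceSums B))
    {r : ℝ} (hr : r ∈ traceSums (A + B)) : r ≤ traceNorm A + traceNorm B := by
  obtain ⟨n, e, f, he, hf, rfl⟩ := hr
  have h1 := le_csSup hA ⟨n, e, f, he, hf, rfl⟩
  have h2 := le_csSup hB ⟨n, e, f, he, hf, rfl⟩
  refine le_trans ?_ (add_le_add h1 h2)
  rw [← Finset.sum_add_distrib]
  refine Finset.sum_le_sum fun i _ => ?_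
  rw [add_apply, inner_add_right]
  exact norm_add_le _ _

lemma traceSums_smul_le {A : Op H} (hA : BddAbove (traceSums A)) (c : ℂ)
    {r : ℝ} (hr : r ∈ traceSums (c • A)) : r ≤ ‖c‖ * traceNorm A := by
  obtain ⟨n, e, f, he, hf, rfl⟩ := hr
  have h1 := le_csSup hA ⟨n, e, f, he, hf, rfl⟩
  refine le_trans (le_of_eq ?_) (mul_le_mul_of_nonneg_left h1 (norm_nonneg c))
  rw [Finset.mul_sum]
  refine Finset.sum_congr rfl fun i _ => ?_
  rw [smul_apply, inner_smul_right, norm_mul]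

variable (H) in
/-- The subspace of trace-class operators in `B(H)`. -/
def traceClassSubmodule : Submodule ℂ (Op H) where
  carrier := {A | BddAbove (traceSums A)}
  zero_mem' := by
    refine ⟨0, ?_⟩
    rintro _ ⟨n, e, f, -, -, rfl⟩
    simp
  add_mem' hA hB := ⟨_, fun _ hr => traceSums_le_add hA hB hr⟩
  smul_mem' c _ hA := ⟨_, fun _ hr => traceSums_smul_le hA c hr⟩

variable (H) in
/-- The Banach space `B₁(H)` of trace-class operators, with the trace norm. -/
def TraceClass : Type _ := traceClassSubmodule H

instance : AddCommGroup (TraceClass H) :=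
  inferInstanceAs (AddCommGroup (traceClassSubmodule H))

instance : Module ℂ (TraceClass H) :=
  inferInstanceAs (Module ℂ (traceClassSubmodule H))

variable (H) in
/-- The inclusion `B₁(H) → B(H)`. -/
def TraceClass.toOpₗ : TraceClass H →ₗ[ℂ] Op H := (traceClassSubmodule H).subtype

/-- The operator underlying an element of `B₁(H)`. -/
abbrev TraceClass.op (ρ : TraceClass H) : Op H := TraceClass.toOpₗ H ρ

lemma TraceClass.bdd (ρ : TraceClass H) : BddAbove (traceSums ρ.op) := ρ.2

lemma TraceClass.op_injective : Function.Injective (TraceClass.toOpₗ H) :=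
  Subtype.val_injective

lemma norm_inner_le_traceNorm {A : Op H} (hA : BddAbove (traceSums A)) (x y : H)
    (hx : ‖x‖ = 1) (hy : ‖y‖ = 1) : ‖inner ℂ x (A y)‖ ≤ traceNorm A := by
  refine le_csSup hA ⟨1, fun _ => x, fun _ => y, ?_, ?_, by simp⟩
  · exact ⟨fun _ => hx, fun i j hij => absurd (Subsingleton.elim i j) hij⟩
  · exact ⟨fun _ => hy, fun i j hij => absurd (Subsingleton.elim i j) hij⟩

instance : NormedAddCommGroup (TraceClass H) :=
  AddGroupNorm.toNormedAddCommGroup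
    { toFun := fun ρ => traceNorm ρ.op
      map_zero' := by
        refine le_antisymm (csSup_le ⟨0, zero_mem_traceSums _⟩ ?_) (traceNorm_nonneg _)
        rintro _ ⟨n, e, f, -, -, rfl⟩
        simp
      add_le' := fun ρ σ => by
        refine csSup_le ⟨0, zero_mem_traceSums _⟩ fun r hr => ?_
        rw [TraceClass.op, map_add] at hr
        exact traceSums_le_add ρ.bdd σ.bdd hr
      neg' := fun ρ => by
        have : traceSums (-ρ).op = traceSums ρ.op := by
          simp only [traceSums, TraceClass.op, map_neg, neg_apply, inner_neg_right, norm_neg]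
        rw [traceNorm, this, traceNorm]
      eq_zero_of_map_eq_zero' := fun ρ hρ => by
        apply TraceClass.op_injective
        rw [map_zero]
        ext y
        by_contra hne
        have hne' : ρ.op y ≠ 0 := hne
        have hy : y ≠ 0 := by
          rintro rfl
          simp at hne'
        have hn : ‖ρ.op y‖ ≠ 0 := norm_ne_zero_iff.2 hne'
        have hm : ‖y‖ ≠ 0 := norm_ne_zero_iff.2 hy
        have h := norm_inner_le_traceNorm ρ.bdd (((‖ρ.op y‖ : ℂ))⁻¹ • ρ.op y)
          (((‖y‖ : ℂ))⁻¹ • y) (by simp [norm_smul, hn]) (by simp [norm_smul, hm])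
        rw [hρ] at h
        have h0 := norm_le_zero_iff.1 h
        rw [map_smul, inner_smul_left, inner_smul_right] at h0
        simp [hn, hm] at h0 }

lemma TraceClass.norm_def (ρ : TraceClass H) : ‖ρ‖ = traceNorm ρ.op := rfl

instance : NormedSpace ℂ (TraceClass H) where
  norm_smul_le c ρ := by
    rw [TraceClass.norm_def, TraceClass.norm_def]
    refine csSup_le ⟨0, zero_mem_traceSums _⟩ fun r hr => ?_
    rw [TraceClass.op, map_smul] at hr
    exact traceSums_smul_le ρ.bdd c hr

/-- The trace `∑ ⟨bᵢ, A bᵢ⟩`, in an orthonormal basis (for trace-class `A` it does not depend on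
the basis). -/
def trace [CompleteSpace H] (A : Op H) : ℂ :=
  ∑' i, inner ℂ ((exists_hilbertBasis ℂ H).choose_spec.choose i)
    (A ((exists_hilbertBasis ℂ H).choose_spec.choose i))

/-! ### Multiplication by bounded operators -/

variable [CompleteSpace H]

lemma orthonormal_unitary {n : ℕ} {e : Fin n → H} (he : Orthonormal ℂ e) {u : Op H}
    (hu : u ∈ unitary (Op H)) : Orthonormal ℂ (fun i => u (e i)) := by
  have h : ∀ x y, inner ℂ (u x) (u y) = inner ℂ x y := fun x y => by
    rw [← ContinuousLinearMap.adjoint_inner_right, ← ContinuousLinearMap.star_eq_adjoint,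
      ← mul_apply_eq_comp, (Unitary.mem_iff.1 hu).1, one_apply_eq_self]
  rw [orthonormal_iff_ite] at he ⊢
  intro i j
  rw [h, he]

lemma traceSums_unitary_mul_mul {u v A : Op H} (hu : u ∈ unitary (Op H))
    (hv : v ∈ unitary (Op H)) : traceSums (u * A * v) ⊆ traceSums A := by
  rintro _ ⟨n, e, f, he, hf, rfl⟩
  refine ⟨n, fun i => star u (e i), fun i => v (f i),
    orthonormal_unitary he (Unitary.star_mem hu), orthonormal_unitary hf hv, ?_⟩
  refine Finset.sum_congr rfl fun i _ => ?_
  rw [ContinuousLinearMap.star_eq_adjoint, ContinuousLinearMap.adjoint_inner_left]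
  rfl

lemma traceClass_mul_mul (A B : Op H) :
    ∃ C : ℝ, ∀ ρ : TraceClass H, BddAbove (traceSums (A * ρ.op * B)) ∧
      traceNorm (A * ρ.op * B) ≤ C * ‖ρ‖ := by
  have base : ∀ u ∈ unitary (Op H), ∀ v ∈ unitary (Op H), ∀ ρ : TraceClass H,
      BddAbove (traceSums (u * ρ.op * v)) ∧ traceNorm (u * ρ.op * v) ≤ 1 * ‖ρ‖ := by
    intro u hu v hv ρ
    have hs := traceSums_unitary_mul_mul (A := ρ.op) hu hv
    refine ⟨ρ.bdd.mono hs, ?_⟩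
    rw [one_mul]
    exact csSup_le_csSup ρ.bdd ⟨0, zero_mem_traceSums _⟩ hs
  have step : ∀ u ∈ unitary (Op H), ∃ C : ℝ, ∀ ρ : TraceClass H,
      BddAbove (traceSums (u * ρ.op * B)) ∧ traceNorm (u * ρ.op * B) ≤ C * ‖ρ‖ := by
    intro u hu
    have hB : B ∈ Submodule.span ℂ (unitary (Op H) : Set (Op H)) := by
      rw [CStarAlgebra.span_unitary]
      trivial
    induction hB using Submodule.span_induction with
    | mem v hv => exact ⟨1, base u hu v hv⟩
    | zero =>
      refine ⟨0, fun ρ => ?_⟩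
      rw [mul_zero]
      exact ⟨(0 : TraceClass H).bdd, le_of_eq (by
        rw [zero_mul]; exact (norm_zero : ‖(0 : TraceClass H)‖ = 0))⟩
    | add x y _ _ hx hy =>
      obtain ⟨C, hC⟩ := hx
      obtain ⟨D, hD⟩ := hy
      refine ⟨C + D, fun ρ => ?_⟩
      rw [mul_add]
      refine ⟨⟨_, fun _ hr => traceSums_le_add (hC ρ).1 (hD ρ).1 hr⟩, ?_⟩
      refine (csSup_le ⟨0, zero_mem_traceSums _⟩ fun _ hr =>
        traceSums_le_add (hC ρ).1 (hD ρ).1 hr).trans ?_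
      rw [add_mul]
      exact add_le_add (hC ρ).2 (hD ρ).2
    | smul c x _ hx =>
      obtain ⟨C, hC⟩ := hx
      refine ⟨‖c‖ * C, fun ρ => ?_⟩
      rw [mul_smul_comm]
      refine ⟨⟨_, fun _ hr => traceSums_smul_le (hC ρ).1 c hr⟩, ?_⟩
      refine (csSup_le ⟨0, zero_mem_traceSums _⟩ fun _ hr =>
        traceSums_smul_le (hC ρ).1 c hr).trans ?_
      rw [mul_assoc ‖c‖]
      exact mul_le_mul_of_nonneg_left (hC ρ).2 (norm_nonneg c)
  have hA : A ∈ Submodule.span ℂ (unitary (Op H) : Set (Op H)) := by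
    rw [CStarAlgebra.span_unitary]
    trivial
  induction hA using Submodule.span_induction with
  | mem u hu => exact step u hu
  | zero =>
    refine ⟨0, fun ρ => ?_⟩
    rw [zero_mul, zero_mul]
    exact ⟨(0 : TraceClass H).bdd, le_of_eq (by
      rw [zero_mul]; exact (norm_zero : ‖(0 : TraceClass H)‖ = 0))⟩
  | add x y _ _ hx hy =>
    obtain ⟨C, hC⟩ := hx
    obtain ⟨D, hD⟩ := hy
    refine ⟨C + D, fun ρ => ?_⟩
    rw [add_mul, add_mul]
    refine ⟨⟨_, fun _ hr => traceSums_le_add (hC ρ).1 (hD ρ).1 hr⟩, ?_⟩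
    refine (csSup_le ⟨0, zero_mem_traceSums _⟩ fun _ hr =>
      traceSums_le_add (hC ρ).1 (hD ρ).1 hr).trans ?_
    rw [add_mul]
    exact add_le_add (hC ρ).2 (hD ρ).2
  | smul c x _ hx =>
    obtain ⟨C, hC⟩ := hx
    refine ⟨‖c‖ * C, fun ρ => ?_⟩
    rw [smul_mul_assoc, smul_mul_assoc]
    refine ⟨⟨_, fun _ hr => traceSums_smul_le (hC ρ).1 c hr⟩, ?_⟩
    refine (csSup_le ⟨0, zero_mem_traceSums _⟩ fun _ hr =>
      traceSums_smul_le (hC ρ).1 c hr).trans ?_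
    rw [mul_assoc ‖c‖]
    exact mul_le_mul_of_nonneg_left (hC ρ).2 (norm_nonneg c)

/-- The map `ρ ↦ A ρ B` on `B₁(H)`. -/
def sandwich (A B : Op H) : TraceClass H →L[ℂ] TraceClass H :=
  LinearMap.mkContinuousOfExistsBound
    { toFun := fun ρ => ⟨A * ρ.op * B, ((traceClass_mul_mul A B).choose_spec ρ).1⟩
      map_add' := fun ρ σ => by
        apply TraceClass.op_injective
        change A * (ρ + σ).op * B = A * ρ.op * B + A * σ.op * B
        rw [TraceClass.op, map_add, mul_add, add_mul]
      map_smul' := fun c ρ => by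
        apply TraceClass.op_injective
        change A * (c • ρ).op * B = c • (A * ρ.op * B)
        rw [TraceClass.op, map_smul, mul_smul_comm, smul_mul_assoc] }
    ⟨(traceClass_mul_mul A B).choose, fun ρ => ((traceClass_mul_mul A B).choose_spec ρ).2⟩

lemma sandwich_op (A B : Op H) (ρ : TraceClass H) : (sandwich A B ρ).op = A * ρ.op * B := rfl

/-- The commutator map `ρ ↦ [A, ρ]` on `B₁(H)`. -/
def commutator (A : Op H) : TraceClass H →L[ℂ] TraceClass H := sandwich A 1 - sandwich 1 A

/-- The anticommutator map `ρ ↦ {A, ρ}` on `B₁(H)`. -/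
def anticommutator (A : Op H) : TraceClass H →L[ℂ] TraceClass H := sandwich A 1 + sandwich 1 A

/-- Conjugation `ρ ↦ U ρ U†` on `B₁(H)`. -/
def conjBy (U : Op H) : TraceClass H →L[ℂ] TraceClass H := sandwich U (star U)

/-- Complete positivity: for every `n`, the map `Φ ⊗ id` preserves positivity of `n × n` block
operators with entries in `B₁(H)`. -/
def IsCompletelyPositive (Φ : TraceClass H →L[ℂ] TraceClass H) : Prop :=
  ∀ (n : ℕ) (X : Fin n → Fin n → TraceClass H),
    (∀ ψ : Fin n → H, 0 ≤ ∑ i, ∑ j, inner ℂ (ψ i) ((X i j).op (ψ j))) →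
    ∀ ψ : Fin n → H, 0 ≤ ∑ i, ∑ j, inner ℂ (ψ i) ((Φ (X i j)).op (ψ j))

/-- Completely positive and trace preserving maps on `B₁(H)`. -/
def IsCPTP (Φ : TraceClass H →L[ℂ] TraceClass H) : Prop :=
  IsCompletelyPositive Φ ∧ ∀ ρ : TraceClass H, trace (Φ ρ).op = trace ρ.op

/-- Density operators. -/
def IsDensity (ρ : TraceClass H) : Prop := ρ.op.IsPositive ∧ trace ρ.op = 1

end TraceClass

/-! ## The driven system: propagator and Floquet data -/

section System

variable {H : Type*} [NormedAddCommGroup H] [InnerProductSpace ℂ H] [CompleteSpace H]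

/-- Piecewise continuity: locally finitely many discontinuities, all with one-sided limits. -/
def PiecewiseContinuous {E : Type*} [TopologicalSpace E] (f : ℝ → E) : Prop :=
  ∃ D : Set ℝ, (∀ a b, (D ∩ Set.Icc a b).Finite) ∧ (∀ t ∉ D, ContinuousAt f t) ∧
    ∀ t ∈ D, (∃ l, Tendsto f (𝓝[<] t) (𝓝 l)) ∧ ∃ r, Tendsto f (𝓝[>] t) (𝓝 r)

/-- `t ↦ X t` is the continuous solution of `X' = A_t X`, `X t₀ = 1`; the equation is required at the
points of continuity of the coefficient `A`. -/
def IsFundamentalSolution {𝔸 : Type*} [NormedRing 𝔸] [NormedSpace ℝ 𝔸]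
    (A : ℝ → 𝔸) (t₀ : ℝ) (X : ℝ → 𝔸) : Prop :=
  Continuous X ∧ X t₀ = 1 ∧ ∀ t, ContinuousAt A t → HasDerivAt X (A t * X t) t

/-- The propagator `U_{t,t₀}`, i.e. the time-ordered exponential of `-i ∫ H_S`. -/
def propagator (HS : ℝ → Op H) (t₀ : ℝ) : ℝ → Op H :=
  Classical.epsilon (IsFundamentalSolution (fun t => (-I) • HS t) t₀)

/-- The averaged Hamiltonian `Hbar`, a logarithm of the monodromy operator
`U_{t₀+T,t₀} = exp(-i T Hbar)`, with orthonormal eigenbasis `φ` and quasienergies `ε`. -/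
structure IsAveragedHamiltonian {κ : Type*} (HS : ℝ → Op H) (t₀ T : ℝ) (Hbar : Op H)
    (φ : HilbertBasis κ ℂ H) (ε : κ → ℝ) : Prop where
  eigen : ∀ k, Hbar (φ k) = (ε k : ℂ) • φ k
  monodromy : propagator HS t₀ (t₀ + T) = NormedSpace.exp ((-I * T) • Hbar)

/-- The periodic part `P_{t,t₀} = U_{t,t₀} exp(i (t - t₀) Hbar)` of the propagator. -/
def periodicPart (HS : ℝ → Op H) (t₀ : ℝ) (Hbar : Op H) (t : ℝ) : Op H :=
  propagator HS t₀ t * NormedSpace.exp ((I * (t - t₀)) • Hbar)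

/-- The Fourier coefficient `S(q)` of `t ↦ P_{t,t₀}⁻¹ S P_{t,t₀}` at frequency `q Ω`,
`Ω = 2π / T`. -/
def fourierComponent (HS : ℝ → Op H) (t₀ T : ℝ) (Hbar S : Op H) (q : ℤ) : Op H :=
  (1 / T : ℂ) • ∫ t in t₀..(t₀ + T), exp (-I * (q * (2 * Real.pi / T) * (t - t₀))) •
    (star (periodicPart HS t₀ Hbar t) * S * periodicPart HS t₀ Hbar t)

/-- `X = ∑_{ε_k - ε_l = w} P(φ_k) A P(φ_l)`, expressed in the basis `φ`. -/
def IsBohrComponent {κ : Type*} (φ : HilbertBasis κ ℂ H) (ε : κ → ℝ) (A : Op H) (w : ℝ)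
    (X : Op H) : Prop :=
  (∀ k l, ε k - ε l = w → inner ℂ (φ k) (X (φ l)) = inner ℂ (φ k) (A (φ l))) ∧
  ∀ k l, ε k - ε l ≠ w → inner ℂ (φ k) (X (φ l)) = 0

/-- The Bohr-Floquet quasifrequencies. -/
def quasifrequencies {κ : Type*} (ε : κ → ℝ) : Set ℝ := {w | ∃ k l, w = ε k - ε l}

end System

/-! ## The reservoir -/

section Reservoir

variable {K : Type*} [NormedAddCommGroup K] [InnerProductSpace ℂ K] [CompleteSpace K]

/-- `V t = exp(-i t A)`, the strongly continuous unitary group of the (possibly unbounded)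
self-adjoint operator `A`. -/
structure IsUnitaryGroupOf (A : K →ₗ.[ℂ] K) (V : ℝ → Op K) : Prop where
  unitary : ∀ t, V t ∈ unitary (Op K)
  zero : V 0 = 1
  add : ∀ s t, V (s + t) = V s * V t
  continuous : ∀ x, Continuous fun t => V t x
  deriv : ∀ x : A.domain, HasDerivAt (fun t => V t x) (-I • A x) 0

/-- The freely evolved operator `exp(i s H_R) A exp(-i s H_R)`. -/
def freeEvolve (V : ℝ → Op K) (A : Op K) (s : ℝ) : Op K := star (V s) * A * V s

variable {ι : Type*}

/-- The autocorrelation function `tr(ω R_α(s) R_β)`. -/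
def correlation (V : ℝ → Op K) (R : ι → Op K) (ω : TraceClass K) (α β : ι) (s : ℝ) : ℂ :=
  trace (ω.op * freeEvolve V (R α) s * R β)

/-- The spectral density `γ_{αβ}(x) = ∫ exp(-i x s) tr(ω R_α(s) R_β) ds`. -/
def spectralDensity (V : ℝ → Op K) (R : ι → Op K) (ω : TraceClass K) (α β : ι) (x : ℝ) : ℂ :=
  ∫ s : ℝ, exp (-I * (x * s)) * correlation V R ω α β s

/-- The one-sided Fourier transform `Γ_{αβ}(x)` of the autocorrelation function. -/
def halfDensity (V : ℝ → Op K) (R : ι → Op K) (ω : TraceClass K) (α β : ι) (x : ℝ) : ℂ :=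
  ∫ s in Set.Ioi (0 : ℝ), exp (-I * (x * s)) * correlation V R ω α β s

/-- The Lamb-shift coefficients `σ_{αβ} = (Γ_{αβ} - conj Γ_{βα}) / 2i`. -/
def lambShift (V : ℝ → Op K) (R : ι → Op K) (ω : TraceClass K) (α β : ι) (x : ℝ) : ℂ :=
  (halfDensity V R ω α β x - star (halfDensity V R ω β α x)) / (2 * I)

/-- Multiplication of `X` by `R_α(s)`, from the left (`true`) or from the right (`false`). -/
def branchMul (V : ℝ → Op K) (R : ι → Op K) (a : Bool × ι × ℝ) (X : Op K) : Op K :=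
  if a.1 then freeEvolve V (R a.2.1) a.2.2 * X else X * freeEvolve V (R a.2.1) a.2.2

/-- The operator `R_1 Q R_2 Q ⋯ Q R_n ω`, with `R_i` multiplication by a reservoir operator from the
left or the right and `Q X = X - tr(X) ω`. -/
def irreducibleState (V : ℝ → Op K) (R : ι → Op K) (ω : TraceClass K) :
    List (Bool × ι × ℝ) → Op K
  | [] => ω.op
  | [a] => branchMul V R a ω.op
  | a :: b :: l =>
    let X := irreducibleState V R ω (b :: l)
    branchMul V R a (X - trace X • ω.op)

/-- The irreducible (truncated) multi-time correlation function of the reservoir: an alternating sum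
of products of multi-time correlation functions that belong to consecutive groups of times. -/
def irreducibleCorrelation (V : ℝ → Op K) (R : ι → Op K) (ω : TraceClass K)
    (l : List (Bool × ι × ℝ)) : ℂ := trace (irreducibleState V R ω l)

variable {H : Type*} [NormedAddCommGroup H] [InnerProductSpace ℂ H]

/-- The integral over `T ≥ s_1 ≥ ⋯ ≥ s_n ≥ 0` of the absolute values of the irreducible `(n+1)`-time
correlation functions at the times `s_1, …, s_n, 0`, weighted with the norms of the system operators
that they multiply. -/
def memoryIntegral (V : ℝ → Op K) (S : ι → Op H) (R : ι → Op K) (ω : TraceClass K)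
    (n : ℕ) (T : ℝ) : ℝ≥0∞ :=
  ∫⁻ s in {s : Fin n → ℝ | Antitone s ∧ ∀ i, s i ∈ Set.Icc 0 T},
    ∑' a : Fin (n + 1) → ι, ∑ e : Fin (n + 1) → Bool, (∏ i, ‖S (a i)‖ₑ) *
      ‖irreducibleCorrelation V R ω
        (List.ofFn fun i => (e i, a i, (Fin.snoc s 0 : Fin (n + 1) → ℝ) i))‖ₑ

/-- Davies' conditions on the reservoir: centred coupling, integrable autocorrelation functions, and
multi-time correlations that factorize on the time scale `λ⁻²` of the weak-coupling limit. -/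
structure IsWeakCouplingReservoir (V : ℝ → Op K) (S : ι → Op H) (R : ι → Op K)
    (ω : TraceClass K) : Prop where
  centred : ∀ α, trace (ω.op * R α) = 0
  integrable : ∀ α β, Integrable (correlation V R ω α β)
  bound : ∃ c : ℕ → ℝ, (∀ z : ℝ, Summable fun n => c n * z ^ n) ∧ ∀ n, 1 ≤ n → ∀ T : ℝ, 0 < T →
    memoryIntegral V S R ω n T ≤ ENNReal.ofReal (c n * T ^ (((n : ℝ) - 1) / 2))
  factorize : ∀ n, 2 ≤ n → Tendsto
    (fun T : ℝ => memoryIntegral V S R ω n T / ENNReal.ofReal (T ^ (((n : ℝ) - 1) / 2)))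
    atTop (𝓝 0)

end Reservoir

/-! ## The composite system -/

section Composite

variable {H K : Type*} [NormedAddCommGroup H] [InnerProductSpace ℂ H] [CompleteSpace H]
  [NormedAddCommGroup K] [InnerProductSpace ℂ K] [CompleteSpace K]

variable (H K) in
/-- The Hilbert tensor product of `H` and `K`. -/
abbrev HTensor := UniformSpace.Completion (H ⊗[ℂ] K)

/-- The operator `A ⊗ B`. -/
def opTensor (A : Op H) (B : Op K) : Op (HTensor H K) := (TensorProduct.mapL A B).completion

variable (H) in
/-- The map `ψ ↦ ψ ⊗ f`. -/
def tensorRight (f : K) : H →L[ℂ] HTensor H K :=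
  UniformSpace.Completion.toComplL ∘L (TensorProduct.mkL ℂ H K).flip f

/-- The partial trace over `K`: `∑_j (1 ⊗ ⟨b_j|) X (1 ⊗ |b_j⟩)` in an orthonormal basis `b` (the sum
converges in norm, independently of the basis, if `X` is trace class). -/
def partialTrace (X : Op (HTensor H K)) : Op H :=
  ∑' j, (tensorRight H ((exists_hilbertBasis ℂ K).choose_spec.choose j)).adjoint ∘L X ∘L
    tensorRight H ((exists_hilbertBasis ℂ K).choose_spec.choose j)

/-- The interaction `∑ S_α ⊗ R_α`. -/
def interaction {ι : Type*} (S : ι → Op H) (R : ι → Op K) : Op (HTensor H K) :=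
  ∑' α, opTensor (S α) (R α)

/-- The evolution of the composite system without coupling, `U_{t,t₀} ⊗ exp(-i (t - t₀) H_R)`. -/
def freeEvolution (HS : ℝ → Op H) (V : ℝ → Op K) (t₀ t : ℝ) : Op (HTensor H K) :=
  opTensor (propagator HS t₀ t) (V (t - t₀))

/-- `W` is the evolution, from time `t₀` on, that belongs to the Hamiltonian
`H_S(t) ⊗ 1 + 1 ⊗ H_R + lam • W_I`. As `H_R` may be unbounded, the Schrödinger equation is required
in the interaction picture. -/
def IsCompositeEvolution (HS : ℝ → Op H) (V : ℝ → Op K) (WI : Op (HTensor H K)) (t₀ lam : ℝ)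
    (W : ℝ → Op (HTensor H K)) : Prop :=
  W t₀ = 1 ∧ ∀ (x : HTensor H K) (t : ℝ),
    HasDerivAt (fun s => star (freeEvolution HS V t₀ s) (W s x))
      ((-I * lam) • star (freeEvolution HS V t₀ t) (WI (W t x))) t

end Composite

/-! ## The master equation -/

section MasterEquation

variable {H : Type*} [NormedAddCommGroup H] [InnerProductSpace ℂ H] [CompleteSpace H]

/-- `ρ ↦ B ρ A† - ½ {A† B, ρ}`. -/
def gklsTerm (A B : Op H) : TraceClass H →L[ℂ] TraceClass H :=
  sandwich B (star A) - (1 / 2 : ℂ) • anticommutator (star A * B)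

/-- The dissipator `D_t = 𝒰_{t,t₀} ∘ L ∘ 𝒰_{t,t₀}⁻¹`, where `𝒰_{t,t₀}` is conjugation by the
propagator. -/
def dissipator (HS : ℝ → Op H) (t₀ : ℝ) (L : TraceClass H →L[ℂ] TraceClass H) (t : ℝ) :
    TraceClass H →L[ℂ] TraceClass H :=
  conjBy (propagator HS t₀ t) * L * conjBy (star (propagator HS t₀ t))

/-- The generator `L_t = -i [H_S(t), ·] + D_t`. -/
def lindbladian (HS : ℝ → Op H) (t₀ : ℝ) (L : TraceClass H →L[ℂ] TraceClass H) (t : ℝ) :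
    TraceClass H →L[ℂ] TraceClass H :=
  (-I) • commutator (HS t) + dissipator HS t₀ L t

/-- The map `𝒰_{t,t₀} ∘ exp((t - t₀) L)`. -/
def dynamicalMap (HS : ℝ → Op H) (t₀ : ℝ) (L : TraceClass H →L[ℂ] TraceClass H) (t : ℝ) :
    TraceClass H →L[ℂ] TraceClass H :=
  conjBy (propagator HS t₀ t) * NormedSpace.exp (((t - t₀ : ℝ) : ℂ) • L)

end MasterEquation

end OpenFloquet

end

set_option linter.unusedSectionVars false

noncomputable section

namespace OpenFloquet

/-! ### Trace-class operators: rank-one operators, lower semicontinuity, completeness. -/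

section TraceClassTheory

variable {H : Type*} [NormedAddCommGroup H] [InnerProductSpace ℂ H]

/-! In the interaction picture the free motion disappears, and the composite state obeys a von
Neumann equation with a bounded, strongly continuous Liouvillian `h s`, multiplied by the coupling
constant `λ`. Let `p` be the partial trace over the reservoir and `i ξ = ξ ⊗ ω`. Centring of the
coupling means `p (h s (i ξ)) = 0`. Eliminating the component `1 - i p` of the state by iterating a
Volterra equation gives, for the reduced state `x`, `x(t) = ρ + λ² ∫₀ᵗ ∫₀ˢ 𝒦(s,u) x(u) du ds +
e(t)`, where `𝒦` is quadratic in `h` and `e` collects the orders three and higher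
(`enorm_sub_nzTerm_one_le`).

Expanded in the couplings, every word in `e` is a product of system operators times one irreducible
reservoir correlation (`enorm_word_le`). Stationarity splits off the integration over the earliest
time as a factor `t`, and what remains is `memoryIntegral` (`iteratedLIntegral_memoryWeight_le`). As
`λ² t ≤ τ`, the Davies bounds give a convergent majorant for the series, the factorization condition
makes each term small, and `e` vanishes uniformly (`tendsto_tsum_memoryIntegral`).

The case `n = 1` of the same bounds dominates `𝒦(s,u)` by an integrable function of `s - u`. On the
time scale `λ⁻²` the memory is therefore instantaneous, and `𝒦` may be replaced by `B s = ∫₀^∞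
𝒦(s,s-v) dv`. Since `x` varies slowly, `B` may in turn be replaced by its time average `L`. A
Gronwall estimate for the memory equation compares `x(t)` with `exp(λ² t L) ρ`; this is
`IsMemoryKernel.tendsto_weakCoupling`.

The average exists by Floquet theory. With `U = P exp(-i s Hbar)`, an interaction-picture operator
is a periodic operator conjugated by a unitary group with pure point spectrum, hence strongly almost
periodic (`isAPOp_interactionPicture`). The mean of a product is the sum over real frequencies of
products of Fourier–Bohr components, and Bessel's inequality controls the sums
(`exists_hasMean_hasSum`). Splitting the one-sided transforms into spectral density and Lamb shift
gives the GKLS form (`exists_lambShift_gkls`). The component at frequency `w + qΩ` is the operator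
`S(w,q)`; non-resonance makes `(w,q)` a function of the frequency and separates the quasifrequencies
(`hasSum_floquetIndex_iff`).

Complete positivity and trace preservation of `exp(s L)` are inherited from the reduced dynamics,
whose limit along `t = s/λ²` it is (`isCPTP_exp`). Positivity of the spectral density matrix is the
easy half of Bochner's theorem (`fourier_nonneg_of_positive`). The master equation is solved by
variation of constants (`isFundamentalSolution_iff_eq_mul`).

Throughout, a trace-class operator is a norm-convergent sum of rank-one operators
(`exists_nuclear`). Identities, continuity and strong limits on `B₁` thus reduce to rank-one
operators and, in the tensor product, to product vectors. -/

lemma Orthonormal.sum_inner_mul_inner_le {n : ℕ} {e f : Fin n → H} (he : Orthonormal ℂ e)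
    (hf : Orthonormal ℂ f) (x y : H) :
    ∑ i, ‖inner ℂ (e i) x‖ * ‖inner ℂ (f i) y‖ ≤ ‖x‖ * ‖y‖ := by
  have h1 := he.sum_inner_products_le (s := Finset.univ) x
  have h2 := hf.sum_inner_products_le (s := Finset.univ) y
  refine le_of_sq_le_sq ?_ (by positivity)
  rw [mul_pow]
  refine (Finset.sum_mul_sq_le_sq_mul_sq _ _ _).trans ?_
  gcongr

lemma le_of_mem_traceSums_rankOne (x y : H) {r : ℝ}
    (hr : r ∈ traceSums (InnerProductSpace.rankOne ℂ x y)) : r ≤ ‖x‖ * ‖y‖ := by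
  obtain ⟨n, e, f, he, hf, rfl⟩ := hr
  refine le_trans (le_of_eq ?_) (Orthonormal.sum_inner_mul_inner_le he hf x y)
  refine Finset.sum_congr rfl fun i _ => ?_
  rw [InnerProductSpace.rankOne_apply, inner_smul_right, norm_mul, mul_comm, norm_inner_symm y]

/-- The rank-one operator `|x⟩⟨y|` as a trace-class operator. -/
def dyad (x y : H) : TraceClass H :=
  ⟨InnerProductSpace.rankOne ℂ x y, ‖x‖ * ‖y‖, fun _ => le_of_mem_traceSums_rankOne x y⟩

lemma dyad_op_apply (x y z : H) : (dyad x y).op z = inner ℂ y z • x := rfl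

lemma norm_dyad_le (x y : H) : ‖dyad x y‖ ≤ ‖x‖ * ‖y‖ :=
  csSup_le ⟨0, zero_mem_traceSums _⟩ fun _ => le_of_mem_traceSums_rankOne x y

lemma TraceClass.ext {ρ σ : TraceClass H} (h : ∀ x, ρ.op x = σ.op x) : ρ = σ :=
  TraceClass.op_injective (ContinuousLinearMap.ext h)

lemma TraceClass.op_add (ρ σ : TraceClass H) : (ρ + σ).op = ρ.op + σ.op := map_add _ _ _
lemma TraceClass.op_sub (ρ σ : TraceClass H) : (ρ - σ).op = ρ.op - σ.op := map_sub _ _ _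
lemma TraceClass.op_smul (c : ℂ) (ρ : TraceClass H) : (c • ρ).op = c • ρ.op := map_smul _ _ _

/-- The trace norm dominates a single matrix element between unit vectors; the unit vectors along `ρ
x` and `x` give the bound. -/
lemma TraceClass.norm_op_apply_le (ρ : TraceClass H) (x : H) : ‖ρ.op x‖ ≤ ‖ρ‖ * ‖x‖ := by
  by_cases hx : x = 0
  · simp [hx]
  by_cases hy : ρ.op x = 0
  · rw [hy, norm_zero]; positivity
  have hn : ‖ρ.op x‖ ≠ 0 := norm_ne_zero_iff.2 hy
  have hm : ‖x‖ ≠ 0 := norm_ne_zero_iff.2 hx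
  have h := norm_inner_le_traceNorm ρ.bdd (((‖ρ.op x‖ : ℂ))⁻¹ • ρ.op x)
    (((‖x‖ : ℂ))⁻¹ • x) (by simp [norm_smul, hn]) (by simp [norm_smul, hm])
  rw [map_smul, inner_smul_left, inner_smul_right, norm_mul, norm_mul, inner_self_eq_norm_sq_to_K,
    ← TraceClass.norm_def] at h
  simp only [map_inv₀, norm_inv, RCLike.norm_conj, Complex.norm_real, norm_norm, norm_pow,
    coe_algebraMap] at h
  have : ‖ρ.op x‖ = ‖x‖ * (‖ρ.op x‖⁻¹ * (‖x‖⁻¹ * ‖ρ.op x‖ ^ 2)) := by field_simp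
  rw [this, mul_comm]
  gcongr

lemma TraceClass.norm_op_le (ρ : TraceClass H) : ‖ρ.op‖ ≤ ‖ρ‖ :=
  ContinuousLinearMap.opNorm_le_bound _ (norm_nonneg _) ρ.norm_op_apply_le

variable (H) in
/-- The continuous inclusion `B₁(H) → B(H)`. -/
def opL : TraceClass H →L[ℂ] Op H :=
  (TraceClass.toOpₗ H).mkContinuous 1 fun ρ => by rw [one_mul]; exact ρ.norm_op_le

lemma opL_apply (ρ : TraceClass H) : opL H ρ = ρ.op := rfl

/-- Lower semicontinuity of the trace norm with respect to strong convergence. -/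
lemma TraceClass.exists_of_tendsto {ι : Type*} {l : Filter ι} [l.NeBot] {u : ι → TraceClass H}
    {A : Op H} {C : ℝ} (h : ∀ x, Tendsto (fun i => (u i).op x) l (𝓝 (A x)))
    (hC : ∀ᶠ i in l, ‖u i‖ ≤ C) : ∃ ρ : TraceClass H, ρ.op = A ∧ ‖ρ‖ ≤ C := by
  have key : ∀ r ∈ traceSums A, r ≤ C := by
    rintro _ ⟨n, e, f, he, hf, rfl⟩
    have ht : Tendsto (fun i => ∑ j, ‖inner ℂ (e j) ((u i).op (f j))‖) l
        (𝓝 (∑ j, ‖inner ℂ (e j) (A (f j))‖)) :=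
      tendsto_finset_sum _ fun j _ => (tendsto_const_nhds.inner (h (f j))).norm
    refine le_of_tendsto ht (hC.mono fun i hi => le_trans ?_ hi)
    exact le_csSup (u i).bdd ⟨n, e, f, he, hf, rfl⟩
  exact ⟨⟨A, C, key⟩, rfl, csSup_le ⟨0, zero_mem_traceSums _⟩ key⟩

/-- A Cauchy sequence has a limit in operator norm. Lower semicontinuity of the trace norm, applied
to the differences `u n - u m`, shows that the limit is trace class and that convergence takes place
in trace norm. -/
instance [CompleteSpace H] : CompleteSpace (TraceClass H) := by
  refine Metric.complete_of_cauchySeq_tendsto fun u hu => ?_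
  have hop : CauchySeq fun n => opL H (u n) := (opL H).uniformContinuous.comp_cauchySeq hu
  obtain ⟨A, hA⟩ := cauchySeq_tendsto_of_complete hop
  have hAx : ∀ x, Tendsto (fun n => (u n).op x) atTop (𝓝 (A x)) := fun x =>
    ((ContinuousLinearMap.apply ℂ H x).continuous.tendsto A).comp hA
  obtain ⟨R, _, hR⟩ := cauchySeq_bdd hu
  obtain ⟨ρ, hρ, -⟩ := TraceClass.exists_of_tendsto (u := fun n => u n - u 0) (A := A - (u 0).op)
    (C := R) (l := atTop)
    (fun x => by simpa [TraceClass.op_sub] using (hAx x).sub_const _)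
    (Eventually.of_forall fun n => by rw [← dist_eq_norm]; exact (hR n 0).le)
  refine ⟨ρ + u 0, Metric.tendsto_atTop.2 fun δ hδ => ?_⟩
  obtain ⟨N, hN⟩ := Metric.cauchySeq_iff.1 hu (δ / 2) (half_pos hδ)
  refine ⟨N, fun n hn => ?_⟩
  obtain ⟨σ, hσ, hσn⟩ := TraceClass.exists_of_tendsto (u := fun m => u n - u m) (l := atTop)
    (A := (u n).op - A) (C := δ / 2)
    (fun x => by simpa [TraceClass.op_sub] using (hAx x).const_sub _)
    ((eventually_ge_atTop N).mono fun m hm => by rw [← dist_eq_norm]; exact (hN n hn m hm).le)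
  have : σ = u n - (ρ + u 0) := TraceClass.op_injective (by
    change σ.op = (u n - (ρ + u 0)).op
    rw [hσ, TraceClass.op_sub, TraceClass.op_add, hρ]; abel)
  rw [dist_eq_norm, ← this]
  linarith

/-- The map is antilinear in the second vector, so real bilinearity is the form in which
differential calculus applies to it. -/
lemma isBoundedBilinearMap_dyad :
    IsBoundedBilinearMap ℝ (fun p : H × H => dyad p.1 p.2) where
  add_left x y z := TraceClass.ext fun w => by
    simp only [TraceClass.op_add, dyad_op_apply, add_apply, smul_add]
  smul_left c x y := TraceClass.ext fun w => by
    change (dyad (c • x) y).op w = (((c : ℂ)) • dyad x y).op w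
    simp only [TraceClass.op_smul, dyad_op_apply, smul_apply]
    rw [smul_comm]; rfl
  add_right x y z := TraceClass.ext fun w => by
    simp only [TraceClass.op_add, dyad_op_apply, add_apply, inner_add_left, add_smul]
  smul_right c x y := TraceClass.ext fun w => by
    change (dyad x (c • y)).op w = (((c : ℂ)) • dyad x y).op w
    simp only [TraceClass.op_smul, dyad_op_apply, smul_apply, ← Complex.coe_smul c y,
      inner_smul_left, mul_smul, conj_ofReal]
  bound := ⟨1, one_pos, fun x y => by rw [one_mul]; exact norm_dyad_le x y⟩

lemma dyad_smul_left (c : ℂ) (x y : H) : dyad (c • x) y = c • dyad x y :=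
  TraceClass.ext fun w => by
    simp only [TraceClass.op_smul, dyad_op_apply, smul_apply]; rw [smul_comm]

lemma dyad_smul_right (c : ℂ) (x y : H) : dyad x (c • y) = star c • dyad x y :=
  TraceClass.ext fun w => by
    simp only [TraceClass.op_smul, dyad_op_apply, smul_apply, inner_smul_left, mul_smul]; rfl

lemma continuous_dyad : Continuous (fun p : H × H => dyad p.1 p.2) :=
  isBoundedBilinearMap_dyad.continuous

lemma TraceClass.hasSum_op_apply {ι : Type*} {u : ι → TraceClass H} {ρ : TraceClass H}
    (h : HasSum u ρ) (x : H) : HasSum (fun i => (u i).op x) (ρ.op x) :=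
  h.mapL ((ContinuousLinearMap.apply ℂ H x).comp (opL H))

end TraceClassTheory

/-! ### Factorization of self-adjoint trace-class operators into Hilbert–Schmidt operators. -/

section Nuclear

variable {H : Type*} [NormedAddCommGroup H] [InnerProductSpace ℂ H] [CompleteSpace H]

lemma norm_sandwich_unitary_le {u v : Op H} (hu : u ∈ unitary (Op H)) (hv : v ∈ unitary (Op H))
    (ρ : TraceClass H) : ‖sandwich u v ρ‖ ≤ ‖ρ‖ :=
  csSup_le_csSup ρ.bdd ⟨0, zero_mem_traceSums _⟩ (traceSums_unitary_mul_mul hu hv)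

/-- A self-adjoint contraction `g` is the average of the unitaries `g ± i √(1 - g²)`, and
multiplication by a unitary does not increase the trace norm. The sharp constant 1 carries over to
`|ρ|`. -/
lemma norm_sandwich_selfAdjoint_le {g : Op H} (hg : IsSelfAdjoint g) (hn : ‖g‖ ≤ 1)
    (ρ : TraceClass H) : ‖sandwich g 1 ρ‖ ≤ ‖ρ‖ := by
  obtain ⟨u, h1⟩ : ∃ u : unitary (Op H), (2 : ℂ) • g = (u : Op H) + star (u : Op H) := by
    refine ⟨⟨g + I • CFC.sqrt (1 - g ^ 2), hg.self_add_I_smul_cfcSqrt_sub_sq_mem_unitary g hn⟩, ?_⟩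
    have h := (CFC.sqrt_nonneg (1 - g ^ 2)).isSelfAdjoint.star_eq
    simp only [star_add, star_smul, hg.star_eq, h, RCLike.star_def, conj_I]
    module
  have h2 : (2 : ℂ) • sandwich g 1 ρ = sandwich (u : Op H) 1 ρ + sandwich (star (u : Op H)) 1 ρ := by
    apply TraceClass.op_injective
    change ((2 : ℂ) • sandwich g 1 ρ).op = (sandwich _ 1 ρ + sandwich _ 1 ρ).op
    rw [TraceClass.op_smul, TraceClass.op_add]
    simp only [sandwich_op, mul_one, ← add_mul, ← h1, smul_mul_assoc]
  have h3 := congrArg norm h2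
  rw [norm_smul] at h3
  have h4 := norm_add_le (sandwich (u : Op H) 1 ρ) (sandwich (star (u : Op H)) 1 ρ)
  have h5 := norm_sandwich_unitary_le u.2 (one_mem _) ρ
  have h6 := norm_sandwich_unitary_le (Unitary.star_mem u.2) (one_mem _) ρ
  norm_num at h3
  linarith

/-- The absolute value is the norm limit of `gₙ(ρ) ρ`, where `gₙ` is a continuous truncation of the
sign function with `|gₙ(x) x - |x|| ≤ 1/n`. Each `gₙ(ρ)` is a self-adjoint contraction, so the trace
norms stay below that of `ρ`, and lower semicontinuity passes this on to the limit. -/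
lemma exists_traceClass_abs (ρ : TraceClass H) (hρ : IsSelfAdjoint ρ.op) :
    ∃ σ : TraceClass H, σ.op = cfc (fun x : ℝ => |x|) ρ.op ∧ ‖σ‖ ≤ ‖ρ‖ := by
  set g : ℕ → ℝ → ℝ := fun n x => max (-1) (min 1 (n * x)) with hg
  have hgc : ∀ n, Continuous (g n) := fun n => by fun_prop
  have hg1 : ∀ n x, |g n x| ≤ 1 := fun n x => abs_le.2 ⟨le_max_left _ _,
    max_le (by norm_num) (min_le_left _ _)⟩
  have hgx : ∀ n : ℕ, ∀ x, abs (g (n + 1) x * x - abs x) ≤ 1 / (n + 1 : ℝ) := by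
    intro n x
    have hn : (0 : ℝ) < n + 1 := by positivity
    simp only [hg, Nat.cast_add, Nat.cast_one]
    rcases le_total 0 x with hx | hx
    · rw [abs_of_nonneg hx, max_eq_right (by
        refine le_min (by norm_num) ?_
        have : 0 ≤ (n + 1 : ℝ) * x := by positivity
        linarith)]
      rcases le_total 1 ((n + 1 : ℝ) * x) with h | h
      · rw [min_eq_left h]; simp; positivity
      · rw [min_eq_right h]
        have hx1 : x ≤ 1 / (n + 1 : ℝ) := by rw [le_div_iff₀ hn]; linarith
        rw [abs_le]
        have : 0 ≤ (n + 1 : ℝ) * x := by positivity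
        constructor <;> nlinarith
    · rw [abs_of_nonpos hx, min_eq_right (by nlinarith)]
      rcases le_total (-1) ((n + 1 : ℝ) * x) with h | h
      · rw [max_eq_right h]
        have hx1 : -x ≤ 1 / (n + 1 : ℝ) := by rw [le_div_iff₀ hn]; linarith
        rw [abs_le]
        have : 0 ≤ (n + 1 : ℝ) * (-x) := mul_nonneg hn.le (by linarith)
        constructor <;> nlinarith
      · rw [max_eq_left h]; simp; positivity
  have hmul : ∀ n, cfc (g n) ρ.op * ρ.op = cfc (fun x => g n x * x) ρ.op := fun n => by
    conv_lhs => rw [← cfc_id' ℝ ρ.op hρ]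
    rw [cfc_id' ℝ ρ.op hρ, cfc_mul (g n) (fun x => x) ρ.op (hgc n).continuousOn
      continuous_id.continuousOn, cfc_id' ℝ ρ.op hρ]
  refine TraceClass.exists_of_tendsto (l := atTop)
    (u := fun n : ℕ => sandwich (cfc (g (n + 1)) ρ.op) 1 ρ) (fun x => ?_) (Eventually.of_forall
      fun n => norm_sandwich_selfAdjoint_le (cfc_predicate _ _) ?_ _)
  · have : Tendsto (fun n : ℕ => (sandwich (cfc (g (n + 1)) ρ.op) 1 ρ).op) atTop
        (𝓝 (cfc (fun x : ℝ => |x|) ρ.op)) := by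
      rw [tendsto_iff_norm_sub_tendsto_zero]
      refine squeeze_zero (fun _ => norm_nonneg _) (fun n => ?_)
        tendsto_one_div_add_atTop_nhds_zero_nat
      rw [sandwich_op, mul_one, hmul, ← cfc_sub (fun x => g (n + 1) x * x) (fun x => |x|) ρ.op
        ((hgc _).mul continuous_id).continuousOn continuous_abs.continuousOn]
      exact norm_cfc_le (by positivity) fun x _ => hgx n x
    exact ((ContinuousLinearMap.apply ℂ H x).continuous.tendsto _).comp this
  · exact norm_cfc_le (by norm_num) fun x _ => hg1 _ x

lemma TraceClass.sum_norm_inner_le {ι : Type*} (b : ι → H) (hb : Orthonormal ℂ b)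
    (ρ : TraceClass H) (s : Finset ι) : ∑ i ∈ s, ‖inner ℂ (b i) (ρ.op (b i))‖ ≤ ‖ρ‖ := by
  have ho : Orthonormal ℂ fun i : Fin s.card => b (s.equivFin.symm i) :=
    hb.comp _ (Subtype.val_injective.comp s.equivFin.symm.injective)
  refine le_trans (le_of_eq ?_) (le_csSup ρ.bdd ⟨_, _, _, ho, ho, rfl⟩)
  rw [← Finset.sum_coe_sort, ← Equiv.sum_comp s.equivFin.symm]

lemma TraceClass.summable_norm_inner {ι : Type*} (b : ι → H) (hb : Orthonormal ℂ b)
    (ρ : TraceClass H) : Summable fun i => ‖inner ℂ (b i) (ρ.op (b i))‖ :=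
  summable_of_sum_le (fun _ => norm_nonneg _) (ρ.sum_norm_inner_le b hb)

lemma norm_sq_selfAdjoint_apply {A : Op H} (hA : IsSelfAdjoint A) (x : H) :
    ‖A x‖ ^ 2 = ‖inner ℂ x ((A * A) x)‖ := by
  have h : inner ℂ x ((A * A) x) = inner ℂ (A x) (A x) := by
    rw [mul_apply_eq_comp, ← ContinuousLinearMap.adjoint_inner_left,
      ContinuousLinearMap.isSelfAdjoint_iff'.1 hA]
  rw [h, inner_self_eq_norm_sq_to_K]
  simp

/-- A factorization `ρ = B C` of a self-adjoint trace-class operator into Hilbert–Schmidt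
operators. -/
lemma exists_factorization (ρ : TraceClass H) (hρ : IsSelfAdjoint ρ.op) :
    ∃ B C : Op H, IsSelfAdjoint B ∧ IsSelfAdjoint C ∧ ρ.op = B * C ∧
      (ρ.op.IsPositive → B = C) ∧ ∀ (ι : Type _) (b : ι → H), Orthonormal ℂ b →
        ∀ s : Finset ι, ∑ i ∈ s, ‖B (b i)‖ ^ 2 ≤ ‖ρ‖ ∧ ∑ i ∈ s, ‖C (b i)‖ ^ 2 ≤ ‖ρ‖ := by
  obtain ⟨σ, hσ, hσn⟩ := exists_traceClass_abs ρ hρ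
  -- `γ` is the square root of `|x|` with the sign of `x`. Both squares equal `|x|` while `β γ = x`,
  -- so the factors are Hilbert–Schmidt with norms controlled by `tr |ρ|`.
  set β : ℝ → ℝ := fun x => √|x|
  set γ : ℝ → ℝ := fun x => √(max x 0) - √(max (-x) 0)
  have hβ : Continuous β := by fun_prop
  have hγ : Continuous γ := by fun_prop
  have hββ : ∀ x, β x * β x = |x| := fun x => Real.mul_self_sqrt (abs_nonneg x)
  have hγγ : ∀ x, γ x * γ x = |x| := fun x => by
    rcases le_total 0 x with h | h
    · simp [γ, max_eq_left h, max_eq_right (neg_nonpos.2 h), abs_of_nonneg h, Real.mul_self_sqrt h]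
    · simp [γ, max_eq_right h, max_eq_left (neg_nonneg.2 h), abs_of_nonpos h,
        Real.mul_self_sqrt (neg_nonneg.2 h)]
  have hβγ : ∀ x, β x * γ x = x := fun x => by
    rcases le_total 0 x with h | h
    · simp [β, γ, max_eq_left h, max_eq_right (neg_nonpos.2 h), abs_of_nonneg h,
        Real.mul_self_sqrt h]
    · simp [β, γ, max_eq_right h, max_eq_left (neg_nonneg.2 h), abs_of_nonpos h,
        Real.mul_self_sqrt (neg_nonneg.2 h)]
  have hB : IsSelfAdjoint (cfc β ρ.op) := cfc_predicate _ _
  have hC : IsSelfAdjoint (cfc γ ρ.op) := cfc_predicate _ _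
  have hBB : cfc β ρ.op * cfc β ρ.op = σ.op := by
    rw [hσ, ← cfc_mul β β ρ.op hβ.continuousOn hβ.continuousOn]; simp only [hββ]
  have hCC : cfc γ ρ.op * cfc γ ρ.op = σ.op := by
    rw [hσ, ← cfc_mul γ γ ρ.op hγ.continuousOn hγ.continuousOn]; simp only [hγγ]
  refine ⟨cfc β ρ.op, cfc γ ρ.op, hB, hC, ?_, fun hp => ?_, fun ι b hb s => ⟨?_, ?_⟩⟩
  · rw [← cfc_mul β γ ρ.op hβ.continuousOn hγ.continuousOn]
    simp only [hβγ]
    rw [cfc_id' ℝ ρ.op hρ]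
  · refine cfc_congr fun x hx => ?_
    have h0 : 0 ≤ x := spectrum_nonneg_of_nonneg
      ((ContinuousLinearMap.nonneg_iff_isPositive _).2 hp) hx
    simp [β, γ, max_eq_left h0, max_eq_right (neg_nonpos.2 h0), abs_of_nonneg h0]
  · simp only [norm_sq_selfAdjoint_apply hB, hBB]
    exact (σ.sum_norm_inner_le b hb s).trans hσn
  · simp only [norm_sq_selfAdjoint_apply hC, hCC]
    exact (σ.sum_norm_inner_le b hb s).trans hσn

lemma summable_mul_of_sum_sq_le {ι : Type*} {x y : ι → ℝ} (hx : ∀ i, 0 ≤ x i) (hy : ∀ i, 0 ≤ y i)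
    {C D : ℝ} (h : ∀ s : Finset ι, ∑ i ∈ s, x i ^ 2 ≤ C ∧ ∑ i ∈ s, y i ^ 2 ≤ D) :
    Summable (fun i => x i * y i) ∧ ∑' i, x i * y i ≤ √(C * D) := by
  have hs : ∀ s : Finset ι, ∑ i ∈ s, x i * y i ≤ √(C * D) := fun s => by
    refine Real.le_sqrt_of_sq_le ((Finset.sum_mul_sq_le_sq_mul_sq _ _ _).trans ?_)
    exact mul_le_mul (h s).1 (h s).2 (Finset.sum_nonneg fun i _ => sq_nonneg _)
      ((Finset.sum_nonneg fun i _ => sq_nonneg _).trans (h s).1)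
  exact ⟨summable_of_sum_le (fun i => mul_nonneg (hx i) (hy i)) hs,
    Real.tsum_le_of_sum_le (fun i => mul_nonneg (hx i) (hy i)) hs⟩

/-- Expand `C x` in the basis: the coefficient `⟨bᵢ, C x⟩` equals `⟨C bᵢ, x⟩`, and `B` is applied to
`bᵢ`. The series converges absolutely in trace norm by Cauchy–Schwarz for the two Hilbert–Schmidt
factors. -/
lemma hasSum_dyad_mul {ι : Type*} (b : HilbertBasis ι ℂ H) {B C : Op H} (hC : IsSelfAdjoint C)
    {ρ : TraceClass H} (hρ : ρ.op = B * C)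
    (hs : Summable fun i => ‖B (b i)‖ * ‖C (b i)‖) :
    HasSum (fun i => dyad (B (b i)) (C (b i))) ρ := by
  have h : Summable fun i => dyad (B (b i)) (C (b i)) :=
    Summable.of_norm_bounded hs fun i => norm_dyad_le _ _
  convert h.hasSum using 1
  refine TraceClass.ext fun x => ?_
  have h1 := TraceClass.hasSum_op_apply h.hasSum x
  have h2 := (b.hasSum_repr (C x)).mapL B
  rw [hρ]
  refine HasSum.unique ?_ h1
  refine h2.congr_fun ?_ |> fun h => h
  intro i
  rw [map_smul, dyad_op_apply, b.repr_apply_apply, ← ContinuousLinearMap.adjoint_inner_left,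
    ContinuousLinearMap.isSelfAdjoint_iff'.1 hC]

end Nuclear

/-! ### Decomposition into rank-one operators, density and strong limits. -/

section NuclearDecomposition

variable {H : Type*} [NormedAddCommGroup H] [InnerProductSpace ℂ H] [CompleteSpace H]

lemma dyad_zero_left (y : H) : dyad 0 y = 0 := by
  simpa using dyad_smul_left 0 (0 : H) y

lemma dyad_zero_right (x : H) : dyad x 0 = 0 := by
  simpa using dyad_smul_right 0 x (0 : H)

lemma exists_traceClass_adjoint (ρ : TraceClass H) :
    ∃ σ : TraceClass H, σ.op = star ρ.op ∧ ‖σ‖ ≤ ‖ρ‖ := by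
  have key : ∀ r ∈ traceSums (star ρ.op), r ≤ ‖ρ‖ := by
    rintro _ ⟨n, e, f, he, hf, rfl⟩
    refine le_csSup ρ.bdd ⟨n, f, e, hf, he, Finset.sum_congr rfl fun i _ => ?_⟩
    rw [ContinuousLinearMap.star_eq_adjoint, ContinuousLinearMap.adjoint_inner_right,
      norm_inner_symm]
  exact ⟨⟨star ρ.op, ‖ρ‖, key⟩, rfl, csSup_le ⟨0, zero_mem_traceSums _⟩ key⟩

lemma exists_realPart_imagPart (ρ : TraceClass H) :
    ∃ σ τ : TraceClass H, IsSelfAdjoint σ.op ∧ IsSelfAdjoint τ.op ∧ ρ = σ + I • τ ∧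
      ‖σ‖ ≤ ‖ρ‖ ∧ ‖τ‖ ≤ ‖ρ‖ := by
  obtain ⟨ρ', hρ', hn⟩ := exists_traceClass_adjoint ρ
  refine ⟨(1 / 2 : ℂ) • (ρ + ρ'), (-I / 2 : ℂ) • (ρ - ρ'), ?_, ?_, ?_, ?_, ?_⟩
  · rw [TraceClass.op_smul, TraceClass.op_add, hρ', IsSelfAdjoint, star_smul, star_add, star_star,
      add_comm]
    simp
  · rw [TraceClass.op_smul, TraceClass.op_sub, hρ', IsSelfAdjoint, star_smul, star_sub, star_star,
      ← neg_sub, smul_neg, ← neg_smul]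
    congr 1
    simp only [star_div₀, star_neg, RCLike.star_def, conj_I, map_ofNat]; ring
  · rw [smul_smul, show I * (-I / 2) = 1 / 2 by
      rw [← mul_div_assoc, mul_neg, I_mul_I, neg_neg]]
    module
  · rw [norm_smul]
    have := norm_add_le ρ ρ'
    norm_num
    linarith
  · rw [norm_smul]
    have := norm_sub_le ρ ρ'
    norm_num
    linarith

/-- Every trace-class operator is a sum of rank-one operators. -/
lemma exists_nuclear (ρ : TraceClass H) : ∃ (J : Set H) (x y : J ⊕ J → H),
    Summable (fun i => ‖x i‖ * ‖y i‖) ∧ ∑' i, ‖x i‖ * ‖y i‖ ≤ 2 * ‖ρ‖ ∧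
      HasSum (fun i => dyad (x i) (y i)) ρ := by
  obtain ⟨σ, τ, hσ, hτ, rfl, hσn, hτn⟩ := exists_realPart_imagPart ρ
  obtain ⟨B, C, -, hC, h1, -, hBC⟩ := exists_factorization σ hσ
  obtain ⟨B', C', -, hC', h1', -, hBC'⟩ := exists_factorization τ hτ
  obtain ⟨J, b, -⟩ := exists_hilbertBasis ℂ H
  obtain ⟨s, hs⟩ := summable_mul_of_sum_sq_le (x := fun i => ‖B (b i)‖) (y := fun i => ‖C (b i)‖)
    (fun _ => norm_nonneg _) (fun _ => norm_nonneg _) (hBC J b b.orthonormal)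
  obtain ⟨s', hs'⟩ := summable_mul_of_sum_sq_le (x := fun i => ‖B' (b i)‖)
    (y := fun i => ‖C' (b i)‖) (fun _ => norm_nonneg _) (fun _ => norm_nonneg _)
    (hBC' J b b.orthonormal)
  rw [Real.sqrt_mul_self (norm_nonneg _)] at hs hs'
  -- One copy of the basis carries the self-adjoint part and the other the anti-self-adjoint part.
  -- Each contributes at most `‖ρ‖`, whence the constant 2.
  have key : HasSum (fun i => ‖(Sum.elim (fun i => B (b i)) (fun i => I • B' (b i)) i : H)‖ *
      ‖(Sum.elim (fun i => C (b i)) (fun i => C' (b i)) i : H)‖)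
      ((∑' i, ‖B (b i)‖ * ‖C (b i)‖) + ∑' i, ‖B' (b i)‖ * ‖C' (b i)‖) := by
    refine HasSum.sum s.hasSum ?_
    simpa [Function.comp_def, norm_smul] using s'.hasSum
  refine ⟨J, Sum.elim (fun i => B (b i)) (fun i => I • B' (b i)),
    Sum.elim (fun i => C (b i)) (fun i => C' (b i)), key.summable, ?_, ?_⟩
  · rw [key.tsum_eq]
    linarith
  · refine HasSum.sum (hasSum_dyad_mul b hC h1 s) ?_
    simpa [Function.comp_def, dyad_smul_left] using (hasSum_dyad_mul b hC' h1' s').const_smul I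

/-- For a positive operator the two Hilbert–Schmidt factors coincide, so only diagonal rank-one
operators `|x⟩⟨x|` occur. -/
lemma exists_nuclear_of_isPositive (ρ : TraceClass H) (hρ : ρ.op.IsPositive) :
    ∃ (J : Set H) (x : J → H), Summable (fun i => ‖x i‖ ^ 2) ∧
      HasSum (fun i => dyad (x i) (x i)) ρ := by
  obtain ⟨B, C, -, hC, h1, h2, hBC⟩ := exists_factorization ρ hρ.isSelfAdjoint
  obtain rfl := h2 hρ
  obtain ⟨J, b, -⟩ := exists_hilbertBasis ℂ H
  have s : Summable fun i => ‖B (b i)‖ ^ 2 :=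
    summable_of_sum_le (fun _ => sq_nonneg _) fun s => (hBC J b b.orthonormal s).1
  exact ⟨J, fun i => B (b i), s, hasSum_dyad_mul b hC h1 (by simpa [sq] using s)⟩

variable {E : Type*} [NormedAddCommGroup E] [NormedSpace ℂ E]

lemma TraceClass.clm_ext {f g : TraceClass H →L[ℂ] E} (h : ∀ x y, f (dyad x y) = g (dyad x y)) :
    f = g := by
  ext ρ
  obtain ⟨J, x, y, -, -, hs⟩ := exists_nuclear ρ
  refine (hs.mapL f).unique ?_
  simpa only [h] using hs.mapL g

/-- Approximate first the second vector and then the first one. Applied to product vectors, this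
reduces identities for the partial trace to rank-one operators between product vectors. -/
lemma span_dyad_dense {s : Set H} (hs : (Submodule.span ℂ s).topologicalClosure = ⊤) :
    (Submodule.span ℂ {ρ | ∃ x ∈ s, ∃ y ∈ s, ρ = dyad x y}).topologicalClosure = ⊤ := by
  set M := (Submodule.span ℂ {ρ | ∃ x ∈ s, ∃ y ∈ s, ρ = dyad x y}).topologicalClosure
  have hMc : IsClosed (M : Set (TraceClass H)) := Submodule.isClosed_topologicalClosure _
  have closure_mem : ∀ x : H, x ∈ (Submodule.span ℂ s).topologicalClosure := fun x => by
    rw [hs]; trivial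
  have h1 : ∀ x ∈ s, ∀ y : H, dyad x y ∈ M := by
    intro x hx y
    refine closure_minimal (t := {y | dyad x y ∈ M}) (fun z hz => ?_)
      (hMc.preimage (continuous_dyad.comp (by fun_prop : Continuous fun y => (x, y))))
      (closure_mem y)
    induction hz using Submodule.span_induction with
    | mem z hz => exact Submodule.le_topologicalClosure _ (Submodule.subset_span ⟨x, hx, z, hz, rfl⟩)
    | zero => simp [dyad_zero_right]
    | add a b _ _ ha hb =>
      have := isBoundedBilinearMap_dyad.add_right x a b
      change dyad x (a + b) = dyad x a + dyad x b at this
      simp only [Set.mem_ofPred_eq, this] at ha hb ⊢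
      exact M.add_mem ha hb
    | smul c a _ ha =>
      simp only [Set.mem_ofPred_eq, dyad_smul_right] at ha ⊢
      exact M.smul_mem _ ha
  have h2 : ∀ x y : H, dyad x y ∈ M := by
    intro x y
    refine closure_minimal (t := {x | dyad x y ∈ M}) (fun z hz => ?_)
      (hMc.preimage (continuous_dyad.comp (by fun_prop : Continuous fun x => (x, y))))
      (closure_mem x)
    induction hz using Submodule.span_induction with
    | mem z hz => exact h1 z hz y
    | zero => simp [dyad_zero_left]
    | add a b _ _ ha hb =>
      have := isBoundedBilinearMap_dyad.add_left a b y
      change dyad (a + b) y = dyad a y + dyad b y at this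
      simp only [Set.mem_ofPred_eq, this] at ha hb ⊢
      exact M.add_mem ha hb
    | smul c a _ ha =>
      simp only [Set.mem_ofPred_eq, dyad_smul_left] at ha ⊢
      exact M.smul_mem _ ha
  rw [eq_top_iff]
  intro ρ _
  obtain ⟨J, x, y, -, -, hs⟩ := exists_nuclear ρ
  exact hMc.mem_of_tendsto hs (Eventually.of_forall fun F => M.sum_mem fun i _ => h2 _ _)

/-- Strong convergence of a uniformly bounded family of linear maps follows from convergence on a
set with dense span. -/
lemma tendsto_of_span_dense {F : Type*} [NormedAddCommGroup F] [NormedSpace ℂ F] {ι : Type*}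
    {l : Filter ι} {s : Set E} (hs : (Submodule.span ℂ s).topologicalClosure = ⊤)
    {T : ι → E →ₗ[ℂ] F} {T₀ : E →L[ℂ] F} {C : ℝ} (hC : ∀ᶠ i in l, ∀ x, ‖T i x‖ ≤ C * ‖x‖)
    (h : ∀ x ∈ s, Tendsto (fun i => T i x) l (𝓝 (T₀ x))) (x : E) :
    Tendsto (fun i => T i x) l (𝓝 (T₀ x)) := by
  have hspan : ∀ x ∈ Submodule.span ℂ s, Tendsto (fun i => T i x) l (𝓝 (T₀ x)) := by
    intro x hx
    induction hx using Submodule.span_induction with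
    | mem x hx => exact h x hx
    | zero => simpa using tendsto_const_nhds
    | add x y _ _ hx hy => simpa using hx.add hy
    | smul c x _ hx => simpa using hx.const_smul c
  have hx : x ∈ closure (Submodule.span ℂ s : Set E) := by
    rw [← Submodule.topologicalClosure_coe, hs]; trivial
  rw [Metric.tendsto_nhds]
  intro δ hδ
  set D := max C 0 + ‖T₀‖ + 1
  have hD : 0 < D := by positivity
  obtain ⟨y, hy, hxy⟩ := Metric.mem_closure_iff.1 hx (δ / (2 * D)) (by positivity)
  filter_upwards [hC, Metric.tendsto_nhds.1 (hspan y hy) (δ / 2) (half_pos hδ)] with i hi hy'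
  rw [dist_eq_norm] at hxy hy' ⊢
  have e : T i x - T₀ x = T i (x - y) + (T i y - T₀ y) - T₀ (x - y) := by
    simp only [map_sub]; abel
  rw [e]
  calc _ ≤ ‖T i (x - y)‖ + ‖T i y - T₀ y‖ + ‖T₀ (x - y)‖ :=
        (norm_sub_le _ _).trans (add_le_add (norm_add_le _ _) le_rfl)
    _ ≤ C * ‖x - y‖ + ‖T i y - T₀ y‖ + ‖T₀‖ * ‖x - y‖ := by
        gcongr
        · exact hi _
        · exact T₀.le_opNorm _
    _ ≤ D * ‖x - y‖ + ‖T i y - T₀ y‖ := by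
        have := mul_le_mul_of_nonneg_right (le_max_left C 0) (norm_nonneg (x - y))
        simp only [D]
        nlinarith [norm_nonneg (x - y)]
    _ < D * (δ / (2 * D)) + δ / 2 := by gcongr
    _ = δ := by field_simp; norm_num

end NuclearDecomposition

/-! ### Two-sided multiplication between different Hilbert spaces. -/

section Compress

variable {H₁ H₂ H₃ : Type*} [NormedAddCommGroup H₁] [InnerProductSpace ℂ H₁] [CompleteSpace H₁]
  [NormedAddCommGroup H₂] [InnerProductSpace ℂ H₂] [CompleteSpace H₂]
  [NormedAddCommGroup H₃] [InnerProductSpace ℂ H₃] [CompleteSpace H₃]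

/-- Apply `A` and `B†` to the vectors of a nuclear decomposition. This works between different
spaces, where no span of unitaries is at hand, and yields an explicit constant; the factor 2 is that
of `exists_nuclear`. -/
lemma exists_compress (A : H₁ →L[ℂ] H₂) (B : H₂ →L[ℂ] H₁) (ρ : TraceClass H₁) :
    ∃ σ : TraceClass H₂, σ.op = A ∘L ρ.op ∘L B ∧ ‖σ‖ ≤ 2 * (‖A‖ * ‖B‖) * ‖ρ‖ := by
  obtain ⟨J, x, y, h1, h2, hs⟩ := exists_nuclear ρ
  have hle : ∀ i, ‖dyad (A (x i)) (B.adjoint (y i))‖ ≤ (‖A‖ * ‖B‖) * (‖x i‖ * ‖y i‖) := fun i => by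
    refine (norm_dyad_le _ _).trans ?_
    have := B.adjoint.le_opNorm (y i)
    rw [LinearIsometryEquiv.norm_map] at this
    calc _ ≤ (‖A‖ * ‖x i‖) * (‖B‖ * ‖y i‖) := by gcongr; exact A.le_opNorm _
      _ = _ := by ring
  have hS : Summable fun i => dyad (A (x i)) (B.adjoint (y i)) :=
    Summable.of_norm_bounded (h1.mul_left _) hle
  refine ⟨∑' i, dyad (A (x i)) (B.adjoint (y i)), ?_, ?_⟩
  · ext z
    refine (TraceClass.hasSum_op_apply hS.hasSum z).unique ?_
    have := (TraceClass.hasSum_op_apply hs (B z)).mapL A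
    simpa only [dyad_op_apply, map_smul, ContinuousLinearMap.adjoint_inner_left,
      ContinuousLinearMap.comp_apply] using this
  · refine (tsum_of_norm_bounded ((h1.mul_left (‖A‖ * ‖B‖)).hasSum) hle).trans ?_
    rw [tsum_mul_left]
    nlinarith [mul_le_mul_of_nonneg_left h2 (by positivity : 0 ≤ ‖A‖ * ‖B‖)]

/-- The operator `A ρ B` as an element of `B₁(H₂)`. -/
def compressFun (A : H₁ →L[ℂ] H₂) (B : H₂ →L[ℂ] H₁) (ρ : TraceClass H₁) : TraceClass H₂ :=
  (exists_compress A B ρ).choose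

lemma compressFun_op (A : H₁ →L[ℂ] H₂) (B : H₂ →L[ℂ] H₁) (ρ : TraceClass H₁) :
    (compressFun A B ρ).op = A ∘L ρ.op ∘L B := (exists_compress A B ρ).choose_spec.1

/-- The map `ρ ↦ A ρ B` from `B₁(H₁)` to `B₁(H₂)`. -/
def compress (A : H₁ →L[ℂ] H₂) (B : H₂ →L[ℂ] H₁) : TraceClass H₁ →L[ℂ] TraceClass H₂ :=
  LinearMap.mkContinuous
    { toFun := compressFun A B
      map_add' := fun ρ σ => TraceClass.ext fun x => by
        simp [TraceClass.op_add, compressFun_op]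
      map_smul' := fun c ρ => TraceClass.ext fun x => by
        simp [compressFun_op] }
    (2 * (‖A‖ * ‖B‖)) fun ρ => (exists_compress A B ρ).choose_spec.2

lemma compress_op (A : H₁ →L[ℂ] H₂) (B : H₂ →L[ℂ] H₁) (ρ : TraceClass H₁) :
    (compress A B ρ).op = A ∘L ρ.op ∘L B := compressFun_op A B ρ

lemma norm_compress_apply_le (A : H₁ →L[ℂ] H₂) (B : H₂ →L[ℂ] H₁) (ρ : TraceClass H₁) :
    ‖compress A B ρ‖ ≤ 2 * (‖A‖ * ‖B‖) * ‖ρ‖ := (exists_compress A B ρ).choose_spec.2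

lemma norm_compress_le (A : H₁ →L[ℂ] H₂) (B : H₂ →L[ℂ] H₁) :
    ‖compress A B‖ ≤ 2 * (‖A‖ * ‖B‖) :=
  ContinuousLinearMap.opNorm_le_bound _ (by positivity) (norm_compress_apply_le A B)

lemma compress_dyad (A : H₁ →L[ℂ] H₂) (B : H₂ →L[ℂ] H₁) (x y : H₁) :
    compress A B (dyad x y) = dyad (A x) (B.adjoint y) := TraceClass.ext fun z => by
  simp [compress_op, dyad_op_apply, ContinuousLinearMap.adjoint_inner_left]

lemma compress_compress (A : H₁ →L[ℂ] H₂) (B : H₂ →L[ℂ] H₁) (C : H₂ →L[ℂ] H₃) (D : H₃ →L[ℂ] H₂)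
    (ρ : TraceClass H₁) : compress C D (compress A B ρ) = compress (C ∘L A) (B ∘L D) ρ :=
  TraceClass.ext fun z => by simp [compress_op]

lemma sandwich_eq_compress (A B : Op H₁) : sandwich A B = compress A B := by
  ext1 ρ
  apply TraceClass.op_injective
  change (sandwich A B ρ).op = (compress A B ρ).op
  rw [compress_op, sandwich_op]
  rfl

lemma norm_sandwich_le (A B : Op H₁) : ‖sandwich A B‖ ≤ 2 * (‖A‖ * ‖B‖) := by
  rw [sandwich_eq_compress]; exact norm_compress_le A B

lemma sandwich_dyad (A B : Op H₁) (x y : H₁) :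
    sandwich A B (dyad x y) = dyad (A x) (star B y) := by
  rw [sandwich_eq_compress, compress_dyad]; rfl

lemma sandwich_sandwich (A B C D : Op H₁) (ρ : TraceClass H₁) :
    sandwich C D (sandwich A B ρ) = sandwich (C * A) (B * D) ρ :=
  TraceClass.op_injective (by
    change TraceClass.op _ = TraceClass.op _
    simp only [sandwich_op, mul_assoc])

lemma sandwich_mul_sandwich (A B C D : Op H₁) :
    sandwich C D * sandwich A B = sandwich (C * A) (B * D) :=
  ContinuousLinearMap.ext fun ρ => sandwich_sandwich A B C D ρ

lemma sandwich_one_one : sandwich (1 : Op H₁) 1 = 1 := by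
  ext1 ρ
  apply TraceClass.op_injective
  change (sandwich 1 1 ρ).op = ρ.op
  rw [sandwich_op, one_mul, mul_one]

end Compress

/-! ### The trace as a bounded functional. -/

section Trace

variable {H : Type*} [NormedAddCommGroup H] [InnerProductSpace ℂ H] [CompleteSpace H]

variable (H) in
/-- The orthonormal basis in the definition of the trace. -/
abbrev traceBasis : HilbertBasis (exists_hilbertBasis ℂ H).choose ℂ H :=
  (exists_hilbertBasis ℂ H).choose_spec.choose

lemma hasSum_trace (ρ : TraceClass H) :
    HasSum (fun i => inner ℂ (traceBasis H i) (ρ.op (traceBasis H i))) (trace ρ.op) :=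
  (ρ.summable_norm_inner _ (traceBasis H).orthonormal).of_norm.hasSum

variable (H) in
/-- The trace as a bounded functional on `B₁(H)`. -/
def traceL : TraceClass H →L[ℂ] ℂ :=
  LinearMap.mkContinuous
    { toFun := fun ρ => trace ρ.op
      map_add' := fun ρ σ => by
        refine (hasSum_trace (ρ + σ)).unique ?_
        simpa only [TraceClass.op_add, add_apply, inner_add_right]
          using (hasSum_trace ρ).add (hasSum_trace σ)
      map_smul' := fun c ρ => by
        refine (hasSum_trace (c • ρ)).unique ?_
        simpa only [TraceClass.op_smul, smul_apply, inner_smul_right, RingHom.id_apply,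
          smul_eq_mul] using (hasSum_trace ρ).mul_left c }
    1 fun ρ => by
      rw [one_mul]
      have hs := ρ.summable_norm_inner _ (traceBasis H).orthonormal
      refine (tsum_of_norm_bounded hs.hasSum fun i => le_rfl).trans ?_
      exact hs.tsum_le_of_sum_le (ρ.sum_norm_inner_le _ (traceBasis H).orthonormal)

lemma traceL_apply (ρ : TraceClass H) : traceL H ρ = trace ρ.op := rfl

lemma norm_trace_le (ρ : TraceClass H) : ‖trace ρ.op‖ ≤ ‖ρ‖ :=
  ((traceL H).le_of_opNorm_le (LinearMap.mkContinuous_norm_le _ zero_le_one _) ρ).trans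
    (one_mul _).le

lemma trace_dyad (x y : H) : traceL H (dyad x y) = inner ℂ y x := by
  refine (hasSum_trace (dyad x y)).unique ?_
  simpa only [dyad_op_apply, inner_smul_right] using (traceBasis H).hasSum_inner_mul_inner y x

/-- Cyclicity of the trace: on `|x⟩⟨y|` both sides are `⟨y, A x⟩`. -/
lemma trace_sandwich_comm (A : Op H) (ρ : TraceClass H) :
    traceL H (sandwich A 1 ρ) = traceL H (sandwich 1 A ρ) := by
  have : traceL H ∘L sandwich A 1 = traceL H ∘L sandwich 1 A := by
    refine TraceClass.clm_ext fun x y => ?_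
    simp only [ContinuousLinearMap.comp_apply, sandwich_dyad, trace_dyad, star_one,
      one_apply_eq_self, ContinuousLinearMap.star_eq_adjoint, ContinuousLinearMap.adjoint_inner_left]
  exact congrArg (fun f => f ρ) this

lemma trace_sandwich_isometry {U : Op H} (hU : star U * U = 1) (ρ : TraceClass H) :
    traceL H (sandwich U (star U) ρ) = traceL H ρ := by
  have : traceL H ∘L sandwich U (star U) = traceL H := by
    refine TraceClass.clm_ext fun x y => ?_
    simp only [ContinuousLinearMap.comp_apply, sandwich_dyad, trace_dyad, star_star]
    rw [← ContinuousLinearMap.adjoint_inner_right, ← ContinuousLinearMap.star_eq_adjoint,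
      ← mul_apply_eq_comp, hU, one_apply_eq_self]
  exact congrArg (fun f => f ρ) this

end Trace

/-! ### Dyson series for bounded linear vector fields. -/

section ODE

variable {E : Type*} [NormedAddCommGroup E] [NormedSpace ℝ E] [CompleteSpace E]

/-- A uniformly bounded time-dependent linear vector field that is measurable along continuous
curves. -/
structure IsBoundedField (B : ℝ → E →L[ℝ] E) (C : ℝ) : Prop where
  bound : ∀ t, ‖B t‖ ≤ C
  measurable : ∀ f : ℝ → E, Continuous f → AEStronglyMeasurable (fun s => B s (f s)) volume

/-- The terms of the Dyson series. -/
def dysonTerm (B : ℝ → E →L[ℝ] E) (t₀ : ℝ) (x : E) : ℕ → ℝ → E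
  | 0 => fun _ => x
  | n + 1 => fun t => ∫ s in t₀..t, B s (dysonTerm B t₀ x n s)

variable {B : ℝ → E →L[ℝ] E} {C : ℝ} (hB : IsBoundedField B C) (t₀ : ℝ) (x : E)

include hB

lemma IsBoundedField.nonneg : 0 ≤ C := (norm_nonneg _).trans (hB.bound 0)

lemma IsBoundedField.norm_apply_le (t : ℝ) (y : E) : ‖B t y‖ ≤ C * ‖y‖ :=
  (B t).le_of_opNorm_le (hB.bound t) y

lemma IsBoundedField.intervalIntegrable {f : ℝ → E} (hf : Continuous f) (a b : ℝ) :
    IntervalIntegrable (fun s => B s (f s)) volume a b := by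
  have h1 : IntervalIntegrable (fun s => C * ‖f s‖) volume a b :=
    (continuous_const.mul hf.norm).intervalIntegrable a b
  refine h1.mono_fun (hB.measurable f hf).restrict (ae_of_all _ fun s => ?_)
  simp only [norm_mul, norm_norm]
  refine (hB.norm_apply_le s _).trans ?_
  gcongr
  exact le_abs_self _

lemma continuous_dysonTerm (n : ℕ) : Continuous (dysonTerm B t₀ x n) := by
  induction n with
  | zero => exact continuous_const
  | succ n ih => exact intervalIntegral.continuous_primitive (hB.intervalIntegrable ih) t₀

lemma norm_dysonTerm_le (n : ℕ) (t : ℝ) :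
    ‖dysonTerm B t₀ x n t‖ ≤ ‖x‖ * ((C * |t - t₀|) ^ n / n.factorial) := by
  induction n generalizing t with
  | zero => simp [dysonTerm]
  | succ n ih =>
    have hC := hB.nonneg
    have h1 : ∀ s, ‖B s (dysonTerm B t₀ x n s)‖ ≤
        (‖x‖ * C ^ (n + 1) / n.factorial) * |s - t₀| ^ n := fun s => by
      refine (hB.norm_apply_le s _).trans ((mul_le_mul_of_nonneg_left (ih s) hC).trans (le_of_eq ?_))
      rw [mul_pow]; ring
    have h2 := intervalIntegral.norm_integral_le_abs_of_norm_le (a := t₀) (b := t) (μ := volume)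
      (f := fun s => B s (dysonTerm B t₀ x n s)) (ae_of_all _ fun s => h1 s)
      (by apply Continuous.intervalIntegrable; fun_prop)
    refine h2.trans (le_of_eq ?_)
    rw [intervalIntegral.abs_integral_eq_abs_integral_uIoc, integral_const_mul,
      integral_pow_abs_sub_uIoc, abs_of_nonneg (by positivity), Nat.factorial_succ]
    push_cast
    field_simp
    ring

/-- The Dyson series solves the integral equation. -/
lemma exists_integral_solution :
    ∃ X : ℝ → E, Continuous X ∧ ∀ t, X t = x + ∫ s in t₀..t, B s (X s) := by
  have hC := hB.nonneg
  have hbd : ∀ R, 0 ≤ R → ∀ n t, |t - t₀| ≤ R →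
      ‖dysonTerm B t₀ x n t‖ ≤ ‖x‖ * ((C * R) ^ n / n.factorial) := fun R hR n t ht => by
    refine (norm_dysonTerm_le hB t₀ x n t).trans ?_
    gcongr
  have hsum : ∀ R, Summable fun n : ℕ => ‖x‖ * ((C * R) ^ n / n.factorial) := fun R =>
    (Real.summable_pow_div_factorial _).mul_left _
  have hS : ∀ t, Summable fun n => dysonTerm B t₀ x n t := fun t =>
    Summable.of_norm_bounded (hsum |t - t₀|) fun n => hbd _ (abs_nonneg _) n t le_rfl
  set X : ℝ → E := fun t => ∑' n, dysonTerm B t₀ x n t with hX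
  have hXc : Continuous X := by
    refine continuous_iff_continuousAt.2 fun t => ?_
    have hn : {s : ℝ | |s - t₀| < |t - t₀| + 1} ∈ 𝓝 t :=
      (isOpen_lt (by fun_prop) continuous_const).mem_nhds (by simp)
    exact (continuousOn_tsum (fun n => (continuous_dysonTerm hB t₀ x n).continuousOn)
      (hsum (|t - t₀| + 1)) fun n s hs => hbd _ (by positivity) n s (le_of_lt hs)).continuousAt hn
  refine ⟨X, hXc, fun t => ?_⟩
  have h1 : HasSum (fun n => ∫ s in t₀..t, B s (dysonTerm B t₀ x n s))
      (∫ s in t₀..t, B s (X s)) := by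
    refine intervalIntegral.hasSum_integral_of_dominated_convergence
      (fun n _ => C * (‖x‖ * ((C * |t - t₀|) ^ n / n.factorial)))
      (fun n => (hB.measurable _ (continuous_dysonTerm hB t₀ x n)).restrict)
      (fun n => ae_of_all _ fun s hs => ?_) (ae_of_all _ fun s _ => (hsum _).mul_left _)
      intervalIntegrable_const (ae_of_all _ fun s _ => (hS s).hasSum.mapL (B s))
    refine (hB.norm_apply_le s _).trans ?_
    gcongr
    refine hbd _ (abs_nonneg _) n s ?_
    have := Set.abs_sub_left_of_mem_uIcc (Set.uIoc_subset_uIcc hs)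
    rwa [abs_sub_comm] at this ⊢
  -- Integrating the series termwise shifts the index by one, so the integral is the series without
  -- its zeroth term `x`.
  have h2 := (hS t).hasSum_iff.2 rfl
  rw [← hasSum_nat_add_iff' 1] at h2
  have h3 := h1.unique h2
  rw [h3]
  simp [dysonTerm, X]

end ODE

/-! ### The fundamental theorem of calculus off a countable set. -/

section Derivative

/-- The coefficients are only piecewise continuous, so derivatives are known only off a countable
set of times. -/
lemma integral_eq_sub_of_hasDerivAt_off_countable {E : Type*} [NormedAddCommGroup E]
    [NormedSpace ℝ E] [CompleteSpace E] {f f' : ℝ → E} {D : Set ℝ} (hD : D.Countable)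
    (hf : Continuous f) (h : ∀ t ∉ D, HasDerivAt f (f' t) t) {a b : ℝ}
    (hi : IntervalIntegrable f' volume a b) : ∫ t in a..b, f' t = f b - f a :=
  integral_eq_of_hasDerivAt_off_countable f f' hD hf.continuousOn (fun t ht => h t ht.2) hi

lemma eq_of_hasDerivAt_zero_off_countable {E : Type*} [NormedAddCommGroup E]
    [NormedSpace ℝ E] [CompleteSpace E] {f : ℝ → E} {D : Set ℝ} (hD : D.Countable)
    (hf : Continuous f) (h : ∀ t ∉ D, HasDerivAt f 0 t) (a b : ℝ) : f b = f a := by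
  have := integral_eq_sub_of_hasDerivAt_off_countable (f' := fun _ => 0) hD hf h (a := a) (b := b)
    intervalIntegrable_const
  rw [intervalIntegral.integral_zero] at this
  exact (sub_eq_zero.1 this.symm)

lemma aestronglyMeasurable_of_continuousAt_off_countable {E : Type*} [TopologicalSpace E]
    [TopologicalSpace.PseudoMetrizableSpace E] {f : ℝ → E} {D : Set ℝ} (hD : D.Countable)
    (h : ∀ t ∉ D, ContinuousAt f t) : AEStronglyMeasurable f volume := by
  have h1 : ContinuousOn f Dᶜ := fun t ht => (h t ht).continuousWithinAt
  have h2 := h1.aestronglyMeasurable (μ := volume) hD.measurableSet.compl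
  rwa [Measure.restrict_eq_self_of_ae_mem] at h2
  exact measure_eq_zero_iff_ae_notMem.1 (hD.measure_zero volume)

end Derivative

/-! ### Linear equations with piecewise continuous coefficients. -/

section FundamentalSolution

lemma PiecewiseContinuous.exists_countable {E : Type*} [TopologicalSpace E] {f : ℝ → E}
    (hf : PiecewiseContinuous f) : ∃ D : Set ℝ, D.Countable ∧ ∀ t ∉ D, ContinuousAt f t := by
  obtain ⟨D, hD, hc, -⟩ := hf
  refine ⟨D, ?_, hc⟩
  have : D = ⋃ n : ℕ, D ∩ Set.Icc (-(n : ℝ)) n := by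
    rw [← Set.inter_iUnion, Set.inter_eq_left.2]
    intro t _
    obtain ⟨n, hn⟩ := exists_nat_ge |t|
    exact Set.mem_iUnion.2 ⟨n, abs_le.1 hn⟩
  rw [this]
  exact Set.countable_iUnion fun n => (hD _ _).countable

/-- Compactness of one period. Near a discontinuity the two one-sided limits bound the function on
either side, and the value at the point itself is added separately. -/
lemma PiecewiseContinuous.exists_bound {E : Type*} [SeminormedAddCommGroup E] {f : ℝ → E}
    (hf : PiecewiseContinuous f) {T : ℝ} (hT : 0 < T) (hp : Function.Periodic f T) :
    ∃ C, ∀ t, ‖f t‖ ≤ C := by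
  obtain ⟨D, -, hc, hd⟩ := hf
  have hloc : ∀ {l : Filter ℝ} {y : E}, Tendsto f l (𝓝 y) → ∀ᶠ t in l, ‖f t‖ ≤ ‖y‖ + 1 :=
    fun h => (h.norm.eventually_lt_const (lt_add_one _)).mono fun _ => le_of_lt
  have key : ∃ C, ∀ t ∈ Set.Icc 0 T, ‖f t‖ ≤ C := by
    refine isCompact_Icc.induction_on (p := fun s => ∃ C, ∀ t ∈ s, ‖f t‖ ≤ C) ⟨0, by simp⟩
      (fun s t hst ⟨C, hC⟩ => ⟨C, fun x hx => hC x (hst hx)⟩)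
      (fun s t ⟨C, hC⟩ ⟨C', hC'⟩ => ⟨max C C', fun x hx => hx.elim
        (fun h => (hC x h).trans (le_max_left _ _)) fun h => (hC' x h).trans (le_max_right _ _)⟩)
      fun t _ => ?_
    by_cases ht : t ∈ D
    · obtain ⟨⟨y, hy⟩, z, hz⟩ := hd t ht
      set C := max (max (‖y‖ + 1) (‖z‖ + 1)) ‖f t‖
      refine ⟨_, mem_nhdsWithin_of_mem_nhds (?_ : {s | ‖f s‖ ≤ C} ∈ 𝓝 t), C, fun _ h => h⟩
      rw [← nhdsNE_sup_pure, ← nhdsLT_sup_nhdsGT]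
      refine Filter.mem_sup.2 ⟨Filter.mem_sup.2 ⟨?_, ?_⟩, ?_⟩
      · exact (hloc hy).mono fun s hs => hs.trans ((le_max_left _ _).trans (le_max_left _ _))
      · exact (hloc hz).mono fun s hs => hs.trans ((le_max_right _ _).trans (le_max_left _ _))
      · exact mem_pure.2 (show ‖f t‖ ≤ C from le_max_right _ _)
    · exact ⟨_, mem_nhdsWithin_of_mem_nhds (hloc (hc t ht)), _, fun _ h => h⟩
  obtain ⟨C, hC⟩ := key
  refine ⟨C, fun t => ?_⟩
  obtain ⟨s, hs, hst⟩ := hp.exists_mem_Ico₀ hT t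
  rw [hst]
  exact hC s (Set.Ico_subset_Icc_self hs)

variable {𝔸 : Type*} [NormedRing 𝔸] [NormedAlgebra ℝ 𝔸] [CompleteSpace 𝔸]

lemma isBoundedField_mul_left {A : ℝ → 𝔸} {C : ℝ} {D : Set ℝ} (hD : D.Countable)
    (hA : ∀ t ∉ D, ContinuousAt A t) (hC : ∀ t, ‖A t‖ ≤ C) :
    IsBoundedField (fun t => ContinuousLinearMap.mul ℝ 𝔸 (A t)) C where
  bound t := (ContinuousLinearMap.opNorm_mul_apply_le ℝ 𝔸 _).trans (hC t)
  measurable _ hf := aestronglyMeasurable_of_continuousAt_off_countable hD fun t ht =>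
    (hA t ht).mul hf.continuousAt

lemma exists_isFundamentalSolution {A : ℝ → 𝔸} {C : ℝ} {D : Set ℝ} (hD : D.Countable)
    (hA : ∀ t ∉ D, ContinuousAt A t) (hC : ∀ t, ‖A t‖ ≤ C) (t₀ : ℝ) :
    ∃ X, IsFundamentalSolution A t₀ X := by
  have hB := isBoundedField_mul_left hD hA hC
  obtain ⟨X, hX, h⟩ := exists_integral_solution hB t₀ (1 : 𝔸)
  refine ⟨X, hX, by simpa using h t₀, fun t ht => ?_⟩
  have h1 : HasDerivAt (fun t => (1 : 𝔸) + ∫ s in t₀..t, A s * X s) (A t * X t) t :=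
    (intervalIntegral.integral_hasDerivAt_right (hB.intervalIntegrable hX t₀ t)
      (hB.measurable X hX).stronglyMeasurableAtFilter (ht.mul hX.continuousAt)).const_add _
  have h2 : X = fun t => (1 : 𝔸) + ∫ s in t₀..t, A s * X s := funext h
  exact h1.congr_of_eventuallyEq (Eventually.of_forall fun t => congrFun h2 t)

end FundamentalSolution

/-! ### Real scalars on the algebra of complex-linear operators. -/

section RealAlgebra

variable {E : Type*} [NormedAddCommGroup E] [NormedSpace ℂ E]

/-- The real Banach algebra structure on complex-linear operators that extends their real normed
space structure. -/
instance realNormedAlgebra : NormedAlgebra ℝ (E →L[ℂ] E) :=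
  { Algebra.ofModule (fun _ _ _ => smul_mul_assoc _ _ _) (fun _ _ _ => mul_smul_comm _ _ _) with
    norm_smul_le := fun c A => (norm_smul c A).le }

end RealAlgebra

/-! ### The propagator: unitarity, uniqueness, periodicity. -/

section Propagator

variable {H : Type*} [NormedAddCommGroup H] [InnerProductSpace ℂ H] [CompleteSpace H]
  {HS : ℝ → Op H} {t₀ C : ℝ} {D : Set ℝ}

lemma continuousAt_neg_I_smul {t : ℝ} (h : ContinuousAt HS t) :
    ContinuousAt (fun t => (-I) • HS t) t :=
  (continuous_const_smul (-I)).continuousAt.comp h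

/-- The propagator is chosen by `Classical.epsilon`, so all its properties rest on the existence of
a fundamental solution, here from the Dyson series. -/
lemma isFundamentalSolution_propagator (hD : D.Countable) (hc : ∀ t ∉ D, ContinuousAt HS t)
    (hC : ∀ t, ‖HS t‖ ≤ C) :
    IsFundamentalSolution (fun t => (-I) • HS t) t₀ (propagator HS t₀) :=
  Classical.epsilon_spec (exists_isFundamentalSolution (C := C) hD
    (fun t ht => continuousAt_neg_I_smul (hc t ht)) (fun t => by simpa [norm_smul] using hC t) t₀)

lemma star_mul_self_of_isFundamentalSolution (hHS : ∀ t, IsSelfAdjoint (HS t)) (hD : D.Countable)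
    (hc : ∀ t ∉ D, ContinuousAt HS t) {U : ℝ → Op H}
    (hU : IsFundamentalSolution (fun t => (-I) • HS t) t₀ U) (t : ℝ) : star (U t) * U t = 1 := by
  have h := eq_of_hasDerivAt_zero_off_countable (f := fun t => star (U t) * U t) hD
    (hU.1.star.mul hU.1) (fun t ht => ?_) t₀ t
  · simpa [hU.2.1] using h
  · have h1 := hU.2.2 t (continuousAt_neg_I_smul (hc t ht))
    refine (h1.star.mul h1).congr_deriv ?_
    simp only [star_mul, star_smul, (hHS t).star_eq, star_neg, RCLike.star_def, conj_I,
      smul_mul_assoc, mul_smul_comm, mul_assoc]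
    module

/-- In infinite dimension `U†U = 1` does not imply `UU† = 1`. The set of times at which the latter
holds is closed, and it is open because the invertible operators form an open set and an invertible
isometry is unitary. It contains `t₀`, hence it is the whole line. -/
lemma mem_unitary_of_isFundamentalSolution (hHS : ∀ t, IsSelfAdjoint (HS t)) (hD : D.Countable)
    (hc : ∀ t ∉ D, ContinuousAt HS t) {U : ℝ → Op H}
    (hU : IsFundamentalSolution (fun t => (-I) • HS t) t₀ U) (t : ℝ) : U t ∈ unitary (Op H) := by
  have h1 := star_mul_self_of_isFundamentalSolution hHS hD hc hU
  have h2 : IsClopen {t | U t * star (U t) = 1} := by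
    refine ⟨isClosed_eq (hU.1.mul hU.1.star) continuous_const, isOpen_iff_mem_nhds.2 fun t ht => ?_⟩
    have hu : IsUnit (U t) := ⟨⟨U t, star (U t), ht, h1 t⟩, rfl⟩
    filter_upwards [hU.1.continuousAt.preimage_mem_nhds (Units.isOpen.mem_nhds hu)] with s hs
    obtain ⟨u, hu⟩ := (hs : IsUnit (U s))
    have h3 := h1 s
    rw [← hu] at h3
    have h4 : star (u : Op H) = (↑u⁻¹ : Op H) := by rw [← u.mul_left_inj, h3, u.inv_mul]
    change U s * star (U s) = 1
    rw [← hu, h4, u.mul_inv]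
  have h3 := h2.eq_univ ⟨t₀, by simp [hU.2.1]⟩
  exact Unitary.mem_iff.2 ⟨h1 t, by have : t ∈ {t | U t * star (U t) = 1} := by rw [h3]; trivial
                                    exact this⟩

lemma eq_of_isFundamentalSolution (hHS : ∀ t, IsSelfAdjoint (HS t)) (hD : D.Countable)
    (hc : ∀ t ∉ D, ContinuousAt HS t) {U W : ℝ → Op H}
    (hU : IsFundamentalSolution (fun t => (-I) • HS t) t₀ U)
    (hW : IsFundamentalSolution (fun t => (-I) • HS t) t₀ W) (t : ℝ) : W t = U t := by
  have h := eq_of_hasDerivAt_zero_off_countable (f := fun t => star (U t) * W t) hD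
    (hU.1.star.mul hW.1) (fun t ht => ?_) t₀ t
  · have h2 : star (U t) * W t = 1 := by simpa [hU.2.1, hW.2.1] using h
    have h3 := (Unitary.mem_iff.1 (mem_unitary_of_isFundamentalSolution hHS hD hc hU t)).2
    rw [← one_mul (W t), ← h3, mul_assoc, h2, mul_one]
  · have h1 := hU.2.2 t (continuousAt_neg_I_smul (hc t ht))
    have h2 := hW.2.2 t (continuousAt_neg_I_smul (hc t ht))
    refine (h1.star.mul h2).congr_deriv ?_
    simp only [star_mul, star_smul, (hHS t).star_eq, star_neg, RCLike.star_def, conj_I,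
      smul_mul_assoc, mul_smul_comm, mul_assoc]
    module

/-- By periodicity of `H_S`, the map `t ↦ U(t+T) U(t₀+T)†` solves the same initial value problem as
`U`; uniqueness does the rest. -/
lemma propagator_add_period (hHS : ∀ t, IsSelfAdjoint (HS t)) (hD : D.Countable)
    (hc : ∀ t ∉ D, ContinuousAt HS t) {T : ℝ} (hper : Function.Periodic HS T)
    (hU : IsFundamentalSolution (fun t => (-I) • HS t) t₀ (propagator HS t₀)) (t : ℝ) :
    propagator HS t₀ (t + T) = propagator HS t₀ t * propagator HS t₀ (t₀ + T) := by
  set U := propagator HS t₀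
  have hu := Unitary.mem_iff.1 (mem_unitary_of_isFundamentalSolution hHS hD hc hU (t₀ + T))
  have hW : IsFundamentalSolution (fun t => (-I) • HS t) t₀
      (fun t => U (t + T) * star (U (t₀ + T))) := by
    refine ⟨by have := hU.1; fun_prop, hu.2, fun t ht => ?_⟩
    have h1 : ContinuousAt (fun t => (-I) • HS t) (t + T) := by
      have h2 : (fun t => (-I) • HS t) = (fun t => (-I) • HS t) ∘ fun t => t - T := by
        ext1 s; simp [hper.sub_eq]
      rw [h2]
      refine ContinuousAt.comp ?_ (by fun_prop)
      simpa using ht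
    have h3 := (hU.2.2 _ h1).comp_add_const t T
    have h4 := h3.mul_const (star (U (t₀ + T)))
    simp only [hper t, mul_assoc] at h4 ⊢
    exact h4
  have h := eq_of_isFundamentalSolution hHS hD hc hU hW t
  rw [← h, mul_assoc, hu.1, mul_one]

end Propagator

/-! ### The master equation by variation of constants. -/

section MasterEquation

variable {H : Type*} [NormedAddCommGroup H] [InnerProductSpace ℂ H] [CompleteSpace H]

lemma isBoundedBilinearMap_sandwich :
    IsBoundedBilinearMap ℝ (fun p : Op H × Op H => sandwich p.1 p.2) where
  add_left A B X := ContinuousLinearMap.ext fun ρ => TraceClass.ext fun x => by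
    simp [sandwich_op, TraceClass.op_add]
  smul_left c A B := ContinuousLinearMap.ext fun ρ => TraceClass.ext fun x => by
    change _ = ((c : ℂ) • (sandwich A B) ρ).op x
    simp [sandwich_op]
  add_right A B X := ContinuousLinearMap.ext fun ρ => TraceClass.ext fun x => by
    simp [sandwich_op, TraceClass.op_add]
  smul_right c A B := ContinuousLinearMap.ext fun ρ => TraceClass.ext fun x => by
    change _ = ((c : ℂ) • (sandwich A B) ρ).op x
    simp [sandwich_op]
  bound := ⟨2, two_pos, fun A B => by rw [mul_assoc]; exact norm_sandwich_le A B⟩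

lemma sandwich_smul_left (c : ℂ) (A B : Op H) : sandwich (c • A) B = c • sandwich A B :=
  ContinuousLinearMap.ext fun ρ => TraceClass.ext fun x => by
    simp [sandwich_op]

lemma sandwich_smul_right (c : ℂ) (A B : Op H) : sandwich A (c • B) = c • sandwich A B :=
  ContinuousLinearMap.ext fun ρ => TraceClass.ext fun x => by
    simp [sandwich_op]

lemma sandwich_add_left (A B X : Op H) : sandwich (A + B) X = sandwich A X + sandwich B X :=
  isBoundedBilinearMap_sandwich.add_left A B X

lemma sandwich_add_right (A B X : Op H) : sandwich X (A + B) = sandwich X A + sandwich X B :=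
  isBoundedBilinearMap_sandwich.add_right X A B

lemma HasDerivAt.sandwich {A B : ℝ → Op H} {A' B' : Op H} {t : ℝ} (hA : HasDerivAt A A' t)
    (hB : HasDerivAt B B' t) : HasDerivAt (fun t => sandwich (A t) (B t))
      (sandwich (A t) B' + sandwich A' (B t)) t := by
  have h1 := (isBoundedBilinearMap_sandwich (H := H)).hasFDerivAt (A t, B t)
  exact h1.comp_hasDerivAt t (hA.prodMk hB)

variable {HS : ℝ → Op H} {t₀ C : ℝ} {D : Set ℝ}

lemma hasDerivAt_conjBy (hHS : ∀ t, IsSelfAdjoint (HS t)) {U : ℝ → Op H} {t : ℝ}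
    (h : HasDerivAt U ((-I) • HS t * U t) t) :
    HasDerivAt (fun t => conjBy (U t)) ((-I) • commutator (HS t) * conjBy (U t)) t := by
  refine (HasDerivAt.sandwich h h.star).congr_deriv ?_
  simp only [conjBy, commutator, smul_mul_assoc, sub_mul, sandwich_mul_sandwich, star_mul, star_smul,
    (hHS t).star_eq, star_neg, RCLike.star_def, conj_I, neg_neg, mul_smul_comm, sandwich_smul_left,
    sandwich_smul_right, one_mul, mul_one]
  module

lemma hasDerivAt_conjBy_star (hHS : ∀ t, IsSelfAdjoint (HS t)) {U : ℝ → Op H} {t : ℝ}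
    (h : HasDerivAt U ((-I) • HS t * U t) t) :
    HasDerivAt (fun t => conjBy (star (U t))) (conjBy (star (U t)) * (I • commutator (HS t))) t := by
  have h1 : (fun t => conjBy (star (U t))) = fun t => OpenFloquet.sandwich (star (U t)) (U t) := by
    simp only [conjBy, star_star]
  rw [h1]
  refine (HasDerivAt.sandwich h.star h).congr_deriv ?_
  simp only [conjBy, commutator, smul_mul_assoc, mul_sub, sandwich_mul_sandwich, star_mul, star_smul,
    (hHS t).star_eq, star_neg, RCLike.star_def, conj_I, neg_neg, mul_smul_comm, sandwich_smul_left,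
    sandwich_smul_right, one_mul, mul_one, star_star]
  module

lemma hasDerivAt_exp_sub_smul {E : Type*} [NormedAddCommGroup E] [NormedSpace ℂ E]
    [CompleteSpace E] (L : E →L[ℂ] E) (t₀ t : ℝ) :
    HasDerivAt (fun t : ℝ => NormedSpace.exp (((t - t₀ : ℝ) : ℂ) • L))
      (L * NormedSpace.exp (((t - t₀ : ℝ) : ℂ) • L)) t := by
  have h1 := hasDerivAt_exp_smul_const' (𝕂 := ℂ) L ((t - t₀ : ℝ) : ℂ)
  have h2 : HasDerivAt (fun t : ℝ => ((t - t₀ : ℝ) : ℂ)) 1 t :=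
    ((hasDerivAt_id t).sub_const t₀).ofReal_comp
  have h3 := h1.scomp t h2
  rw [one_smul] at h3
  exact h3

lemma continuous_conjBy {U : ℝ → Op H} (hU : Continuous U) : Continuous fun t => conjBy (U t) :=
  isBoundedBilinearMap_sandwich.continuous.comp (hU.prodMk hU.star)

lemma conjBy_mul_conjBy_star {U : Op H} (hU : U ∈ unitary (Op H)) :
    conjBy U * conjBy (star U) = 1 := by
  rw [conjBy, conjBy, sandwich_mul_sandwich, (Unitary.mem_iff.1 hU).2, star_star,
    (Unitary.mem_iff.1 hU).2, sandwich_one_one]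

lemma conjBy_star_mul_conjBy {U : Op H} (hU : U ∈ unitary (Op H)) :
    conjBy (star U) * conjBy U = 1 := by
  rw [conjBy, conjBy, sandwich_mul_sandwich, (Unitary.mem_iff.1 hU).1, star_star,
    (Unitary.mem_iff.1 hU).1, sandwich_one_one]

lemma continuousAt_commutator {t : ℝ} (h : ContinuousAt HS t) :
    ContinuousAt (fun t => commutator (HS t)) t := by
  have hc := (isBoundedBilinearMap_sandwich (H := H)).continuous
  exact (hc.continuousAt.comp (h.prodMk continuousAt_const)).sub
    (hc.continuousAt.comp (f := fun t => ((1 : Op H), HS t)) (continuousAt_const.prodMk h))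

section Abstract

variable {𝔸 : Type*} [NormedRing 𝔸] [NormedAlgebra ℝ 𝔸] [CompleteSpace 𝔸]

/-- Variation of constants: `X' = (k + Z L Y) X` is solved uniquely by `Z E` if `Z' = k Z`,
`Y = Z⁻¹` and `E' = L E`. -/
lemma isFundamentalSolution_iff_eq_mul {Z Y E F k G : ℝ → 𝔸} {L : 𝔸} {D : Set ℝ} {t₀ C : ℝ}
    (hD : D.Countable) (hZc : Continuous Z) (hYc : Continuous Y)
    (hZ : ∀ t ∉ D, HasDerivAt Z (k t * Z t) t) (hY : ∀ t ∉ D, HasDerivAt Y (-(Y t * k t)) t)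
    (hE : ∀ t, HasDerivAt E (L * E t) t) (hF : ∀ t, HasDerivAt F (-(F t * L)) t)
    (hZY : ∀ t, Z t * Y t = 1) (hYZ : ∀ t, Y t * Z t = 1) (hEF : ∀ t, E t * F t = 1)
    (hZ₀ : Z t₀ = 1) (hY₀ : Y t₀ = 1) (hE₀ : E t₀ = 1) (hF₀ : F t₀ = 1)
    (hG : ∀ t, G t = k t + Z t * L * Y t) (hGc : ∀ t ∉ D, ContinuousAt G t)
    (hGb : ∀ t, ‖G t‖ ≤ C) (X : ℝ → 𝔸) :
    IsFundamentalSolution G t₀ X ↔ ∀ t, X t = Z t * E t := by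
  have hEc : Continuous E := continuous_iff_continuousAt.2 fun t => (hE t).continuousAt
  have hFc : Continuous F := continuous_iff_continuousAt.2 fun t => (hF t).continuousAt
  constructor
  · intro hX t
    -- The candidate solution is inverted: `F Y = (Z E)⁻¹`, and `F Y X` has derivative zero off `D`,
    -- hence equals 1.
    have h := eq_of_hasDerivAt_zero_off_countable (f := fun t => F t * Y t * X t) hD
      ((hFc.mul hYc).mul hX.1) (fun t ht => ?_) t₀ t
    · rw [hF₀, hY₀, hX.2.1, one_mul, one_mul] at h
      calc X t = Z t * (E t * F t) * Y t * X t := by rw [hEF, mul_one, hZY, one_mul]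
        _ = Z t * E t * (F t * Y t * X t) := by simp only [mul_assoc]
        _ = _ := by rw [h, mul_one]
    · refine (((hF t).mul (hY t ht)).mul (hX.2.2 t (hGc t ht))).congr_deriv ?_
      have e : F t * Y t * ((k t + Z t * L * Y t) * X t) =
          F t * Y t * k t * X t + F t * (Y t * Z t) * L * Y t * X t := by
        simp only [add_mul, mul_add, mul_assoc]
      rw [hG, Pi.mul_apply, e, hYZ]
      simp only [mul_neg, neg_mul, mul_one, add_mul, mul_assoc]
      abel
  · intro hX
    obtain rfl : X = fun t => Z t * E t := funext hX
    have hXc : Continuous fun t => Z t * E t := hZc.mul hEc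
    have hder : ∀ t ∉ D, HasDerivAt (fun t => Z t * E t) (G t * (Z t * E t)) t := by
      intro t ht
      refine ((hZ t ht).mul (hE t)).congr_deriv ?_
      have e : (k t + Z t * L * Y t) * (Z t * E t) =
          k t * Z t * E t + Z t * L * (Y t * Z t) * E t := by
        simp only [add_mul, mul_assoc]
      rw [hG, e, hYZ, mul_one]
      simp only [mul_assoc]
    have hB := isBoundedField_mul_left hD hGc hGb
    refine ⟨hXc, by simp [hZ₀, hE₀], fun t ht => ?_⟩
    -- The equation is required at every point of continuity of `G`, including those that lie in
    -- `D`, where `Z` need not be differentiable a priori. The integrated form of the equation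
    -- covers them.
    have h1 : HasDerivAt (fun t => Z t₀ * E t₀ + ∫ s in t₀..t, G s * (Z s * E s))
        (G t * (Z t * E t)) t :=
      (intervalIntegral.integral_hasDerivAt_right (hB.intervalIntegrable hXc t₀ t)
        (hB.measurable _ hXc).stronglyMeasurableAtFilter (ht.mul hXc.continuousAt)).const_add _
    refine h1.congr_of_eventuallyEq (Eventually.of_forall fun t => ?_)
    have := integral_eq_sub_of_hasDerivAt_off_countable hD hXc hder
      (hB.intervalIntegrable hXc t₀ t)
    exact (add_eq_of_eq_sub' this).symm

end Abstract

lemma norm_conjBy_le {U : Op H} (hU : U ∈ unitary (Op H)) : ‖conjBy U‖ ≤ 1 :=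
  ContinuousLinearMap.opNorm_le_bound _ zero_le_one fun ρ => by
    rw [one_mul]; exact norm_sandwich_unitary_le hU (Unitary.star_mem hU) ρ

lemma norm_commutator_le (A : Op H) : ‖commutator A‖ ≤ 4 * ‖A‖ := by
  have ha := norm_sandwich_le A 1
  have hb := norm_sandwich_le 1 A
  have h1 : ‖(1 : Op H)‖ ≤ 1 := ContinuousLinearMap.norm_id_le
  have := norm_sub_le (sandwich A 1) (sandwich 1 A)
  rw [← commutator] at this
  nlinarith [norm_nonneg A]

lemma norm_lindbladian_le {t : ℝ} (hu : propagator HS t₀ t ∈ unitary (Op H)) (hC : ‖HS t‖ ≤ C)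
    (L : TraceClass H →L[ℂ] TraceClass H) : ‖lindbladian HS t₀ L t‖ ≤ 4 * C + ‖L‖ := by
  have h2 : ‖dissipator HS t₀ L t‖ ≤ ‖L‖ := by
    refine (norm_mul_le _ _).trans ?_
    calc _ ≤ (1 * ‖L‖) * 1 := by
          gcongr
          · refine (norm_mul_le _ _).trans ?_
            gcongr
            exact norm_conjBy_le hu
          · exact norm_conjBy_le (Unitary.star_mem hu)
      _ = ‖L‖ := by ring
  refine (norm_add_le _ _).trans ?_
  rw [norm_smul, norm_neg, norm_I, one_mul]
  linarith [norm_commutator_le (HS t)]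

lemma exp_smul_mul_exp_smul_neg {E : Type*} [NormedAddCommGroup E] [NormedSpace ℂ E]
    [CompleteSpace E] (L : E →L[ℂ] E) (z : ℂ) :
    NormedSpace.exp (z • L) * NormedSpace.exp (z • (-L)) = 1 := by
  let _ : NormedAlgebra ℚ (E →L[ℂ] E) := .restrictScalars ℚ ℂ _
  rw [smul_neg, ← NormedSpace.exp_add_of_commute (Commute.refl _).neg_right, add_neg_cancel,
    NormedSpace.exp_zero]

/-- The master equation with generator `lindbladian` is solved uniquely by `dynamicalMap`. -/
lemma isFundamentalSolution_lindbladian_iff (hHS : ∀ t, IsSelfAdjoint (HS t)) (hD : D.Countable)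
    (hc : ∀ t ∉ D, ContinuousAt HS t) (hC : ∀ t, ‖HS t‖ ≤ C)
    (L : TraceClass H →L[ℂ] TraceClass H) (Λ : ℝ → TraceClass H →L[ℂ] TraceClass H) :
    IsFundamentalSolution (lindbladian HS t₀ L) t₀ Λ ↔ ∀ t, Λ t = dynamicalMap HS t₀ L t := by
  have hU := isFundamentalSolution_propagator (t₀ := t₀) hD hc hC
  have hu := mem_unitary_of_isFundamentalSolution hHS hD hc hU
  have hdiss : Continuous (dissipator HS t₀ L) :=
    ((continuous_conjBy hU.1).mul continuous_const).mul (continuous_conjBy hU.1.star)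
  have hone : conjBy (1 : Op H) = 1 := by rw [conjBy, star_one, sandwich_one_one]
  refine isFundamentalSolution_iff_eq_mul (Z := fun t => conjBy (propagator HS t₀ t))
    (Y := fun t => conjBy (star (propagator HS t₀ t)))
    (E := fun t => NormedSpace.exp (((t - t₀ : ℝ) : ℂ) • L))
    (F := fun t => NormedSpace.exp (((t - t₀ : ℝ) : ℂ) • (-L)))
    (k := fun t => (-I) • commutator (HS t)) (L := L) (C := 4 * C + ‖L‖)
    hD (continuous_conjBy hU.1) (continuous_conjBy hU.1.star)
    (fun t ht => hasDerivAt_conjBy hHS (hU.2.2 t (continuousAt_neg_I_smul (hc t ht))))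
    (fun t ht => (hasDerivAt_conjBy_star hHS
      (hU.2.2 t (continuousAt_neg_I_smul (hc t ht)))).congr_deriv ?_)
    (fun t => hasDerivAt_exp_sub_smul L t₀ t)
    (fun t => (hasDerivAt_exp_sub_smul (-L) t₀ t).congr_deriv ?_)
    (fun t => conjBy_mul_conjBy_star (hu t)) (fun t => conjBy_star_mul_conjBy (hu t))
    (fun t => exp_smul_mul_exp_smul_neg L _)
    (by simp only [hU.2.1, hone]) (by simp only [hU.2.1, star_one, hone])
    (by simp) (by simp) (fun t => rfl)
    (fun t ht => ?_) (fun t => norm_lindbladian_le (hu t) (hC t) L) Λ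
  · rw [neg_smul, mul_neg, neg_neg]
  · rw [neg_mul, neg_inj]
    exact (((Commute.refl L).neg_right.smul_right _).exp_right).eq
  · exact ((continuous_const_smul (-I)).continuousAt.comp (continuousAt_commutator (hc t ht))).add
      hdiss.continuousAt

end MasterEquation

/-! ### Asymptotic mean values of functions on the line. -/

section Mean

variable {E F : Type*} [NormedAddCommGroup E] [NormedSpace ℂ E]
  [NormedAddCommGroup F] [NormedSpace ℂ F]

/-- `m` is the asymptotic mean value of `f`. -/
def HasMean (f : ℝ → E) (m : E) : Prop :=
  Tendsto (fun t : ℝ => t⁻¹ • ∫ s in (0 : ℝ)..t, f s) atTop (𝓝 m)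

lemma HasMean.unique {f : ℝ → E} {m m' : E} (h : HasMean f m) (h' : HasMean f m') : m = m' :=
  tendsto_nhds_unique h h'

lemma HasMean.add {f g : ℝ → E} {m m' : E} (h : HasMean f m) (h' : HasMean g m')
    (hf : Continuous f) (hg : Continuous g) : HasMean (fun s => f s + g s) (m + m') := by
  refine (Tendsto.add h h').congr fun t => ?_
  rw [intervalIntegral.integral_add (hf.intervalIntegrable _ _) (hg.intervalIntegrable _ _),
    smul_add]

lemma HasMean.sub {f g : ℝ → E} {m m' : E} (h : HasMean f m) (h' : HasMean g m')
    (hf : Continuous f) (hg : Continuous g) : HasMean (fun s => f s - g s) (m - m') := by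
  refine (Tendsto.sub h h').congr fun t => ?_
  rw [intervalIntegral.integral_sub (hf.intervalIntegrable _ _) (hg.intervalIntegrable _ _),
    smul_sub]

lemma HasMean.const_smul {f : ℝ → E} {m : E} (h : HasMean f m) (c : ℂ) :
    HasMean (fun s => c • f s) (c • m) := by
  refine (Tendsto.const_smul h c).congr fun t => ?_
  rw [intervalIntegral.integral_smul, smul_comm]

lemma HasMean.map [CompleteSpace E] [CompleteSpace F] {f : ℝ → E} {m : E} (h : HasMean f m)
    (hf : Continuous f) (L : E →L[ℝ] F) : HasMean (fun s => L (f s)) (L m) := by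
  refine ((L.continuous.tendsto m).comp h).congr fun t => ?_
  rw [Function.comp_apply, map_smul,
    ContinuousLinearMap.intervalIntegral_comp_comm L (hf.intervalIntegrable _ _)]

lemma hasMean_const [CompleteSpace E] (c : E) : HasMean (fun _ => c) c := by
  refine Tendsto.congr' ?_ tendsto_const_nhds
  filter_upwards [eventually_gt_atTop 0] with t ht
  rw [intervalIntegral.integral_const, sub_zero, smul_smul, inv_mul_cancel₀ ht.ne', one_smul]

lemma norm_avg_le {f : ℝ → E} {R : ℝ} (hR : ∀ s, ‖f s‖ ≤ R) {t : ℝ} (ht : 0 < t) :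
    ‖t⁻¹ • ∫ s in (0 : ℝ)..t, f s‖ ≤ R := by
  have h1 := intervalIntegral.norm_integral_le_of_norm_le_const (a := 0) (b := t) (f := f) (C := R)
    fun s _ => hR s
  rw [norm_smul, norm_inv, Real.norm_of_nonneg ht.le, inv_mul_le_iff₀ ht]
  rwa [sub_zero, abs_of_pos ht, mul_comm] at h1

lemma HasMean.norm_le {f : ℝ → E} {m : E} (h : HasMean f m) {R : ℝ} (hR : ∀ s, ‖f s‖ ≤ R) :
    ‖m‖ ≤ R :=
  le_of_tendsto (Tendsto.norm h) ((eventually_gt_atTop 0).mono fun _ => norm_avg_le hR)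

lemma HasMean.norm_sub_le {f g : ℝ → E} {m m' : E} (h : HasMean f m) (h' : HasMean g m')
    (hf : Continuous f) (hg : Continuous g) {δ : ℝ} (hδ : ∀ s, ‖f s - g s‖ ≤ δ) : ‖m - m'‖ ≤ δ :=
  (h.sub h' hf hg).norm_le hδ

lemma norm_avg_sub_avg_le {f g : ℝ → E} (hf : Continuous f) (hg : Continuous g) {δ : ℝ}
    (hδ : ∀ s, ‖f s - g s‖ ≤ δ) {t : ℝ} (ht : 0 < t) :
    ‖(t⁻¹ • ∫ s in (0 : ℝ)..t, f s) - t⁻¹ • ∫ s in (0 : ℝ)..t, g s‖ ≤ δ := by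
  rw [← smul_sub, ← intervalIntegral.integral_sub (hf.intervalIntegrable _ _)
    (hg.intervalIntegrable _ _)]
  exact norm_avg_le hδ ht

/-- Uniform limits of functions with a mean value have a mean value. -/
lemma exists_hasMean_of_approx [CompleteSpace E] {f : ℝ → E} (hf : Continuous f)
    (h : ∀ δ > 0, ∃ p m, Continuous p ∧ HasMean p m ∧ ∀ s, ‖f s - p s‖ ≤ δ) :
    ∃ m, HasMean f m := by
  refine cauchySeq_tendsto_of_complete (Metric.cauchySeq_iff.2 fun δ hδ => ?_)
  obtain ⟨p, m, hp, hm, hfp⟩ := h (δ / 4) (by positivity)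
  obtain ⟨N, hN⟩ := Metric.cauchySeq_iff.1 (Tendsto.cauchySeq hm) (δ / 4) (by positivity)
  refine ⟨max N 1, fun t ht u hu => ?_⟩
  have h1 := hN t ((le_max_left _ _).trans ht) u ((le_max_left _ _).trans hu)
  have h2 := norm_avg_sub_avg_le hf hp hfp
    (lt_of_lt_of_le one_pos ((le_max_right _ _).trans ht))
  have h3 := norm_avg_sub_avg_le hf hp hfp
    (lt_of_lt_of_le one_pos ((le_max_right _ _).trans hu))
  rw [← dist_eq_norm] at h2 h3
  have h4 := dist_triangle4_right (t⁻¹ • ∫ s in (0 : ℝ)..t, f s) (u⁻¹ • ∫ s in (0 : ℝ)..u, f s)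
    (t⁻¹ • ∫ s in (0 : ℝ)..t, p s) (u⁻¹ • ∫ s in (0 : ℝ)..u, p s)
  linarith

lemma hasMean_of_approx {f : ℝ → E} {m : E} (hf : Continuous f)
    (h : ∀ δ > 0, ∃ p m', Continuous p ∧ HasMean p m' ∧ (∀ s, ‖f s - p s‖ ≤ δ) ∧ ‖m' - m‖ ≤ δ) :
    HasMean f m := by
  refine Metric.tendsto_nhds.2 fun δ hδ => ?_
  obtain ⟨p, m', hp, hm, hfp, hmm⟩ := h (δ / 3) (by positivity)
  filter_upwards [Metric.tendsto_nhds.1 hm (δ / 3) (by positivity), eventually_gt_atTop 0] with t h1 ht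
  have h2 := norm_avg_sub_avg_le hf hp hfp ht
  rw [← dist_eq_norm] at h2 hmm
  have h4 := dist_triangle4 (t⁻¹ • ∫ s in (0 : ℝ)..t, f s) (t⁻¹ • ∫ s in (0 : ℝ)..t, p s) m' m
  linarith

/-- The character `s ↦ exp(i ν s)`. -/
def chi (ν s : ℝ) : ℂ := exp (I * (ν * s))

lemma continuous_chi (ν : ℝ) : Continuous (chi ν) := by unfold chi; fun_prop

lemma norm_chi (ν s : ℝ) : ‖chi ν s‖ = 1 := by
  rw [chi, mul_comm, ← ofReal_mul, norm_exp_ofReal_mul_I]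

lemma chi_add (ν μ s : ℝ) : chi (ν + μ) s = chi ν s * chi μ s := by
  rw [chi, chi, chi, ← exp_add]; push_cast; ring_nf

lemma chi_zero (s : ℝ) : chi 0 s = 1 := by simp [chi]

lemma chi_add_right (ν s t : ℝ) : chi ν (s + t) = chi ν s * chi ν t := by
  rw [chi, chi, chi, ← exp_add]; push_cast; ring_nf

lemma star_chi (ν s : ℝ) : star (chi ν s) = chi (-ν) s := by
  rw [chi, chi, RCLike.star_def, ← exp_conj]
  simp

lemma chi_neg_right (ν s : ℝ) : chi ν (-s) = chi (-ν) s := by simp [chi]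

/-- For `ν ≠ 0` a character has a bounded primitive, of size `1/|ν|`, so its average decays like
`1/t`. -/
lemma hasMean_chi_smul [CompleteSpace E] (ν : ℝ) (c : E) :
    HasMean (fun s => chi ν s • c) (if ν = 0 then c else 0) := by
  split_ifs with h
  · simpa [h, chi_zero] using hasMean_const c
  · have hd : ∀ s : ℝ, HasDerivAt (fun s : ℝ => ((I * ν)⁻¹ * chi ν s) • c) (chi ν s • c) s := by
      intro s
      have h1 : HasDerivAt (fun s : ℝ => chi ν s) (chi ν s * (I * ν)) s := by
        have h0 : HasDerivAt (fun s : ℝ => I * (ν * (s : ℂ))) (I * ν) s := by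
          simpa using ((hasDerivAt_id s).ofReal_comp.const_mul (ν : ℂ)).const_mul I
        exact h0.cexp
      refine ((h1.const_mul (I * ν : ℂ)⁻¹).smul_const c).congr_deriv ?_
      rw [mul_comm (chi ν s), inv_mul_cancel_left₀ (by simp [h])]
    have hi : ∀ t : ℝ, ‖∫ s in (0 : ℝ)..t, chi ν s • c‖ ≤ 2 * (|ν|⁻¹ * ‖c‖) := by
      intro t
      rw [intervalIntegral.integral_eq_sub_of_hasDerivAt (fun s _ => hd s)
        (((continuous_chi ν).smul continuous_const).intervalIntegrable _ _)]
      refine (norm_sub_le _ _).trans (le_of_eq ?_)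
      simp only [norm_smul, norm_mul, norm_chi, norm_inv, norm_I, Complex.norm_real,
        Real.norm_eq_abs]
      ring
    have hz : Tendsto (fun t : ℝ => t⁻¹ * (2 * (|ν|⁻¹ * ‖c‖))) atTop (𝓝 0) := by
      simpa using tendsto_inv_atTop_zero.mul_const (2 * (|ν|⁻¹ * ‖c‖))
    refine squeeze_zero_norm' ?_ hz
    filter_upwards [eventually_gt_atTop 0] with t ht
    rw [norm_smul, norm_inv, Real.norm_of_nonneg ht.le]
    gcongr
    exact hi t

end Mean

/-! ### Bohr almost periodic functions and their Fourier–Bohr coefficients. -/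

section AlmostPeriodic

variable {E F : Type*} [NormedAddCommGroup E] [NormedSpace ℂ E]
  [NormedAddCommGroup F] [NormedSpace ℂ F]

variable (E) in
/-- The trigonometric polynomials with coefficients in `E`. -/
def trigPoly : Submodule ℂ (ℝ → E) :=
  Submodule.span ℂ {g | ∃ (ν : ℝ) (c : E), g = fun s => chi ν s • c}

lemma chi_smul_mem_trigPoly (ν : ℝ) (c : E) : (fun s => chi ν s • c) ∈ trigPoly E :=
  Submodule.subset_span ⟨ν, c, rfl⟩

/-- A scalar factor is absorbed into the coefficient of a character, so additivity of `P` suffices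
and no case for scalar multiples arises. -/
lemma trigPoly_induction {P : (ℝ → E) → Prop} (h1 : ∀ ν c, P fun s => chi ν s • c)
    (h2 : ∀ f ∈ trigPoly E, ∀ g ∈ trigPoly E, P f → P g → P (f + g))
    (f : ℝ → E) (hf : f ∈ trigPoly E) : P f := by
  induction hf using Submodule.closure_induction with
  | zero => simpa [Pi.zero_def] using h1 0 0
  | add f g hf hg h h' =>
    exact h2 f hf g hg h h'
  | smul_mem c f hf =>
    obtain ⟨ν, x, rfl⟩ := hf
    have : (c • fun s => chi ν s • x) = fun s => chi ν s • (c • x) := by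
      ext s; simp [smul_comm c]
    rw [this]
    exact h1 _ _

lemma continuous_of_mem_trigPoly {f : ℝ → E} (hf : f ∈ trigPoly E) : Continuous f :=
  trigPoly_induction (fun ν c => (continuous_chi ν).smul continuous_const)
    (fun _ _ _ _ h h' => h.add h') f hf

lemma exists_bound_of_mem_trigPoly {f : ℝ → E} (hf : f ∈ trigPoly E) : ∃ C, ∀ s, ‖f s‖ ≤ C :=
  trigPoly_induction (P := fun f => ∃ C, ∀ s, ‖f s‖ ≤ C)
    (fun ν c => ⟨‖c‖, fun s => by rw [norm_smul, norm_chi, one_mul]⟩)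
    (fun _ _ _ _ ⟨C, h⟩ ⟨C', h'⟩ => ⟨C + C', fun s => (norm_add_le _ _).trans
      (add_le_add (h s) (h' s))⟩) f hf

/-- Bohr almost periodic functions: uniform limits of trigonometric polynomials. -/
def IsAlmostPeriodic (f : ℝ → E) : Prop :=
  ∀ δ > 0, ∃ p ∈ trigPoly E, ∀ s, ‖f s - p s‖ ≤ δ

lemma isAlmostPeriodic_of_mem_trigPoly {f : ℝ → E} (hf : f ∈ trigPoly E) : IsAlmostPeriodic f :=
  fun δ hδ => ⟨f, hf, fun s => by simpa using hδ.le⟩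

lemma isAlmostPeriodic_of_approx {f : ℝ → E}
    (h : ∀ δ > 0, ∃ p, IsAlmostPeriodic p ∧ ∀ s, ‖f s - p s‖ ≤ δ) : IsAlmostPeriodic f := by
  intro δ hδ
  obtain ⟨g, hg, hfg⟩ := h (δ / 2) (half_pos hδ)
  obtain ⟨p, hp, hgp⟩ := hg (δ / 2) (half_pos hδ)
  refine ⟨p, hp, fun s => ?_⟩
  have := norm_sub_le_norm_sub_add_norm_sub (f s) (g s) (p s)
  linarith [hfg s, hgp s]

lemma IsAlmostPeriodic.continuous {f : ℝ → E} (hf : IsAlmostPeriodic f) : Continuous f := by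
  choose p hp hfp using fun n : ℕ => hf (1 / (n + 1 : ℝ)) (by positivity)
  refine TendstoUniformly.continuous (F := p) (p := atTop) (Metric.tendstoUniformly_iff.2 ?_)
    (Eventually.frequently (Eventually.of_forall fun n => continuous_of_mem_trigPoly (hp n)))
  intro δ hδ
  filter_upwards [(tendsto_one_div_add_atTop_nhds_zero_nat (𝕜 := ℝ)).eventually_lt_const hδ]
    with n hn s
  rw [dist_eq_norm]
  exact (hfp n s).trans_lt hn

lemma IsAlmostPeriodic.exists_bound {f : ℝ → E} (hf : IsAlmostPeriodic f) :
    ∃ C, ∀ s, ‖f s‖ ≤ C := by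
  obtain ⟨p, hp, hfp⟩ := hf 1 one_pos
  obtain ⟨C, hC⟩ := exists_bound_of_mem_trigPoly hp
  refine ⟨1 + C, fun s => ?_⟩
  have := norm_le_norm_sub_add (f s) (p s)
  linarith [hfp s, hC s]

lemma IsAlmostPeriodic.add {f g : ℝ → E} (hf : IsAlmostPeriodic f) (hg : IsAlmostPeriodic g) :
    IsAlmostPeriodic (fun s => f s + g s) := by
  intro δ hδ
  obtain ⟨p, hp, hfp⟩ := hf (δ / 2) (half_pos hδ)
  obtain ⟨q, hq, hgq⟩ := hg (δ / 2) (half_pos hδ)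
  refine ⟨p + q, Submodule.add_mem _ hp hq, fun s => ?_⟩
  rw [Pi.add_apply, add_sub_add_comm]
  exact (norm_add_le _ _).trans (by linarith [hfp s, hgq s])

/-- A bounded linear operation on functions that maps characters to trigonometric polynomials
preserves almost periodicity. -/
lemma IsAlmostPeriodic.map {Φ : (ℝ → E) → ℝ → F} {C : ℝ} {f : ℝ → E} (hf : IsAlmostPeriodic f)
    (h1 : ∀ ν c, Φ (fun s => chi ν s • c) ∈ trigPoly F)
    (h2 : ∀ p ∈ trigPoly E, ∀ q ∈ trigPoly E, Φ (p + q) = Φ p + Φ q)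
    (hC : ∀ p ∈ trigPoly E, ∀ δ, 0 ≤ δ → (∀ s, ‖f s - p s‖ ≤ δ) →
      ∀ s, ‖Φ f s - Φ p s‖ ≤ C * δ) : IsAlmostPeriodic (Φ f) := by
  intro δ hδ
  obtain ⟨p, hp, hfp⟩ := hf (δ / (|C| + 1)) (by positivity)
  refine ⟨Φ p, trigPoly_induction (P := fun p => Φ p ∈ trigPoly F) h1
    (fun p hp q hq h h' => by rw [h2 p hp q hq]; exact Submodule.add_mem _ h h') p hp,
    fun s => (hC p hp _ (by positivity) hfp s).trans ?_⟩
  rw [← mul_div_assoc, div_le_iff₀ (by positivity)]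
  nlinarith [le_abs_self C]

lemma IsAlmostPeriodic.clm_apply {f : ℝ → E} (hf : IsAlmostPeriodic f) (L : E →L[ℂ] F) :
    IsAlmostPeriodic (fun s => L (f s)) := by
  refine hf.map (Φ := fun f s => L (f s)) (C := ‖L‖) (fun ν c => ?_) (fun p _ q _ => ?_)
    (fun p _ δ _ h s => ?_)
  · simpa using chi_smul_mem_trigPoly ν (L c)
  · ext s; simp
  · rw [← map_sub]
    exact (L.le_opNorm _).trans (by gcongr; exact h s)

lemma IsAlmostPeriodic.chi_smul {f : ℝ → E} (hf : IsAlmostPeriodic f) (μ : ℝ) :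
    IsAlmostPeriodic (fun s => chi μ s • f s) := by
  refine hf.map (Φ := fun f s => chi μ s • f s) (C := 1) (fun ν c => ?_) (fun p _ q _ => ?_)
    (fun p _ δ _ h s => ?_)
  · simpa [smul_smul, ← chi_add] using chi_smul_mem_trigPoly (μ + ν) c
  · ext s; simp
  · rw [← smul_sub, norm_smul, norm_chi, one_mul, one_mul]
    exact h s

/-- Convolution with an integrable function preserves almost periodicity. -/
lemma IsAlmostPeriodic.integral_comp_sub [CompleteSpace E] {f : ℝ → E} (hf : IsAlmostPeriodic f)
    {r : ℝ → ℂ} {A : Set ℝ} (hr : IntegrableOn r A) :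
    IsAlmostPeriodic (fun s => ∫ v in A, r v • f (s - v)) := by
  have hi : ∀ g : ℝ → E, Continuous g → (∃ C, ∀ s, ‖g s‖ ≤ C) → ∀ s,
      Integrable (fun v => r v • g (s - v)) (volume.restrict A) := fun g hg ⟨C, hC⟩ s =>
    hr.smul_of_top_left (memLp_top_of_bound
      (by have := hg; exact (Continuous.aestronglyMeasurable (by fun_prop))) C
      (ae_of_all _ fun v => hC _))
  refine hf.map (Φ := fun f s => ∫ v in A, r v • f (s - v)) (C := ∫ v in A, ‖r v‖)
    (fun ν c => ?_) (fun p hp q hq => ?_) (fun p hp δ hδ h s => ?_)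
  · convert chi_smul_mem_trigPoly ν (∫ v in A, r v • chi ν (-v) • c) using 2 with s
    rw [← integral_smul]
    refine integral_congr_ae (ae_of_all _ fun v => ?_)
    simp only [sub_eq_add_neg, chi_add_right, smul_smul]
    ring_nf
  · ext s
    simp only [Pi.add_apply, smul_add]
    exact integral_add (hi p (continuous_of_mem_trigPoly hp) (exists_bound_of_mem_trigPoly hp) s)
      (hi q (continuous_of_mem_trigPoly hq) (exists_bound_of_mem_trigPoly hq) s)
  · rw [← integral_sub (hi f hf.continuous hf.exists_bound s)
      (hi p (continuous_of_mem_trigPoly hp) (exists_bound_of_mem_trigPoly hp) s),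
      ← integral_mul_const]
    refine norm_integral_le_of_norm_le (hr.norm.mul_const δ) (ae_of_all _ fun v => ?_)
    rw [← smul_sub, norm_smul]
    gcongr
    exact h _

lemma exists_hasMean_of_mem_trigPoly [CompleteSpace E] {f : ℝ → E} (hf : f ∈ trigPoly E) :
    ∃ m, HasMean f m :=
  trigPoly_induction (P := fun f => ∃ m, HasMean f m) (fun ν c => ⟨_, hasMean_chi_smul ν c⟩)
    (fun f hf g hg ⟨m, h⟩ ⟨m', h'⟩ => ⟨m + m', h.add h' (continuous_of_mem_trigPoly hf)
      (continuous_of_mem_trigPoly hg)⟩) f hf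

lemma IsAlmostPeriodic.exists_hasMean [CompleteSpace E] {f : ℝ → E} (hf : IsAlmostPeriodic f) :
    ∃ m, HasMean f m :=
  exists_hasMean_of_approx hf.continuous fun δ hδ => by
    obtain ⟨p, hp, hfp⟩ := hf δ hδ
    obtain ⟨m, hm⟩ := exists_hasMean_of_mem_trigPoly hp
    exact ⟨p, m, continuous_of_mem_trigPoly hp, hm, hfp⟩

/-- The Fourier–Bohr coefficient of `f` at frequency `ν` (meaningful if `f` is almost periodic). -/
def bohrCoeff (f : ℝ → E) (ν : ℝ) : E :=
  limUnder atTop (fun t : ℝ => t⁻¹ • ∫ s in (0 : ℝ)..t, chi (-ν) s • f s)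

lemma HasMean.bohrCoeff_eq {f : ℝ → E} {ν : ℝ} {m : E}
    (h : HasMean (fun s => chi (-ν) s • f s) m) : bohrCoeff f ν = m := Tendsto.limUnder_eq h

lemma IsAlmostPeriodic.hasMean_bohrCoeff [CompleteSpace E] {f : ℝ → E} (hf : IsAlmostPeriodic f)
    (ν : ℝ) : HasMean (fun s => chi (-ν) s • f s) (bohrCoeff f ν) := by
  obtain ⟨m, hm⟩ := (hf.chi_smul (-ν)).exists_hasMean
  rwa [hm.bohrCoeff_eq]

lemma bohrCoeff_chi_smul [CompleteSpace E] (μ : ℝ) (c : E) (ν : ℝ) :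
    bohrCoeff (fun s => chi μ s • c) ν = if ν = μ then c else 0 := by
  have h := hasMean_chi_smul (μ - ν) c
  simp only [sub_eq_add_neg, chi_add, mul_comm (chi μ _), mul_smul] at h
  rw [h.bohrCoeff_eq]
  simp only [← sub_eq_add_neg, sub_eq_zero, eq_comm]

lemma IsAlmostPeriodic.bohrCoeff_add [CompleteSpace E] {f g : ℝ → E} (hf : IsAlmostPeriodic f)
    (hg : IsAlmostPeriodic g) (ν : ℝ) :
    bohrCoeff (fun s => f s + g s) ν = bohrCoeff f ν + bohrCoeff g ν := by
  refine HasMean.bohrCoeff_eq ?_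
  simp only [smul_add]
  exact (hf.hasMean_bohrCoeff ν).add (hg.hasMean_bohrCoeff ν) (hf.chi_smul _).continuous
    (hg.chi_smul _).continuous

lemma IsAlmostPeriodic.norm_bohrCoeff_sub_le [CompleteSpace E] {f g : ℝ → E}
    (hf : IsAlmostPeriodic f) (hg : IsAlmostPeriodic g) (ν : ℝ) {δ : ℝ}
    (hδ : ∀ s, ‖f s - g s‖ ≤ δ) : ‖bohrCoeff f ν - bohrCoeff g ν‖ ≤ δ :=
  (hf.hasMean_bohrCoeff ν).norm_sub_le (hg.hasMean_bohrCoeff ν) (hf.chi_smul _).continuous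
    (hg.chi_smul _).continuous fun s => by
      rw [← smul_sub, norm_smul, norm_chi, one_mul]; exact hδ s

/-- The Fourier–Bohr coefficients of a convolution. -/
lemma bohrCoeff_integral_comp_sub [CompleteSpace E] {f : ℝ → E} (hf : IsAlmostPeriodic f)
    {r : ℝ → ℂ} {A : Set ℝ} (hr : IntegrableOn r A) (ν : ℝ) :
    bohrCoeff (fun s => ∫ v in A, r v • f (s - v)) ν =
      (∫ v in A, chi (-ν) v * r v) • bohrCoeff f ν := by
  have hi : ∀ g : ℝ → E, Continuous g → (∃ C, ∀ s, ‖g s‖ ≤ C) → ∀ s,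
      Integrable (fun v => r v • g (s - v)) (volume.restrict A) := fun g hg ⟨C, hC⟩ s =>
    hr.smul_of_top_left (memLp_top_of_bound
      (by have := hg; exact (Continuous.aestronglyMeasurable (by fun_prop))) C
      (ae_of_all _ fun v => hC _))
  have hpoly : ∀ p ∈ trigPoly E, bohrCoeff (fun s => ∫ v in A, r v • p (s - v)) ν =
      (∫ v in A, chi (-ν) v * r v) • bohrCoeff p ν := by
    refine trigPoly_induction (fun μ c => ?_) (fun p hp q hq h h' => ?_)
    · have h1 : (fun s => ∫ v in A, r v • chi μ (s - v) • c) =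
          fun s => chi μ s • ((∫ v in A, chi (-μ) v * r v) • c) := by
        ext s
        rw [smul_smul, ← integral_const_mul, ← integral_smul_const]
        refine integral_congr_ae (ae_of_all _ fun v => ?_)
        simp only [sub_eq_add_neg, chi_add_right, chi_neg_right, smul_smul]
        ring_nf
      rw [h1, bohrCoeff_chi_smul, bohrCoeff_chi_smul]
      split_ifs with h
      · rw [h]
      · rw [smul_zero]
    · have hpa := isAlmostPeriodic_of_mem_trigPoly hp
      have hqa := isAlmostPeriodic_of_mem_trigPoly hq
      have h1 : (fun s => ∫ v in A, r v • (p + q) (s - v)) =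
          fun s => (∫ v in A, r v • p (s - v)) + ∫ v in A, r v • q (s - v) := by
        ext s
        simp only [Pi.add_apply, smul_add]
        exact integral_add (hi p hpa.continuous hpa.exists_bound s)
          (hi q hqa.continuous hqa.exists_bound s)
      rw [h1, (hpa.integral_comp_sub hr).bohrCoeff_add (hqa.integral_comp_sub hr), h, h', ← smul_add]
      exact congrArg _ (hpa.bohrCoeff_add hqa ν).symm
  refine eq_of_forall_dist_le fun δ hδ => ?_
  set M := ∫ v in A, ‖r v‖
  have hM : 0 ≤ M := integral_nonneg fun _ => norm_nonneg _
  have hM' : ‖∫ v in A, chi (-ν) v * r v‖ ≤ M :=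
    norm_integral_le_of_norm_le hr.norm (ae_of_all _ fun v => by rw [norm_mul, norm_chi, one_mul])
  -- Both sides are Lipschitz in `f` for the supremum norm with constant `M`, so replacing `f` by
  -- `p` costs `M` times the tolerance twice. The summand 1 covers `M = 0`.
  obtain ⟨p, hp, hfp⟩ := hf (δ / (2 * M + 1)) (by positivity)
  have hpa := isAlmostPeriodic_of_mem_trigPoly hp
  have h1 : ‖bohrCoeff (fun s => ∫ v in A, r v • f (s - v)) ν -
      bohrCoeff (fun s => ∫ v in A, r v • p (s - v)) ν‖ ≤ M * (δ / (2 * M + 1)) := by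
    refine (hf.integral_comp_sub hr).norm_bohrCoeff_sub_le (hpa.integral_comp_sub hr) ν fun s => ?_
    rw [← integral_sub (hi f hf.continuous hf.exists_bound s) (hi p hpa.continuous hpa.exists_bound s),
      ← integral_mul_const]
    refine norm_integral_le_of_norm_le (hr.norm.mul_const _) (ae_of_all _ fun v => ?_)
    rw [← smul_sub, norm_smul]
    gcongr
    exact hfp _
  have h2 := hf.norm_bohrCoeff_sub_le hpa ν hfp
  rw [hpoly p hp] at h1
  rw [dist_eq_norm]
  calc _ ≤ ‖bohrCoeff (fun s => ∫ v in A, r v • f (s - v)) ν -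
          (∫ v in A, chi (-ν) v * r v) • bohrCoeff p ν‖ +
        ‖(∫ v in A, chi (-ν) v * r v) • bohrCoeff p ν -
          (∫ v in A, chi (-ν) v * r v) • bohrCoeff f ν‖ := norm_sub_le_norm_sub_add_norm_sub _ _ _
    _ ≤ M * (δ / (2 * M + 1)) + M * (δ / (2 * M + 1)) := by
        refine add_le_add h1 ?_
        rw [← smul_sub, norm_smul, norm_sub_rev]
        gcongr
    _ ≤ δ := by
        rw [← two_mul, ← mul_assoc, ← mul_div_assoc, div_le_iff₀ (by positivity)]
        nlinarith

end AlmostPeriodic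

/-! ### Unconditional sums of double families. -/

section Sums

/-- Summation of a double family with summable bounds on the partial inner sums. -/
lemma hasSum_prod_of_bound {α β E : Type*} [NormedAddCommGroup E] [CompleteSpace E]
    {f : α → β → E} {m : α → E} {c : α → ℝ} (hc : Summable c) (hf : ∀ i, HasSum (f i) (m i))
    (hb : ∀ i (F : Finset β), ‖∑ j ∈ F, f i j‖ ≤ c i) :
    HasSum (fun p : α × β => f p.1 p.2) (∑' i, m i) := by
  classical
  -- The inner sums need not converge absolutely, so Fubini for summable norms is not available. A
  -- finite set of pairs is cut into its fibres over the first index; each fibre exhausts `β`, and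
  -- dominated convergence applies to the sum over `i`.
  let fib : Finset (α × β) → α → Finset β := fun t i =>
    t.preimage (fun j => (i, j)) (Prod.mk_right_injective i).injOn
  have h1 : ∀ t : Finset (α × β), ∑ p ∈ t, f p.1 p.2 = ∑' i, ∑ j ∈ fib t i, f i j := by
    intro t
    rw [tsum_eq_sum (s := t.image Prod.fst), Finset.sum_sigma']
    · refine Finset.sum_bij' (fun p _ => ⟨p.1, p.2⟩) (fun q _ => (q.1, q.2)) ?_ ?_ ?_ ?_ ?_ <;>
        simp [fib] <;> tauto
    · intro i hi
      refine Finset.sum_eq_zero fun j hj => ?_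
      simp only [fib, Finset.mem_preimage] at hj
      exact absurd (Finset.mem_image_of_mem Prod.fst hj) hi
  have h2 : ∀ i, Tendsto (fun t => fib t i) atTop atTop := by
    intro i
    refine tendsto_atTop.2 fun F => ?_
    filter_upwards [eventually_ge_atTop (F.image fun j => (i, j))] with t ht j hj
    simp only [fib, Finset.mem_preimage]
    exact ht (Finset.mem_image_of_mem _ hj)
  refine Tendsto.congr (fun t => (h1 t).symm) ?_
  exact tendsto_tsum_of_dominated_convergence hc (fun i => (hf i).comp (h2 i))
    (Eventually.of_forall fun t i => hb i _)

end Sums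

/-! ### Mean values of series. -/

section MeanSum

variable {E : Type*} [NormedAddCommGroup E] [NormedSpace ℂ E] [CompleteSpace E]

lemma hasMean_tsum {α : Type*} [Countable α] {f : α → ℝ → E} {m : α → E} {c : α → ℝ}
    (hc : Summable c) (hf : ∀ i, Continuous (f i)) (hb : ∀ i s, ‖f i s‖ ≤ c i)
    (hm : ∀ i, HasMean (f i) (m i)) : HasMean (fun s => ∑' i, f i s) (∑' i, m i) := by
  have h1 : ∀ t : ℝ, t⁻¹ • ∫ s in (0 : ℝ)..t, ∑' i, f i s =
      ∑' i, t⁻¹ • ∫ s in (0 : ℝ)..t, f i s := by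
    intro t
    rw [tsum_const_smul'', ← (intervalIntegral.hasSum_integral_of_dominated_convergence
      (bound := fun i _ => c i) (F := f) (f := fun s => ∑' i, f i s)
      (fun i => (hf i).aestronglyMeasurable) (fun i => ae_of_all _ fun s _ => hb i s)
      (ae_of_all _ fun s _ => hc) (by simp)
      (ae_of_all _ fun s _ => (Summable.of_norm_bounded hc fun i => hb i s).hasSum)).tsum_eq]
  refine Tendsto.congr (fun t => (h1 t).symm) ?_
  refine tendsto_tsum_of_dominated_convergence hc hm ?_
  filter_upwards [eventually_gt_atTop 0] with t ht i
  exact norm_avg_le (hb i) ht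

end MeanSum

/-! ### Bessel's inequality for almost periodic functions. -/

section Bessel

variable {E : Type*} [NormedAddCommGroup E] [InnerProductSpace ℂ E] [CompleteSpace E]

lemma hasMean_finsetSum {α F : Type*} [NormedAddCommGroup F] [NormedSpace ℂ F] [CompleteSpace F]
    (A : Finset α) {f : α → ℝ → F} {m : α → F}
    (hf : ∀ i, Continuous (f i)) (h : ∀ i, HasMean (f i) (m i)) :
    HasMean (fun s => ∑ i ∈ A, f i s) (∑ i ∈ A, m i) := by
  classical
  induction A using Finset.induction with
  | empty => simpa using hasMean_const (0 : F)
  | insert a A ha ih =>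
    simp only [Finset.sum_insert ha]
    exact (h a).add ih (hf a) (continuous_finsetSum _ fun i _ => hf i)

/-- Bessel's inequality for the Fourier–Bohr coefficients. -/
lemma IsAlmostPeriodic.sum_norm_sq_bohrCoeff_le {f : ℝ → E} (hf : IsAlmostPeriodic f) {R : ℝ}
    (hR : ∀ s, ‖f s‖ ≤ R) (F : Finset ℝ) : ∑ ν ∈ F, ‖bohrCoeff f ν‖ ^ 2 ≤ R ^ 2 := by
  classical
  set p : ℝ → E := fun s => ∑ ν ∈ F, chi ν s • bohrCoeff f ν with hp
  have hpc : Continuous p :=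
    continuous_finsetSum _ fun ν _ => (continuous_chi ν).smul continuous_const
  have hpm : ∀ ν ∈ F, HasMean (fun s => chi (-ν) s • p s) (bohrCoeff f ν) := by
    intro ν hν
    have h := hasMean_finsetSum F (f := fun μ s => chi (μ - ν) s • bohrCoeff f μ)
      (fun μ => (continuous_chi _).smul continuous_const) (fun μ => hasMean_chi_smul _ _)
    simp only [sub_eq_zero, Finset.sum_ite_eq', hν, if_true] at h
    simpa [hp, Finset.smul_sum, sub_eq_add_neg, chi_add, mul_comm, smul_smul] using h
  -- With `p` the partial Fourier series, `⟨p, 2f - p⟩` has mean `∑ ‖cᵥ‖²`, since `2f - p` has the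
  -- coefficients `cᵥ` on `F`. Its real part is `‖f‖² - ‖f - p‖² ≤ R²` pointwise. Only means that
  -- are linear in `f` occur, so no mean of `‖f‖²` is needed.
  have hq : HasMean (fun s => ∑ ν ∈ F.attach, innerSL ℂ (bohrCoeff f ν)
        (chi (-ν) s • (f s + f s - p s)))
      (∑ ν ∈ F.attach, innerSL ℂ (bohrCoeff f ν) (bohrCoeff f ν)) := by
    refine hasMean_finsetSum _ (fun ν => ?_) fun ν => ?_
    · exact (innerSL ℂ _).continuous.comp
        ((continuous_chi _).smul ((hf.continuous.add hf.continuous).sub hpc))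
    · have h0 := hf.hasMean_bohrCoeff ν
      have h1 := ((h0.add h0 (hf.chi_smul _).continuous (hf.chi_smul _).continuous).sub
        (hpm ν ν.2) (((hf.chi_smul _).continuous).add (hf.chi_smul _).continuous)
        ((continuous_chi _).smul hpc))
      rw [add_sub_cancel_right] at h1
      simp only [← smul_add, ← smul_sub] at h1
      exact h1.map ((continuous_chi _).smul ((hf.continuous.add hf.continuous).sub hpc))
        ((innerSL ℂ (bohrCoeff f ν)).restrictScalars ℝ)
  have hs : ∀ s, ∑ ν ∈ F.attach, innerSL ℂ (bohrCoeff f ν) (chi (-ν) s • (f s + f s - p s)) =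
      inner ℂ (p s) (f s + f s - p s) := by
    intro s
    rw [Finset.sum_attach F fun ν => innerSL ℂ (bohrCoeff f ν) (chi (-ν) s • (f s + f s - p s)),
      hp, sum_inner]
    refine Finset.sum_congr rfl fun ν _ => ?_
    rw [inner_smul_left, innerSL_apply_apply, inner_smul_right, ← star_chi, RCLike.star_def]
  simp only [hs] at hq
  have hqc : Continuous fun s => inner ℂ (p s) (f s + f s - p s) :=
    hpc.inner ((hf.continuous.add hf.continuous).sub hpc)
  have hre : Tendsto (fun t : ℝ => t⁻¹ * ∫ s in (0 : ℝ)..t, (inner ℂ (p s) (f s + f s - p s)).re)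
      atTop (𝓝 (∑ ν ∈ F, ‖bohrCoeff f ν‖ ^ 2)) := by
    have h1 := (Complex.reCLM.continuous.tendsto _).comp hq
    have h2 : Complex.reCLM (∑ ν ∈ F.attach, innerSL ℂ (bohrCoeff f ν) (bohrCoeff f ν)) =
        ∑ ν ∈ F, ‖bohrCoeff f ν‖ ^ 2 := by
      rw [map_sum, Finset.sum_attach F fun ν => Complex.reCLM (innerSL ℂ (bohrCoeff f ν)
        (bohrCoeff f ν))]
      refine Finset.sum_congr rfl fun ν _ => ?_
      rw [innerSL_apply_apply, inner_self_eq_norm_sq_to_K]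
      norm_cast
    rw [h2] at h1
    refine h1.congr fun t => ?_
    rw [Function.comp_apply, map_smul, ← ContinuousLinearMap.intervalIntegral_comp_comm _
      (hqc.intervalIntegrable _ _)]
    rfl
  refine le_of_tendsto hre ?_
  filter_upwards [eventually_gt_atTop 0] with t ht
  rw [inv_mul_le_iff₀ ht]
  have h3 := intervalIntegral.integral_mono_on (a := 0) (b := t) (μ := volume)
    (f := fun s => (inner ℂ (p s) (f s + f s - p s)).re) (g := fun _ => R ^ 2) ht.le
    ((Complex.continuous_re.comp hqc).intervalIntegrable _ _) (by simp) ?_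
  · simpa using h3
  · intro s _
    have h4 : (0 : ℝ) ≤ ‖f s - p s‖ ^ 2 := by positivity
    have h5 := @norm_sub_sq ℂ _ _ _ _ (p s) (f s)
    rw [norm_sub_rev] at h5
    have h6 : (inner ℂ (p s) (p s)).re = ‖p s‖ ^ 2 := inner_self_eq_norm_sq (𝕜 := ℂ) (p s)
    rw [inner_sub_right, inner_add_right, sub_re, add_re, h6]
    have h7 : ‖f s‖ ^ 2 ≤ R ^ 2 := by gcongr; exact hR s
    have h8 : RCLike.re (inner ℂ (p s) (f s)) = (inner ℂ (p s) (f s)).re := rfl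
    rw [h8] at h5
    linarith

/-- The Cauchy–Schwarz inequality for the Fourier–Bohr coefficients of two functions. -/
lemma IsAlmostPeriodic.sum_norm_mul_norm_bohrCoeff_le {E' : Type*} [NormedAddCommGroup E']
    [InnerProductSpace ℂ E'] [CompleteSpace E'] {f : ℝ → E} {g : ℝ → E'} (hf : IsAlmostPeriodic f)
    (hg : IsAlmostPeriodic g) {R R' : ℝ} (hR : ∀ s, ‖f s‖ ≤ R) (hR' : ∀ s, ‖g s‖ ≤ R')
    (F : Finset ℝ) : ∑ ν ∈ F, ‖bohrCoeff f ν‖ * ‖bohrCoeff g ν‖ ≤ R * R' := by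
  have h1 := Finset.sum_mul_sq_le_sq_mul_sq F (fun ν => ‖bohrCoeff f ν‖)
    (fun ν => ‖bohrCoeff g ν‖)
  have h2 := hf.sum_norm_sq_bohrCoeff_le hR F
  have h3 := hg.sum_norm_sq_bohrCoeff_le hR' F
  have hR0 := (norm_nonneg _).trans (hR 0)
  have hR0' := (norm_nonneg _).trans (hR' 0)
  refine le_of_sq_le_sq ?_ (by positivity)
  rw [mul_pow]
  exact h1.trans (mul_le_mul h2 h3 (Finset.sum_nonneg fun _ _ => by positivity) (by positivity))

end Bessel

/-! ### Mean values of products. -/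

section MeanProduct

variable {E G : Type*} [NormedAddCommGroup E] [NormedSpace ℂ E] [CompleteSpace E]
  [NormedAddCommGroup G] [NormedSpace ℂ G] [CompleteSpace G]

/-- The mean value of `B(s) f(s)`, for an almost periodic function `f`, as the sum of the
contributions of the Fourier–Bohr components. -/
lemma exists_hasMean_hasSum {B : ℝ → E →L[ℂ] G} (hBc : Continuous B) {Bh : ℝ → E →L[ℂ] G}
    {C C' : ℝ} (hBC : ∀ s, ‖B s‖ ≤ C)
    (hm : ∀ ν c, HasMean (fun s => chi ν s • B s c) (Bh ν c))
    (hb : ∀ f : ℝ → E, IsAlmostPeriodic f → ∀ R, (∀ s, ‖f s‖ ≤ R) → ∀ F : Finset ℝ,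
      ‖∑ ν ∈ F, Bh ν (bohrCoeff f ν)‖ ≤ C' * R)
    {f : ℝ → E} (hf : IsAlmostPeriodic f) :
    ∃ m, HasMean (fun s => B s (f s)) m ∧ HasSum (fun ν => Bh ν (bohrCoeff f ν)) m := by
  have hC : 0 ≤ C := (norm_nonneg _).trans (hBC 0)
  have hcont : ∀ g : ℝ → E, Continuous g → Continuous fun s => B s (g s) :=
    fun g hg => hBc.clm_apply hg
  have hpoly : ∀ p ∈ trigPoly E, ∃ m, HasMean (fun s => B s (p s)) m ∧
      HasSum (fun ν => Bh ν (bohrCoeff p ν)) m := by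
    refine trigPoly_induction (fun μ c => ⟨Bh μ c, ?_, ?_⟩) ?_
    · simpa using hm μ c
    · have : (fun ν => Bh ν (bohrCoeff (fun s => chi μ s • c) ν)) =
          fun ν => if ν = μ then Bh μ c else 0 := by
        ext ν
        rw [bohrCoeff_chi_smul]
        split_ifs with h
        · rw [h]
        · rw [map_zero]
      rw [this]
      exact hasSum_ite_eq μ _
    · rintro p hp q hq ⟨m, h1, h2⟩ ⟨m', h1', h2'⟩
      refine ⟨m + m', ?_, ?_⟩
      · simp only [Pi.add_apply, map_add]
        exact h1.add h1' (hcont p (continuous_of_mem_trigPoly hp))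
          (hcont q (continuous_of_mem_trigPoly hq))
      · refine (h2.add h2').congr_fun fun ν => ?_
        rw [← map_add]
        exact congrArg _ ((isAlmostPeriodic_of_mem_trigPoly hp).bohrCoeff_add
          (isAlmostPeriodic_of_mem_trigPoly hq) ν)
  have hclose : ∀ δ, ∀ p : ℝ → E, (∀ s, ‖f s - p s‖ ≤ δ) → ∀ s, ‖B s (f s) - B s (p s)‖ ≤ C * δ := by
    intro δ p hp s
    rw [← map_sub]
    exact ((B s).le_opNorm _).trans (mul_le_mul (hBC s) (hp s) (norm_nonneg _) hC)
  obtain ⟨m, hm'⟩ : ∃ m, HasMean (fun s => B s (f s)) m := by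
    refine exists_hasMean_of_approx (hcont f hf.continuous) fun δ hδ => ?_
    obtain ⟨p, hp, hfp⟩ := hf (δ / (C + 1)) (by positivity)
    obtain ⟨m, hm, -⟩ := hpoly p hp
    refine ⟨_, m, hcont p (continuous_of_mem_trigPoly hp), hm, fun s =>
      (hclose _ p hfp s).trans ?_⟩
    rw [← mul_div_assoc, div_le_iff₀ (by positivity)]
    nlinarith
  refine ⟨m, hm', Metric.tendsto_atTop.2 fun δ hδ => ?_⟩
  have hC' : 0 ≤ |C'| := abs_nonneg _
  -- Three errors: the means of `f` and `p` differ by at most `C d`; their partial sums over any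
  -- finite `F` by at most `|C'| d`, thanks to the bound `hb` that is uniform in `F`; and the sum
  -- for the polynomial `p` is within `d` of its limit.
  set d := δ / (C + |C'| + 2) with hd
  have hd0 : 0 < d := by positivity
  obtain ⟨p, hp, hfp⟩ := hf d hd0
  have hpa := isAlmostPeriodic_of_mem_trigPoly hp
  obtain ⟨mp, h1, h2⟩ := hpoly p hp
  obtain ⟨F₀, hF₀⟩ := Metric.tendsto_atTop.1 h2 d hd0
  refine ⟨F₀, fun F hF => ?_⟩
  have h3 := hF₀ F hF
  have h4 : dist mp m ≤ C * d := by
    rw [dist_eq_norm, norm_sub_rev]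
    exact hm'.norm_sub_le h1 (hcont f hf.continuous) (hcont p hpa.continuous) (hclose d p hfp)
  have h5 : dist (∑ ν ∈ F, Bh ν (bohrCoeff f ν)) (∑ ν ∈ F, Bh ν (bohrCoeff p ν)) ≤ |C'| * d := by
    have hneg : IsAlmostPeriodic fun s => -p s := by
      simpa using hpa.clm_apply (-ContinuousLinearMap.id ℂ E)
    have hsub : ∀ ν, bohrCoeff (fun s => f s + -p s) ν = bohrCoeff f ν - bohrCoeff p ν := by
      intro ν
      refine HasMean.bohrCoeff_eq ?_
      simp only [← sub_eq_add_neg, smul_sub]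
      exact (hf.hasMean_bohrCoeff ν).sub (hpa.hasMean_bohrCoeff ν) (hf.chi_smul _).continuous
        (hpa.chi_smul _).continuous
    have h6 := hb (fun s => f s + -p s) (hf.add hneg) d
      (fun s => by rw [← sub_eq_add_neg]; exact hfp s) F
    simp only [hsub, map_sub, Finset.sum_sub_distrib] at h6
    rw [dist_eq_norm]
    exact h6.trans (by gcongr; exact le_abs_self _)
  have h7 := dist_triangle4 (∑ ν ∈ F, Bh ν (bohrCoeff f ν)) (∑ ν ∈ F, Bh ν (bohrCoeff p ν)) mp m
  have h8 : (C + |C'| + 2) * d = δ := by rw [hd]; field_simp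
  nlinarith

end MeanProduct

/-! ### Strongly* almost periodic families of operators. -/

section APOp

variable {H : Type*} [NormedAddCommGroup H] [InnerProductSpace ℂ H] [CompleteSpace H]

/-- A bounded norm-continuous family of operators that is strongly* almost periodic. -/
structure IsAPOp (X : ℝ → Op H) (C : ℝ) : Prop where
  continuous : Continuous X
  bound : ∀ s, ‖X s‖ ≤ C
  ap : ∀ x, IsAlmostPeriodic fun s => X s x
  ap_star : ∀ x, IsAlmostPeriodic fun s => star (X s) x

variable {X Y : ℝ → Op H} {C D : ℝ}

lemma IsAPOp.nonneg (hX : IsAPOp X C) : 0 ≤ C := (norm_nonneg _).trans (hX.bound 0)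

lemma IsAPOp.norm_apply_le (hX : IsAPOp X C) (x : H) (s : ℝ) : ‖X s x‖ ≤ C * ‖x‖ :=
  (X s).le_of_opNorm_le (hX.bound s) x

/-- The Fourier–Bohr component of a strongly almost periodic family of operators. -/
def IsAPOp.bohrOp (hX : IsAPOp X C) (ν : ℝ) : Op H :=
  LinearMap.mkContinuous
    { toFun := fun x => bohrCoeff (fun s => X s x) ν
      map_add' := fun x y => by
        simp only [map_add]
        exact (hX.ap x).bohrCoeff_add (hX.ap y) ν
      map_smul' := fun c x => by
        refine HasMean.bohrCoeff_eq ?_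
        simp only [map_smul, smul_comm _ c]
        exact ((hX.ap x).hasMean_bohrCoeff ν).const_smul c } C
    fun x => ((hX.ap x).hasMean_bohrCoeff ν).norm_le fun s => by
      rw [norm_smul, norm_chi, one_mul]; exact hX.norm_apply_le x s

lemma IsAPOp.bohrOp_apply (hX : IsAPOp X C) (ν : ℝ) (x : H) :
    hX.bohrOp ν x = bohrCoeff (fun s => X s x) ν := rfl

lemma IsAPOp.hasMean_bohrOp (hX : IsAPOp X C) (ν : ℝ) (x : H) :
    HasMean (fun s => chi (-ν) s • X s x) (hX.bohrOp ν x) := (hX.ap x).hasMean_bohrCoeff ν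

lemma HasMean.inner_left {f : ℝ → H} {m : H} (h : HasMean f m) (hf : Continuous f) (x : H) :
    HasMean (fun s => inner ℂ x (f s)) (inner ℂ x m) :=
  h.map hf ((innerSL ℂ x).restrictScalars ℝ)

/-- Taking adjoints reverses the frequency. The norm mean exists by almost periodicity of the
adjoint family; it is identified weakly, because the adjoint is not strongly continuous. -/
lemma IsAPOp.hasMean_star (hX : IsAPOp X C) (ν : ℝ) (x : H) :
    HasMean (fun s => chi ν s • star (X s) x) (star (hX.bohrOp ν) x) := by
  have h1 := (hX.ap_star x).hasMean_bohrCoeff (-ν)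
  rw [neg_neg] at h1
  convert h1 using 1
  refine ext_inner_left ℂ fun z => ?_
  have hc : ∀ μ, Continuous fun s => chi μ s • star (X s) x :=
    fun μ => ((hX.ap_star x).chi_smul _).continuous
  have hc' : ∀ μ, Continuous fun s => chi μ s • X s z := fun μ => ((hX.ap z).chi_smul _).continuous
  refine HasMean.unique ?_ (h1.inner_left (hc _) z)
  have h2 := ((hX.hasMean_bohrOp ν z).inner_left (hc' _) x).map
    (continuous_const.inner (hc' _)) (Complex.conjCLE : ℂ →L[ℝ] ℂ)
  simp only [ContinuousLinearEquiv.coe_coe, conjCLE_apply, inner_conj_symm] at h2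
  rw [ContinuousLinearMap.star_eq_adjoint, ContinuousLinearMap.adjoint_inner_right]
  have h3 : ∀ s, inner ℂ z (chi ν s • star (X s) x) = inner ℂ (chi (-ν) s • X s z) x := by
    intro s
    rw [inner_smul_left, inner_smul_right, ContinuousLinearMap.star_eq_adjoint,
      ContinuousLinearMap.adjoint_inner_right, ← RCLike.star_def, star_chi, neg_neg]
  simp only [h3]
  exact h2

/-- By duality the sum is tested against a vector `z`. The pairing is bounded by Cauchy–Schwarz and
Bessel for `f` and for `X(·) z`, uniformly in the finite set, although the terms need not be
absolutely summable in norm. -/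
lemma IsAPOp.norm_sum_star_le (hX : IsAPOp X C) {f : ℝ → H} (hf : IsAlmostPeriodic f) {R : ℝ}
    (hR : ∀ s, ‖f s‖ ≤ R) (F : Finset ℝ) :
    ‖∑ ν ∈ F, star (hX.bohrOp ν) (bohrCoeff f ν)‖ ≤ C * R := by
  have hR0 := (norm_nonneg _).trans (hR 0)
  rw [← innerSL_apply_norm ℂ]
  refine ContinuousLinearMap.opNorm_le_bound _ (mul_nonneg hX.nonneg hR0) fun z => ?_
  rw [innerSL_apply_apply, sum_inner]
  calc _ ≤ ∑ ν ∈ F, ‖bohrCoeff f ν‖ * ‖bohrCoeff (fun s => X s z) ν‖ := by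
        refine (norm_sum_le _ _).trans (Finset.sum_le_sum fun ν _ => ?_)
        rw [ContinuousLinearMap.star_eq_adjoint, ContinuousLinearMap.adjoint_inner_left]
        exact norm_inner_le_norm _ _
    _ ≤ R * (C * ‖z‖) := hf.sum_norm_mul_norm_bohrCoeff_le (hX.ap z) hR (hX.norm_apply_le z) F
    _ = C * R * ‖z‖ := by ring

/-- The mean value of `X(s)† f(s)`. -/
lemma IsAPOp.exists_hasMean_star_apply (hX : IsAPOp X C) {f : ℝ → H} (hf : IsAlmostPeriodic f) :
    ∃ m, HasMean (fun s => star (X s) (f s)) m ∧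
      HasSum (fun ν => star (hX.bohrOp ν) (bohrCoeff f ν)) m :=
  exists_hasMean_hasSum (B := fun s => star (X s)) hX.continuous.star
    (C := C) (C' := C) (fun s => by rw [norm_star]; exact hX.bound s) hX.hasMean_star
    (fun _ hf _ hR F => hX.norm_sum_star_le hf hR F) hf

/-- The map `x ↦ |x⟩⟨y|`. -/
def dyadL (y : H) : H →L[ℂ] TraceClass H :=
  LinearMap.mkContinuous
    { toFun := fun x => dyad x y
      map_add' := fun x x' => isBoundedBilinearMap_dyad.add_left x x' y
      map_smul' := fun c x => dyad_smul_left c x y } ‖y‖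
    fun x => by rw [mul_comm]; exact norm_dyad_le x y

lemma dyadL_apply (x y : H) : dyadL y x = dyad x y := rfl

lemma norm_dyadL_le (y : H) : ‖dyadL y‖ ≤ ‖y‖ := LinearMap.mkContinuous_norm_le _ (norm_nonneg _) _

lemma dyad_sub_right (x y y' : H) : dyad x (y - y') = dyad x y - dyad x y' :=
  (isBoundedBilinearMap_dyad (H := H)).toContinuousLinearMap x |>.map_sub y y'

lemma continuous_dyadL : Continuous (dyadL : H → H →L[ℂ] TraceClass H) := by
  refine LipschitzWith.continuous (K := 1) (LipschitzWith.of_dist_le_mul fun y y' => ?_)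
  rw [dist_eq_norm, dist_eq_norm, NNReal.coe_one, one_mul]
  have : dyadL y - dyadL y' = dyadL (y - y') := by
    ext1 x
    rw [sub_apply, dyadL_apply, dyadL_apply, dyadL_apply, dyad_sub_right]
  rw [this]
  exact norm_dyadL_le _

/-- The mean value of `|f(s)⟩⟨g(s)|`. -/
lemma IsAlmostPeriodic.exists_hasMean_dyad {f g : ℝ → H} (hf : IsAlmostPeriodic f)
    (hg : IsAlmostPeriodic g) :
    ∃ m, HasMean (fun s => dyad (f s) (g s)) m ∧
      HasSum (fun ν => dyad (bohrCoeff f ν) (bohrCoeff g ν)) m := by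
  obtain ⟨R, hR⟩ := hg.exists_bound
  refine exists_hasMean_hasSum (B := fun s => dyadL (g s)) (Bh := fun ν => dyadL (bohrCoeff g ν))
    (C := R) (C' := R) (continuous_dyadL.comp hg.continuous)
    (fun s => (norm_dyadL_le _).trans (hR s)) (fun ν c => ?_) (fun f hf R' hR' F => ?_) hf
  · have h := (hg.hasMean_bohrCoeff ν).map (hg.chi_smul _).continuous
      ((isBoundedBilinearMap_dyad (H := H)).toContinuousLinearMap c)
    have h1 : ∀ y, ((isBoundedBilinearMap_dyad (H := H)).toContinuousLinearMap c) y = dyad c y :=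
      fun _ => rfl
    simp only [h1, dyad_smul_right, ← RCLike.star_def, star_chi, neg_neg] at h
    exact h
  · refine (norm_sum_le _ _).trans ?_
    rw [mul_comm]
    exact (Finset.sum_le_sum fun ν _ => norm_dyad_le _ _).trans
      (hf.sum_norm_mul_norm_bohrCoeff_le hg hR' hR F)

/-- Convolution with an integrable function. -/
lemma IsAPOp.integral_comp_sub (hX : IsAPOp X C) {r : ℝ → ℂ} {A : Set ℝ} (hr : IntegrableOn r A) :
    IsAPOp (fun s => ∫ v in A, r v • X (s - v)) ((∫ v in A, ‖r v‖) * C) := by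
  have hi : ∀ s, Integrable (fun v => r v • X (s - v)) (volume.restrict A) := fun s =>
    hr.smul_of_top_left (memLp_top_of_bound
      (by have := hX.continuous; exact (Continuous.aestronglyMeasurable (by fun_prop))) C
      (ae_of_all _ fun v => hX.bound _))
  have happ : ∀ x s, (∫ v in A, r v • X (s - v)) x = ∫ v in A, r v • X (s - v) x := by
    intro x s
    rw [ContinuousLinearMap.integral_apply (hi s)]
    rfl
  have hstar : ∀ x s, star (∫ v in A, r v • X (s - v)) x =
      ∫ v in A, star (r v) • star (X (s - v)) x := by
    intro x s
    have h1 : star (∫ v in A, r v • X (s - v)) = ∫ v in A, star (r v • X (s - v)) :=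
      ((starL' ℝ : Op H ≃L[ℝ] Op H).integral_comp_comm _).symm
    have h2 : Integrable (fun v => star (r v • X (s - v))) (volume.restrict A) :=
      ((starL' ℝ : Op H ≃L[ℝ] Op H) : Op H →L[ℝ] Op H).integrable_comp (hi s)
    rw [h1, ContinuousLinearMap.integral_apply h2]
    refine integral_congr_ae (ae_of_all _ fun v => ?_)
    simp only [star_smul]
    rfl
  refine ⟨?_, fun s => ?_, fun x => ?_, fun x => ?_⟩
  · refine continuous_of_dominated (bound := fun v => ‖r v‖ * C) (fun s => (hi s).1)
      (fun s => ae_of_all _ fun v => ?_) (hr.norm.mul_const C) (ae_of_all _ fun v => ?_)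
    · rw [norm_smul]; gcongr; exact hX.bound _
    · have := hX.continuous; fun_prop
  · rw [← integral_mul_const]
    refine norm_integral_le_of_norm_le (hr.norm.mul_const C) (ae_of_all _ fun v => ?_)
    rw [norm_smul]; gcongr; exact hX.bound _
  · simp only [happ]
    exact (hX.ap x).integral_comp_sub hr
  · simp only [hstar]
    exact (hX.ap_star x).integral_comp_sub
      (((conjCLE : ℂ ≃L[ℝ] ℂ) : ℂ →L[ℝ] ℂ).integrable_comp hr)

lemma IsAPOp.bohrOp_integral_comp_sub (hX : IsAPOp X C) {r : ℝ → ℂ} {A : Set ℝ}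
    (hr : IntegrableOn r A) (ν : ℝ) : (hX.integral_comp_sub hr).bohrOp ν =
      (∫ v in A, chi (-ν) v * r v) • hX.bohrOp ν := by
  ext x
  rw [IsAPOp.bohrOp_apply, smul_apply, IsAPOp.bohrOp_apply, ← bohrCoeff_integral_comp_sub (hX.ap x) hr]
  congr 1
  ext s
  rw [ContinuousLinearMap.integral_apply]
  · rfl
  · exact hr.smul_of_top_left (memLp_top_of_bound
      (by have := hX.continuous; exact (Continuous.aestronglyMeasurable (by fun_prop))) C
      (ae_of_all _ fun v => hX.bound _))

end APOp

/-! ### Periodic functions and diagonal families are almost periodic. -/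

section Periodic

variable {E : Type*} [NormedAddCommGroup E] [NormedSpace ℂ E]

/-- Shifting changes the integral only by two boundary pieces of length `|a|`, which are bounded and
disappear after division by `t`. -/
lemma HasMean.comp_add {f : ℝ → E} {m : E} (h : HasMean f m) (hf : Continuous f) {C : ℝ}
    (hC : ∀ s, ‖f s‖ ≤ C) (a : ℝ) : HasMean (fun s => f (s + a)) m := by
  have hi : ∀ a b, IntervalIntegrable f volume a b := fun a b => hf.intervalIntegrable a b
  have h1 : ∀ t : ℝ, t⁻¹ • ∫ s in (0 : ℝ)..t, f (s + a) = (t⁻¹ • ∫ s in (0 : ℝ)..t, f s) +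
      t⁻¹ • ((∫ s in t..t + a, f s) - ∫ s in (0 : ℝ)..a, f s) := by
    intro t
    rw [intervalIntegral.integral_comp_add_right, zero_add, ← smul_add,
      ← intervalIntegral.integral_add_adjacent_intervals (hi a 0) (hi 0 (t + a)),
      ← intervalIntegral.integral_add_adjacent_intervals (hi 0 t) (hi t (t + a)),
      intervalIntegral.integral_symm 0 a]
    congr 1
    abel
  have h2 : Tendsto (fun t : ℝ => t⁻¹ • ((∫ s in t..t + a, f s) - ∫ s in (0 : ℝ)..a, f s)) atTop
      (𝓝 0) := by
    have hz : Tendsto (fun t : ℝ => t⁻¹ * (C * |a| + C * |a|)) atTop (𝓝 0) := by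
      simpa using tendsto_inv_atTop_zero.mul_const (C * |a| + C * |a|)
    refine squeeze_zero_norm' ?_ hz
    filter_upwards [eventually_gt_atTop 0] with t ht
    rw [norm_smul, norm_inv, Real.norm_of_nonneg ht.le]
    gcongr
    refine (_root_.norm_sub_le _ _).trans (add_le_add ?_ ?_)
    · simpa using intervalIntegral.norm_integral_le_of_norm_le_const (a := t) (b := t + a)
        fun s _ => hC s
    · simpa using intervalIntegral.norm_integral_le_of_norm_le_const (a := 0) (b := a)
        fun s _ => hC s
  have h3 := Tendsto.add h h2
  rw [add_zero] at h3
  exact h3.congr fun t => (h1 t).symm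

lemma HasMean.eq_of_periodic [CompleteSpace E] {f : ℝ → E} {m : E} (h : HasMean f m)
    (hf : Continuous f) {T : ℝ} (hT : 0 < T) (hper : Function.Periodic f T) :
    m = T⁻¹ • ∫ s in (0 : ℝ)..T, f s := by
  have h1 : Tendsto (fun n : ℕ => ((n + 1 : ℕ) : ℝ) * T) atTop atTop :=
    Tendsto.atTop_mul_const hT (tendsto_natCast_atTop_atTop.comp (tendsto_add_atTop_nat 1))
  refine tendsto_nhds_unique (Tendsto.comp h h1) (tendsto_const_nhds.congr fun n => ?_)
  have h2 := hper.intervalIntegral_add_zsmul_eq ((n + 1 : ℕ) : ℤ) 0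
    (fun a b => hf.intervalIntegrable a b)
  rw [zero_add, zero_add, zsmul_eq_mul, Int.cast_natCast] at h2
  rw [Function.comp_apply, h2, natCast_zsmul, ← Nat.cast_smul_eq_nsmul ℝ, smul_smul, mul_inv,
    mul_right_comm, inv_mul_cancel₀ (by positivity), one_mul]

/-- Continuous periodic functions are almost periodic. -/
lemma isAlmostPeriodic_of_periodic {f : ℝ → ℂ} (hf : Continuous f) {T : ℝ} (hT : 0 < T)
    (hper : Function.Periodic f T) : IsAlmostPeriodic f := by
  have : Fact (0 < T) := ⟨hT⟩
  intro δ hδ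
  let g : C(AddCircle T, ℂ) := ⟨hper.lift, continuous_coinduced_dom.2 hf⟩
  have hg : g ∈ (Submodule.span ℂ (Set.range (@fourier T))).topologicalClosure := by
    rw [span_fourier_closure_eq_top]; trivial
  obtain ⟨p, hp, hgp⟩ := Metric.mem_closure_iff.1 hg δ hδ
  refine ⟨fun s => p (s : AddCircle T), ?_, fun s => ?_⟩
  · clear hgp
    induction hp using Submodule.span_induction with
    | mem x hx =>
      obtain ⟨n, rfl⟩ := hx
      convert chi_smul_mem_trigPoly (E := ℂ) (n * (2 * Real.pi / T)) 1 using 2 with s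
      rw [fourier_coe_apply, chi, smul_eq_mul, mul_one]
      congr 1
      push_cast
      ring
    | zero => exact Submodule.zero_mem _
    | add x y _ _ hx hy => exact Submodule.add_mem _ hx hy
    | smul c x _ hx => exact Submodule.smul_mem _ c hx
  · rw [dist_eq_norm] at hgp
    exact ((g - p).norm_coe_le_norm (s : AddCircle T)).trans hgp.le

lemma norm_sum_inner_smul_le {H κ : Type*} [NormedAddCommGroup H] [InnerProductSpace ℂ H]
    {φ : κ → H} (hφ : Orthonormal ℂ φ) (F : Finset κ) (y : H) :
    ‖∑ k ∈ F, inner ℂ (φ k) y • φ k‖ ≤ ‖y‖ := by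
  have h1 := hφ.sum_inner_products_le y (s := F)
  have h2 := hφ.inner_sum (fun k => inner ℂ (φ k) y) (fun k => inner ℂ (φ k) y) F
  have h3 : ‖∑ k ∈ F, inner ℂ (φ k) y • φ k‖ ^ 2 = ∑ k ∈ F, ‖inner ℂ (φ k) y‖ ^ 2 := by
    rw [← inner_self_eq_norm_sq (𝕜 := ℂ), h2, map_sum]
    refine Finset.sum_congr rfl fun k _ => ?_
    rw [conj_mul']
    norm_cast
  exact (sq_le_sq₀ (norm_nonneg _) (norm_nonneg _)).1 (h3 ▸ h1)

variable {H κ : Type*} [NormedAddCommGroup H] [InnerProductSpace ℂ H]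
  (φ : HilbertBasis κ ℂ H)

include φ in
-- The range over one period is compact, so one finite-rank projection onto basis vectors
-- approximates the function uniformly. This leaves finitely many scalar periodic functions, for
-- which trigonometric polynomials are dense on the circle.
lemma isAlmostPeriodic_of_periodic_hilbert {f : ℝ → H} (hf : Continuous f) {T : ℝ} (hT : 0 < T)
    (hper : Function.Periodic f T) : IsAlmostPeriodic f := by
  classical
  refine isAlmostPeriodic_of_approx fun δ hδ => ?_
  obtain ⟨A, -, hA, hcov⟩ := (isCompact_Icc (a := 0) (b := T)).image hf |>.finite_cover_balls
    (show 0 < δ / 3 by positivity)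
  have h1 : ∀ y : H, ∀ᶠ F : Finset κ in atTop, ‖(∑ k ∈ F, inner ℂ (φ k) y • φ k) - y‖ < δ / 3 := by
    intro y
    have h := φ.hasSum_repr y
    simp only [φ.repr_apply_apply] at h
    filter_upwards [Metric.tendsto_nhds.1 h (δ / 3) (by positivity)] with F hF
    rwa [← dist_eq_norm]
  obtain ⟨F, hF⟩ := ((eventually_all_finite hA).2 fun y _ => h1 y).exists
  refine ⟨fun s => ∑ k ∈ F, inner ℂ (φ k) (f s) • φ k, ?_, fun s => ?_⟩
  · have h2 : ∀ k, IsAlmostPeriodic fun s => inner ℂ (φ k) (f s) • φ k := by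
      intro k
      have h3 : IsAlmostPeriodic fun s => inner ℂ (φ k) (f s) :=
        isAlmostPeriodic_of_periodic (continuous_const.inner hf) hT fun s => by rw [hper s]
      exact h3.clm_apply ((ContinuousLinearMap.id ℂ ℂ).smulRight (φ k))
    clear hF
    induction F using Finset.induction with
    | empty =>
      simpa [Pi.zero_def] using isAlmostPeriodic_of_mem_trigPoly (Submodule.zero_mem (trigPoly H))
    | insert a F ha ih =>
      simp only [Finset.sum_insert ha]
      exact (h2 a).add ih
  · obtain ⟨u, hu, hfu⟩ := hper.exists_mem_Ico₀ hT s
    obtain ⟨y, hy, hdist⟩ := Set.mem_iUnion₂.1 (hcov ⟨u, Set.Ico_subset_Icc_self hu, rfl⟩)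
    have h2 := hF y hy
    have h3 := norm_sum_inner_smul_le φ.orthonormal F (f u - y)
    have h4 : f u - ∑ k ∈ F, inner ℂ (φ k) (f u) • φ k = (f u - y) -
        (∑ k ∈ F, inner ℂ (φ k) (f u - y) • φ k) - ((∑ k ∈ F, inner ℂ (φ k) y • φ k) - y) := by
      simp only [inner_sub_right, sub_smul, Finset.sum_sub_distrib]
      abel
    beta_reduce
    rw [hfu, h4]
    rw [Metric.mem_ball, dist_eq_norm] at hdist
    refine (norm_sub_le _ _).trans ((add_le_add (norm_sub_le _ _) le_rfl).trans ?_)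
    linarith

/-- A bounded, strongly almost periodic family of operators preserves almost periodicity. -/
lemma IsAlmostPeriodic.op_apply {X : ℝ → Op H} {C : ℝ} (hC : ∀ s, ‖X s‖ ≤ C)
    (hX : ∀ x, IsAlmostPeriodic fun s => X s x) {f : ℝ → H} (hf : IsAlmostPeriodic f) :
    IsAlmostPeriodic fun s => X s (f s) := by
  have hC0 : 0 ≤ C := (norm_nonneg _).trans (hC 0)
  have hpoly : ∀ p ∈ trigPoly H, IsAlmostPeriodic fun s => X s (p s) := by
    refine trigPoly_induction (fun ν c => ?_) (fun p _ q _ h h' => ?_)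
    · simpa using (hX c).chi_smul ν
    · simpa using h.add h'
  refine isAlmostPeriodic_of_approx fun δ hδ => ?_
  obtain ⟨p, hp, hfp⟩ := hf (δ / (C + 1)) (by positivity)
  refine ⟨_, hpoly p hp, fun s => ?_⟩
  rw [← map_sub]
  refine ((X s).le_of_opNorm_le (hC s) _).trans ?_
  calc C * ‖f s - p s‖ ≤ C * (δ / (C + 1)) := by gcongr; exact hfp s
    _ ≤ δ := by rw [← mul_div_assoc, div_le_iff₀ (by positivity)]; nlinarith

/-- A family of contractions that is diagonal in the basis `φ` is strongly almost periodic. -/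
lemma isAlmostPeriodic_of_diagonal {X : ℝ → Op H} (hX : ∀ s, ‖X s‖ ≤ 1) {ν : κ → ℝ}
    (hd : ∀ s k, X s (φ k) = chi (ν k) s • φ k) (x : H) : IsAlmostPeriodic fun s => X s x := by
  classical
  refine fun δ hδ => ?_
  have h := φ.hasSum_repr x
  obtain ⟨F, hF⟩ := (Metric.tendsto_nhds.1 h δ hδ).exists
  refine ⟨∑ k ∈ F, fun s => chi (ν k) s • (φ.repr x k • φ k),
    Submodule.sum_mem _ fun k _ => chi_smul_mem_trigPoly _ _, fun s => ?_⟩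
  have h1 : (∑ k ∈ F, fun s => chi (ν k) s • (φ.repr x k • φ k)) s =
      X s (∑ k ∈ F, φ.repr x k • φ k) := by
    simp only [Finset.sum_apply, map_sum, map_smul, hd, smul_comm (chi _ _)]
  rw [h1, ← map_sub]
  refine ((X s).le_of_opNorm_le (hX s) _).trans ?_
  rw [one_mul, ← dist_eq_norm, dist_comm]
  exact hF.le

end Periodic

/-! ### Exponentials on eigenvectors. -/

section Eigen

lemma pow_apply_of_eigen {E : Type*} [NormedAddCommGroup E] [NormedSpace ℂ E]
    {A : E →L[ℂ] E} {x : E} {c : ℂ} (h : A x = c • x) (n : ℕ) : (A ^ n) x = c ^ n • x := by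
  induction n with
  | zero => simp
  | succ n ih => rw [pow_succ', mul_apply_eq_comp, ih, map_smul, h, smul_smul, pow_succ]

lemma exp_apply_of_eigen {E : Type*} [NormedAddCommGroup E] [NormedSpace ℂ E] [CompleteSpace E]
    {A : E →L[ℂ] E} {x : E} {c : ℂ} (h : A x = c • x) :
    NormedSpace.exp A x = exp c • x := by
  have h1 := (NormedSpace.exp_series_hasSum_exp' (𝕂 := ℂ) A).mapL (ContinuousLinearMap.apply ℂ E x)
  have h2 := (NormedSpace.exp_series_hasSum_exp' (𝕂 := ℂ) c).smul_const x
  rw [← Complex.exp_eq_exp_ℂ] at h2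
  refine h1.unique (h2.congr_fun fun n => ?_)
  simp [pow_apply_of_eigen h, smul_smul]

end Eigen

/-! ### Floquet factorization and the components of interaction-picture operators. -/

section Floquet

variable {H κ : Type*} [NormedAddCommGroup H] [InnerProductSpace ℂ H] [CompleteSpace H]
  {HS : ℝ → Op H} {t₀ T : ℝ} {Hbar : Op H} {φ : HilbertBasis κ ℂ H} {ε : κ → ℝ}

/-- The operator is diagonal in an orthonormal basis with real eigenvalues. -/
lemma IsAveragedHamiltonian.isSelfAdjoint (hFl : IsAveragedHamiltonian HS t₀ T Hbar φ ε) :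
    IsSelfAdjoint Hbar := by
  refine ContinuousLinearMap.ext_on (s := Set.range φ)
    (Submodule.dense_iff_topologicalClosure_eq_top.2 φ.dense_span) ?_
  rintro _ ⟨k, rfl⟩
  refine φ.repr.injective ?_
  ext l
  rw [φ.repr_apply_apply, φ.repr_apply_apply, ContinuousLinearMap.star_eq_adjoint,
    ContinuousLinearMap.adjoint_inner_right, hFl.eigen, hFl.eigen, inner_smul_left,
    inner_smul_right, conj_ofReal]
  by_cases h : l = k
  · rw [h]
  · rw [φ.orthonormal.2 h, mul_zero, mul_zero]

/-- The unitary group `exp(-i s H)` of a bounded operator. -/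
def expGroup (A : Op H) (s : ℝ) : Op H := NormedSpace.exp ((-I * s) • A)

lemma expGroup_neg_mul (A : Op H) (s : ℝ) : expGroup A (-s) * expGroup A s = 1 := by
  have h := exp_smul_mul_exp_smul_neg A (I * s)
  rw [smul_neg, ← neg_smul] at h
  rw [expGroup, expGroup]
  convert h using 3
  · push_cast; ring_nf
  · ring_nf

lemma expGroup_add (A : Op H) (s t : ℝ) : expGroup A (s + t) = expGroup A s * expGroup A t := by
  let _ : NormedAlgebra ℚ (Op H) := .restrictScalars ℚ ℂ _
  rw [expGroup, expGroup, expGroup, ← NormedSpace.exp_add_of_commute, ← add_smul]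
  · push_cast; ring_nf
  · exact (Commute.refl A).smul_left _ |>.smul_right _

lemma star_expGroup {A : Op H} (hA : IsSelfAdjoint A) (s : ℝ) :
    star (expGroup A s) = expGroup A (-s) := by
  let _ : NormedAlgebra ℚ (Op H) := .restrictScalars ℚ ℂ _
  rw [expGroup, expGroup, NormedSpace.star_exp, star_smul, hA.star_eq]
  simp

lemma expGroup_mem_unitary {A : Op H} (hA : IsSelfAdjoint A) (s : ℝ) :
    expGroup A s ∈ unitary (Op H) := by
  rw [Unitary.mem_iff, star_expGroup hA]
  refine ⟨expGroup_neg_mul A s, ?_⟩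
  simpa using expGroup_neg_mul A (-s)

lemma continuous_expGroup (A : Op H) : Continuous (expGroup A) := by
  let _ : NormedAlgebra ℚ (Op H) := .restrictScalars ℚ ℂ _
  unfold expGroup
  exact NormedSpace.exp_continuous.comp (by fun_prop)

lemma norm_le_one_of_mem_unitary {U : Op H} (hU : U ∈ unitary (Op H)) : ‖U‖ ≤ 1 := by
  refine ContinuousLinearMap.opNorm_le_bound _ zero_le_one fun x => ?_
  have h := Unitary.mem_iff.1 hU
  have h1 : ‖U x‖ ^ 2 = ‖x‖ ^ 2 := by
    have h2 : inner ℂ (U x) (U x) = inner ℂ x x := by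
      rw [← ContinuousLinearMap.adjoint_inner_right, ← ContinuousLinearMap.star_eq_adjoint,
        ← mul_apply_eq_comp, h.1, one_apply_eq_self]
    rw [inner_self_eq_norm_sq_to_K, inner_self_eq_norm_sq_to_K] at h2
    exact_mod_cast h2
  rw [one_mul]
  exact ((sq_eq_sq₀ (norm_nonneg _) (norm_nonneg _)).1 h1).le

variable (HS t₀) in
/-- The operator `S` in the interaction picture, as a function of the elapsed time. -/
def interactionPicture (S : Op H) (s : ℝ) : Op H :=
  star (propagator HS t₀ (t₀ + s)) * S * propagator HS t₀ (t₀ + s)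

variable (HS t₀ Hbar) in
/-- The periodic operator `P† S P`, as a function of the elapsed time. -/
def rotatedOp (S : Op H) (s : ℝ) : Op H :=
  star (periodicPart HS t₀ Hbar (t₀ + s)) * S * periodicPart HS t₀ Hbar (t₀ + s)

variable {D : Set ℝ} {C : ℝ}

lemma periodicPart_add (s : ℝ) : periodicPart HS t₀ Hbar (t₀ + s) =
    propagator HS t₀ (t₀ + s) * expGroup Hbar (-s) := by
  rw [periodicPart, expGroup]
  congr 3
  push_cast
  ring

/-- Floquet factorization `U = P exp(-i s Hbar)`: the inner factor `P†SP` is periodic, and the outer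
factors are diagonal in the quasienergy basis. -/
lemma interactionPicture_eq (hFl : IsAveragedHamiltonian HS t₀ T Hbar φ ε) (S : Op H) (s : ℝ) :
    interactionPicture HS t₀ S s =
      expGroup Hbar (-s) * rotatedOp HS t₀ Hbar S s * expGroup Hbar s := by
  have h1 := expGroup_neg_mul Hbar s
  have h2 : star (expGroup Hbar (-s)) = expGroup Hbar s := by
    rw [star_expGroup hFl.isSelfAdjoint, neg_neg]
  rw [interactionPicture, rotatedOp, periodicPart_add, star_mul, h2]
  simp only [mul_assoc, h1, mul_one]
  rw [← mul_assoc _ (expGroup Hbar s), h1, one_mul]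

/-- After one period `U` acquires the monodromy `exp(-i T Hbar)` on the right, which the other
factor of `P` cancels. -/
lemma rotatedOp_periodic (hHS : ∀ t, IsSelfAdjoint (HS t)) (hD : D.Countable)
    (hc : ∀ t ∉ D, ContinuousAt HS t) (hper : Function.Periodic HS T)
    (hU : IsFundamentalSolution (fun t => (-I) • HS t) t₀ (propagator HS t₀))
    (hFl : IsAveragedHamiltonian HS t₀ T Hbar φ ε) (S : Op H) :
    Function.Periodic (rotatedOp HS t₀ Hbar S) T := by
  intro s
  have h : periodicPart HS t₀ Hbar (t₀ + (s + T)) = periodicPart HS t₀ Hbar (t₀ + s) := by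
    have hm : propagator HS t₀ (t₀ + T) = expGroup Hbar T := hFl.monodromy
    rw [periodicPart_add, periodicPart_add, ← add_assoc, propagator_add_period hHS hD hc hper hU,
      hm, mul_assoc, ← expGroup_add]
    congr 2
    ring
  rw [rotatedOp, h, rotatedOp]

lemma continuous_rotatedOp
    (hU : IsFundamentalSolution (fun t => (-I) • HS t) t₀ (propagator HS t₀)) (S : Op H) :
    Continuous (rotatedOp HS t₀ Hbar S) := by
  have h : Continuous fun s => periodicPart HS t₀ Hbar (t₀ + s) := by
    simp only [periodicPart_add]
    exact (hU.1.comp (by fun_prop)).mul ((continuous_expGroup _).comp continuous_neg)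
  exact (h.star.mul continuous_const).mul h

lemma continuous_interactionPicture
    (hU : IsFundamentalSolution (fun t => (-I) • HS t) t₀ (propagator HS t₀)) (S : Op H) :
    Continuous (interactionPicture HS t₀ S) := by
  have h : Continuous fun s => propagator HS t₀ (t₀ + s) := hU.1.comp (by fun_prop)
  exact (h.star.mul continuous_const).mul h

lemma norm_star_mul_mul_le {U S : Op H} (hU : U ∈ unitary (Op H)) : ‖star U * S * U‖ ≤ ‖S‖ := by
  have h1 := norm_le_one_of_mem_unitary hU
  have h2 := norm_le_one_of_mem_unitary (Unitary.star_mem hU)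
  calc _ ≤ ‖star U‖ * ‖S‖ * ‖U‖ := (norm_mul_le _ _).trans (by gcongr; exact norm_mul_le _ _)
    _ ≤ 1 * ‖S‖ * 1 := by gcongr
    _ = ‖S‖ := by ring

lemma norm_rotatedOp_le (hFl : IsAveragedHamiltonian HS t₀ T Hbar φ ε)
    (hu : ∀ t, propagator HS t₀ t ∈ unitary (Op H)) (S : Op H) (s : ℝ) :
    ‖rotatedOp HS t₀ Hbar S s‖ ≤ ‖S‖ := by
  refine norm_star_mul_mul_le ?_
  rw [periodicPart_add]
  exact mul_mem (hu _) (expGroup_mem_unitary hFl.isSelfAdjoint _)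

lemma star_interactionPicture {S : Op H} (hS : IsSelfAdjoint S) (s : ℝ) :
    star (interactionPicture HS t₀ S s) = interactionPicture HS t₀ S s := by
  rw [interactionPicture, star_mul, star_mul, star_star, hS.star_eq, mul_assoc]

lemma expGroup_basis (hFl : IsAveragedHamiltonian HS t₀ T Hbar φ ε) (s : ℝ) (k : κ) :
    expGroup Hbar s (φ k) = chi (-ε k) s • φ k := by
  rw [expGroup, exp_apply_of_eigen (c := -I * s * ε k), chi]
  · congr 2; push_cast; ring
  · rw [smul_apply, hFl.eigen, smul_smul]

/-- Operators in the interaction picture are almost periodic. -/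
lemma isAPOp_interactionPicture (hHS : ∀ t, IsSelfAdjoint (HS t)) (hD : D.Countable)
    (hc : ∀ t ∉ D, ContinuousAt HS t) (hper : Function.Periodic HS T) (hT : 0 < T)
    (hU : IsFundamentalSolution (fun t => (-I) • HS t) t₀ (propagator HS t₀))
    (hu : ∀ t, propagator HS t₀ t ∈ unitary (Op H))
    (hFl : IsAveragedHamiltonian HS t₀ T Hbar φ ε) {S : Op H} (hS : IsSelfAdjoint S) :
    IsAPOp (interactionPicture HS t₀ S) ‖S‖ := by
  have hap : ∀ x, IsAlmostPeriodic fun s => interactionPicture HS t₀ S s x := by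
    intro x
    simp only [interactionPicture_eq hFl, mul_apply_eq_comp]
    have hE := fun s => norm_le_one_of_mem_unitary (expGroup_mem_unitary hFl.isSelfAdjoint s)
    -- Of the three factors, the outer ones are diagonal contractions and the middle one is
    -- periodic. Each is bounded and strongly almost periodic and so preserves almost periodicity.
    refine IsAlmostPeriodic.op_apply (X := fun s => expGroup Hbar (-s)) (fun s => hE _) (fun y => ?_)
      (IsAlmostPeriodic.op_apply (X := rotatedOp HS t₀ Hbar S)
        (fun s => norm_rotatedOp_le hFl hu S s) (fun y => ?_) ?_)
    · refine isAlmostPeriodic_of_diagonal φ (fun s => hE _) (ν := ε) (fun s k => ?_) y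
      rw [expGroup_basis hFl, chi_neg_right, neg_neg]
    · exact isAlmostPeriodic_of_periodic_hilbert φ
        ((continuous_rotatedOp hU S).clm_apply continuous_const) hT
        fun s => by rw [rotatedOp_periodic hHS hD hc hper hU hFl S s]
    · exact isAlmostPeriodic_of_diagonal φ hE (expGroup_basis hFl) x
  exact ⟨continuous_interactionPicture hU S, fun s => norm_star_mul_mul_le (hu _), hap,
    fun x => by simpa only [star_interactionPicture hS] using hap x⟩

section Components

variable (hHS : ∀ t, IsSelfAdjoint (HS t)) (hD : D.Countable)
    (hc : ∀ t ∉ D, ContinuousAt HS t) (hper : Function.Periodic HS T) (hT : 0 < T)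
    (hU : IsFundamentalSolution (fun t => (-I) • HS t) t₀ (propagator HS t₀))
    (hFl : IsAveragedHamiltonian HS t₀ T Hbar φ ε) {S : Op H}
    (hS : IsAPOp (interactionPicture HS t₀ S) ‖S‖)

include hFl hU in
-- Between eigenvectors the outer factors become characters, so passing to the periodic operator
-- shifts the frequency by `ε k - ε l`.
lemma hasMean_matrixElement (ν : ℝ) (k l : κ) :
    HasMean (fun s => chi (-(ν - (ε k - ε l))) s *
      inner ℂ (φ k) (rotatedOp HS t₀ Hbar S s (φ l))) (inner ℂ (φ k) (hS.bohrOp ν (φ l))) := by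
  have h := (hS.hasMean_bohrOp ν (φ l)).inner_left ((hS.ap _).chi_smul _).continuous (φ k)
  have h1 : ∀ s, inner ℂ (φ k) (chi (-ν) s • interactionPicture HS t₀ S s (φ l)) =
      chi (-(ν - (ε k - ε l))) s * inner ℂ (φ k) (rotatedOp HS t₀ Hbar S s (φ l)) := by
    intro s
    rw [interactionPicture_eq hFl, mul_apply_eq_comp, mul_apply_eq_comp, expGroup_basis hFl,
      map_smul, map_smul, inner_smul_right, inner_smul_right, ← neg_neg s,
      ← star_expGroup hFl.isSelfAdjoint, neg_neg, ContinuousLinearMap.star_eq_adjoint,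
      ContinuousLinearMap.adjoint_inner_right, expGroup_basis hFl, inner_smul_left,
      ← RCLike.star_def, star_chi, neg_neg, ← mul_assoc, ← mul_assoc, ← chi_add, ← chi_add]
    congr 2
    ring
  simpa only [h1] using h

include hHS hD hc hper hFl hU hT in
-- At this frequency the averaged function is `T`-periodic, and its mean is the integral over one
-- period that defines the Fourier coefficient.
lemma inner_bohrOp_eq_fourierComponent {ν : ℝ} {k l : κ} {q : ℤ}
    (hν : ν = ε k - ε l + q * (2 * Real.pi / T)) :
    inner ℂ (φ k) (hS.bohrOp ν (φ l)) =
      inner ℂ (φ k) (fourierComponent HS t₀ T Hbar S q (φ l)) := by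
  have hrc := continuous_rotatedOp (Hbar := Hbar) hU S
  have h := hasMean_matrixElement hU hFl hS ν k l
  rw [show -(ν - (ε k - ε l)) = -(q * (2 * Real.pi / T)) by rw [hν]; ring] at h
  have hper' : Function.Periodic (fun s => chi (-(q * (2 * Real.pi / T))) s *
      inner ℂ (φ k) (rotatedOp HS t₀ Hbar S s (φ l))) T := by
    intro s
    have h1 : chi (-(q * (2 * Real.pi / T))) T = 1 := by
      rw [chi, Complex.exp_eq_one_iff]
      refine ⟨-q, ?_⟩
      have : (T : ℂ) ≠ 0 := by exact_mod_cast hT.ne'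
      push_cast
      field_simp
    simp only [chi_add_right, h1, mul_one, rotatedOp_periodic hHS hD hc hper hU hFl S s]
  have hcc : Continuous fun s => rotatedOp HS t₀ Hbar S s (φ l) := hrc.clm_apply continuous_const
  rw [h.eq_of_periodic ((continuous_chi _).mul (continuous_const.inner hcc)) hT hper',
    fourierComponent]
  have h2 : (∫ t in t₀..(t₀ + T), exp (-I * (q * (2 * Real.pi / T) * (t - t₀))) •
      (star (periodicPart HS t₀ Hbar t) * S * periodicPart HS t₀ Hbar t)) =
      ∫ s in (0 : ℝ)..T, chi (-(q * (2 * Real.pi / T))) s • rotatedOp HS t₀ Hbar S s := by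
    have h3 := intervalIntegral.integral_comp_add_left (a := 0) (b := T)
      (fun t : ℝ => exp (-I * (q * (2 * Real.pi / T) * (t - t₀))) •
      (star (periodicPart HS t₀ Hbar t) * S * periodicPart HS t₀ Hbar t)) t₀
    rw [add_zero] at h3
    rw [← h3]
    refine intervalIntegral.integral_congr fun s _ => ?_
    simp only [rotatedOp, chi]
    congr 2
    push_cast
    ring
  have h4 : Continuous fun s => chi (-(q * (2 * Real.pi / T))) s • rotatedOp HS t₀ Hbar S s :=
    (continuous_chi _).smul hrc
  rw [h2, smul_apply, inner_smul_right, ContinuousLinearMap.intervalIntegral_apply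
    (h4.intervalIntegrable _ _), ← innerSL_apply_apply ℂ (φ k),
    ← ContinuousLinearMap.intervalIntegral_comp_comm]
  · simp [inner_smul_right, Complex.real_smul]
  · exact ((h4.clm_apply continuous_const).intervalIntegrable _ _)

include hHS hD hc hper hFl hU hT in
-- Shifting time by `T` multiplies the averaged function by the phase `chi μ T` but leaves its mean
-- unchanged. A nonzero mean forces the phase to be 1, that is `μ` to be a multiple of `Ω`.
lemma inner_bohrOp_eq_zero {ν : ℝ} {k l : κ}
    (hν : ∀ q : ℤ, ν ≠ ε k - ε l + q * (2 * Real.pi / T)) :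
    inner ℂ (φ k) (hS.bohrOp ν (φ l)) = 0 := by
  have hrc := continuous_rotatedOp (Hbar := Hbar) hU S
  have h := hasMean_matrixElement hU hFl hS ν k l
  have hcc : Continuous fun s => rotatedOp HS t₀ Hbar S s (φ l) := hrc.clm_apply continuous_const
  set μ := -(ν - (ε k - ε l)) with hμ
  have hcont : Continuous fun s => chi μ s * inner ℂ (φ k) (rotatedOp HS t₀ Hbar S s (φ l)) :=
    (continuous_chi _).mul (continuous_const.inner hcc)
  obtain ⟨R, hR⟩ := (isAlmostPeriodic_of_periodic_hilbert φ hcc hT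
    fun s => by rw [rotatedOp_periodic hHS hD hc hper hU hFl S s]).exists_bound
  have h1 := h.comp_add hcont (C := R) (fun s => by
    rw [norm_mul, norm_chi, one_mul]
    exact (norm_inner_le_norm _ _).trans (by
      rw [φ.orthonormal.1, one_mul]; exact hR s)) T
  simp only [chi_add_right, rotatedOp_periodic hHS hD hc hper hU hFl S _, mul_right_comm _ (chi μ T)]
    at h1
  have h2 := h.const_smul (chi μ T)
  simp only [smul_eq_mul] at h2
  have h3 := h1.unique (by simpa only [mul_comm (chi μ T)] using h2)
  by_contra hne
  have h4 : chi μ T = 1 := by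
    have := mul_right_cancel₀ hne ((one_mul _).trans (h3.trans (mul_comm _ _)))
    exact this.symm
  rw [chi, Complex.exp_eq_one_iff] at h4
  obtain ⟨n, hn⟩ := h4
  refine hν (-n) ?_
  have h5 : μ * T = n * (2 * Real.pi) := by
    have : I * ((μ * T : ℝ) : ℂ) = I * ((n * (2 * Real.pi) : ℝ) : ℂ) := by
      push_cast; rw [hn]; ring
    exact_mod_cast mul_left_cancel₀ I_ne_zero this
  have h6 : ν = ε k - ε l - μ := by rw [hμ]; ring
  rw [h6, eq_div_of_mul_eq hT.ne' h5]
  push_cast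
  ring

end Components

end Floquet

/-! ### Strong continuity from uniform bounds. -/

section StrongContinuity

variable {α E F : Type*} [TopologicalSpace α] [NormedAddCommGroup E] [NormedSpace ℂ E]
  [NormedAddCommGroup F] [NormedSpace ℂ F] {X : α → E →L[ℂ] F} {C : ℝ}

lemma continuous_clm_apply_of_bound (hb : ∀ a, ‖X a‖ ≤ C) (hX : ∀ x, Continuous fun a => X a x)
    {f : α → E} (hf : Continuous f) : Continuous fun a => X a (f a) := by
  refine continuous_iff_continuousAt.2 fun a => ?_
  have h1 : Tendsto (fun b => X b (f b - f a)) (𝓝 a) (𝓝 0) := by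
    have h2 : Tendsto (fun b => C * ‖f b - f a‖) (𝓝 a) (𝓝 0) := by
      have := ((hf.sub (continuous_const (y := f a))).norm.const_mul C).tendsto a
      simpa using this
    exact squeeze_zero_norm (fun b => (X b).le_of_opNorm_le (hb b) _) h2
  have h3 := h1.add ((hX (f a)).tendsto a)
  rw [zero_add] at h3
  refine h3.congr fun b => ?_
  rw [map_sub, sub_add_cancel]

lemma continuous_clm_apply_of_span_dense {s : Set E}
    (hs : (Submodule.span ℂ s).topologicalClosure = ⊤) (hb : ∀ a, ‖X a‖ ≤ C)
    (h : ∀ x ∈ s, Continuous fun a => X a x) (x : E) : Continuous fun a => X a x :=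
  continuous_iff_continuousAt.2 fun a => tendsto_of_span_dense (T := fun b => (X b : E →ₗ[ℂ] F))
    (T₀ := X a) hs (Eventually.of_forall fun b x => (X b).le_of_opNorm_le (hb b) x)
    (fun x hx => (h x hx).tendsto a) x

end StrongContinuity

/-! ### The reservoir group and freely evolved operators. -/

section UnitaryGroup

variable {K : Type*} [NormedAddCommGroup K] [InnerProductSpace ℂ K] [CompleteSpace K]
  {HR : K →ₗ.[ℂ] K} {V : ℝ → Op K}

lemma IsUnitaryGroupOf.star_eq (hV : IsUnitaryGroupOf HR V) (s : ℝ) : star (V s) = V (-s) := by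
  have h1 : V (-s) * V s = 1 := by rw [← hV.add, neg_add_cancel, hV.zero]
  have h2 := (Unitary.mem_iff.1 (hV.unitary s)).2
  calc star (V s) = (V (-s) * V s) * star (V s) := by rw [h1, one_mul]
    _ = V (-s) := by rw [mul_assoc, h2, mul_one]

lemma IsUnitaryGroupOf.norm_le (hV : IsUnitaryGroupOf HR V) (s : ℝ) : ‖V s‖ ≤ 1 :=
  norm_le_one_of_mem_unitary (hV.unitary s)

lemma freeEvolve_zero (hV : IsUnitaryGroupOf HR V) (A : Op K) : freeEvolve V A 0 = A := by
  rw [freeEvolve, hV.zero, star_one, one_mul, mul_one]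

lemma freeEvolve_add (hV : IsUnitaryGroupOf HR V) (A : Op K) (s u : ℝ) :
    freeEvolve V A (s + u) = star (V u) * freeEvolve V A s * V u := by
  simp only [freeEvolve, hV.add, star_mul, mul_assoc]

lemma norm_freeEvolve_le (hV : IsUnitaryGroupOf HR V) (A : Op K) (s : ℝ) :
    ‖freeEvolve V A s‖ ≤ ‖A‖ := norm_star_mul_mul_le (hV.unitary s)

lemma star_freeEvolve {A : Op K} (hA : IsSelfAdjoint A) (s : ℝ) :
    star (freeEvolve V A s) = freeEvolve V A s := by
  rw [freeEvolve, star_mul, star_mul, star_star, hA.star_eq, mul_assoc]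

lemma continuous_freeEvolve_apply (hV : IsUnitaryGroupOf HR V) (A : Op K) (x : K) :
    Continuous fun s => freeEvolve V A s x := by
  have h : Continuous fun s => star (V s) (A (V s x)) := by
    simp only [hV.star_eq]
    exact continuous_clm_apply_of_bound (fun s => hV.norm_le (-s))
      (fun y => (hV.continuous y).comp continuous_neg) (A.continuous.comp (hV.continuous x))
  exact h

end UnitaryGroup

/-! ### Reservoir correlation functions: stationarity, symmetry, continuity. -/

section Correlation

variable {K : Type*} [NormedAddCommGroup K] [InnerProductSpace ℂ K] [CompleteSpace K]
  {HR : K →ₗ.[ℂ] K} {V : ℝ → Op K} {ι : Type*} {R : ι → Op K} {ω : TraceClass K}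

lemma trace_op_mul (ω : TraceClass K) (A : Op K) : trace (ω.op * A) = traceL K (sandwich 1 A ω) := by
  rw [traceL_apply, sandwich_op, one_mul]

lemma trace_mul_op (ω : TraceClass K) (A : Op K) : trace (A * ω.op) = trace (ω.op * A) := by
  rw [trace_op_mul, ← trace_sandwich_comm, traceL_apply, sandwich_op, mul_one]

/-- The map `A ↦ tr(ω A)`. -/
def expectL (ω : TraceClass K) : Op K →ₗ[ℂ] ℂ where
  toFun A := trace (ω.op * A)
  map_add' A B := by
    simp only [trace_op_mul, sandwich_add_right, add_apply, map_add]
  map_smul' c A := by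
    simp only [trace_op_mul, sandwich_smul_right, smul_apply, map_smul, RingHom.id_apply]

lemma norm_trace_op_mul_le (ω : TraceClass K) (A : Op K) :
    ‖trace (ω.op * A)‖ ≤ 2 * ‖ω‖ * ‖A‖ := by
  rw [trace_op_mul]
  refine (norm_trace_le _).trans ?_
  rw [sandwich_eq_compress]
  refine (norm_compress_apply_le _ _ _).trans ?_
  have h1 : ‖(1 : Op K)‖ ≤ 1 := ContinuousLinearMap.norm_id_le
  have h2 : ‖(1 : Op K)‖ * ‖A‖ ≤ 1 * ‖A‖ := by gcongr
  nlinarith [norm_nonneg ω, mul_le_mul_of_nonneg_right h2 (norm_nonneg ω)]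

lemma hasSum_trace_op_mul {J : Type*} {w : J → K} (h : HasSum (fun i => dyad (w i) (w i)) ω)
    (A : Op K) : HasSum (fun i => inner ℂ (w i) (A (w i))) (trace (ω.op * A)) := by
  have h1 := h.mapL (traceL K ∘L sandwich 1 A)
  rw [trace_op_mul]
  refine h1.congr_fun fun i => ?_
  rw [ContinuousLinearMap.comp_apply, sandwich_dyad, trace_dyad, one_apply_eq_self,
    ContinuousLinearMap.star_eq_adjoint, ContinuousLinearMap.adjoint_inner_left]

lemma star_trace_op_mul (hω : ω.op.IsPositive) (A : Op K) :
    star (trace (ω.op * A)) = trace (ω.op * star A) := by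
  obtain ⟨J, w, -, hw⟩ := exists_nuclear_of_isPositive ω hω
  have h1 : HasSum (fun i => star (inner ℂ (w i) (A (w i)))) (star (trace (ω.op * A))) :=
    (hasSum_trace_op_mul hw A).star
  refine h1.unique ((hasSum_trace_op_mul hw (star A)).congr_fun fun i => ?_)
  rw [ContinuousLinearMap.star_eq_adjoint, ContinuousLinearMap.adjoint_inner_right,
    RCLike.star_def, inner_conj_symm]

lemma trace_op_mul_conj (hV : IsUnitaryGroupOf HR V) (hωV : ∀ t, Commute ω.op (V t)) (A : Op K)
    (u : ℝ) : trace (ω.op * (star (V u) * A * V u)) = trace (ω.op * A) := by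
  have h1 : ω.op * (star (V u) * A * V u) = (sandwich 1 (star (V u) * A) ω).op * V u := by
    rw [sandwich_op]; simp only [one_mul, mul_assoc]
  rw [h1, ← trace_mul_op, sandwich_op, one_mul, ← mul_assoc, ← (hωV u).eq, mul_assoc, ← mul_assoc (V u),
    (Unitary.mem_iff.1 (hV.unitary u)).2, one_mul]

lemma correlation_eq (α β : ι) (s : ℝ) :
    correlation V R ω α β s = trace (ω.op * (freeEvolve V (R α) s * R β)) := by
  rw [correlation, mul_assoc]

/-- Stationarity of the correlation functions. -/
lemma trace_freeEvolve_mul_freeEvolve (hV : IsUnitaryGroupOf HR V)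
    (hωV : ∀ t, Commute ω.op (V t)) (A B : Op K) (s u : ℝ) :
    trace (ω.op * (freeEvolve V A s * freeEvolve V B u)) =
      trace (ω.op * (freeEvolve V A (s - u) * B)) := by
  rw [← trace_op_mul_conj hV hωV (freeEvolve V A (s - u) * B) u]
  congr 2
  have h := (Unitary.mem_iff.1 (hV.unitary u)).2
  conv_lhs => rw [← sub_add_cancel s u, freeEvolve_add hV]
  rw [freeEvolve, freeEvolve]
  simp only [mul_assoc]
  rw [← mul_assoc (V u) (star (V u)), h, one_mul]

lemma star_correlation (hV : IsUnitaryGroupOf HR V) (hω : ω.op.IsPositive)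
    (hωV : ∀ t, Commute ω.op (V t)) (hR : ∀ α, IsSelfAdjoint (R α)) (α β : ι) (s : ℝ) :
    star (correlation V R ω α β s) = correlation V R ω β α (-s) := by
  rw [correlation_eq, star_trace_op_mul hω, star_mul, (hR β).star_eq, star_freeEvolve (hR α),
    correlation_eq]
  have h := trace_freeEvolve_mul_freeEvolve hV hωV (R β) (R α) 0 s
  rw [freeEvolve_zero hV, zero_sub] at h
  exact h

lemma norm_correlation_le (hV : IsUnitaryGroupOf HR V) (α β : ι) (s : ℝ) :
    ‖correlation V R ω α β s‖ ≤ 2 * ‖ω‖ * (‖R α‖ * ‖R β‖) := by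
  rw [correlation_eq]
  refine (norm_trace_op_mul_le _ _).trans ?_
  gcongr
  exact (norm_mul_le _ _).trans (by gcongr; exact norm_freeEvolve_le hV _ _)

/-- Strong continuity is enough: on a decomposition of `ω` into vectors the trace is a series of
continuous expectation values, with summable bounds `C ‖wᵢ‖²`. -/
lemma continuous_trace_op_mul {α : Type*} [TopologicalSpace α] (hω : ω.op.IsPositive)
    {A : α → Op K} {C : ℝ} (hC : ∀ s, ‖A s‖ ≤ C) (hA : ∀ x, Continuous fun s => A s x) :
    Continuous fun s => trace (ω.op * A s) := by
  obtain ⟨J, w, hw', hw⟩ := exists_nuclear_of_isPositive ω hω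
  have h : (fun s => trace (ω.op * A s)) = fun s => ∑' i, inner ℂ (w i) (A s (w i)) :=
    funext fun s => (hasSum_trace_op_mul hw (A s)).tsum_eq.symm
  rw [h]
  refine continuous_tsum (fun i => continuous_const.inner (hA _)) (hw'.mul_left C) fun i s => ?_
  refine (norm_inner_le_norm _ _).trans ?_
  have := (A s).le_of_opNorm_le (hC s) (w i)
  nlinarith [norm_nonneg (w i)]

lemma continuous_correlation (hV : IsUnitaryGroupOf HR V) (hω : ω.op.IsPositive) (α β : ι) :
    Continuous (correlation V R ω α β) := by
  simp only [funext (correlation_eq (V := V) (R := R) (ω := ω) α β)]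
  refine continuous_trace_op_mul hω (C := ‖R α‖ * ‖R β‖) (fun s => (norm_mul_le _ _).trans (by
    gcongr; exact norm_freeEvolve_le hV _ _)) fun x => ?_
  exact continuous_freeEvolve_apply hV (R α) (R β x)

lemma exp_eq_chi (x s : ℝ) : exp (-I * (x * s)) = chi (-x) s := by
  rw [chi]; congr 1; push_cast; ring

/-- The spectral density as a sum of one-sided Fourier transforms. -/
lemma spectralDensity_eq (hV : IsUnitaryGroupOf HR V) (hω : ω.op.IsPositive)
    (hωV : ∀ t, Commute ω.op (V t)) (hR : ∀ α, IsSelfAdjoint (R α))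
    (hint : ∀ α β, Integrable (correlation V R ω α β)) (α β : ι) (x : ℝ) :
    spectralDensity V R ω α β x = halfDensity V R ω α β x + star (halfDensity V R ω β α x) := by
  have hi : ∀ α β, Integrable fun s : ℝ => exp (-I * (x * s)) * correlation V R ω α β s := fun α β => by
    simp only [exp_eq_chi]
    exact (hint α β).bdd_mul (continuous_chi _).aestronglyMeasurable (c := 1)
      (ae_of_all _ fun v => (norm_chi _ _).le)
  have h1 : star (halfDensity V R ω β α x) =
      ∫ s in Set.Iic (0 : ℝ), exp (-I * (x * s)) * correlation V R ω α β s := by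
    have h2 := integral_comp_neg_Ioi (0 : ℝ)
      (fun s => exp (-I * (x * s)) * correlation V R ω α β s)
    rw [neg_zero] at h2
    rw [← h2, halfDensity, RCLike.star_def, ← integral_conj]
    refine integral_congr_ae (ae_of_all _ fun s => ?_)
    simp only [map_mul, ← RCLike.star_def]
    rw [star_correlation hV hω hωV hR, exp_eq_chi, star_chi,
      exp_eq_chi, chi_neg_right, neg_neg]
  rw [h1, halfDensity, spectralDensity, add_comm]
  exact (intervalIntegral.integral_Iic_add_Ioi (hi α β).integrableOn (hi α β).integrableOn).symm

end Correlation

/-! ### Functions of positive type. -/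

section PositiveType

/-- A continuous integrable function of positive type has a nonnegative Fourier transform. -/
lemma fourier_nonneg_of_positive {g : ℝ → ℂ} (hg : Integrable g)
    (hpos : ∀ n : ℕ, 0 ≤ ∫ u in (0 : ℝ)..n, ∫ s in (0 : ℝ)..n, g (s - u)) : 0 ≤ ∫ s, g s := by
  -- Substituting `u = nθ` turns `1/n` times the double integral into an average over `θ` of
  -- integrals of `g` over `[-nθ, n(1-θ)]`, which tend to the full integral.
  have h1 : ∀ n : ℕ, 0 < n → (∫ u in (0 : ℝ)..n, ∫ s in (0 : ℝ)..n, g (s - u)) =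
      (n : ℝ) • ∫ θ in (0 : ℝ)..1, ∫ v in (-(n * θ))..(n * (1 - θ)), g v := by
    intro n hn
    have h2 := intervalIntegral.smul_integral_comp_mul_left (a := 0) (b := 1)
      (fun u => ∫ s in (0 : ℝ)..n, g (s - u)) (n : ℝ)
    rw [mul_zero, mul_one] at h2
    rw [← h2]
    congr 1
    refine intervalIntegral.integral_congr fun θ _ => ?_
    rw [intervalIntegral.integral_comp_sub_right g]
    congr 1 <;> ring
  have h2 : Tendsto (fun n : ℕ => ∫ θ in (0 : ℝ)..1, ∫ v in (-(n * θ))..(n * (1 - θ)), g v) atTop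
      (𝓝 (∫ θ in (0 : ℝ)..1, ∫ s, g s)) := by
    refine intervalIntegral.tendsto_integral_filter_of_dominated_convergence (fun _ => ∫ s, ‖g s‖)
      (Eventually.of_forall fun n => ?_) (Eventually.of_forall fun n => ae_of_all _ fun θ _ => ?_)
      (by simp) ?_
    · refine Continuous.aestronglyMeasurable ?_
      have hc : Continuous fun t => ∫ v in (0 : ℝ)..t, g v :=
        intervalIntegral.continuous_primitive (fun a b => hg.intervalIntegrable) 0
      have h3 : (fun θ : ℝ => ∫ v in (-(n * θ))..(n * (1 - θ)), g v) =
          fun θ : ℝ => (∫ v in (0 : ℝ)..(n * (1 - θ)), g v) - ∫ v in (0 : ℝ)..(-(n * θ)), g v := by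
        ext θ
        rw [intervalIntegral.integral_interval_sub_left hg.intervalIntegrable hg.intervalIntegrable]
      rw [h3]
      exact (hc.comp (by fun_prop)).sub (hc.comp (by fun_prop))
    · rw [intervalIntegral.norm_intervalIntegral_eq]
      refine (norm_integral_le_integral_norm _).trans ?_
      exact setIntegral_le_integral hg.norm (ae_of_all _ fun s => norm_nonneg _)
    · have h0 : ∀ᵐ θ : ℝ, θ ≠ 1 := by simp [ae_iff, measure_singleton]
      filter_upwards [h0] with θ hθ1 hθ
      rw [Set.uIoc_of_le zero_le_one] at hθ
      have hn : Tendsto (fun n : ℕ => (n : ℝ)) atTop atTop := tendsto_natCast_atTop_atTop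
      exact intervalIntegral_tendsto_integral hg
        (tendsto_neg_atTop_atBot.comp (hn.atTop_mul_const hθ.1))
        (hn.atTop_mul_const (sub_pos.2 (lt_of_le_of_ne hθ.2 hθ1)))
  rw [intervalIntegral.integral_const, sub_zero, one_smul] at h2
  refine ge_of_tendsto h2 ?_
  filter_upwards [eventually_gt_atTop 0] with n hn
  have h3 := hpos n
  rw [h1 n hn] at h3
  have h4 : (∫ θ in (0 : ℝ)..1, ∫ v in (-(n * θ))..(n * (1 - θ)), g v) = ((n : ℝ)⁻¹ : ℝ) •
      ((n : ℝ) • ∫ θ in (0 : ℝ)..1, ∫ v in (-(n * θ))..(n * (1 - θ)), g v) := by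
    rw [smul_smul, inv_mul_cancel₀ (by positivity), one_smul]
  rw [h4]
  exact smul_nonneg (by positivity) h3

/-- The double integral is the squared norm of `∫ h`. -/
lemma integral_integral_inner_nonneg {E : Type*} [NormedAddCommGroup E] [InnerProductSpace ℂ E]
    [CompleteSpace E] {h : ℝ → E} (hc : Continuous h) (t : ℝ) :
    0 ≤ ∫ u in (0 : ℝ)..t, ∫ s in (0 : ℝ)..t, inner ℂ (h s) (h u) := by
  have h1 : ∀ u, (∫ s in (0 : ℝ)..t, inner ℂ (h s) (h u)) = inner ℂ (∫ s in (0 : ℝ)..t, h s) (h u) := by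
    intro u
    have h2 := ContinuousLinearMap.intervalIntegral_comp_comm (𝕜 := ℝ)
      ((innerSL ℂ (h u)).restrictScalars ℝ) (hc.intervalIntegrable (μ := volume) (0 : ℝ) t)
    have h3 := congrArg (starRingEnd ℂ) h2
    simp only [ContinuousLinearMap.coe_restrictScalars', innerSL_apply_apply, inner_conj_symm] at h3
    rw [← h3, intervalIntegral, intervalIntegral, map_sub, ← integral_conj, ← integral_conj,
      ← intervalIntegral]
    simp only [inner_conj_symm]
    rfl
  simp only [h1]
  have h2 := ContinuousLinearMap.intervalIntegral_comp_comm (𝕜 := ℝ)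
    ((innerSL ℂ (∫ s in (0 : ℝ)..t, h s)).restrictScalars ℝ) (hc.intervalIntegrable (μ := volume) (0 : ℝ) t)
  simp only [ContinuousLinearMap.coe_restrictScalars', innerSL_apply_apply] at h2
  rw [h2]
  exact inner_self_nonneg (𝕜 := ℂ) |> fun h => (RCLike.nonneg_iff (K := ℂ)).2
    ⟨h, inner_self_im (𝕜 := ℂ) _⟩

lemma hasSum_integral_integral {J : Type*} [Countable J] {f : J → ℝ → ℝ → ℂ} {c : J → ℝ}
    (hc : Summable c) (hf : ∀ i, Continuous (Function.uncurry (f i))) (hb : ∀ i u s, ‖f i u s‖ ≤ c i)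
    (t : ℝ) : HasSum (fun i => ∫ u in (0 : ℝ)..t, ∫ s in (0 : ℝ)..t, f i u s)
      (∫ u in (0 : ℝ)..t, ∫ s in (0 : ℝ)..t, ∑' i, f i u s) := by
  have h1 : ∀ u, HasSum (fun i => ∫ s in (0 : ℝ)..t, f i u s) (∫ s in (0 : ℝ)..t, ∑' i, f i u s) :=
    fun u => intervalIntegral.hasSum_integral_of_dominated_convergence (fun i _ => c i)
      (fun i => ((hf i).comp (Continuous.prodMk_right u)).aestronglyMeasurable)
      (fun i => ae_of_all _ fun s _ => hb i u s) (ae_of_all _ fun _ _ => hc) (by simp)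
      (ae_of_all _ fun s _ => (Summable.of_norm_bounded hc fun i => hb i u s).hasSum)
  refine intervalIntegral.hasSum_integral_of_dominated_convergence (fun i _ => c i * |t - 0|)
    (fun i => (intervalIntegral.continuous_parametric_intervalIntegral_of_continuous'
      (hf i) 0 t).aestronglyMeasurable)
    (fun i => ae_of_all _ fun u _ => intervalIntegral.norm_integral_le_of_norm_le_const
      fun s _ => hb i u s) (ae_of_all _ fun _ _ => hc.mul_right _) (by simp)
    (ae_of_all _ fun u _ => h1 u)

end PositiveType

/-! ### Positivity of the spectral density matrix. -/

section SpectralDensity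

variable {K : Type*} [NormedAddCommGroup K] [InnerProductSpace ℂ K] [CompleteSpace K]
  {HR : K →ₗ.[ℂ] K} {V : ℝ → Op K} {ι : Type*} {R : ι → Op K} {ω : TraceClass K}

/-- Only countably many vectors of a summable family are nonzero. A countable index is what
interchanging sums with integrals requires. -/
lemma exists_countable_nuclear_of_isPositive (ρ : TraceClass K) (hρ : ρ.op.IsPositive) :
    ∃ (J : Type) (_ : Countable J) (x : J → K), Summable (fun i => ‖x i‖ ^ 2) ∧
      HasSum (fun i => dyad (x i) (x i)) ρ := by
  obtain ⟨J, x, h1, h2⟩ := exists_nuclear_of_isPositive ρ hρ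
  have hc : (Function.support fun i => ‖x i‖ ^ 2).Countable := h1.countable_support
  have : Countable (Function.support fun i => ‖x i‖ ^ 2) := hc.to_subtype
  obtain ⟨f, hf⟩ := exists_injective_nat (Function.support fun i => ‖x i‖ ^ 2)
  let e := Equiv.ofInjective f hf
  refine ⟨Set.range f, inferInstance, fun j => x (e.symm j), ?_, ?_⟩
  · exact (h1.comp_injective Subtype.val_injective).comp_injective e.symm.injective
  · have h3 : HasSum (fun j : Function.support fun i => ‖x i‖ ^ 2 => dyad (x j) (x j)) ρ := by
      refine (hasSum_subtype_iff_of_support_subset (f := fun j => dyad (x j) (x j)) ?_).2 h2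
      · intro i hi
        simp only [Function.mem_support, ne_eq] at hi ⊢
        intro h0
        have : x i = 0 := by simpa using h0
        exact hi (by rw [this, dyad_zero_left])
    exact (e.symm.hasSum_iff).2 h3

/-- The autocorrelation function of any bounded operator has a nonnegative Fourier transform. -/
lemma fourier_autocorrelation_nonneg (hV : IsUnitaryGroupOf HR V) (hω : ω.op.IsPositive)
    (hωV : ∀ t, Commute ω.op (V t)) (B : Op K) (x : ℝ)
    (hint : Integrable fun s => trace (ω.op * (freeEvolve V (star B) s * B))) :
    0 ≤ ∫ s : ℝ, chi (-x) s * trace (ω.op * (freeEvolve V (star B) s * B)) := by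
  obtain ⟨J, _, w, hw', hw⟩ := exists_countable_nuclear_of_isPositive ω hω
  refine fourier_nonneg_of_positive (hint.bdd_mul (continuous_chi _).aestronglyMeasurable (c := 1)
    (ae_of_all _ fun v => (norm_chi _ _).le)) fun n => ?_
  -- By stationarity the integrand at `s - u` is `∑ ⟨hᵢ(s), hᵢ(u)⟩`, so each term of the double
  -- integral is a squared norm.
  set h : J → ℝ → K := fun i s => chi x s • freeEvolve V B s (w i) with hh
  have hhc : ∀ i, Continuous (h i) := fun i =>
    (continuous_chi x).smul (continuous_freeEvolve_apply hV B (w i))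
  have hhb : ∀ i s, ‖h i s‖ ≤ ‖B‖ * ‖w i‖ := fun i s => by
    rw [hh, norm_smul, norm_chi, one_mul]
    exact (freeEvolve V B s).le_of_opNorm_le (norm_freeEvolve_le hV B s) _
  have h1 : ∀ u s : ℝ, chi (-x) (s - u) * trace (ω.op * (freeEvolve V (star B) (s - u) * B)) =
      ∑' i, inner ℂ (h i s) (h i u) := by
    intro u s
    rw [← trace_freeEvolve_mul_freeEvolve hV hωV]
    refine (((hasSum_trace_op_mul hw _).mul_left (chi (-x) (s - u))).congr_fun fun i => ?_).tsum_eq.symm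
    have h2 : star (freeEvolve V B s) = freeEvolve V (star B) s := by
      rw [freeEvolve, freeEvolve, star_mul, star_mul, star_star, mul_assoc]
    rw [hh, inner_smul_left, inner_smul_right, mul_apply_eq_comp, ← h2,
      ContinuousLinearMap.star_eq_adjoint, ContinuousLinearMap.adjoint_inner_right,
      ← RCLike.star_def, star_chi, sub_eq_add_neg, chi_add_right, chi_neg_right, neg_neg, mul_assoc]
  simp only [h1]
  refine (hasSum_integral_integral (f := fun i u s => inner ℂ (h i s) (h i u))
    (hw'.mul_left (‖B‖ ^ 2)) (fun i => ?_) (fun i u s => ?_) n).nonneg fun i =>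
      integral_integral_inner_nonneg (hhc i) n
  · exact ((hhc i).comp continuous_snd).inner ((hhc i).comp continuous_fst)
  · refine (norm_inner_le_norm _ _).trans ?_
    calc _ ≤ (‖B‖ * ‖w i‖) * (‖B‖ * ‖w i‖) := by gcongr <;> exact hhb i _
      _ = _ := by ring

/-- The spectral density matrix is positive semidefinite. -/
lemma posSemidef_spectralDensity (hV : IsUnitaryGroupOf HR V) (hω : ω.op.IsPositive)
    (hωV : ∀ t, Commute ω.op (V t)) (hR : ∀ α, IsSelfAdjoint (R α))
    (hint : ∀ α β, Integrable (correlation V R ω α β)) (x : ℝ) :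
    (Matrix.of fun α β => spectralDensity V R ω α β x).PosSemidef := by
  refine ⟨?_, fun c => ?_⟩
  · ext α β
    rw [Matrix.conjTranspose_apply, Matrix.of_apply, Matrix.of_apply,
      spectralDensity_eq hV hω hωV hR hint, spectralDensity_eq hV hω hωV hR hint, star_add, star_star,
      add_comm]
  · set B : Op K := ∑ j ∈ c.support, c j • R j with hB
    have h1 : ∀ s, trace (ω.op * (freeEvolve V (star B) s * B)) =
        ∑ i ∈ c.support, ∑ j ∈ c.support, star (c i) * c j * correlation V R ω i j s := by
      intro s
      have h2 : freeEvolve V (star B) s * B = ∑ i ∈ c.support, ∑ j ∈ c.support,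
          (star (c i) * c j) • (freeEvolve V (R i) s * R j) := by
        have h3 : freeEvolve V (star B) s = ∑ i ∈ c.support, star (V s) * star (c i • R i) * V s := by
          rw [hB, freeEvolve, star_sum, Finset.mul_sum, Finset.sum_mul]
        rw [h3, Finset.sum_mul]
        refine Finset.sum_congr rfl fun i _ => ?_
        rw [hB, Finset.mul_sum]
        refine Finset.sum_congr rfl fun j _ => ?_
        simp only [star_smul, (hR i).star_eq, mul_smul_comm, smul_mul_assoc, smul_smul, freeEvolve]
        rw [mul_comm]
      change expectL ω _ = _
      simp only [h2, map_sum, map_smul, smul_eq_mul, correlation_eq]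
      rfl
    have h6 := fourier_autocorrelation_nonneg hV hω hωV B x (by
      simp only [h1]
      exact integrable_finsetSum _ fun i _ => integrable_finsetSum _ fun j _ =>
        (hint i j).const_mul _)
    have hi : ∀ i j, Integrable fun s => chi (-x) s * (star (c i) * c j * correlation V R ω i j s) :=
      fun i j => ((hint i j).const_mul _).bdd_mul (continuous_chi _).aestronglyMeasurable (c := 1)
        (ae_of_all _ fun v => (norm_chi _ _).le)
    simp only [h1, Finset.mul_sum] at h6
    rw [integral_finsetSum _ fun i _ => integrable_finsetSum _ fun j _ => hi i j] at h6
    refine h6.trans (le_of_eq ?_)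
    rw [Finsupp.sum]
    refine Finset.sum_congr rfl fun i _ => ?_
    rw [integral_finsetSum _ fun j _ => hi i j, Finsupp.sum]
    refine Finset.sum_congr rfl fun j _ => ?_
    rw [Matrix.of_apply, spectralDensity, mul_right_comm, ← integral_const_mul]
    refine integral_congr_ae (ae_of_all _ fun s => ?_)
    simp only [exp_eq_chi]
    ring

end SpectralDensity

/-! ### The Hilbert tensor product and its product vectors. -/

section HilbertTensor

variable {H K : Type*} [NormedAddCommGroup H] [InnerProductSpace ℂ H] [CompleteSpace H]
  [NormedAddCommGroup K] [InnerProductSpace ℂ K] [CompleteSpace K]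

/-- The product vector `x ⊗ u` of the Hilbert tensor product. -/
def ptens (x : H) (u : K) : HTensor H K := ((x ⊗ₜ[ℂ] u : H ⊗[ℂ] K) : HTensor H K)

lemma tensorRight_apply (x : H) (u : K) : tensorRight H u x = ptens x u := rfl

lemma inner_ptens (x y : H) (u v : K) :
    inner ℂ (ptens x u) (ptens y v) = inner ℂ x y * inner ℂ u v := by
  rw [ptens, ptens, UniformSpace.Completion.inner_coe, TensorProduct.inner_tmul]

lemma norm_ptens (x : H) (u : K) : ‖ptens x u‖ = ‖x‖ * ‖u‖ := by
  rw [ptens, UniformSpace.Completion.norm_coe, TensorProduct.norm_tmul]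

/-- The map `u ↦ x ⊗ u`. -/
def tensorLeft (x : H) : K →L[ℂ] HTensor H K :=
  UniformSpace.Completion.toComplL ∘L (TensorProduct.mkL ℂ H K) x

lemma tensorLeft_apply (x : H) (u : K) : tensorLeft x u = ptens x u := rfl

variable (H K) in
lemma span_ptens_dense : (Submodule.span ℂ {ψ : HTensor H K | ∃ x u, ψ = ptens x u}).topologicalClosure
    = ⊤ := by
  refine Submodule.dense_iff_topologicalClosure_eq_top.1 ?_
  refine (UniformSpace.Completion.denseRange_coe (α := H ⊗[ℂ] K)).mono ?_
  rintro _ ⟨z, rfl⟩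
  induction z using TensorProduct.induction_on with
  | zero => exact Submodule.zero_mem _
  | tmul x u => exact Submodule.subset_span ⟨x, u, rfl⟩
  | add a b ha hb =>
    rw [UniformSpace.Completion.coe_add]
    exact Submodule.add_mem _ ha hb

lemma htensor_clm_ext {E : Type*} [NormedAddCommGroup E] [NormedSpace ℂ E]
    {f g : HTensor H K →L[ℂ] E} (h : ∀ x u, f (ptens x u) = g (ptens x u)) : f = g :=
  ContinuousLinearMap.ext_on (Submodule.dense_iff_topologicalClosure_eq_top.2 (span_ptens_dense H K))
    (by rintro _ ⟨x, u, rfl⟩; exact h x u)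

lemma opTensor_ptens (A : Op H) (B : Op K) (x : H) (u : K) :
    opTensor A B (ptens x u) = ptens (A x) (B u) :=
  ContinuousLinearMap.completion_apply_coe _ _

lemma opTensor_mul (A C : Op H) (B D : Op K) :
    opTensor A B * opTensor C D = opTensor (A * C) (B * D) :=
  htensor_clm_ext fun x u => by simp only [mul_apply_eq_comp, opTensor_ptens]

lemma opTensor_one : opTensor (1 : Op H) (1 : Op K) = 1 :=
  htensor_clm_ext fun x u => by simp only [opTensor_ptens, one_apply_eq_self]

lemma htensor_ext_inner {A B : Op (HTensor H K)}
    (h : ∀ x u y v, inner ℂ (ptens x u) (A (ptens y v)) = inner ℂ (ptens x u) (B (ptens y v))) :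
    A = B := by
  refine htensor_clm_ext fun y v => ?_
  have h1 : innerSL ℂ (A (ptens y v)) = innerSL ℂ (B (ptens y v)) := by
    refine htensor_clm_ext fun x u => ?_
    rw [innerSL_apply_apply, innerSL_apply_apply, ← inner_conj_symm, h, inner_conj_symm]
  refine ext_inner_right ℂ fun z => ?_
  exact congrArg (fun f => f z) h1

lemma star_opTensor (A : Op H) (B : Op K) : star (opTensor A B) = opTensor (star A) (star B) := by
  refine htensor_ext_inner fun x u y v => ?_
  simp only [ContinuousLinearMap.star_eq_adjoint, ContinuousLinearMap.adjoint_inner_right,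
    opTensor_ptens, inner_ptens]

lemma norm_opTensor_le (A : Op H) (B : Op K) : ‖opTensor A B‖ ≤ ‖A‖ * ‖B‖ := by
  refine ContinuousLinearMap.opNorm_le_bound _ (by positivity) fun z => ?_
  refine UniformSpace.Completion.induction_on z ?_ fun a => ?_
  · exact isClosed_le (opTensor A B).continuous.norm (continuous_const.mul continuous_norm)
  · have h : opTensor A B (a : HTensor H K) = ((TensorProduct.mapL A B a : H ⊗[ℂ] K) : HTensor H K) :=
      ContinuousLinearMap.completion_apply_coe _ _
    rw [h, UniformSpace.Completion.norm_coe, UniformSpace.Completion.norm_coe]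
    exact (TensorProduct.mapL A B).le_of_opNorm_le (TensorProduct.norm_mapL_le A B) a

lemma opTensor_mem_unitary {A : Op H} {B : Op K} (hA : A ∈ unitary (Op H)) (hB : B ∈ unitary (Op K)) :
    opTensor A B ∈ unitary (Op (HTensor H K)) := by
  rw [Unitary.mem_iff] at hA hB ⊢
  rw [star_opTensor, opTensor_mul, opTensor_mul, hA.1, hA.2, hB.1, hB.2, opTensor_one]
  exact ⟨rfl, rfl⟩

lemma ptens_add_left (x y : H) (u : K) : ptens (x + y) u = ptens x u + ptens y u :=
  (tensorRight H u).map_add x y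

lemma ptens_add_right (x : H) (u v : K) : ptens x (u + v) = ptens x u + ptens x v :=
  (tensorLeft x).map_add u v

lemma ptens_smul_left (c : ℂ) (x : H) (u : K) : ptens (c • x) u = c • ptens x u :=
  (tensorRight H u).map_smul c x

lemma ptens_smul_right (c : ℂ) (x : H) (u : K) : ptens x (c • u) = c • ptens x u :=
  (tensorLeft x).map_smul c u

lemma opTensor_add_right (A : Op H) (B C : Op K) :
    opTensor A (B + C) = opTensor A B + opTensor A C :=
  htensor_clm_ext fun x u => by simp only [add_apply, opTensor_ptens, ptens_add_right]

lemma opTensor_add_left (A C : Op H) (B : Op K) :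
    opTensor (A + C) B = opTensor A B + opTensor C B :=
  htensor_clm_ext fun x u => by simp only [add_apply, opTensor_ptens, ptens_add_left]

lemma opTensor_smul_right (c : ℂ) (A : Op H) (B : Op K) : opTensor A (c • B) = c • opTensor A B :=
  htensor_clm_ext fun x u => by simp only [smul_apply, opTensor_ptens, ptens_smul_right]

lemma opTensor_smul_left (c : ℂ) (A : Op H) (B : Op K) : opTensor (c • A) B = c • opTensor A B :=
  htensor_clm_ext fun x u => by simp only [smul_apply, opTensor_ptens, ptens_smul_left]

lemma adjoint_tensorRight_ptens (v u : K) (x : H) :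
    (tensorRight H v).adjoint (ptens x u) = inner ℂ v u • x := by
  refine ext_inner_left ℂ fun y => ?_
  rw [ContinuousLinearMap.adjoint_inner_right, tensorRight_apply, inner_ptens, inner_smul_right,
    mul_comm]

lemma norm_tensorRight_le (u : K) : ‖tensorRight H u‖ ≤ ‖u‖ :=
  ContinuousLinearMap.opNorm_le_bound _ (norm_nonneg _) fun x => by
    rw [tensorRight_apply, norm_ptens, mul_comm]

/-- Bessel's inequality for the components along an orthonormal system of the second factor. -/
lemma sum_norm_sq_adjoint_tensorRight_le {J : Type*} {b : J → K} (hb : Orthonormal ℂ b)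
    (F : Finset J) (Ψ : HTensor H K) : ∑ j ∈ F, ‖(tensorRight H (b j)).adjoint Ψ‖ ^ 2 ≤ ‖Ψ‖ ^ 2 := by
  classical
  set c : J → H := fun j => (tensorRight H (b j)).adjoint Ψ with hc
  set p : HTensor H K := ∑ j ∈ F, ptens (c j) (b j) with hp
  have hin : ∀ Φ : HTensor H K, inner ℂ p Φ =
      ∑ j ∈ F, inner ℂ (c j) ((tensorRight H (b j)).adjoint Φ) := fun Φ => by
    rw [hp, sum_inner]
    refine Finset.sum_congr rfl fun j _ => ?_
    rw [ContinuousLinearMap.adjoint_inner_right, tensorRight_apply]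
  have hTp : ∀ j ∈ F, (tensorRight H (b j)).adjoint p = c j := by
    intro j hj
    rw [hp, map_sum, Finset.sum_eq_single j]
    · rw [adjoint_tensorRight_ptens, inner_self_eq_norm_sq_to_K, hb.1]; simp
    · intro i _ hi
      rw [adjoint_tensorRight_ptens, hb.2 hi.symm, zero_smul]
    · exact fun h => absurd hj h
  have h1 : inner ℂ p Ψ = ((∑ j ∈ F, ‖c j‖ ^ 2 : ℝ) : ℂ) := by
    rw [hin]; push_cast
    exact Finset.sum_congr rfl fun j _ => inner_self_eq_norm_sq_to_K _
  have h2 : inner ℂ p p = ((∑ j ∈ F, ‖c j‖ ^ 2 : ℝ) : ℂ) := by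
    rw [hin]; push_cast
    refine Finset.sum_congr rfl fun j hj => ?_
    rw [hTp j hj]
    exact inner_self_eq_norm_sq_to_K _
  have h3 := @norm_sub_sq ℂ _ _ _ _ p Ψ
  have h4 : ‖p‖ ^ 2 = ∑ j ∈ F, ‖c j‖ ^ 2 := by
    rw [← inner_self_eq_norm_sq (𝕜 := ℂ), h2]; exact ofReal_re _
  have h5 : RCLike.re (inner ℂ p Ψ) = ∑ j ∈ F, ‖c j‖ ^ 2 := by rw [h1]; exact ofReal_re _
  rw [h4, h5] at h3
  nlinarith [sq_nonneg ‖p - Ψ‖]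

end HilbertTensor

/-! ### Tensor products and partial traces of trace-class operators. -/

section TensorTraceClass

variable {H K : Type*} [NormedAddCommGroup H] [InnerProductSpace ℂ H] [CompleteSpace H]
  [NormedAddCommGroup K] [InnerProductSpace ℂ K] [CompleteSpace K]

/-- For `X = |u⟩⟨v|` the operator is `ρ` sandwiched between `· ⊗ u` and the adjoint of `· ⊗ v`. The
general case is a sum over a nuclear decomposition of `X`; the constant 4 combines that of
`exists_nuclear` with that of `compress`. -/
lemma exists_traceClass_opTensor (ρ : TraceClass H) (X : TraceClass K) :
    ∃ σ : TraceClass (HTensor H K), σ.op = opTensor ρ.op X.op ∧ ‖σ‖ ≤ 4 * ‖X‖ * ‖ρ‖ := by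
  obtain ⟨J, u, v, h1, h2, hs⟩ := exists_nuclear X
  have hle : ∀ j, ‖compress (tensorRight H (u j)) (tensorRight H (v j)).adjoint ρ‖ ≤
      2 * ‖ρ‖ * (‖u j‖ * ‖v j‖) := fun j => by
    refine (norm_compress_apply_le _ _ _).trans ?_
    rw [LinearIsometryEquiv.norm_map]
    have := mul_le_mul (norm_tensorRight_le (H := H) (u j)) (norm_tensorRight_le (H := H) (v j))
      (norm_nonneg (tensorRight H (v j))) (norm_nonneg (u j))
    nlinarith [norm_nonneg ρ]
  have hS := Summable.of_norm_bounded (h1.mul_left _) hle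
  refine ⟨∑' j, compress (tensorRight H (u j)) (tensorRight H (v j)).adjoint ρ,
    htensor_clm_ext fun x w => ?_, ?_⟩
  · refine (TraceClass.hasSum_op_apply hS.hasSum (ptens x w)).unique ?_
    rw [opTensor_ptens, ← tensorLeft_apply (ρ.op x)]
    refine ((TraceClass.hasSum_op_apply hs w).mapL (tensorLeft (ρ.op x))).congr_fun fun j => ?_
    rw [compress_op, ContinuousLinearMap.comp_apply, ContinuousLinearMap.comp_apply,
      adjoint_tensorRight_ptens, dyad_op_apply, map_smul, map_smul, map_smul]
    rfl
  · refine (tsum_of_norm_bounded ((h1.mul_left (2 * ‖ρ‖)).hasSum) hle).trans ?_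
    rw [tsum_mul_left]
    nlinarith [norm_nonneg ρ]

/-- The operator `ρ ⊗ X` as an element of `B₁`. -/
def tensFun (X : TraceClass K) (ρ : TraceClass H) : TraceClass (HTensor H K) :=
  (exists_traceClass_opTensor ρ X).choose

lemma tensFun_op (X : TraceClass K) (ρ : TraceClass H) :
    (tensFun X ρ).op = opTensor ρ.op X.op := (exists_traceClass_opTensor ρ X).choose_spec.1

/-- The map `ρ ↦ ρ ⊗ X` on trace-class operators. -/
def tensL (X : TraceClass K) : TraceClass H →L[ℂ] TraceClass (HTensor H K) :=
  LinearMap.mkContinuous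
    { toFun := tensFun X
      map_add' := fun ρ σ => TraceClass.op_injective (by
        change TraceClass.op _ = TraceClass.op _
        rw [TraceClass.op_add, tensFun_op, tensFun_op, tensFun_op, TraceClass.op_add,
          opTensor_add_left])
      map_smul' := fun c ρ => TraceClass.op_injective (by
        change TraceClass.op _ = TraceClass.op _
        rw [RingHom.id_apply, TraceClass.op_smul, tensFun_op, tensFun_op, TraceClass.op_smul,
          opTensor_smul_left]) }
    (4 * ‖X‖) fun ρ => (exists_traceClass_opTensor ρ X).choose_spec.2

lemma tensL_op (X : TraceClass K) (ρ : TraceClass H) : (tensL X ρ).op = opTensor ρ.op X.op :=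
  (exists_traceClass_opTensor ρ X).choose_spec.1

lemma norm_tensL_apply_le (X : TraceClass K) (ρ : TraceClass H) :
    ‖tensL X ρ‖ ≤ 4 * ‖X‖ * ‖ρ‖ := (exists_traceClass_opTensor ρ X).choose_spec.2

lemma tensL_add (X Y : TraceClass K) (ρ : TraceClass H) :
    tensL (X + Y) ρ = tensL X ρ + tensL Y ρ := TraceClass.op_injective (by
  change TraceClass.op _ = TraceClass.op _
  simp only [TraceClass.op_add, tensL_op, opTensor_add_right])

lemma tensL_smul (c : ℂ) (X : TraceClass K) (ρ : TraceClass H) :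
    tensL (c • X) ρ = c • tensL X ρ := TraceClass.op_injective (by
  change TraceClass.op _ = TraceClass.op _
  simp only [TraceClass.op_smul, tensL_op, opTensor_smul_right])

variable (K) in
/-- The map `X ↦ ρ ⊗ X` on trace-class operators. -/
def tensR (ρ : TraceClass H) : TraceClass K →L[ℂ] TraceClass (HTensor H K) :=
  LinearMap.mkContinuous
    { toFun := fun X => tensL X ρ
      map_add' := fun X Y => tensL_add X Y ρ
      map_smul' := fun c X => tensL_smul c X ρ }
    (4 * ‖ρ‖) fun X => by
      have := norm_tensL_apply_le X ρ
      change ‖tensL X ρ‖ ≤ _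
      linarith

lemma tensR_apply (ρ : TraceClass H) (X : TraceClass K) : tensR K ρ X = tensL X ρ := rfl

lemma tensL_dyad (x y : H) (u v : K) :
    tensL (dyad u v) (dyad x y) = dyad (ptens x u) (ptens y v) := TraceClass.op_injective (by
  change TraceClass.op _ = TraceClass.op _
  rw [tensL_op]
  refine htensor_clm_ext fun z w => ?_
  rw [opTensor_ptens, dyad_op_apply, dyad_op_apply, dyad_op_apply, inner_ptens, ptens_smul_left,
    ptens_smul_right, smul_smul])

lemma sandwich_opTensor_tensL (A C : Op H) (B D : Op K) (X : TraceClass K) (ρ : TraceClass H) :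
    sandwich (opTensor A B) (opTensor C D) (tensL X ρ) = tensL (sandwich B D X) (sandwich A C ρ) :=
  TraceClass.op_injective (by
  change TraceClass.op _ = TraceClass.op _
  simp only [sandwich_op, tensL_op, opTensor_mul])

/-! ### The partial trace -/

/-- The slices are absolutely summable in trace norm: for each rank-one part `|x⟩⟨y|`,
Cauchy–Schwarz and Bessel over the basis of the second factor bound the sum by `‖x‖ ‖y‖`. -/
lemma exists_ptr (Y : TraceClass (HTensor H K)) : ∃ σ : TraceClass H,
    HasSum (fun j => compress (tensorRight H (traceBasis K j)).adjoint
      (tensorRight H (traceBasis K j)) Y) σ ∧ ‖σ‖ ≤ 2 * ‖Y‖ := by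
  obtain ⟨J, x, y, h1, h2, hs⟩ := exists_nuclear Y
  set T := fun j => tensorRight H (traceBasis K j) with hT
  have hle : ∀ F : Finset (exists_hilbertBasis ℂ K).choose,
      ∑ j ∈ F, ‖compress (T j).adjoint (T j) Y‖ ≤ 2 * ‖Y‖ := by
    intro F
    have h3 : ∀ j, HasSum (fun i => dyad ((T j).adjoint (x i)) ((T j).adjoint (y i)))
        (compress (T j).adjoint (T j) Y) := fun j => by
      simpa only [compress_dyad] using hs.mapL (compress (T j).adjoint (T j))
    have h4 : ∀ i, ∑ j ∈ F, ‖(T j).adjoint (x i)‖ * ‖(T j).adjoint (y i)‖ ≤ ‖x i‖ * ‖y i‖ := by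
      intro i
      refine le_of_sq_le_sq ?_ (by positivity)
      refine (Finset.sum_mul_sq_le_sq_mul_sq _ _ _).trans ?_
      rw [mul_pow]
      exact mul_le_mul (sum_norm_sq_adjoint_tensorRight_le (traceBasis K).orthonormal F _)
        (sum_norm_sq_adjoint_tensorRight_le (traceBasis K).orthonormal F _)
        (Finset.sum_nonneg fun _ _ => by positivity) (by positivity)
    have h5 : ∀ j ∈ F, Summable fun i => ‖(T j).adjoint (x i)‖ * ‖(T j).adjoint (y i)‖ :=
      fun j hj => Summable.of_nonneg_of_le (fun i => by positivity) (fun i =>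
        (Finset.single_le_sum (f := fun j => ‖(T j).adjoint (x i)‖ * ‖(T j).adjoint (y i)‖)
          (fun _ _ => by positivity) hj).trans (h4 i)) h1
    calc _ ≤ ∑ j ∈ F, ∑' i, ‖(T j).adjoint (x i)‖ * ‖(T j).adjoint (y i)‖ := by
          refine Finset.sum_le_sum fun j hj => ?_
          rw [← (h3 j).tsum_eq]
          exact tsum_of_norm_bounded (h5 j hj).hasSum fun i => norm_dyad_le _ _
      _ = ∑' i, ∑ j ∈ F, ‖(T j).adjoint (x i)‖ * ‖(T j).adjoint (y i)‖ :=
          (Summable.tsum_finsetSum h5).symm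
      _ ≤ ∑' i, ‖x i‖ * ‖y i‖ := Summable.tsum_le_tsum h4 (summable_sum h5) h1
      _ ≤ 2 * ‖Y‖ := h2
  have hS : Summable fun j => ‖compress (T j).adjoint (T j) Y‖ :=
    summable_of_sum_le (fun _ => norm_nonneg _) hle
  exact ⟨_, hS.of_norm.hasSum, (norm_tsum_le_tsum_norm hS).trans (hS.tsum_le_of_sum_le hle)⟩

variable (H K) in
/-- The partial trace on trace-class operators. -/
def ptr : TraceClass (HTensor H K) →L[ℂ] TraceClass H :=
  LinearMap.mkContinuous
    { toFun := fun Y => (exists_ptr Y).choose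
      map_add' := fun Y Z => by
        refine (exists_ptr (Y + Z)).choose_spec.1.unique ?_
        simpa only [map_add] using (exists_ptr Y).choose_spec.1.add (exists_ptr Z).choose_spec.1
      map_smul' := fun c Y => by
        refine (exists_ptr (c • Y)).choose_spec.1.unique ?_
        simpa only [map_smul, RingHom.id_apply] using (exists_ptr Y).choose_spec.1.const_smul c } 2
    fun Y => (exists_ptr Y).choose_spec.2

lemma hasSum_ptr (Y : TraceClass (HTensor H K)) :
    HasSum (fun j => compress (tensorRight H (traceBasis K j)).adjoint
      (tensorRight H (traceBasis K j)) Y) (ptr H K Y) := (exists_ptr Y).choose_spec.1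

lemma norm_ptr_le : ‖ptr H K‖ ≤ 2 := LinearMap.mkContinuous_norm_le _ zero_le_two _

lemma ptr_op (Y : TraceClass (HTensor H K)) : (ptr H K Y).op = partialTrace Y.op := by
  have h := ((hasSum_ptr Y).mapL (opL H)).tsum_eq
  simp only [opL_apply, compress_op] at h
  exact h.symm

lemma ptr_dyad_ptens (x y : H) (u v : K) :
    ptr H K (dyad (ptens x u) (ptens y v)) = inner ℂ v u • dyad x y := by
  refine (hasSum_ptr _).unique ?_
  refine (((traceBasis K).hasSum_inner_mul_inner v u).smul_const (dyad x y)).congr_fun fun j => ?_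
  rw [compress_dyad, adjoint_tensorRight_ptens, adjoint_tensorRight_ptens, dyad_smul_left,
    dyad_smul_right, smul_smul, RCLike.star_def, inner_conj_symm, mul_comm]

lemma ptr_tensL (X : TraceClass K) (ρ : TraceClass H) :
    ptr H K (tensL X ρ) = traceL K X • ρ := by
  have h1 : ∀ x y : H, ptr H K ∘L tensR K (dyad x y) = (traceL K).smulRight (dyad x y) := by
    intro x y
    refine TraceClass.clm_ext fun u v => ?_
    rw [ContinuousLinearMap.comp_apply, tensR_apply, tensL_dyad, ptr_dyad_ptens,
      ContinuousLinearMap.smulRight_apply, trace_dyad]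
  have h2 : ptr H K ∘L tensL X = traceL K X • ContinuousLinearMap.id ℂ (TraceClass H) := by
    refine TraceClass.clm_ext fun x y => ?_
    exact congrArg (fun f => f X) (h1 x y)
  exact congrArg (fun f => f ρ) h2

lemma trace_ptr (Y : TraceClass (HTensor H K)) :
    traceL H (ptr H K Y) = traceL (HTensor H K) Y := by
  have h : traceL H ∘L ptr H K = traceL (HTensor H K) := by
    refine ContinuousLinearMap.ext_on (Submodule.dense_iff_topologicalClosure_eq_top.2
      (span_dyad_dense (span_ptens_dense H K))) ?_
    rintro _ ⟨_, ⟨x, u, rfl⟩, _, ⟨y, v, rfl⟩, rfl⟩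
    rw [ContinuousLinearMap.comp_apply, ptr_dyad_ptens, map_smul, trace_dyad, trace_dyad,
      inner_ptens, smul_eq_mul, mul_comm]
  exact congrArg (fun f => f Y) h

end TensorTraceClass

/-! ### Complete positivity of the reduced dynamics. -/

section CompletelyPositive

variable {H K : Type*} [NormedAddCommGroup H] [InnerProductSpace ℂ H] [CompleteSpace H]
  [NormedAddCommGroup K] [InnerProductSpace ℂ K] [CompleteSpace K]

/-- Complete positivity is a family of closed inequalities that involve finitely many values of the
map, so it survives strong limits. -/
lemma IsCompletelyPositive.of_tendsto {α : Type*} {l : Filter α} [l.NeBot]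
    {Φ : α → TraceClass H →L[ℂ] TraceClass H} {Φ₀ : TraceClass H →L[ℂ] TraceClass H}
    (h : ∀ ρ, Tendsto (fun a => Φ a ρ) l (𝓝 (Φ₀ ρ)))
    (hΦ : ∀ᶠ a in l, IsCompletelyPositive (Φ a)) : IsCompletelyPositive Φ₀ := by
  intro n X hX ψ
  refine ge_of_tendsto (x := l) (f := fun a => ∑ i, ∑ j, inner ℂ (ψ i) ((Φ a (X i j)).op (ψ j))) ?_
    (hΦ.mono fun a ha => ha n X hX ψ)
  refine tendsto_finsetSum _ fun i _ => tendsto_finsetSum _ fun j _ => ?_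
  have hc : Continuous fun ρ : TraceClass H => inner ℂ (ψ i) (ρ.op (ψ j)) :=
    continuous_const.inner ((opL H).continuous.clm_apply continuous_const)
  exact (hc.tendsto _).comp (h (X i j))

lemma IsCPTP.of_tendsto {α : Type*} {l : Filter α} [l.NeBot]
    {Φ : α → TraceClass H →L[ℂ] TraceClass H} {Φ₀ : TraceClass H →L[ℂ] TraceClass H}
    (h : ∀ ρ, Tendsto (fun a => Φ a ρ) l (𝓝 (Φ₀ ρ))) (hΦ : ∀ᶠ a in l, IsCPTP (Φ a)) :
    IsCPTP Φ₀ := by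
  refine ⟨IsCompletelyPositive.of_tendsto h (hΦ.mono fun _ h => h.1), fun ρ => ?_⟩
  refine tendsto_nhds_unique (((traceL H).continuous.tendsto _).comp (h ρ)) ?_
  exact tendsto_const_nhds.congr' (hΦ.mono fun a ha => (ha.2 ρ).symm)

lemma isCompletelyPositive_sum {J : Type*} (F : Finset J) {Φ : J → TraceClass H →L[ℂ] TraceClass H}
    (h : ∀ j, IsCompletelyPositive (Φ j)) : IsCompletelyPositive (∑ j ∈ F, Φ j) := by
  intro n X hX ψ
  have h1 : ∀ i j, inner ℂ (ψ i) (((∑ k ∈ F, Φ k) (X i j)).op (ψ j)) =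
      ∑ k ∈ F, inner ℂ (ψ i) ((Φ k (X i j)).op (ψ j)) := fun i j => by
    rw [sum_apply, TraceClass.op, map_sum, sum_apply, inner_sum]
  simp only [h1]
  have h2 : ∑ i, ∑ j, ∑ k ∈ F, inner ℂ (ψ i) ((Φ k (X i j)).op (ψ j)) =
      ∑ k ∈ F, ∑ i, ∑ j, inner ℂ (ψ i) ((Φ k (X i j)).op (ψ j)) := by
    rw [Finset.sum_comm]
    rw [Finset.sum_comm]
    simp only [Finset.sum_comm (s := F)]
  rw [h2]
  exact Finset.sum_nonneg fun k _ => h k n X hX ψ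

lemma isCompletelyPositive_of_hasSum {J : Type*} {Φ : J → TraceClass H →L[ℂ] TraceClass H}
    {Φ₀ : TraceClass H →L[ℂ] TraceClass H} (h : ∀ ρ, HasSum (fun j => Φ j ρ) (Φ₀ ρ))
    (hΦ : ∀ j, IsCompletelyPositive (Φ j)) : IsCompletelyPositive Φ₀ :=
  IsCompletelyPositive.of_tendsto (Φ := fun F : Finset J => ∑ j ∈ F, Φ j) (l := atTop)
    (fun ρ => by simpa [HasSum, sum_apply] using h ρ)
    (Eventually.of_forall fun F => isCompletelyPositive_sum F hΦ)

lemma isCompletelyPositive_compress (A : Op H) :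
    IsCompletelyPositive (compress A A.adjoint) := by
  intro n X hX ψ
  have h := hX fun i => A.adjoint (ψ i)
  simpa only [compress_op, ContinuousLinearMap.comp_apply, ContinuousLinearMap.adjoint_inner_left]
    using h

/-- The reduced dynamics that belongs to the evolution `W` of the composite system. -/
def reducedMap (W : Op (HTensor H K)) (ω : TraceClass K) : TraceClass H →L[ℂ] TraceClass H :=
  ptr H K ∘L sandwich W (star W) ∘L tensL ω

lemma reducedMap_op (W : Op (HTensor H K)) (ω : TraceClass K) (ρ : TraceClass H) :
    (reducedMap W ω ρ).op = partialTrace (W * opTensor ρ.op ω.op * star W) := by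
  rw [reducedMap, ContinuousLinearMap.comp_apply, ptr_op, ContinuousLinearMap.comp_apply, sandwich_op,
    tensL_op]

/-- Kraus form: with `ω = ∑ |wᵢ⟩⟨wᵢ|` the Kraus operators are the slices `⟨bⱼ| W |wᵢ⟩`. Trace
preservation uses only that `W` is an isometry. -/
lemma isCPTP_reducedMap {W : Op (HTensor H K)} (hW : star W * W = 1) {ω : TraceClass K}
    (hω : IsDensity ω) : IsCPTP (reducedMap (H := H) W ω) := by
  refine ⟨?_, fun ρ => ?_⟩
  · obtain ⟨J, w, -, hw⟩ := exists_nuclear_of_isPositive ω hω.1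
    refine isCompletelyPositive_of_hasSum (Φ := fun i => reducedMap W (dyad (w i) (w i)))
      (fun ρ => hw.mapL (ptr H K ∘L sandwich W (star W) ∘L tensR K ρ)) fun i => ?_
    refine isCompletelyPositive_of_hasSum (Φ := fun j =>
      compress ((tensorRight H (traceBasis K j)).adjoint ∘L W ∘L tensorRight H (w i))
        (((tensorRight H (traceBasis K j)).adjoint ∘L W ∘L tensorRight H (w i))).adjoint) (fun ρ => ?_)
      fun j => isCompletelyPositive_compress _
    refine (hasSum_ptr (sandwich W (star W) (tensL (dyad (w i) (w i)) ρ))).congr_fun fun j => ?_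
    have h1 : (tensL (dyad (w i) (w i)) : TraceClass H →L[ℂ] _) =
        compress (tensorRight H (w i)) (tensorRight H (w i)).adjoint := by
      refine TraceClass.clm_ext fun x y => ?_
      rw [tensL_dyad, compress_dyad, ContinuousLinearMap.adjoint_adjoint, tensorRight_apply,
        tensorRight_apply]
    rw [h1, sandwich_eq_compress, compress_compress, compress_compress,
      ContinuousLinearMap.adjoint_comp, ContinuousLinearMap.adjoint_comp,
      ContinuousLinearMap.adjoint_adjoint]
    rfl
  · rw [← traceL_apply, reducedMap, ContinuousLinearMap.comp_apply, trace_ptr,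
      ContinuousLinearMap.comp_apply, trace_sandwich_isometry hW, ← trace_ptr, ptr_tensL, map_smul,
      traceL_apply, hω.2, one_smul, traceL_apply]

end CompletelyPositive

/-! ### Strong continuity on `B₁`, tested on rank-one operators. -/

section DyadContinuity

variable {H F α : Type*} [NormedAddCommGroup H] [InnerProductSpace ℂ H] [CompleteSpace H]
  [NormedAddCommGroup F] [NormedSpace ℂ F] [TopologicalSpace α]

lemma continuous_of_continuous_dyad {X : α → TraceClass H →L[ℂ] F} {C : ℝ} (hb : ∀ a, ‖X a‖ ≤ C)
    (h : ∀ x y, Continuous fun a => X a (dyad x y)) (ρ : TraceClass H) :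
    Continuous fun a => X a ρ :=
  continuous_clm_apply_of_span_dense (span_dyad_dense (s := Set.univ)
    (by rw [Submodule.span_univ]; exact top_unique (Submodule.le_topologicalClosure _))) hb
    (by rintro _ ⟨x, -, y, -, rfl⟩; exact h x y) ρ

lemma commutator_dyad (A : Op H) (x y : H) :
    commutator A (dyad x y) = dyad (A x) y - dyad x (star A y) := by
  rw [commutator, sub_apply, sandwich_dyad, sandwich_dyad, star_one, one_apply_eq_self,
    one_apply_eq_self]

end DyadContinuity

/-! ### Schrödinger and von Neumann equations with bounded time-dependent Hamiltonian. -/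

section Schroedinger

variable {G : Type*} [NormedAddCommGroup G] [InnerProductSpace ℂ G] [CompleteSpace G]

/-- A bounded, strongly continuous family of self-adjoint operators. -/
structure IsHamiltonianField (h : ℝ → Op G) (M : ℝ) : Prop where
  selfAdjoint : ∀ s, IsSelfAdjoint (h s)
  bound : ∀ s, ‖h s‖ ≤ M
  continuous : ∀ x, Continuous fun s => h s x

variable {h : ℝ → Op G} {M : ℝ}

/-- Solutions of the Schrödinger equation `X' = -i lam h X`. -/
def IsSchroedingerSolution (h : ℝ → Op G) (lam : ℝ) (X : ℝ → G) : Prop :=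
  ∀ t, HasDerivAt X ((-I * lam) • h t (X t)) t

lemma IsSchroedingerSolution.continuous {lam : ℝ} {X : ℝ → G} (hX : IsSchroedingerSolution h lam X) :
    Continuous X := continuous_iff_continuousAt.2 fun t => (hX t).continuousAt

lemma IsHamiltonianField.inner_eq (hh : IsHamiltonianField h M) {lam : ℝ} {X Y : ℝ → G}
    (hX : IsSchroedingerSolution h lam X) (hY : IsSchroedingerSolution h lam Y) (t : ℝ) :
    inner ℂ (X t) (Y t) = inner ℂ (X 0) (Y 0) := by
  refine eq_of_hasDerivAt_zero_off_countable (f := fun t => inner ℂ (X t) (Y t)) (D := ∅)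
    Set.countable_empty (hX.continuous.inner hY.continuous) (fun t _ => ?_) 0 t
  refine ((hX t).inner ℂ (hY t)).congr_deriv ?_
  have h1 : inner ℂ (h t (X t)) (Y t) = inner ℂ (X t) (h t (Y t)) := by
    rw [← ContinuousLinearMap.adjoint_inner_right,
      ContinuousLinearMap.isSelfAdjoint_iff'.1 (hh.selfAdjoint t)]
  rw [inner_smul_left, inner_smul_right, h1]
  simp

lemma IsHamiltonianField.norm_eq (hh : IsHamiltonianField h M) {lam : ℝ} {X : ℝ → G}
    (hX : IsSchroedingerSolution h lam X) (t : ℝ) : ‖X t‖ = ‖X 0‖ := by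
  have h1 := hh.inner_eq hX hX t
  rw [@norm_eq_sqrt_re_inner ℂ, @norm_eq_sqrt_re_inner ℂ, h1]

lemma IsHamiltonianField.exists_solution (hh : IsHamiltonianField h M) (lam : ℝ) (x : G) :
    ∃ X : ℝ → G, X 0 = x ∧ IsSchroedingerSolution h lam X := by
  have hcont : ∀ f : ℝ → G, Continuous f → Continuous fun s => (-I * lam) • h s (f s) :=
    fun f hf => (continuous_clm_apply_of_bound hh.bound hh.continuous hf).const_smul _
  have hB : IsBoundedField (fun s => (((-I * lam : ℂ)) • h s).restrictScalars ℝ) (|lam| * M) := by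
    refine ⟨fun s => ?_, fun f hf => (hcont f hf).aestronglyMeasurable⟩
    rw [ContinuousLinearMap.norm_restrictScalars, norm_smul]
    simp only [norm_mul, norm_neg, norm_I, one_mul, norm_real, Real.norm_eq_abs]
    gcongr
    exact hh.bound s
  obtain ⟨X, hX, hs⟩ := exists_integral_solution hB 0 x
  refine ⟨X, by simpa using hs 0, fun t => ?_⟩
  have h1 := (hcont X hX).integral_hasStrictDerivAt 0 t |>.hasDerivAt.const_add x
  exact h1.congr_of_eventuallyEq (Eventually.of_forall fun t => hs t)

/-- The unitary evolution generated by `lam • h`. -/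
lemma IsHamiltonianField.exists_evolution (hh : IsHamiltonianField h M) (lam : ℝ) :
    ∃ Z : ℝ → Op G, Z 0 = 1 ∧ ∀ x, IsSchroedingerSolution h lam fun t => Z t x := by
  choose X hX0 hX using hh.exists_solution lam
  -- Norm conservation for the difference of two solutions gives uniqueness, and the linearity of
  -- the evolution follows from it.
  have hlin : ∀ Y : ℝ → G, IsSchroedingerSolution h lam Y → ∀ t, Y t = X (Y 0) t := by
    intro Y hY t
    have h1 : IsSchroedingerSolution h lam fun t => Y t - X (Y 0) t := fun t => by
      refine ((hY t).sub (hX (Y 0) t)).congr_deriv ?_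
      rw [map_sub, smul_sub]
    have h2 := hh.norm_eq h1 t
    simp only [hX0, sub_self, norm_zero, norm_eq_zero] at h2
    exact sub_eq_zero.1 h2
  refine ⟨fun t => LinearMap.mkContinuous
    { toFun := fun x => X x t
      map_add' := fun x y => by
        have h1 : IsSchroedingerSolution h lam fun t => X x t + X y t := fun t => by
          refine ((hX x t).add (hX y t)).congr_deriv ?_
          rw [map_add, smul_add]
        have h2 := hlin _ h1 t
        simp only [hX0] at h2
        exact h2.symm
      map_smul' := fun c x => by
        have h1 : IsSchroedingerSolution h lam fun t => c • X x t := fun t => by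
          refine ((hX x t).const_smul c).congr_deriv ?_
          rw [map_smul, smul_comm]
        have h2 := hlin _ h1 t
        simp only [hX0] at h2
        exact h2.symm } 1 fun x => by
      rw [one_mul]
      have h1 := hh.norm_eq (hX x) t
      rw [hX0] at h1
      exact h1.le, ?_, fun x => hX x⟩
  ext x
  exact hX0 x

variable {Z : ℝ → Op G} {lam : ℝ}

lemma IsHamiltonianField.star_mul_self (hh : IsHamiltonianField h M) (hZ0 : Z 0 = 1)
    (hZ : ∀ x, IsSchroedingerSolution h lam fun t => Z t x) (t : ℝ) : star (Z t) * Z t = 1 := by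
  ext y
  refine ext_inner_left ℂ fun x => ?_
  rw [mul_apply_eq_comp, ContinuousLinearMap.star_eq_adjoint, ContinuousLinearMap.adjoint_inner_right,
    hh.inner_eq (hZ x) (hZ y), hZ0]
  rfl

lemma norm_le_one_of_star_mul_self {A : Op G} (hA : star A * A = 1) : ‖A‖ ≤ 1 := by
  have h1 := CStarRing.norm_star_mul_self (x := A)
  rw [hA] at h1
  have h2 : ‖(1 : Op G)‖ ≤ 1 := ContinuousLinearMap.norm_id_le
  nlinarith [norm_nonneg A]

lemma norm_star_le_one_of_star_mul_self {A : Op G} (hA : star A * A = 1) : ‖star A‖ ≤ 1 := by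
  rw [norm_star]; exact norm_le_one_of_star_mul_self hA

lemma norm_sandwich_isometry_le {A : Op G} (hA : star A * A = 1) : ‖sandwich A (star A)‖ ≤ 2 := by
  refine (norm_sandwich_le _ _).trans ?_
  have := mul_le_mul (norm_le_one_of_star_mul_self hA) (norm_star_le_one_of_star_mul_self hA)
    (norm_nonneg (star A)) zero_le_one
  linarith

lemma IsHamiltonianField.continuous_sandwich (hh : IsHamiltonianField h M) (hZ0 : Z 0 = 1)
    (hZ : ∀ x, IsSchroedingerSolution h lam fun t => Z t x) (σ : TraceClass G) :
    Continuous fun t => sandwich (Z t) (star (Z t)) σ := by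
  refine continuous_of_continuous_dyad (C := 2)
    (fun t => norm_sandwich_isometry_le (hh.star_mul_self hZ0 hZ t)) (fun x y => ?_) σ
  simp only [sandwich_dyad, star_star]
  exact continuous_dyad.comp ((hZ x).continuous.prodMk (hZ y).continuous)

/-- The Liouville operator `-i [h, ·]`. -/
def liouvillian (h : Op G) : TraceClass G →L[ℂ] TraceClass G := (-I) • commutator h

lemma norm_liouvillian_le (A : Op G) : ‖liouvillian A‖ ≤ 4 * ‖A‖ := by
  rw [liouvillian, norm_smul, norm_neg, norm_I, one_mul]
  exact norm_commutator_le A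

lemma IsHamiltonianField.norm_liouvillian_le (hh : IsHamiltonianField h M) (s : ℝ) :
    ‖liouvillian (h s)‖ ≤ 4 * M :=
  (OpenFloquet.norm_liouvillian_le _).trans (by gcongr; exact hh.bound s)

lemma IsHamiltonianField.continuous_liouvillian (hh : IsHamiltonianField h M) (σ : TraceClass G) :
    Continuous fun s => liouvillian (h s) σ := by
  refine continuous_of_continuous_dyad hh.norm_liouvillian_le (fun x y => ?_) σ
  simp only [liouvillian, smul_apply, commutator_dyad, (hh.selfAdjoint _).star_eq]
  exact (continuous_const_smul (-I)).comp ((continuous_dyad.comp ((hh.continuous x).prodMk continuous_const)).sub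
    (continuous_dyad.comp (continuous_const.prodMk (hh.continuous y))))

lemma IsHamiltonianField.continuous_liouvillian_apply (hh : IsHamiltonianField h M)
    {f : ℝ → TraceClass G} (hf : Continuous f) : Continuous fun s => liouvillian (h s) (f s) :=
  continuous_clm_apply_of_bound hh.norm_liouvillian_le hh.continuous_liouvillian hf

/-- The von Neumann equation, in integrated form. -/
lemma IsHamiltonianField.sandwich_eq_add_integral (hh : IsHamiltonianField h M) (hZ0 : Z 0 = 1)
    (hZ : ∀ x, IsSchroedingerSolution h lam fun t => Z t x) (σ : TraceClass G) (t : ℝ) :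
    sandwich (Z t) (star (Z t)) σ = σ + (lam : ℂ) • ∫ s in (0 : ℝ)..t,
      liouvillian (h s) (sandwich (Z s) (star (Z s)) σ) := by
  have hcont : ∀ σ, Continuous fun s => (lam : ℂ) • liouvillian (h s)
      (sandwich (Z s) (star (Z s)) σ) := fun σ => (continuous_const_smul (lam : ℂ)).comp
    (hh.continuous_liouvillian_apply (hh.continuous_sandwich hZ0 hZ σ))
  -- The evolution is differentiable only strongly, so the equation is differentiated on rank-one
  -- operators and then summed over a nuclear decomposition in integrated form.
  have hdy : ∀ x y, ∫ s in (0 : ℝ)..t, (lam : ℂ) • liouvillian (h s) (sandwich (Z s) (star (Z s))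
      (dyad x y)) = sandwich (Z t) (star (Z t)) (dyad x y) - dyad x y := by
    intro x y
    have hd : ∀ s, HasDerivAt (fun s => sandwich (Z s) (star (Z s)) (dyad x y))
        ((lam : ℂ) • liouvillian (h s) (sandwich (Z s) (star (Z s)) (dyad x y))) s := by
      intro s
      simp only [sandwich_dyad, star_star]
      have h1 := (isBoundedBilinearMap_dyad (H := G)).hasFDerivAt (Z s x, Z s y)
      refine (h1.comp_hasDerivAt s ((hZ x s).prodMk (hZ y s))).congr_deriv ?_
      simp only [IsBoundedBilinearMap.deriv_apply, liouvillian, smul_apply, commutator_dyad,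
        (hh.selfAdjoint _).star_eq, dyad_smul_left, dyad_smul_right, smul_sub, smul_smul]
      simp only [star_mul', RCLike.star_def, map_neg, conj_I, conj_ofReal, neg_neg]
      rw [add_comm, sub_eq_add_neg, ← neg_smul]
      congr 2 <;> ring
    rw [intervalIntegral.integral_eq_sub_of_hasDerivAt (fun s _ => hd s)
      ((hcont _).intervalIntegrable _ _), hZ0, star_one, sandwich_one_one]
    rfl
  obtain ⟨J, x, y, h1, -, hs⟩ := exists_nuclear σ
  have hc : (Function.support fun i => ‖x i‖ * ‖y i‖).Countable := h1.countable_support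
  set s₀ := Function.support fun i => ‖x i‖ * ‖y i‖
  have hcs : Countable s₀ := hc.to_subtype
  have hs' : HasSum (fun j : s₀ => dyad (x j) (y j)) σ := by
    refine (hasSum_subtype_iff_of_support_subset (f := fun j => dyad (x j) (y j)) ?_).2 hs
    intro i hi
    simp only [s₀, Function.mem_support, ne_eq] at hi ⊢
    exact fun h0 => hi (norm_le_zero_iff.1 ((norm_dyad_le _ _).trans h0.le))
  have h1' : Summable fun i : s₀ => ‖x i‖ * ‖y i‖ := h1.comp_injective Subtype.val_injective
  have hM : 0 ≤ M := (norm_nonneg _).trans (hh.bound 0)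
  have hI : HasSum (fun i : s₀ => ∫ s in (0 : ℝ)..t, (lam : ℂ) • liouvillian (h s)
      (sandwich (Z s) (star (Z s)) (dyad (x i) (y i))))
      (∫ s in (0 : ℝ)..t, (lam : ℂ) • liouvillian (h s) (sandwich (Z s) (star (Z s)) σ)) := by
    refine intervalIntegral.hasSum_integral_of_dominated_convergence
      (fun i _ => |lam| * (4 * M * (2 * (‖x i‖ * ‖y i‖))))
      (fun i => (hcont _).aestronglyMeasurable)
      (fun i => ae_of_all _ fun s _ => ?_) (ae_of_all _ fun s _ => ?_) (by simp)
      (ae_of_all _ fun s _ => ?_)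
    · have h2 := (sandwich (Z s) (star (Z s))).le_of_opNorm_le_of_le
        (norm_sandwich_isometry_le (hh.star_mul_self hZ0 hZ s)) (norm_dyad_le (x i) (y i))
      have h3 := (liouvillian (h s)).le_of_opNorm_le_of_le (hh.norm_liouvillian_le s) h2
      rw [norm_smul, norm_real, Real.norm_eq_abs]
      exact mul_le_mul_of_nonneg_left h3 (abs_nonneg lam)
    · exact (((h1'.mul_left 2).mul_left (4 * M)).mul_left |lam|)
    · exact hs'.mapL ((lam : ℂ) • (liouvillian (h s) ∘L sandwich (Z s) (star (Z s))))
  simp only [hdy] at hI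
  have h2 := hI.unique ((hs'.mapL (sandwich (Z t) (star (Z t)))).sub hs')
  rw [← intervalIntegral.integral_smul, h2, add_sub_cancel]

end Schroedinger

/-! ### The composite evolution in the interaction picture. -/

section Composite

variable {H K : Type*} [NormedAddCommGroup H] [InnerProductSpace ℂ H] [CompleteSpace H]
  [NormedAddCommGroup K] [InnerProductSpace ℂ K] [CompleteSpace K]
  {HR : K →ₗ.[ℂ] K} {V : ℝ → Op K} {HS : ℝ → Op H} {t₀ : ℝ}
  {ι : Type*} {S : ι → Op H} {R : ι → Op K}

/-- The free evolution as a function of the elapsed time. -/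
def freeFlow (HS : ℝ → Op H) (V : ℝ → Op K) (t₀ s : ℝ) : Op (HTensor H K) := freeEvolution HS V t₀ (t₀ + s)

lemma freeFlow_eq (s : ℝ) : freeFlow HS V t₀ s = opTensor (propagator HS t₀ (t₀ + s)) (V s) := by
  rw [freeFlow, freeEvolution, add_sub_cancel_left]

/-- The interaction Hamiltonian in the interaction picture. -/
def interactionField (HS : ℝ → Op H) (V : ℝ → Op K) (t₀ : ℝ) (S : ι → Op H) (R : ι → Op K) (s : ℝ) : Op (HTensor H K) :=
  star (freeFlow HS V t₀ s) * interaction S R * freeFlow HS V t₀ s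

variable (hV : IsUnitaryGroupOf HR V) (hu : ∀ t, propagator HS t₀ t ∈ unitary (Op H))
  (hUc : Continuous (propagator HS t₀)) (hSR : Summable fun α => ‖S α‖ * ‖R α‖)
  (hS : ∀ α, IsSelfAdjoint (S α)) (hR : ∀ α, IsSelfAdjoint (R α))

include hSR in
lemma hasSum_interaction : HasSum (fun α => opTensor (S α) (R α)) (interaction S R) :=
  (Summable.of_norm_bounded hSR fun _ => norm_opTensor_le _ _).hasSum

include hSR in
lemma norm_interaction_le : ‖interaction S R‖ ≤ ∑' α, ‖S α‖ * ‖R α‖ :=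
  tsum_of_norm_bounded hSR.hasSum fun _ => norm_opTensor_le _ _

include hV hu in
lemma freeFlow_mem_unitary (s : ℝ) : freeFlow HS V t₀ s ∈ unitary (Op (HTensor H K)) := by
  rw [freeFlow_eq]
  exact opTensor_mem_unitary (hu _) (hV.unitary s)

include hSR in
/-- The interaction Hamiltonian in the interaction picture, as a norm-convergent sum. -/
lemma hasSum_interactionField (s : ℝ) :
    HasSum (fun α => opTensor (interactionPicture HS t₀ (S α) s) (freeEvolve V (R α) s))
      (interactionField HS V t₀ S R s) := by
  have h1 := ((hasSum_interaction hSR).mul_left (star (freeFlow HS V t₀ s))).mul_right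
    (freeFlow HS V t₀ s)
  refine h1.congr_fun fun α => ?_
  rw [freeFlow_eq, star_opTensor, opTensor_mul, opTensor_mul]
  rfl

include hSR hS hR in
lemma isSelfAdjoint_interaction : IsSelfAdjoint (interaction S R) := by
  have h1 := (hasSum_interaction hSR).star
  simp only [star_opTensor, (hS _).star_eq, (hR _).star_eq] at h1
  exact h1.unique (hasSum_interaction hSR)

include hV hu hUc hSR hS hR in
-- The reservoir group is only strongly continuous. Continuity of the free flow and of its adjoint
-- is checked on product vectors and extended by the uniform norm bound.
lemma isHamiltonianField_interactionField :
    IsHamiltonianField (interactionField HS V t₀ S R) (∑' α, ‖S α‖ * ‖R α‖) where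
  selfAdjoint s := by
    rw [IsSelfAdjoint, interactionField, star_mul, star_mul, star_star,
      (isSelfAdjoint_interaction hSR hS hR).star_eq, mul_assoc]
  bound s := (norm_star_mul_mul_le (freeFlow_mem_unitary hV hu s)).trans (norm_interaction_le hSR)
  continuous := by
    have hF : ∀ x, Continuous fun s => freeFlow HS V t₀ s x := by
      refine continuous_clm_apply_of_span_dense (span_ptens_dense H K)
        (fun s => norm_le_one_of_mem_unitary (freeFlow_mem_unitary hV hu s)) ?_
      rintro _ ⟨x, u, rfl⟩
      simp only [freeFlow_eq, opTensor_ptens]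
      have h1 : Continuous fun s => propagator HS t₀ (t₀ + s) x :=
        (hUc.comp (by fun_prop)).clm_apply continuous_const
      have h2 : ∀ s, ptens (propagator HS t₀ (t₀ + s) x) (V s u) =
          tensorRight H (V s u) (propagator HS t₀ (t₀ + s) x) := fun s => rfl
      simp only [h2]
      refine Continuous.clm_apply ?_ h1
      have h3 : Continuous fun s => (TensorProduct.mkL ℂ H K).flip (V s u) :=
        (TensorProduct.mkL ℂ H K).flip.continuous.comp (hV.continuous u)
      exact continuous_const.clm_comp h3
    have hF' : ∀ x, Continuous fun s => star (freeFlow HS V t₀ s) x := by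
      refine continuous_clm_apply_of_span_dense (span_ptens_dense H K)
        (fun s => norm_le_one_of_mem_unitary (Unitary.star_mem (freeFlow_mem_unitary hV hu s))) ?_
      rintro _ ⟨x, u, rfl⟩
      simp only [freeFlow_eq, star_opTensor, opTensor_ptens, hV.star_eq]
      have h1 : Continuous fun s => star (propagator HS t₀ (t₀ + s)) x :=
        ((hUc.comp (by fun_prop)).star).clm_apply continuous_const
      have h2 : ∀ s, ptens (star (propagator HS t₀ (t₀ + s)) x) (V (-s) u) =
          tensorRight H (V (-s) u) (star (propagator HS t₀ (t₀ + s)) x) := fun s => rfl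
      simp only [h2]
      refine Continuous.clm_apply ?_ h1
      have h3 : Continuous fun s => (TensorProduct.mkL ℂ H K).flip (V (-s) u) :=
        (TensorProduct.mkL ℂ H K).flip.continuous.comp ((hV.continuous u).comp continuous_neg)
      exact continuous_const.clm_comp h3
    intro x
    exact continuous_clm_apply_of_bound
      (fun s => norm_le_one_of_mem_unitary (Unitary.star_mem (freeFlow_mem_unitary hV hu s))) hF'
      ((interaction S R).continuous.comp (hF x))

/-- The composite evolution in the interaction picture, as a function of the elapsed time. -/
def interactionEvolution (HS : ℝ → Op H) (V : ℝ → Op K) (t₀ : ℝ) (W : ℝ → Op (HTensor H K))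
    (s : ℝ) : Op (HTensor H K) := star (freeFlow HS V t₀ s) * W (t₀ + s)

include hV in
lemma freeFlow_zero (hU0 : propagator HS t₀ t₀ = 1) : freeFlow HS V t₀ 0 = 1 := by
  rw [freeFlow_eq, add_zero, hU0, hV.zero, opTensor_one]

include hV in
lemma interactionEvolution_zero (hU0 : propagator HS t₀ t₀ = 1) {W : ℝ → Op (HTensor H K)}
    (hW : W t₀ = 1) : interactionEvolution HS V t₀ W 0 = 1 := by
  rw [interactionEvolution, freeFlow_zero hV hU0, add_zero, hW, star_one, one_mul]

include hV hu in
lemma isSchroedingerSolution_interactionEvolution {lam : ℝ} {W : ℝ → Op (HTensor H K)}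
    (hW : IsCompositeEvolution HS V (interaction S R) t₀ lam W) (x : HTensor H K) :
    IsSchroedingerSolution (interactionField HS V t₀ S R) lam
      fun s => interactionEvolution HS V t₀ W s x := by
  intro s
  have h1 := (hW.2 x (t₀ + s)).comp_const_add t₀ s
  refine h1.congr_deriv ?_
  have h2 := (Unitary.mem_iff.1 (freeFlow_mem_unitary hV hu s)).2
  have h3 : freeFlow HS V t₀ s (star (freeFlow HS V t₀ s) (W (t₀ + s) x)) = W (t₀ + s) x := by
    rw [← mul_apply_eq_comp, h2, one_apply_eq_self]
  simp only [interactionField, interactionEvolution, mul_apply_eq_comp, h3]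
  rfl

include hV hu in
lemma eq_freeFlow_mul_interactionEvolution (W : ℝ → Op (HTensor H K)) (s : ℝ) :
    W (t₀ + s) = freeFlow HS V t₀ s * interactionEvolution HS V t₀ W s := by
  rw [interactionEvolution, ← mul_assoc, (Unitary.mem_iff.1 (freeFlow_mem_unitary hV hu s)).2,
    one_mul]

include hV hu hUc hSR hS hR in
lemma exists_isCompositeEvolution (hU0 : propagator HS t₀ t₀ = 1) (lam : ℝ) :
    ∃ W, IsCompositeEvolution HS V (interaction S R) t₀ lam W := by
  obtain ⟨Z, hZ0, hZ⟩ :=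
    (isHamiltonianField_interactionField hV hu hUc hSR hS hR).exists_evolution lam
  have hF := fun s => Unitary.mem_iff.1 (freeFlow_mem_unitary hV hu s)
  refine ⟨fun t => freeFlow HS V t₀ (t - t₀) * Z (t - t₀), ?_, fun x t => ?_⟩
  · simp only [sub_self, freeFlow_zero hV hU0, hZ0, mul_one]
  · have h1 : ∀ t, freeEvolution HS V t₀ t = freeFlow HS V t₀ (t - t₀) := fun t => by
      rw [freeFlow, add_sub_cancel]
    have h2 : ∀ s y, star (freeFlow HS V t₀ s) (freeFlow HS V t₀ s y) = y := fun s y => by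
      rw [← mul_apply_eq_comp, (hF s).1, one_apply_eq_self]
    simp only [h1, mul_apply_eq_comp, h2]
    exact (hZ x (t - t₀)).comp_sub_const t t₀

/-- The partial trace does not see an isometry acting on the reservoir alone, so the reservoir part
of the free flow drops out of the reduced dynamics. -/
lemma ptr_sandwich_opTensor (A C : Op H) {B : Op K} (hB : star B * B = 1)
    (Y : TraceClass (HTensor H K)) : ptr H K (sandwich (opTensor A B) (opTensor C (star B)) Y) =
      sandwich A C (ptr H K Y) := by
  have h : ptr H K ∘L sandwich (opTensor A B) (opTensor C (star B)) = sandwich A C ∘L ptr H K := by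
    refine ContinuousLinearMap.ext_on (Submodule.dense_iff_topologicalClosure_eq_top.2
      (span_dyad_dense (span_ptens_dense H K))) ?_
    rintro _ ⟨_, ⟨x, u, rfl⟩, _, ⟨y, v, rfl⟩, rfl⟩
    have h1 : inner ℂ (B v) (B u) = inner ℂ v u := by
      rw [← ContinuousLinearMap.adjoint_inner_right, ← ContinuousLinearMap.star_eq_adjoint,
        ← mul_apply_eq_comp, hB, one_apply_eq_self]
    rw [ContinuousLinearMap.comp_apply, ContinuousLinearMap.comp_apply, sandwich_dyad, star_opTensor,
      opTensor_ptens, opTensor_ptens, star_star, ptr_dyad_ptens, ptr_dyad_ptens, map_smul,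
      sandwich_dyad, h1]
  exact congrArg (fun f => f Y) h

end Composite

/-! ### Powers of Volterra operators as iterated integrals. -/

section Volterra

variable {E F : Type*} [NormedAddCommGroup E] [NormedSpace ℂ E] [NormedAddCommGroup F]
  [NormedSpace ℂ F]

/-- A bounded, strongly continuous family of operators. -/
structure IsOperatorField (A : ℝ → F →L[ℂ] E) (C : ℝ) : Prop where
  bound : ∀ s, ‖A s‖ ≤ C
  continuous : ∀ x, Continuous fun s => A s x

lemma IsOperatorField.continuous_apply {A : ℝ → F →L[ℂ] E} {C : ℝ} (hA : IsOperatorField A C)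
    {f : ℝ → F} (hf : Continuous f) : Continuous fun s => A s (f s) :=
  continuous_clm_apply_of_bound hA.bound hA.continuous hf

lemma IsOperatorField.nonneg {A : ℝ → F →L[ℂ] E} {C : ℝ} (hA : IsOperatorField A C) : 0 ≤ C :=
  (norm_nonneg _).trans (hA.bound 0)

/-- The Volterra operator `f ↦ ∫₀ᵗ A_s f_s ds`. -/
def volterra {A : ℝ → F →L[ℂ] F} {C : ℝ} (hA : IsOperatorField A C) : Module.End ℂ C(ℝ, F) where
  toFun f := ⟨fun t => ∫ s in (0 : ℝ)..t, A s (f s), intervalIntegral.continuous_primitive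
    (fun _ _ => (hA.continuous_apply f.continuous).intervalIntegrable _ _) 0⟩
  map_add' f g := by
    ext t
    change ∫ s in (0 : ℝ)..t, A s (f s + g s) = (∫ s in (0 : ℝ)..t, A s (f s)) + ∫ s in (0 : ℝ)..t, A s (g s)
    simp only [map_add]
    exact intervalIntegral.integral_add ((hA.continuous_apply f.continuous).intervalIntegrable _ _)
      ((hA.continuous_apply g.continuous).intervalIntegrable _ _)
  map_smul' c f := by
    ext t
    change ∫ s in (0 : ℝ)..t, A s (c • f s) = c • ∫ s in (0 : ℝ)..t, A s (f s)
    simp only [map_smul]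
    exact intervalIntegral.integral_smul _ _

lemma volterra_apply {A : ℝ → F →L[ℂ] F} {C : ℝ} (hA : IsOperatorField A C) (f : C(ℝ, F)) (t : ℝ) :
    volterra hA f t = ∫ s in (0 : ℝ)..t, A s (f s) := rfl

lemma norm_volterra_pow_le {A : ℝ → F →L[ℂ] F} {C : ℝ} (hA : IsOperatorField A C) {f : C(ℝ, F)}
    {m : ℝ} (hf : ∀ s, ‖f s‖ ≤ m) (n : ℕ) {t : ℝ} (ht : 0 ≤ t) :
    ‖(volterra hA ^ n) f t‖ ≤ (C * t) ^ n / n.factorial * m := by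
  induction n generalizing t with
  | zero => simpa using hf t
  | succ n ih =>
    rw [pow_succ', Module.End.mul_apply, volterra_apply]
    refine (intervalIntegral.norm_integral_le_of_norm_le ht
      (g := fun s => C * ((C * s) ^ n / n.factorial * m)) (ae_of_all _ fun s hs => ?_)
      (Continuous.intervalIntegrable (by fun_prop) _ _)).trans (le_of_eq ?_)
    · exact (A s).le_of_opNorm_le_of_le (hA.bound s) (ih hs.1.le)
    · have h1 : ∀ s : ℝ, C * ((C * s) ^ n / n.factorial * m) =
          (C ^ (n + 1) / n.factorial * m) * s ^ n := fun s => by rw [mul_pow]; ring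
      simp only [h1]
      rw [intervalIntegral.integral_const_mul, integral_pow, Nat.factorial_succ]
      have : (n.factorial : ℝ) ≠ 0 := by positivity
      push_cast
      field_simp
      rw [mul_pow]
      rw [mul_comm (C ^ (n + 1)), mul_assoc]
      simp

/-- The integral of `w` over `t ≥ s_1 ≥ ⋯ ≥ s_n ≥ 0`, as an iterated integral. -/
def iteratedLIntegral : (n : ℕ) → ((Fin n → ℝ) → ℝ≥0∞) → ℝ → ℝ≥0∞
  | 0, w, _ => w Fin.elim0
  | n + 1, w, t => ∫⁻ s in Set.Ioc 0 t, iteratedLIntegral n (fun v => w (Fin.cons s v)) s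

/-- In the induction the outermost operator `A s` is absorbed into `D`, and the first time into `w`.
A norm is taken only of the complete word, so cancellations between its factors, such as those in
irreducible correlations, are preserved. -/
lemma enorm_volterra_pow_le [CompleteSpace E] [CompleteSpace F] {A : ℝ → F →L[ℂ] F} {C : ℝ}
    (hA : IsOperatorField A C) {G : Type*} [NormedAddCommGroup G] [NormedSpace ℂ G] (i : G →L[ℂ] F) (n : ℕ) (D : F →L[ℂ] E)
    {w : (Fin n → ℝ) → ℝ≥0∞}
    (hw : ∀ s ξ, ‖D ((List.ofFn fun j => A (s j)).prod (i ξ))‖ₑ ≤ w s * ‖ξ‖ₑ) {x : ℝ → G} {f : C(ℝ, F)}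
    (hx : ∀ s, f s = i (x s)) {m : ℝ≥0∞} (hm : m ≠ ⊤)
    {t : ℝ} (hxm : ∀ s ∈ Set.Icc 0 t, ‖x s‖ₑ ≤ m) (ht : 0 ≤ t) :
    ‖D ((volterra hA ^ n) f t)‖ₑ ≤ iteratedLIntegral n w t * m := by
  induction n generalizing D t with
  | zero =>
    have h1 := hw Fin.elim0 (x t)
    simp only [List.ofFn_zero, List.prod_nil, one_apply_eq_self] at h1
    rw [pow_zero, Module.End.one_apply, hx]
    refine h1.trans ?_
    rw [iteratedLIntegral]
    gcongr
    exact hxm t ⟨ht, le_rfl⟩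
  | succ n ih =>
    rw [pow_succ', Module.End.mul_apply, volterra_apply, ← D.intervalIntegral_comp_comm
      ((hA.continuous_apply (ContinuousMap.continuous _)).intervalIntegrable _ _),
      intervalIntegral.integral_of_le ht, iteratedLIntegral, ← lintegral_mul_const' _ _ hm]
    refine (enorm_integral_le_lintegral_enorm _).trans
      (setLIntegral_mono' measurableSet_Ioc fun s hs => ?_)
    refine ih (D ∘L A s) (fun v ξ => ?_) (fun u hu => hxm u ⟨hu.1, hu.2.trans hs.2⟩) hs.1.le
    have h1 := hw (Fin.cons s v) ξ
    simpa [List.ofFn_succ] using h1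

end Volterra

/-! ### The Nakajima–Zwanzig expansion. -/

section NakajimaZwanzig

variable {E F : Type*} [NormedAddCommGroup E] [NormedSpace ℂ E] [CompleteSpace E]
  [NormedAddCommGroup F] [NormedSpace ℂ F] [CompleteSpace F]

lemma comp_isOperatorField {A : ℝ → F →L[ℂ] F} {C : ℝ} (hA : IsOperatorField A C)
    (p : F →L[ℂ] E) : IsOperatorField (fun s => p ∘L A s) (‖p‖ * C) where
  bound s := (p.opNorm_comp_le _).trans (by gcongr; exact hA.bound s)
  continuous x := p.continuous.comp (hA.continuous x)

/-- The `n`-th order term of the Nakajima-Zwanzig expansion. -/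
def nzTerm {h : ℝ → F →L[ℂ] F} {C : ℝ} (hh : IsOperatorField h C) (p : F →L[ℂ] E) (i : E →L[ℂ] F)
    (f : C(ℝ, F)) (n : ℕ) (t : ℝ) : E :=
  ∫ s in (0 : ℝ)..t, p (h s ((volterra (comp_isOperatorField hh
    (ContinuousLinearMap.id ℂ F - i ∘L p)) ^ n) f s))

lemma nzTerm_enorm_le {h : ℝ → F →L[ℂ] F} {C : ℝ} (hh : IsOperatorField h C) (p : F →L[ℂ] E)
    (i : E →L[ℂ] F) {x : ℝ → E} {f : C(ℝ, F)} (hx : ∀ s, f s = i (x s)) (n : ℕ)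
    {w : (Fin (n + 1) → ℝ) → ℝ≥0∞}
    (hw : ∀ s v ξ, ‖p (h s ((List.ofFn fun j =>
      (ContinuousLinearMap.id ℂ F - i ∘L p) ∘L h (v j)).prod (i ξ)))‖ₑ ≤ w (Fin.cons s v) * ‖ξ‖ₑ)
    {m : ℝ≥0∞} (hm : m ≠ ⊤) {t : ℝ} (hxm : ∀ s ∈ Set.Icc 0 t, ‖x s‖ₑ ≤ m) (ht : 0 ≤ t) :
    ‖nzTerm hh p i f n t‖ₑ ≤ iteratedLIntegral (n + 1) w t * m := by
  rw [nzTerm, intervalIntegral.integral_of_le ht, iteratedLIntegral, ← lintegral_mul_const' _ _ hm]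
  refine (enorm_integral_le_lintegral_enorm _).trans
    (setLIntegral_mono' measurableSet_Ioc fun s hs => ?_)
  exact enorm_volterra_pow_le _ i n (p ∘L h s) (fun v ξ => hw s v ξ) hx hm
    (fun u hu => hxm u ⟨hu.1, hu.2.trans hs.2⟩) hs.1.le

/-- The Nakajima-Zwanzig expansion of a reduced evolution, truncated after the second order. -/
lemma enorm_sub_nzTerm_one_le {h : ℝ → F →L[ℂ] F} {C : ℝ} (hh : IsOperatorField h C)
    {p : F →L[ℂ] E} {i : E →L[ℂ] F} (hpi : ∀ ξ, p (i ξ) = ξ) (hphi : ∀ s ξ, p (h s (i ξ)) = 0)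
    {X : C(ℝ, F)} {ρ : E} {lam : ℝ}
    (hX : ∀ t, X t = i ρ + (lam : ℂ) • ∫ s in (0 : ℝ)..t, h s (X s))
    {M : ℝ} (hXM : ∀ t, ‖X t‖ ≤ M) {f : C(ℝ, F)} (hf : ∀ t, f t = i (p (X t))) {t : ℝ} (ht : 0 ≤ t) :
    ‖p (X t) - ρ - ((lam ^ 2 : ℝ) : ℂ) • nzTerm hh p i f 1 t‖ₑ ≤
      ∑' n : ℕ, ‖lam‖ₑ ^ (n + 3) * ‖nzTerm hh p i f (n + 2) t‖ₑ := by
  set q : F →L[ℂ] F := ContinuousLinearMap.id ℂ F - i ∘L p with hq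
  set J := volterra (comp_isOperatorField hh q) with hJ
  have hXi : ∀ t, IntervalIntegrable (fun s => h s (X s)) volume 0 t := fun t =>
    (hh.continuous_apply X.continuous).intervalIntegrable _ _
  have hqi : ∀ ξ, q (i ξ) = 0 := fun ξ => by simp [hq, hpi]
  -- `y = q X` is the irrelevant part of the state. As `q` annihilates the initial value `i ρ`, it
  -- satisfies `y = lam J y + lam J f`, which is iterated below.
  set y : C(ℝ, F) := X - f with hy
  have hyq : ∀ t, y t = q (X t) := fun t => by simp [hy, hq, hf]
  have hyJ : y = ((lam : ℂ) • J) y + ((lam : ℂ) • J) f := by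
    rw [← map_add, hy, sub_add_cancel, ← hy]
    ext t
    rw [hyq, hX t, map_add, hqi, zero_add, map_smul, ← q.intervalIntegral_comp_comm (hXi t)]
    rfl
  have hiter : ∀ N : ℕ, y = ∑ n ∈ Finset.range N, (((lam : ℂ) • J) ^ (n + 1)) f +
      (((lam : ℂ) • J) ^ N) y := by
    intro N
    induction N with
    | zero => simp
    | succ N ih =>
      conv_lhs => rw [ih]
      conv_lhs => rw [hyJ]
      rw [← hyJ, Finset.sum_range_succ, add_assoc]
      congr 1
      conv_lhs => rw [hyJ]
      rw [map_add, pow_succ, Module.End.mul_apply, Module.End.mul_apply, add_comm]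
  have hpow : ∀ (n : ℕ) (g : C(ℝ, F)) (s : ℝ), (((lam : ℂ) • J) ^ n) g s =
      (lam : ℂ) ^ n • (J ^ n) g s := by
    intro n g s
    rw [smul_pow]
    rfl
  have hph := comp_isOperatorField hh p
  have hint : ∀ g : C(ℝ, F), IntervalIntegrable (fun s => p (h s (g s))) volume 0 t := fun g =>
    (hph.continuous_apply g.continuous).intervalIntegrable _ _
  -- The relation `p h i = 0` removes the relevant part `f` from the integral. The first-order term
  -- vanishes, and the expansion of `y` starts at second order.
  have hx : p (X t) = ρ + (lam : ℂ) • ∫ s in (0 : ℝ)..t, p (h s (y s)) := by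
    have h1 : ∀ s, p (h s (y s)) = p (h s (X s)) := fun s => by
      rw [hy, ContinuousMap.sub_apply, map_sub, map_sub, hf, hphi, sub_zero]
    simp only [h1]
    conv_lhs => rw [hX t]
    rw [map_add, hpi, map_smul, ← p.intervalIntegral_comp_comm (hXi t)]
  have hym : ∀ s, ‖y s‖ ≤ ‖q‖ * M := fun s => by
    rw [hyq]; exact q.le_opNorm_of_le (hXM s)
  have hN : ∀ N : ℕ, p (X t) - ρ - ((lam ^ 2 : ℝ) : ℂ) • nzTerm hh p i f 1 t =
      ∑ n ∈ Finset.range N, (lam : ℂ) ^ (n + 3) • nzTerm hh p i f (n + 2) t +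
      (lam : ℂ) ^ (N + 2) • ∫ s in (0 : ℝ)..t, p (h s ((J ^ (N + 1)) y s)) := by
    intro N
    have h1 : ∀ s, p (h s (y s)) = ∑ n ∈ Finset.range (N + 1), (lam : ℂ) ^ (n + 1) •
        p (h s ((J ^ (n + 1)) f s)) + (lam : ℂ) ^ (N + 1) • p (h s ((J ^ (N + 1)) y s)) := by
      intro s
      have h2 := congrArg (fun g : C(ℝ, F) => p (h s (g s))) (hiter (N + 1))
      simp only [ContinuousMap.add_apply, ContinuousMap.sum_apply, map_add, map_sum, hpow,
        map_smul] at h2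
      exact h2
    rw [hx]
    simp only [h1]
    rw [intervalIntegral.integral_add, intervalIntegral.integral_finsetSum]
    · simp only [intervalIntegral.integral_smul]
      have h3 : ∀ n, ∫ s in (0 : ℝ)..t, p (h s ((J ^ n) f s)) = nzTerm hh p i f n t := fun n => rfl
      simp only [h3]
      rw [Finset.sum_range_succ', smul_add, smul_add, Finset.smul_sum]
      simp only [smul_smul]
      push_cast
      have h4 : ∀ n : ℕ, (lam : ℂ) * (lam : ℂ) ^ (n + 1 + 1) = (lam : ℂ) ^ (n + 3) := fun n => by ring
      simp only [h4]
      rw [show (lam : ℂ) * (lam : ℂ) ^ (0 + 1) = (lam : ℂ) ^ 2 by ring,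
        show (lam : ℂ) * (lam : ℂ) ^ (N + 1) = (lam : ℂ) ^ (N + 2) by ring]
      abel
    · intro n _
      exact (hint _).smul _
    · exact (Continuous.intervalIntegrable (continuous_finsetSum _ fun n _ =>
        (hph.continuous_apply (ContinuousMap.continuous _)).const_smul _) _ _)
    · exact (hint _).smul _
  set c := ‖q‖ * C with hc
  set B := |lam| * (‖p‖ * C * (‖q‖ * M)) * t with hB
  -- For fixed `lam` and `t` the crude factorial bound of the Volterra powers makes the remainder
  -- vanish as `N → ∞`; no property of the reservoir enters here.
  have hrem : ∀ N : ℕ, ‖(lam : ℂ) ^ (N + 2) • ∫ s in (0 : ℝ)..t, p (h s ((J ^ (N + 1)) y s))‖ ≤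
      B * ((|lam| * (c * t)) ^ (N + 1) / (N + 1).factorial) := by
    intro N
    have h1 : ‖∫ s in (0 : ℝ)..t, p (h s ((J ^ (N + 1)) y s))‖ ≤
        (‖p‖ * C * ((c * t) ^ (N + 1) / (N + 1).factorial * (‖q‖ * M))) * |t - 0| := by
      refine intervalIntegral.norm_integral_le_of_norm_le_const fun s hs => ?_
      rw [Set.uIoc_of_le ht] at hs
      refine (p ∘L h s).le_of_opNorm_le_of_le (hph.bound s)
        ((norm_volterra_pow_le _ hym (N + 1) hs.1.le).trans ?_)
      have hc0 : 0 ≤ c := mul_nonneg (norm_nonneg _) hh.nonneg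
      have hM0 : 0 ≤ M := (norm_nonneg _).trans (hXM 0)
      have hs1 := hs.1.le
      have hs2 := hs.2
      gcongr
    rw [norm_smul, norm_pow, norm_real, Real.norm_eq_abs]
    refine (mul_le_mul_of_nonneg_left h1 (by positivity)).trans (le_of_eq ?_)
    rw [sub_zero, abs_of_nonneg ht, hB, mul_pow]
    ring
  have htend : Tendsto (fun N : ℕ => (∑' n : ℕ, ‖lam‖ₑ ^ (n + 3) * ‖nzTerm hh p i f (n + 2) t‖ₑ) +
      ENNReal.ofReal (B * ((|lam| * (c * t)) ^ (N + 1) / (N + 1).factorial))) atTop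
      (𝓝 ((∑' n : ℕ, ‖lam‖ₑ ^ (n + 3) * ‖nzTerm hh p i f (n + 2) t‖ₑ) + ENNReal.ofReal (B * 0))) :=
    tendsto_const_nhds.add (ENNReal.tendsto_ofReal (((FloorSemiring.tendsto_pow_div_factorial_atTop
      (|lam| * (c * t))).comp (tendsto_add_atTop_nat 1)).const_mul B))
  rw [mul_zero, ENNReal.ofReal_zero, add_zero] at htend
  refine ge_of_tendsto' htend fun N => ?_
  rw [hN N]
  refine (enorm_add_le _ _).trans (add_le_add ((enorm_sum_le _ _).trans ?_) ?_)
  · refine le_trans (Finset.sum_le_sum fun n _ => ?_) (ENNReal.sum_le_tsum (Finset.range N))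
    rw [enorm_smul, enorm_pow]
    rw [← ofReal_norm (lam : ℂ), norm_real, ofReal_norm]
  · rw [← ofReal_norm]
    exact ENNReal.ofReal_le_ofReal (hrem N)

end NakajimaZwanzig

/-! ### Integrals over ordered times. -/

section TimeSimplex

/-- The simplex `T ≥ s_1 ≥ ⋯ ≥ s_n ≥ 0`. -/
def timeSimplex (n : ℕ) (T : ℝ) : Set (Fin n → ℝ) := {s | Antitone s ∧ ∀ i, s i ∈ Set.Icc 0 T}

lemma measurableSet_timeSimplex (n : ℕ) (T : ℝ) : MeasurableSet (timeSimplex n T) := by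
  have h : timeSimplex n T = (⋂ i, ⋂ j, ⋂ _ : i ≤ j, {s : Fin n → ℝ | s j ≤ s i}) ∩
      ⋂ i, {s : Fin n → ℝ | s i ∈ Set.Icc 0 T} := by
    ext s
    simp [timeSimplex, Antitone]
  rw [h]
  refine MeasurableSet.inter (MeasurableSet.iInter fun i => MeasurableSet.iInter fun j =>
    MeasurableSet.iInter fun _ => measurableSet_le (measurable_pi_apply j) (measurable_pi_apply i))
    (MeasurableSet.iInter fun i => measurable_pi_apply i measurableSet_Icc)

lemma cons_mem_timeSimplex {n : ℕ} {T u : ℝ} {v : Fin n → ℝ} :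
    (Fin.cons u v : Fin (n + 1) → ℝ) ∈ timeSimplex (n + 1) T ↔
      u ∈ Set.Icc 0 T ∧ v ∈ timeSimplex n u := by
  constructor
  · rintro ⟨h1, h2⟩
    refine ⟨h2 0, fun i j hij => ?_, fun i => ⟨?_, ?_⟩⟩
    · simpa using h1 (Fin.succ_le_succ_iff.2 hij)
    · simpa using (h2 i.succ).1
    · simpa using h1 (Fin.zero_le i.succ)
  · rintro ⟨h1, h2, h3⟩
    refine ⟨fun i j hij => ?_, fun i => ?_⟩
    · refine Fin.cases (fun hij => ?_) (fun i hij => ?_) i hij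
      · refine Fin.cases le_rfl (fun j => ?_) j
        simpa using (h3 j).2
      · revert hij
        refine Fin.cases (fun hij => absurd hij (by simp)) (fun j hij => ?_) j
        simpa using h2 (Fin.succ_le_succ_iff.1 hij)
    · refine Fin.cases h1 (fun i => ?_) i
      simpa using ⟨(h3 i).1, (h3 i).2.trans h1.2⟩

lemma measurable_fin_cons {n : ℕ} (u : ℝ) :
    Measurable fun v : Fin n → ℝ => (Fin.cons u v : Fin (n + 1) → ℝ) :=
  measurable_pi_lambda _ fun i => Fin.cases (by simp) (fun i => by
    simpa using measurable_pi_apply i) i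

lemma lintegral_fin_cons {n : ℕ} {g : (Fin (n + 1) → ℝ) → ℝ≥0∞} (hg : Measurable g) :
    ∫⁻ s, g s = ∫⁻ u, ∫⁻ v, g (Fin.cons u v) := by
  have h1 := (volume_preserving_piFinSuccAbove (fun _ : Fin (n + 1) => ℝ) 0).symm
  rw [← h1.lintegral_comp_emb (MeasurableEquiv.measurableEmbedding _)]
  rw [Measure.volume_eq_prod, lintegral_prod (fun p => g _) (hg.comp (MeasurableEquiv.measurable _)).aemeasurable]
  refine lintegral_congr fun u => lintegral_congr fun v => ?_
  congr 1
  exact Fin.insertNth_zero' u v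

lemma lintegral_fin_snoc {n : ℕ} {g : (Fin (n + 1) → ℝ) → ℝ≥0∞} (hg : Measurable g) :
    ∫⁻ s, g s = ∫⁻ u, ∫⁻ v, g (Fin.snoc v u) := by
  have h1 := (volume_preserving_piFinSuccAbove (fun _ : Fin (n + 1) => ℝ) (Fin.last n)).symm
  rw [← h1.lintegral_comp_emb (MeasurableEquiv.measurableEmbedding _)]
  rw [Measure.volume_eq_prod, lintegral_prod (fun p => g _) (hg.comp (MeasurableEquiv.measurable _)).aemeasurable]
  refine lintegral_congr fun u => lintegral_congr fun v => ?_
  congr 1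
  exact Fin.insertNth_last' u v

lemma iteratedLIntegral_eq {n : ℕ} {w : (Fin n → ℝ) → ℝ≥0∞} (hw : Measurable w) (t : ℝ) :
    iteratedLIntegral n w t = ∫⁻ s in timeSimplex n t, w s := by
  induction n generalizing t with
  | zero =>
    have h1 : timeSimplex 0 t = Set.univ := by
      ext s
      simp [timeSimplex, Subsingleton.antitone]
    rw [h1, Measure.restrict_univ, iteratedLIntegral]
    rw [Measure.volume_pi_eq_dirac Fin.elim0, lintegral_dirac]
  | succ n ih =>
    rw [iteratedLIntegral, ← lintegral_indicator (measurableSet_timeSimplex _ _),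
      lintegral_fin_cons (hw.indicator (measurableSet_timeSimplex _ _)),
      setLIntegral_congr Ioc_ae_eq_Icc, ← lintegral_indicator measurableSet_Icc]
    refine lintegral_congr fun u => ?_
    by_cases hu : u ∈ Set.Icc 0 t
    · rw [Set.indicator_of_mem hu, ih (w := fun v => w (Fin.cons u v))
        (hw.comp (measurable_fin_cons u)),
        ← lintegral_indicator (measurableSet_timeSimplex _ _)]
      refine lintegral_congr fun v => ?_
      by_cases hv : v ∈ timeSimplex n u
      · rw [Set.indicator_of_mem hv, Set.indicator_of_mem (cons_mem_timeSimplex.2 ⟨hu, hv⟩)]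
      · rw [Set.indicator_of_notMem hv,
          Set.indicator_of_notMem fun h => hv (cons_mem_timeSimplex.1 h).2]
    · rw [Set.indicator_of_notMem hu]
      symm
      rw [lintegral_eq_zero_iff' (by
        exact ((hw.indicator (measurableSet_timeSimplex _ _)).comp (measurable_fin_cons u)).aemeasurable)]
      exact ae_of_all _ fun v => Set.indicator_of_notMem
        (fun h => hu (cons_mem_timeSimplex.1 h).1) _

/-- Let `u` be the smallest time and subtract it from the others. Translation invariance puts the
last argument of `w` at 0, the translated times still lie in the simplex up to `t`, and integrating
over `u` contributes the factor `t`. -/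
lemma setLIntegral_timeSimplex_succ_le {n : ℕ} {w : (Fin (n + 1) → ℝ) → ℝ≥0∞} (hw : Measurable w)
    (hinv : ∀ s u, w (fun i => s i + u) = w s) (t : ℝ) :
    ∫⁻ s in timeSimplex (n + 1) t, w s ≤
      ENNReal.ofReal t * ∫⁻ v in timeSimplex n t, w (Fin.snoc v 0) := by
  rw [← lintegral_indicator (measurableSet_timeSimplex _ _),
    lintegral_fin_snoc (hw.indicator (measurableSet_timeSimplex _ _))]
  have h1 : ∀ u : ℝ, ∫⁻ v, (timeSimplex (n + 1) t).indicator w (Fin.snoc v u) ≤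
      (Set.Icc 0 t).indicator (fun _ => ∫⁻ v in timeSimplex n t, w (Fin.snoc v 0)) u := by
    intro u
    by_cases hu : u ∈ Set.Icc 0 t
    · rw [Set.indicator_of_mem hu, ← lintegral_indicator (measurableSet_timeSimplex _ _),
        ← lintegral_add_right_eq_self _ (fun _ : Fin n => u)]
      refine lintegral_mono fun v => ?_
      have h2 : (Fin.snoc (v + fun _ => u) u : Fin (n + 1) → ℝ) =
          fun i => (Fin.snoc v 0 : Fin (n + 1) → ℝ) i + u := by
        ext i
        refine Fin.lastCases (by simp) (fun i => by simp) i
      by_cases h : (Fin.snoc (v + fun _ => u) u : Fin (n + 1) → ℝ) ∈ timeSimplex (n + 1) t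
      · have hv : v ∈ timeSimplex n t := by
          refine ⟨fun i j hij => ?_, fun i => ⟨?_, ?_⟩⟩
          · simpa using h.1 (Fin.castSucc_le_castSucc_iff.2 hij)
          · simpa using h.1 (Fin.le_last i.castSucc)
          · have := (h.2 i.castSucc).2
            simp at this
            linarith [hu.1]
        simp only [Set.indicator_of_mem h, Set.indicator_of_mem hv]
        rw [h2, hinv]
      · simp only [Set.indicator_of_notMem h]
        exact zero_le
    · rw [Set.indicator_of_notMem hu]
      have h2 : ∀ v, (timeSimplex (n + 1) t).indicator w (Fin.snoc v u) = 0 := fun v =>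
        Set.indicator_of_notMem (fun h => hu (by simpa using h.2 (Fin.last n))) _
      simp [h2]
  refine (lintegral_mono h1).trans (le_of_eq ?_)
  rw [lintegral_indicator measurableSet_Icc, setLIntegral_const, Real.volume_Icc, sub_zero, mul_comm]

end TimeSimplex

/-! ### Left and right multiplication on `B₁`. -/

section Branch

variable {H : Type*} [NormedAddCommGroup H] [InnerProductSpace ℂ H] [CompleteSpace H]

/-- Left (`true`) or right (`false`) multiplication, as a continuous linear map `B(H) → B(B₁(H))`. -/
def branchL (e : Bool) : Op H →L[ℂ] TraceClass H →L[ℂ] TraceClass H :=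
  LinearMap.mkContinuous
    { toFun := fun A => if e then sandwich A 1 else sandwich 1 A
      map_add' := fun A B => by
        cases e
        · exact sandwich_add_right A B 1
        · exact sandwich_add_left A B 1
      map_smul' := fun c A => by
        cases e
        · exact sandwich_smul_right c 1 A
        · exact sandwich_smul_left c A 1 } 2 fun A => by
    have h1 : ‖(1 : Op H)‖ ≤ 1 := ContinuousLinearMap.norm_id_le
    cases e
    · refine (norm_sandwich_le 1 A).trans ?_
      nlinarith [norm_nonneg A]
    · refine (norm_sandwich_le A 1).trans ?_
      nlinarith [norm_nonneg A]

lemma branchL_true (A : Op H) : branchL true A = sandwich A 1 := rfl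

lemma branchL_false (A : Op H) : branchL false A = sandwich 1 A := rfl

lemma opNorm_branchL_le (e : Bool) : ‖(branchL e : Op H →L[ℂ] TraceClass H →L[ℂ] TraceClass H)‖ ≤ 2 :=
  LinearMap.mkContinuous_norm_le _ zero_le_two _

lemma norm_branchL_le (e : Bool) (A : Op H) : ‖branchL e A‖ ≤ 2 * ‖A‖ := by
  have h1 : ‖(1 : Op H)‖ ≤ 1 := ContinuousLinearMap.norm_id_le
  cases e
  · rw [branchL_false]
    refine (norm_sandwich_le 1 A).trans ?_
    nlinarith [norm_nonneg A]
  · rw [branchL_true]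
    refine (norm_sandwich_le A 1).trans ?_
    nlinarith [norm_nonneg A]

lemma enorm_branchL_apply_le (e : Bool) (A : Op H) (ξ : TraceClass H) :
    ‖branchL e A ξ‖ₑ ≤ 2 * ‖A‖ₑ * ‖ξ‖ₑ := by
  refine ((branchL e A).le_opENorm ξ).trans ?_
  gcongr
  refine ((branchL e).le_opENorm A).trans ?_
  gcongr
  rw [← ofReal_norm]
  refine (ENNReal.ofReal_le_ofReal (opNorm_branchL_le e)).trans ?_
  simp

lemma branchL_dyad (e : Bool) (A : Op H) (x y : H) : branchL e A (dyad x y) =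
    if e then dyad (A x) y else dyad x (star A y) := by
  cases e
  · rw [branchL_false, sandwich_dyad]; rfl
  · rw [branchL_true, sandwich_dyad, star_one]; rfl

lemma trace_branchL (e : Bool) (A : Op H) (ξ : TraceClass H) :
    traceL H (branchL e A ξ) = trace (ξ.op * A) := by
  cases e
  · rw [branchL_false, trace_op_mul]
  · rw [branchL_true, trace_sandwich_comm, trace_op_mul]

lemma liouvillian_eq (A : Op H) : liouvillian A = (-I) • branchL true A + I • branchL false A := by
  rw [liouvillian, commutator, branchL_true, branchL_false, smul_sub, neg_smul, neg_smul, sub_neg_eq_add]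

lemma branchL_sandwich {U : Op H} (hU : U * star U = 1) (e : Bool) (A : Op H)
    (ξ : TraceClass H) : branchL e (star U * A * U) (sandwich (star U) U ξ) =
      sandwich (star U) U (branchL e A ξ) := by
  cases e
  · rw [branchL_false, branchL_false, sandwich_sandwich, sandwich_sandwich, one_mul, mul_one,
      ← mul_assoc, ← mul_assoc, hU, one_mul]
  · rw [branchL_true, branchL_true, sandwich_sandwich, sandwich_sandwich, one_mul, mul_one,
      mul_assoc, hU, mul_one]

lemma branchL_opTensor_tensL {K : Type*} [NormedAddCommGroup K] [InnerProductSpace ℂ K]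
    [CompleteSpace K] (e : Bool) (A : Op H) (B : Op K) (X : TraceClass K) (ξ : TraceClass H) :
    branchL e (opTensor A B) (tensL X ξ) = tensL (branchL e B X) (branchL e A ξ) := by
  cases e
  · rw [branchL_false, branchL_false, branchL_false, ← opTensor_one, sandwich_opTensor_tensL]
  · rw [branchL_true, branchL_true, branchL_true, ← opTensor_one, sandwich_opTensor_tensL]

end Branch

/-! ### Irreducible words of the reservoir. -/

section Words

variable {H K : Type*} [NormedAddCommGroup H] [InnerProductSpace ℂ H] [CompleteSpace H]
  [NormedAddCommGroup K] [InnerProductSpace ℂ K] [CompleteSpace K]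
  {HR : K →ₗ.[ℂ] K} {ι : Type*}

/-- The trace-class version of `irreducibleState`. -/
def irreducibleWord (V : ℝ → Op K) (R : ι → Op K) (ω : TraceClass K) :
    List (Bool × ι × ℝ) → TraceClass K
  | [] => ω
  | [a] => branchL a.1 (freeEvolve V (R a.2.1) a.2.2) ω
  | a :: b :: l => branchL a.1 (freeEvolve V (R a.2.1) a.2.2)
      (irreducibleWord V R ω (b :: l) - traceL K (irreducibleWord V R ω (b :: l)) • ω)

lemma op_branchL_freeEvolve (V : ℝ → Op K) (R : ι → Op K) (a : Bool × ι × ℝ) (X : TraceClass K) :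
    (branchL a.1 (freeEvolve V (R a.2.1) a.2.2) X).op = branchMul V R a X.op := by
  obtain ⟨e, b, s⟩ := a
  cases e
  · rw [branchL_false, sandwich_op, one_mul]; rfl
  · rw [branchL_true, sandwich_op, mul_one]; rfl

lemma irreducibleWord_op (V : ℝ → Op K) (R : ι → Op K) (ω : TraceClass K) (l : List (Bool × ι × ℝ)) :
    (irreducibleWord V R ω l).op = irreducibleState V R ω l := by
  match l with
  | [] => rfl
  | [a] => exact op_branchL_freeEvolve V R a ω
  | a :: b :: l =>
    rw [irreducibleWord, op_branchL_freeEvolve, TraceClass.op_sub, TraceClass.op_smul, traceL_apply,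
      irreducibleWord_op V R ω (b :: l)]
    rfl

lemma irreducibleCorrelation_eq (V : ℝ → Op K) (R : ι → Op K) (ω : TraceClass K)
    (l : List (Bool × ι × ℝ)) :
    irreducibleCorrelation V R ω l = traceL K (irreducibleWord V R ω l) := by
  rw [traceL_apply, irreducibleWord_op, irreducibleCorrelation]

lemma sandwich_state {V : ℝ → Op K} {ω : TraceClass K} (hV : IsUnitaryGroupOf HR V)
    (hωV : ∀ t, Commute ω.op (V t)) (u : ℝ) : sandwich (star (V u)) (V u) ω = ω := by
  refine TraceClass.op_injective ?_
  change TraceClass.op _ = TraceClass.op _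
  rw [sandwich_op, mul_assoc, (hωV u).eq, ← mul_assoc, (Unitary.mem_iff.1 (hV.unitary u)).1, one_mul]

lemma trace_sandwich_group {V : ℝ → Op K} (hV : IsUnitaryGroupOf HR V) (u : ℝ) (X : TraceClass K) :
    traceL K (sandwich (star (V u)) (V u) X) = traceL K X := by
  have h := trace_sandwich_isometry (U := star (V u))
    (by rw [star_star]; exact (Unitary.mem_iff.1 (hV.unitary u)).2) X
  rwa [star_star] at h

/-- Conjugation by the group fixes `ω` and the trace, hence commutes with the projection between
consecutive factors. -/
lemma irreducibleWord_shift {V : ℝ → Op K} {ω : TraceClass K} (hV : IsUnitaryGroupOf HR V)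
    (hωV : ∀ t, Commute ω.op (V t)) (R : ι → Op K) (u : ℝ) (l : List (Bool × ι × ℝ)) :
    irreducibleWord V R ω (l.map fun a => (a.1, a.2.1, a.2.2 + u)) =
      sandwich (star (V u)) (V u) (irreducibleWord V R ω l) := by
  have hU := (Unitary.mem_iff.1 (hV.unitary u)).2
  match l with
  | [] => exact (sandwich_state hV hωV u).symm
  | [a] =>
    simp only [List.map_cons, List.map_nil, irreducibleWord, freeEvolve_add hV]
    conv_lhs => rw [← sandwich_state hV hωV u]
    exact branchL_sandwich hU _ _ _
  | a :: b :: l =>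
    have ih := irreducibleWord_shift hV hωV R u (b :: l)
    simp only [List.map_cons] at ih
    simp only [List.map_cons, irreducibleWord, freeEvolve_add hV, ih, trace_sandwich_group hV]
    conv_lhs => enter [2, 2, 2]; rw [← sandwich_state hV hωV u]
    rw [← map_smul, ← map_sub]
    exact branchL_sandwich hU _ _ _

lemma irreducibleCorrelation_shift {V : ℝ → Op K} {ω : TraceClass K} (hV : IsUnitaryGroupOf HR V)
    (hωV : ∀ t, Commute ω.op (V t)) (R : ι → Op K) (u : ℝ) (l : List (Bool × ι × ℝ)) :
    irreducibleCorrelation V R ω (l.map fun a => (a.1, a.2.1, a.2.2 + u)) =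
      irreducibleCorrelation V R ω l := by
  rw [irreducibleCorrelation_eq, irreducibleCorrelation_eq, irreducibleWord_shift hV hωV,
    trace_sandwich_group hV]

lemma continuous_freeEvolve_branchL {V : ℝ → Op K} (hV : IsUnitaryGroupOf HR V) (A : Op K) (e : Bool)
    {α : Type*} [TopologicalSpace α] {s : α → ℝ} (hs : Continuous s) {X : α → TraceClass K}
    (hX : Continuous X) : Continuous fun a => branchL e (freeEvolve V A (s a)) (X a) := by
  have hb : ∀ a, ‖branchL e (freeEvolve V A (s a))‖ ≤ 2 * ‖A‖ := fun a =>
    (norm_branchL_le _ _).trans (by gcongr; exact norm_freeEvolve_le hV A _)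
  refine continuous_clm_apply_of_bound hb (continuous_of_continuous_dyad hb fun x y => ?_) hX
  cases e
  · have h1 : ∀ s, star (freeEvolve V A s) = freeEvolve V (star A) s := fun s => by
      rw [freeEvolve, freeEvolve, star_mul, star_mul, star_star, mul_assoc]
    have h2 := continuous_dyad.comp
      (continuous_const.prodMk ((continuous_freeEvolve_apply hV (star A) y).comp hs) :
        Continuous fun a => (x, freeEvolve V (star A) (s a) y))
    refine h2.congr fun a => ?_
    rw [branchL_dyad, h1]
    rfl
  · have h2 := continuous_dyad.comp
      (((continuous_freeEvolve_apply hV A x).comp hs).prodMk continuous_const :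
        Continuous fun a => (freeEvolve V A (s a) x, y))
    refine h2.congr fun a => ?_
    rw [branchL_dyad]
    rfl

lemma continuous_irreducibleWord {V : ℝ → Op K} (hV : IsUnitaryGroupOf HR V) (R : ι → Op K)
    (ω : TraceClass K) {n : ℕ} (b : Fin n → Bool × ι) :
    Continuous fun s : Fin n → ℝ =>
      irreducibleWord V R ω (List.ofFn fun i => ((b i).1, (b i).2, s i)) := by
  induction n with
  | zero => simpa using continuous_const
  | succ n ih =>
    have h1 := (ih (fun i => b i.succ)).comp
      (continuous_pi fun i => continuous_apply (i.succ) : Continuous fun (s : Fin (n + 1) → ℝ) i => s i.succ)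
    simp only [List.ofFn_succ]
    cases n with
    | zero =>
      simp only [List.ofFn_zero, irreducibleWord]
      exact continuous_freeEvolve_branchL hV _ _ (continuous_apply 0) continuous_const
    | succ n =>
      simp only [Function.comp_def, List.ofFn_succ] at h1
      simp only [List.ofFn_succ, irreducibleWord]
      exact continuous_freeEvolve_branchL hV _ _ (continuous_apply 0)
        (h1.sub (((traceL K).continuous.comp h1).smul continuous_const))

lemma continuous_irreducibleCorrelation {V : ℝ → Op K} (hV : IsUnitaryGroupOf HR V) (R : ι → Op K)
    (ω : TraceClass K) {n : ℕ} (b : Fin n → Bool × ι) :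
    Continuous fun s : Fin n → ℝ =>
      irreducibleCorrelation V R ω (List.ofFn fun i => ((b i).1, (b i).2, s i)) := by
  simp only [irreducibleCorrelation_eq]
  exact (traceL K).continuous.comp (continuous_irreducibleWord hV R ω b)

/-- The integrand of `memoryIntegral`, as a function of all times. -/
def memoryWeight (V : ℝ → Op K) (S : ι → Op H) (R : ι → Op K) (ω : TraceClass K) (n : ℕ)
    (s : Fin n → ℝ) : ℝ≥0∞ :=
  ∑' a : Fin n → ι, ∑ e : Fin n → Bool, (∏ i, ‖S (a i)‖ₑ) *
    ‖irreducibleCorrelation V R ω (List.ofFn fun i => (e i, a i, s i))‖ₑ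

lemma measurable_memoryWeight [Countable ι] {V : ℝ → Op K} (hV : IsUnitaryGroupOf HR V) (S : ι → Op H)
    (R : ι → Op K) (ω : TraceClass K) (n : ℕ) : Measurable (memoryWeight V S R ω n) :=
  Measurable.ennreal_tsum fun a => Finset.measurable_sum _ fun e _ =>
    (((continuous_irreducibleCorrelation hV R ω fun i => (e i, a i)).enorm).measurable).const_mul _

lemma memoryWeight_shift {V : ℝ → Op K} {ω : TraceClass K} (hV : IsUnitaryGroupOf HR V)
    (hωV : ∀ t, Commute ω.op (V t)) (S : ι → Op H) (R : ι → Op K) {n : ℕ} (s : Fin n → ℝ) (u : ℝ) :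
    memoryWeight V S R ω n (fun i => s i + u) = memoryWeight V S R ω n s := by
  refine tsum_congr fun a => Finset.sum_congr rfl fun e _ => ?_
  rw [← irreducibleCorrelation_shift hV hωV R u (List.ofFn fun i => (e i, a i, s i)), List.map_ofFn]
  rfl

lemma iteratedLIntegral_memoryWeight_le [Countable ι] {V : ℝ → Op K} {ω : TraceClass K}
    (hV : IsUnitaryGroupOf HR V) (hωV : ∀ t, Commute ω.op (V t)) (S : ι → Op H) (R : ι → Op K)
    (n : ℕ) (t : ℝ) : iteratedLIntegral (n + 1) (memoryWeight V S R ω (n + 1)) t ≤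
      ENNReal.ofReal t * memoryIntegral V S R ω n t := by
  rw [iteratedLIntegral_eq (measurable_memoryWeight hV S R ω _)]
  exact setLIntegral_timeSimplex_succ_le (measurable_memoryWeight hV S R ω _)
    (memoryWeight_shift hV hωV S R) t

end Words

/-! ### Bounds for the words of the expansion. -/

section WordBound

variable {H K : Type*} [NormedAddCommGroup H] [InnerProductSpace ℂ H] [CompleteSpace H]
  [NormedAddCommGroup K] [InnerProductSpace ℂ K] [CompleteSpace K]
  {HR : K →ₗ.[ℂ] K} {V : ℝ → Op K} {HS : ℝ → Op H} {t₀ : ℝ}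
  {ι : Type*} {S : ι → Op H} {R : ι → Op K}

variable (H) in
/-- The projection `Y ↦ Y - tr_K(Y) ⊗ ω`. -/
def irrelevantPart (ω : TraceClass K) : TraceClass (HTensor H K) →L[ℂ] TraceClass (HTensor H K) :=
  ContinuousLinearMap.id ℂ _ - tensL ω ∘L ptr H K

/-- On product operators the projection acts on the reservoir factor alone, as `X ↦ X - tr(X) ω`.
This is why the words of the expansion produce exactly the irreducible correlation functions. -/
lemma irrelevantPart_tensL (ω X : TraceClass K) (ξ : TraceClass H) :
    irrelevantPart H ω (tensL X ξ) = tensL (X - traceL K X • ω) ξ := by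
  change tensL X ξ - tensL ω (ptr H K (tensL X ξ)) = _
  rw [ptr_tensL, map_smul, ← tensR_apply, ← tensR_apply, ← tensR_apply, map_sub, map_smul]

/-- The product of system operators that accompanies `irreducibleWord`. -/
def systemWord (HS : ℝ → Op H) (t₀ : ℝ) (S : ι → Op H) :
    List (Bool × ι × ℝ) → TraceClass H →L[ℂ] TraceClass H
  | [] => 1
  | a :: l => branchL a.1 (interactionPicture HS t₀ (S a.2.1) a.2.2) ∘L systemWord HS t₀ S l

lemma enorm_branchL_interactionPicture_le (hu : ∀ t, propagator HS t₀ t ∈ unitary (Op H)) (e : Bool)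
    (A : Op H) (s : ℝ) (ξ : TraceClass H) :
    ‖branchL e (interactionPicture HS t₀ A s) ξ‖ₑ ≤ 2 * ‖A‖ₑ * ‖ξ‖ₑ := by
  refine (enorm_branchL_apply_le _ _ _).trans ?_
  gcongr
  exact enorm_le_iff_norm_le.2 (norm_star_mul_mul_le (hu _))

lemma enorm_systemWord_le (hu : ∀ t, propagator HS t₀ t ∈ unitary (Op H)) {n : ℕ}
    (b : Fin n → Bool × ι) (s : Fin n → ℝ) (ξ : TraceClass H) :
    ‖systemWord HS t₀ S (List.ofFn fun i => ((b i).1, (b i).2, s i)) ξ‖ₑ ≤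
      2 ^ n * (∏ i, ‖S (b i).2‖ₑ) * ‖ξ‖ₑ := by
  induction n with
  | zero => simp [systemWord]
  | succ n ih =>
    rw [List.ofFn_succ, systemWord, ContinuousLinearMap.comp_apply]
    refine (enorm_branchL_interactionPicture_le hu _ _ _ _).trans ?_
    rw [Fin.prod_univ_succ]
    refine (mul_le_mul_right (ih (fun i => b i.succ) (fun i => s i.succ)) _).trans (le_of_eq ?_)
    ring

lemma enorm_liouvillian_tensL_le (hSR : Summable fun α => ‖S α‖ * ‖R α‖) {E : Type*}
    [NormedAddCommGroup E] [NormedSpace ℂ E] (D : TraceClass (HTensor H K) →L[ℂ] E) (s : ℝ)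
    (X : TraceClass K) (ξ : TraceClass H) :
    ‖D (liouvillian (interactionField HS V t₀ S R s) (tensL X ξ))‖ₑ ≤
      ∑' b : Bool × ι, ‖D (tensL (branchL b.1 (freeEvolve V (R b.2) s) X)
        (branchL b.1 (interactionPicture HS t₀ (S b.2) s) ξ))‖ₑ := by
  have h1 : ∀ e, HasSum (fun α => D (tensL (branchL e (freeEvolve V (R α) s) X)
        (branchL e (interactionPicture HS t₀ (S α) s) ξ)))
      (D (branchL e (interactionField HS V t₀ S R s) (tensL X ξ))) := by
    intro e
    have h2 := ((hasSum_interactionField (HS := HS) (V := V) (t₀ := t₀) hSR s).mapL (branchL e))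
    have h3 := (h2.mapL (ContinuousLinearMap.apply ℂ _ (tensL X ξ))).mapL D
    simpa only [ContinuousLinearMap.apply_apply, branchL_opTensor_tensL] using h3
  have h4 : ∀ e, ‖D (branchL e (interactionField HS V t₀ S R s) (tensL X ξ))‖ₑ ≤
      ∑' α, ‖D (tensL (branchL e (freeEvolve V (R α) s) X)
        (branchL e (interactionPicture HS t₀ (S α) s) ξ))‖ₑ := fun e => by
    rw [← (h1 e).tsum_eq]; exact enorm_tsum_le_tsum_enorm
  rw [ENNReal.tsum_prod (f := fun e α => ‖D (tensL (branchL e (freeEvolve V (R α) s) X)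
        (branchL e (interactionPicture HS t₀ (S α) s) ξ))‖ₑ), tsum_fintype, Fintype.sum_bool,
    liouvillian_eq, add_apply, smul_apply, smul_apply, map_add, map_smul, map_smul]
  have hI : ‖I‖ₑ = 1 := by rw [← ofReal_norm, norm_I, ENNReal.ofReal_one]
  refine (enorm_add_le _ _).trans (add_le_add ?_ ?_)
  · rw [enorm_smul, enorm_neg, hI, one_mul]
    exact h4 true
  · rw [enorm_smul, hI, one_mul]
    exact h4 false

lemma tsum_fin_cons {β : Type*} {n : ℕ} (f : (Fin (n + 1) → β) → ℝ≥0∞) :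
    ∑' b, f b = ∑' (b' : Fin n → β) (b₀ : β), f (Fin.cons b₀ b') := by
  rw [ENNReal.tsum_comm, ← ENNReal.tsum_prod (f := fun b₀ b' => f (Fin.cons b₀ b')),
    ← (Fin.consEquiv fun _ => β).tsum_eq]
  rfl

/-- Expansion of the Nakajima-Zwanzig words into irreducible words of the reservoir. -/
lemma enorm_word_le (hSR : Summable fun α => ‖S α‖ * ‖R α‖) {E : Type*} [NormedAddCommGroup E]
    [NormedSpace ℂ E] (ω : TraceClass K) {n : ℕ} (D : TraceClass (HTensor H K) →L[ℂ] E)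
    (s : Fin (n + 1) → ℝ) (ξ : TraceClass H) :
    ‖D (liouvillian (interactionField HS V t₀ S R (s 0)) ((List.ofFn fun j : Fin n =>
      irrelevantPart H ω ∘L liouvillian (interactionField HS V t₀ S R (s j.succ))).prod
        (tensL ω ξ)))‖ₑ ≤
      ∑' b : Fin (n + 1) → Bool × ι,
        ‖D (tensL (irreducibleWord V R ω (List.ofFn fun i => ((b i).1, (b i).2, s i)))
          (systemWord HS t₀ S (List.ofFn fun i => ((b i).1, (b i).2, s i)) ξ))‖ₑ := by
  induction n generalizing D with
  | zero =>
    rw [tsum_fin_cons, tsum_fintype]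
    simpa [irreducibleWord, systemWord] using
      enorm_liouvillian_tensL_le (V := V) (HS := HS) (t₀ := t₀) hSR D (s 0) ω ξ
  | succ n ih =>
    -- The first factor and the projection are moved into `D`. The induction hypothesis turns the
    -- remaining word into products, on which the first factor can then be expanded.
    have h1 := ih (D ∘L liouvillian (interactionField HS V t₀ S R (s 0)) ∘L irrelevantPart H ω)
      (fun i => s i.succ)
    rw [List.ofFn_succ, List.prod_cons]
    refine h1.trans ?_
    rw [tsum_fin_cons (n := n + 1)]
    refine ENNReal.tsum_le_tsum fun b' => ?_
    rw [ContinuousLinearMap.comp_apply, ContinuousLinearMap.comp_apply, irrelevantPart_tensL]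
    refine (enorm_liouvillian_tensL_le hSR D (s 0) _ _).trans (le_of_eq ?_)
    refine tsum_congr fun b₀ => ?_
    simp [List.ofFn_succ, irreducibleWord, systemWord]

lemma tsum_fin_prod {n : ℕ} (f : (Fin n → Bool) → (Fin n → ι) → ℝ≥0∞) :
    ∑' b : Fin n → Bool × ι, f (fun i => (b i).1) (fun i => (b i).2) =
      ∑' a : Fin n → ι, ∑ e : Fin n → Bool, f e a := by
  rw [← (Equiv.arrowProdEquivProdArrow (Fin n) (fun _ => Bool) (fun _ => ι)).symm.tsum_eq]
  simp only [Equiv.arrowProdEquivProdArrow]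
  refine (ENNReal.tsum_prod (f := f)).trans ?_
  rw [ENNReal.tsum_comm]
  refine tsum_congr fun a => tsum_fintype _

/-- The partial trace replaces each reservoir word by its scalar irreducible correlation. The
accompanying system operators contribute their norms and a factor 2 each. -/
lemma enorm_ptr_word_le (hu : ∀ t, propagator HS t₀ t ∈ unitary (Op H))
    (hSR : Summable fun α => ‖S α‖ * ‖R α‖) (ω : TraceClass K) {n : ℕ}
    (s : Fin (n + 1) → ℝ) (ξ : TraceClass H) :
    ‖ptr H K (liouvillian (interactionField HS V t₀ S R (s 0)) ((List.ofFn fun j : Fin n =>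
      irrelevantPart H ω ∘L liouvillian (interactionField HS V t₀ S R (s j.succ))).prod
        (tensL ω ξ)))‖ₑ ≤ 2 ^ (n + 1) * memoryWeight V S R ω (n + 1) s * ‖ξ‖ₑ := by
  refine (enorm_word_le hSR ω (ptr H K) s ξ).trans ?_
  rw [memoryWeight, ← tsum_fin_prod (n := n + 1) (fun e a => (∏ i, ‖S (a i)‖ₑ) *
    ‖irreducibleCorrelation V R ω (List.ofFn fun i => (e i, a i, s i))‖ₑ), ← ENNReal.tsum_mul_left,
    ← ENNReal.tsum_mul_right]
  refine ENNReal.tsum_le_tsum fun b => ?_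
  rw [ptr_tensL, ← irreducibleCorrelation_eq, enorm_smul]
  refine (mul_le_mul_right (enorm_systemWord_le hu b s ξ) _).trans (le_of_eq ?_)
  ring

end WordBound

/-! ### The higher orders vanish in the weak-coupling limit. -/

section Remainder

variable {H K : Type*} [NormedAddCommGroup H] [InnerProductSpace ℂ H] [CompleteSpace H]
  [NormedAddCommGroup K] [InnerProductSpace ℂ K] [CompleteSpace K]
  {HR : K →ₗ.[ℂ] K} {V : ℝ → Op K} {ι : Type*} {S : ι → Op H} {R : ι → Op K} {ω : TraceClass K}

/-- The filter of pairs `(lam, t)` with `lam → 0`, `lam ≠ 0`, uniformly in `0 < t ≤ τ / lam²`. -/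
def weakCoupling (τ : ℝ) : Filter (ℝ × ℝ) :=
  comap Prod.fst (𝓝[≠] 0) ⊓ 𝓟 {p | 0 < p.2 ∧ p.1 ^ 2 * p.2 ≤ τ}

lemma eventually_weakCoupling {τ : ℝ} {P : ℝ → ℝ → Prop} :
    (∀ᶠ p in weakCoupling τ, P p.1 p.2) ↔ ∃ lam₀ > 0, ∀ lam, lam ≠ 0 → |lam| < lam₀ → ∀ t, 0 < t →
      lam ^ 2 * t ≤ τ → P lam t := by
  rw [weakCoupling, eventually_inf_principal, eventually_comap, eventually_nhdsWithin_iff,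
    Metric.eventually_nhds_iff]
  simp only [Real.dist_eq, sub_zero, Set.mem_compl_iff, Set.mem_singleton_iff, Prod.forall,
    Set.mem_ofPred_eq]
  constructor
  · rintro ⟨l, hl, h⟩
    exact ⟨l, hl, fun lam h0 h1 t ht ht' => h h1 h0 lam t rfl ⟨ht, ht'⟩⟩
  · rintro ⟨l, hl, h⟩
    refine ⟨l, hl, ?_⟩
    rintro y hy h0 _ t rfl ⟨ht, ht'⟩
    exact h _ h0 hy t ht ht'

lemma sqrt_pow_eq_rpow (n : ℕ) {t : ℝ} (ht : 0 ≤ t) :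
    t ^ ((((n + 2 : ℕ) : ℝ) - 1) / 2) = √t ^ (n + 1) := by
  rw [Real.sqrt_eq_rpow, ← Real.rpow_natCast, ← Real.rpow_mul ht]
  congr 1
  push_cast
  ring

lemma abs_pow_mul_sqrt_pow_le {lam t τ : ℝ} (ht : 0 < t) (h : lam ^ 2 * t ≤ τ) (n : ℕ) :
    |lam| ^ n * √t ^ n ≤ √τ ^ n := by
  rw [← mul_pow]
  refine pow_le_pow_left₀ (by positivity) ?_ n
  rw [← Real.sqrt_sq_eq_abs, ← Real.sqrt_mul (sq_nonneg _)]
  exact Real.sqrt_le_sqrt h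

/-- For large `t` the factorization condition supplies a small multiple of `√t ^ (n+1)`, and `|lam|
√t ≤ √τ`. For `t` below a fixed threshold the a priori bound is constant, and the power of `lam`
tends to zero. -/
lemma tendsto_memoryIntegral (hres : IsWeakCouplingReservoir V S R ω) (τ : ℝ) (n : ℕ) :
    Tendsto (fun p : ℝ × ℝ => ‖p.1‖ₑ ^ (n + 1) * memoryIntegral V S R ω (n + 2) p.2)
      (weakCoupling τ) (𝓝 0) := by
  obtain ⟨c, -, hc⟩ := hres.bound
  rw [ENNReal.tendsto_nhds_zero]
  intro δ hδ
  have hf := hres.factorize (n + 2) (by omega)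
  obtain ⟨δ', hδ', hδδ⟩ : ∃ δ' : ℝ≥0∞, 0 < δ' ∧ ENNReal.ofReal (√τ ^ (n + 1)) * δ' ≤ δ := by
    obtain ⟨d, hd, hd'⟩ := ENNReal.exists_pos_mul_lt (ENNReal.ofReal_ne_top (r := √τ ^ (n + 1))) hδ.ne'
    exact ⟨d, hd, by rw [mul_comm]; exact hd'.le⟩
  obtain ⟨T₀, hT₀⟩ := eventually_atTop.1 (ENNReal.tendsto_nhds_zero.1 hf δ' hδ')
  have hsmall : ∀ᶠ lam : ℝ in 𝓝 0, ENNReal.ofReal (|lam| ^ (n + 1) * (|c (n + 2)| * √(max T₀ 1) ^ (n + 1))) ≤ δ := by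
    have h1 : Tendsto (fun lam : ℝ => ENNReal.ofReal (|lam| ^ (n + 1) * (|c (n + 2)| * √(max T₀ 1) ^ (n + 1))))
        (𝓝 0) (𝓝 (ENNReal.ofReal (|(0 : ℝ)| ^ (n + 1) * (|c (n + 2)| * √(max T₀ 1) ^ (n + 1))))) :=
      ENNReal.tendsto_ofReal (Continuous.tendsto (by fun_prop) 0)
    simp only [abs_zero, ne_eq, Nat.add_eq_zero_iff, one_ne_zero, and_false, not_false_eq_true,
      zero_pow, zero_mul, ENNReal.ofReal_zero] at h1
    exact ENNReal.tendsto_nhds_zero.1 h1 δ hδ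
  obtain ⟨l, hl, hls⟩ := Metric.eventually_nhds_iff.1 hsmall
  refine (eventually_weakCoupling (P := fun lam t => ‖lam‖ₑ ^ (n + 1) *
    memoryIntegral V S R ω (n + 2) t ≤ δ)).2 ⟨l, hl, fun lam _ hlam t ht htτ => ?_⟩
  have he : ‖lam‖ₑ ^ (n + 1) = ENNReal.ofReal (|lam| ^ (n + 1)) := by
    rw [← ofReal_norm, Real.norm_eq_abs, ENNReal.ofReal_pow (abs_nonneg _)]
  rcases le_or_gt (max T₀ 1) t with h | h
  · have h1 := hT₀ t ((le_max_left _ _).trans h)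
    have hp : 0 < √t ^ (n + 1) := by positivity
    rw [sqrt_pow_eq_rpow n ht.le, ENNReal.div_le_iff (ENNReal.ofReal_pos.2 hp).ne' ENNReal.ofReal_ne_top] at h1
    calc _ ≤ ENNReal.ofReal (|lam| ^ (n + 1)) * (δ' * ENNReal.ofReal (√t ^ (n + 1))) := by
          rw [he]; gcongr
      _ = ENNReal.ofReal (|lam| ^ (n + 1) * √t ^ (n + 1)) * δ' := by
          rw [ENNReal.ofReal_mul (by positivity)]; ring
      _ ≤ ENNReal.ofReal (√τ ^ (n + 1)) * δ' := by
          gcongr; exact abs_pow_mul_sqrt_pow_le ht htτ _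
      _ ≤ δ := hδδ
  · refine le_trans ?_ (hls (y := lam) (by simpa [Real.dist_eq] using hlam))
    rw [he, ENNReal.ofReal_mul (by positivity)]
    gcongr
    refine (hc (n + 2) (by omega) t ht).trans (ENNReal.ofReal_le_ofReal ?_)
    rw [sqrt_pow_eq_rpow n ht.le]
    gcongr
    exact le_abs_self _

/-- The higher order terms of the Nakajima-Zwanzig expansion vanish in the weak-coupling limit. -/
lemma tendsto_tsum_memoryIntegral (hres : IsWeakCouplingReservoir V S R ω) (τ : ℝ) :
    Tendsto (fun p : ℝ × ℝ => ∑' n : ℕ, 2 ^ (n + 3) *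
      (‖p.1‖ₑ ^ (n + 1) * memoryIntegral V S R ω (n + 2) p.2)) (weakCoupling τ) (𝓝 0) := by
  obtain ⟨c, hcs, hc⟩ := hres.bound
  set u : ℕ → ℝ × ℝ → ℝ := fun n p => (2 ^ (n + 3) *
      (‖p.1‖ₑ ^ (n + 1) * memoryIntegral V S R ω (n + 2) p.2)).toReal with hu
  have hmem : ∀ᶠ p in weakCoupling τ, 0 < p.2 ∧ p.1 ^ 2 * p.2 ≤ τ :=
    eventually_inf_principal.2 (Eventually.of_forall fun _ h => h)
  have hbd : ∀ p : ℝ × ℝ, 0 < p.2 → p.1 ^ 2 * p.2 ≤ τ → ∀ n, 2 ^ (n + 3) *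
      (‖p.1‖ₑ ^ (n + 1) * memoryIntegral V S R ω (n + 2) p.2) ≤
      ENNReal.ofReal (2 ^ (n + 3) * (|c (n + 2)| * √τ ^ (n + 1))) := by
    rintro ⟨lam, t⟩ ht htτ n
    have he : ‖lam‖ₑ ^ (n + 1) = ENNReal.ofReal (|lam| ^ (n + 1)) := by
      rw [← ofReal_norm, Real.norm_eq_abs, ENNReal.ofReal_pow (abs_nonneg _)]
    rw [ENNReal.ofReal_mul (by positivity), ENNReal.ofReal_pow zero_le_two]
    simp only [ENNReal.ofReal_ofNat]
    gcongr
    calc _ ≤ ENNReal.ofReal (|lam| ^ (n + 1)) * ENNReal.ofReal (|c (n + 2)| * √t ^ (n + 1)) := by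
          rw [he]
          gcongr
          refine (hc (n + 2) (by omega) t ht).trans (ENNReal.ofReal_le_ofReal ?_)
          rw [sqrt_pow_eq_rpow n ht.le]
          gcongr
          exact le_abs_self _
      _ = ENNReal.ofReal (|c (n + 2)| * (|lam| ^ (n + 1) * √t ^ (n + 1))) := by
          rw [← ENNReal.ofReal_mul (by positivity)]; congr 1; ring
      _ ≤ _ := by
          gcongr
          exact abs_pow_mul_sqrt_pow_le ht htτ _
  -- The majorant is compared with the everywhere convergent series at `z = 2 (√τ + 1)`. The summand
  -- 1 allows the exponent `n+1` to be raised to `n+2`.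
  have hsum : Summable fun n : ℕ => (2 : ℝ) ^ (n + 3) * (|c (n + 2)| * √τ ^ (n + 1)) := by
    have h1 := ((summable_nat_add_iff 2).2 (hcs (2 * (√τ + 1))).abs).mul_left 2
    refine Summable.of_nonneg_of_le (fun n => by positivity) (fun n => ?_) h1
    rw [abs_mul, abs_of_nonneg (by positivity : (0 : ℝ) ≤ (2 * (√τ + 1)) ^ (n + 2))]
    have h2 : √τ ^ (n + 1) ≤ (√τ + 1) ^ (n + 2) := by
      calc √τ ^ (n + 1) ≤ (√τ + 1) ^ (n + 1) := by gcongr; linarith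
        _ ≤ (√τ + 1) ^ (n + 2) := pow_le_pow_right₀ (by linarith [Real.sqrt_nonneg τ]) (by omega)
    calc _ ≤ (2 : ℝ) ^ (n + 3) * (|c (n + 2)| * (√τ + 1) ^ (n + 2)) := by gcongr
      _ = _ := by rw [mul_pow]; ring
  have h0 : Tendsto (fun p => ∑' n, u n p) (weakCoupling τ) (𝓝 (∑' _ : ℕ, (0 : ℝ))) := by
    refine tendsto_tsum_of_dominated_convergence hsum (fun n => ?_) ?_
    · have h1 := ENNReal.Tendsto.const_mul (a := 2 ^ (n + 3)) (tendsto_memoryIntegral hres τ n)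
        (Or.inr (by simp))
      rw [mul_zero] at h1
      exact (ENNReal.tendsto_toReal ENNReal.zero_ne_top).comp h1
    · filter_upwards [hmem] with p hp n
      rw [Real.norm_of_nonneg ENNReal.toReal_nonneg]
      exact ENNReal.toReal_le_of_le_ofReal (by positivity) (hbd p hp.1 hp.2 n)
  rw [tsum_zero] at h0
  have h1 := ENNReal.tendsto_ofReal h0
  rw [ENNReal.ofReal_zero] at h1
  refine h1.congr' ?_
  filter_upwards [hmem] with p hp
  rw [ENNReal.ofReal_tsum_of_nonneg (fun n => ENNReal.toReal_nonneg)]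
  · refine tsum_congr fun n => ENNReal.ofReal_toReal (ne_top_of_le_ne_top ENNReal.ofReal_ne_top
      (hbd p hp.1 hp.2 n))
  · refine Summable.of_nonneg_of_le (fun n => ENNReal.toReal_nonneg) (fun n => ?_) hsum
    exact ENNReal.toReal_le_of_le_ofReal (by positivity) (hbd p hp.1 hp.2 n)

end Remainder

/-! ### Averaging on the time scale `λ⁻²`. -/

section WeakCouplingAverage

variable {E : Type*} [NormedAddCommGroup E] [NormedSpace ℂ E] [CompleteSpace E]

lemma eventually_mem_weakCoupling (τ : ℝ) :
    ∀ᶠ p in weakCoupling τ, 0 < p.2 ∧ p.1 ^ 2 * p.2 ≤ τ :=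
  eventually_inf_principal.2 (Eventually.of_forall fun _ h => h)

lemma tendsto_weakCoupling_iff {E : Type*} [NormedAddCommGroup E] {F : ℝ → ℝ → E} {τ : ℝ} :
    Tendsto (fun p : ℝ × ℝ => F p.1 p.2) (weakCoupling τ) (𝓝 0) ↔
      ∀ ε > 0, ∃ lam₀ > 0, ∀ lam, lam ≠ 0 → |lam| < lam₀ → ∀ t, 0 < t → lam ^ 2 * t ≤ τ →
        ‖F lam t‖ ≤ ε := by
  rw [Metric.tendsto_nhds]
  constructor
  · intro h ε hε
    refine eventually_weakCoupling.1 ((h ε hε).mono fun p hp => ?_)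
    rw [dist_zero_right] at hp
    exact hp.le
  · intro h ε hε
    refine (eventually_weakCoupling.2 (h (ε / 2) (by positivity))).mono fun p hp => ?_
    rw [dist_zero_right]
    linarith

lemma hasMean_zero_of_tendsto {f : ℝ → E} (hf : Continuous f) (h : Tendsto f atTop (𝓝 0)) :
    HasMean f 0 := by
  rw [HasMean, Metric.tendsto_atTop]
  intro ε hε
  obtain ⟨s, hs⟩ := Metric.tendsto_atTop.1 h (ε / 2) (by positivity)
  set a := max s 1 with ha
  set B := ‖∫ u in (0 : ℝ)..a, f u‖ with hB
  refine ⟨max a (4 * B / ε + 1), fun t ht => ?_⟩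
  have hat : a ≤ t := (le_max_left _ _).trans ht
  have ha1 : 1 ≤ a := le_max_right _ _
  have ht0 : 0 < t := by linarith
  have h4 : 4 * B / ε < t := by linarith [(le_max_right a (4 * B / ε + 1)).trans ht]
  rw [div_lt_iff₀ hε] at h4
  have h1 : ‖∫ u in a..t, f u‖ ≤ ε / 2 * |t - a| := by
    refine intervalIntegral.norm_integral_le_of_norm_le_const fun u hu => ?_
    rw [Set.uIoc_of_le hat] at hu
    have := hs u (by linarith [hu.1, le_max_left s 1])
    rw [dist_zero_right] at this
    exact this.le
  rw [dist_zero_right, norm_smul, norm_inv, Real.norm_of_nonneg ht0.le, inv_mul_lt_iff₀ ht0,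
    ← intervalIntegral.integral_add_adjacent_intervals (hf.intervalIntegrable 0 a)
      (hf.intervalIntegrable a t)]
  rw [abs_of_nonneg (by linarith)] at h1
  refine (norm_add_le _ _).trans_lt ?_
  nlinarith

/-- For large `t` the expression is `lam² t ≤ τ` times an average that is small; for bounded `t` it
is `lam²` times a bounded integral. -/
lemma tendsto_weakCoupling_integral {f : ℝ → E} {C : ℝ} (hC : ∀ s, ‖f s‖ ≤ C) (h : HasMean f 0)
    (τ : ℝ) : Tendsto (fun p : ℝ × ℝ => (p.1 ^ 2) • ∫ s in (0 : ℝ)..p.2, f s) (weakCoupling τ)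
      (𝓝 0) := by
  refine (tendsto_weakCoupling_iff (F := fun lam t => lam ^ 2 • ∫ s in (0 : ℝ)..t, f s)).2
    fun ε hε => ?_
  have hC0 : 0 ≤ C := (norm_nonneg _).trans (hC 0)
  obtain ⟨a, ha⟩ := Metric.tendsto_atTop.1 h (ε / (|τ| + 1)) (by positivity)
  set b := max a 1
  refine ⟨min 1 (ε / (C * b + 1)), by positivity, fun lam h0 hlam t ht htτ => ?_⟩
  rw [norm_smul, Real.norm_of_nonneg (sq_nonneg lam)]
  have hl1 : |lam| ≤ 1 := hlam.le.trans (min_le_left _ _)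
  have hl2 : |lam| ≤ ε / (C * b + 1) := hlam.le.trans (min_le_right _ _)
  rcases le_or_gt b t with hbt | hbt
  · have h1 := ha t ((le_max_left _ _).trans hbt)
    rw [dist_zero_right, norm_smul, norm_inv, Real.norm_of_nonneg ht.le, inv_mul_lt_iff₀ ht] at h1
    calc _ ≤ lam ^ 2 * (t * (ε / (|τ| + 1))) := by gcongr
      _ = (lam ^ 2 * t) * (ε / (|τ| + 1)) := by ring
      _ ≤ (|τ| + 1) * (ε / (|τ| + 1)) := by
          gcongr
          linarith [le_abs_self τ]
      _ = ε := by field_simp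
  · have h1 : ‖∫ s in (0 : ℝ)..t, f s‖ ≤ C * |t - 0| :=
      intervalIntegral.norm_integral_le_of_norm_le_const fun u _ => hC u
    rw [sub_zero, abs_of_pos ht] at h1
    have hb : 0 < C * b + 1 := by positivity
    calc _ ≤ lam ^ 2 * (C * b) := by
          gcongr
          exact h1.trans (by gcongr)
      _ = |lam| * (|lam| * (C * b)) := by rw [← sq_abs]; ring
      _ ≤ |lam| * (1 * (C * b + 1)) := by gcongr; linarith
      _ ≤ ε := by rw [one_mul]; exact (le_div_iff₀ hb).1 hl2

/-- Integrate by parts: the primitive is uniformly small on `[0,t]` by the case without weight, and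
the monotone weight `(lam² s)ⁿ` has total variation at most `τⁿ`. -/
lemma tendsto_weakCoupling_integral_pow {f : ℝ → E} (hf : Continuous f) {C : ℝ}
    (hC : ∀ s, ‖f s‖ ≤ C) (h : HasMean f 0) (τ : ℝ) (n : ℕ) :
    Tendsto (fun p : ℝ × ℝ => (p.1 ^ 2) • ∫ s in (0 : ℝ)..p.2, (p.1 ^ 2 * s) ^ n • f s)
      (weakCoupling τ) (𝓝 0) := by
  refine (tendsto_weakCoupling_iff (F := fun lam t => lam ^ 2 • ∫ s in (0 : ℝ)..t,
    (lam ^ 2 * s) ^ n • f s)).2 fun ε hε => ?_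
  obtain ⟨l, hl, hl'⟩ := (tendsto_weakCoupling_iff (F := fun lam t => lam ^ 2 • ∫ s in (0 : ℝ)..t,
    f s)).1 (tendsto_weakCoupling_integral hC h τ) (ε / (2 * (|τ| + 1) ^ n)) (by positivity)
  refine ⟨l, hl, fun lam h0 hlam t ht htτ => ?_⟩
  set G : ℝ → E := fun s => lam ^ 2 • ∫ u in (0 : ℝ)..s, f u with hG
  set η := ε / (2 * (|τ| + 1) ^ n) with hη
  have hGd : ∀ s, HasDerivAt G (lam ^ 2 • f s) s := fun s =>
    ((hf.integral_hasStrictDerivAt 0 s).hasDerivAt).const_smul _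
  have hGb : ∀ s ∈ Set.Icc 0 t, ‖G s‖ ≤ η := by
    intro s hs
    rcases hs.1.eq_or_lt with h1 | h1
    · rw [hG]
      simp only [← h1, intervalIntegral.integral_same, smul_zero, norm_zero]
      positivity
    · exact hl' lam h0 hlam s h1 (le_trans (by gcongr; exact hs.2) htτ)
  have hpd : ∀ s, HasDerivAt (fun s => (lam ^ 2 * s) ^ n)
      (n * (lam ^ 2 * s) ^ (n - 1) * lam ^ 2) s := fun s => by
    have := (((hasDerivAt_id s).const_mul (lam ^ 2)).pow n)
    rw [mul_one] at this
    exact this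
  have hcd : Continuous fun s : ℝ => (n * (lam ^ 2 * s) ^ (n - 1) * lam ^ 2 : ℝ) := by fun_prop
  have hGc : Continuous G := continuous_iff_continuousAt.2 fun s => (hGd s).continuousAt
  have hparts := intervalIntegral.integral_smul_deriv_eq_deriv_smul (a := 0) (b := t)
    (fun s _ => hpd s) (fun s _ => hGd s) (hcd.intervalIntegrable _ _)
    ((hf.const_smul (lam ^ 2)).intervalIntegrable _ _)
  have heq : lam ^ 2 • ∫ s in (0 : ℝ)..t, (lam ^ 2 * s) ^ n • f s =
      ∫ s in (0 : ℝ)..t, (lam ^ 2 * s) ^ n • lam ^ 2 • f s := by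
    rw [← intervalIntegral.integral_smul]
    simp only [smul_comm (lam ^ 2)]
  have hG0 : G 0 = 0 := by simp [hG]
  change ‖lam ^ 2 • ∫ s in (0 : ℝ)..t, (lam ^ 2 * s) ^ n • f s‖ ≤ ε
  rw [heq, hparts, hG0, smul_zero, sub_zero]
  have hpt : (lam ^ 2 * t) ^ n ≤ (|τ| + 1) ^ n := by
    gcongr
    linarith [le_abs_self τ]
  have hlt : 0 ≤ lam ^ 2 * t := by positivity
  have h2 : ‖∫ s in (0 : ℝ)..t, (n * (lam ^ 2 * s) ^ (n - 1) * lam ^ 2) • G s‖ ≤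
      (lam ^ 2 * t) ^ n * η := by
    refine (intervalIntegral.norm_integral_le_of_norm_le ht.le
      (g := fun s => (n * (lam ^ 2 * s) ^ (n - 1) * lam ^ 2) * η) (ae_of_all _ fun s hs => ?_)
      ((hcd.mul continuous_const).intervalIntegrable _ _)).trans ?_
    · have h3 : 0 ≤ (n * (lam ^ 2 * s) ^ (n - 1) * lam ^ 2 : ℝ) := by
        have := hs.1.le; positivity
      rw [norm_smul, Real.norm_of_nonneg h3]
      exact mul_le_mul_of_nonneg_left (hGb s ⟨hs.1.le, hs.2⟩) h3
    · rw [intervalIntegral.integral_mul_const, intervalIntegral.integral_eq_sub_of_hasDerivAt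
        (fun s _ => hpd s) (hcd.intervalIntegrable _ _)]
      exact mul_le_mul_of_nonneg_right (sub_le_self _ (by positivity)) (by positivity)
  refine (norm_sub_le _ _).trans ?_
  rw [norm_smul, Real.norm_of_nonneg (by positivity)]
  have h3 := hGb t ⟨ht.le, le_rfl⟩
  have hη0 : 0 ≤ η := by positivity
  calc _ ≤ (lam ^ 2 * t) ^ n * η + (lam ^ 2 * t) ^ n * η := by gcongr
    _ = 2 * (lam ^ 2 * t) ^ n * η := by ring
    _ ≤ 2 * (|τ| + 1) ^ n * η := by gcongr
    _ = ε := by rw [hη]; field_simp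

lemma exp_smul_apply_hasSum (L : E →L[ℂ] E) (c : ℝ) (ρ : E) :
    HasSum (fun n : ℕ => (c ^ n / n.factorial : ℝ) • (L ^ n) ρ)
      (NormedSpace.exp ((c : ℂ) • L) ρ) := by
  have h1 := (NormedSpace.exp_series_hasSum_exp' (𝕂 := ℂ) ((c : ℂ) • L)).mapL
    (ContinuousLinearMap.apply ℂ E ρ)
  refine h1.congr_fun fun n => ?_
  rw [ContinuousLinearMap.apply_apply, smul_pow, smul_apply, smul_apply, smul_smul,
    ← Complex.coe_smul]
  congr 1
  push_cast
  ring

lemma summable_pow_norm (L : E →L[ℂ] E) (c : ℝ) (ρ : E) :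
    Summable fun n : ℕ => c ^ n / n.factorial * (‖L‖ ^ n * ‖ρ‖) := by
  have h1 := (Real.summable_pow_div_factorial (c * ‖L‖)).mul_right ‖ρ‖
  refine h1.congr fun n => ?_
  rw [mul_pow]
  ring

lemma norm_pow_apply_le (L : E →L[ℂ] E) (n : ℕ) (ρ : E) : ‖(L ^ n) ρ‖ ≤ ‖L‖ ^ n * ‖ρ‖ := by
  induction n with
  | zero => simp
  | succ n ih =>
    rw [pow_succ', mul_apply_eq_comp, pow_succ', mul_assoc]
    exact L.le_opNorm_of_le ih

/-- The averaging principle for a family of operators with mean zero. -/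
lemma tendsto_weakCoupling_integral_exp {A : ℝ → E →L[ℂ] E} {a : ℝ} (hA : IsOperatorField A a)
    (hm : ∀ ξ, HasMean (fun s => A s ξ) 0) (L : E →L[ℂ] E) (ρ : E) (τ : ℝ) :
    Tendsto (fun p : ℝ × ℝ => (p.1 ^ 2) • ∫ s in (0 : ℝ)..p.2,
      A s (NormedSpace.exp (((p.1 ^ 2 * s : ℝ) : ℂ) • L) ρ)) (weakCoupling τ) (𝓝 0) := by
  have ha := hA.nonneg
  -- The exponential is expanded in powers of `lam² s`, so that the operators act on the fixed
  -- vectors `Lⁿ ρ`. Each term tends to zero, and the exponential series at `τ` dominates.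
  have hterm : ∀ n : ℕ, Tendsto (fun p : ℝ × ℝ => (p.1 ^ 2) • ∫ s in (0 : ℝ)..p.2,
      ((p.1 ^ 2 * s) ^ n / n.factorial : ℝ) • A s ((L ^ n) ρ)) (weakCoupling τ) (𝓝 0) := by
    intro n
    have h1 := (tendsto_weakCoupling_integral_pow (hA.continuous ((L ^ n) ρ))
      (C := a * ‖(L ^ n) ρ‖) (fun s => (A s).le_of_opNorm_le (hA.bound s) _) (hm _) τ n).const_smul
      ((n.factorial : ℝ)⁻¹)
    rw [smul_zero] at h1
    refine h1.congr fun p => ?_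
    rw [smul_comm, ← intervalIntegral.integral_smul]
    simp only [smul_smul, div_eq_inv_mul]
  have hbd : ∀ p : ℝ × ℝ, 0 < p.2 → p.1 ^ 2 * p.2 ≤ τ → ∀ n : ℕ, ∀ s ∈ Set.Ioc 0 p.2,
      ‖((p.1 ^ 2 * s) ^ n / n.factorial : ℝ) • A s ((L ^ n) ρ)‖ ≤
        a * (τ ^ n / n.factorial * (‖L‖ ^ n * ‖ρ‖)) := by
    intro p hp hpτ n s hs
    have hs0 := hs.1.le
    have h1 : p.1 ^ 2 * s ≤ τ := le_trans (by gcongr; exact hs.2) hpτ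
    have hτ : 0 ≤ τ := le_trans (by positivity) h1
    rw [norm_smul, Real.norm_of_nonneg (by positivity)]
    calc _ ≤ τ ^ n / n.factorial * (a * (‖L‖ ^ n * ‖ρ‖)) := by
          gcongr
          exact (A s).le_of_opNorm_le_of_le (hA.bound s) (norm_pow_apply_le L n ρ)
      _ = _ := by ring
  have hsum := (summable_pow_norm L τ ρ).mul_left a
  have hc : ∀ (p : ℝ × ℝ) (n : ℕ), Continuous fun s : ℝ =>
      ((p.1 ^ 2 * s) ^ n / n.factorial : ℝ) • A s ((L ^ n) ρ) := fun p n =>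
    Continuous.smul (f := fun s : ℝ => ((p.1 ^ 2 * s) ^ n / n.factorial : ℝ)) (by fun_prop)
      (hA.continuous _)
  have hlim : Tendsto (fun p : ℝ × ℝ => ∑' n : ℕ, (p.1 ^ 2) • ∫ s in (0 : ℝ)..p.2,
      ((p.1 ^ 2 * s) ^ n / n.factorial : ℝ) • A s ((L ^ n) ρ)) (weakCoupling τ)
      (𝓝 (∑' _ : ℕ, (0 : E))) := by
    refine tendsto_tsum_of_dominated_convergence (hsum.mul_left τ) hterm ?_
    filter_upwards [eventually_mem_weakCoupling τ] with p hp n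
    rw [norm_smul, Real.norm_of_nonneg (sq_nonneg _)]
    have h1 := intervalIntegral.norm_integral_le_of_norm_le_const (a := 0) (b := p.2)
      (f := fun s => ((p.1 ^ 2 * s) ^ n / n.factorial : ℝ) • A s ((L ^ n) ρ)) (fun s hs => by
        rw [Set.uIoc_of_le hp.1.le] at hs
        exact hbd p hp.1 hp.2 n s hs)
    rw [sub_zero, abs_of_pos hp.1] at h1
    have hτ : 0 ≤ τ := le_trans (by have := hp.1.le; positivity) hp.2
    calc _ ≤ p.1 ^ 2 * (a * (τ ^ n / n.factorial * (‖L‖ ^ n * ‖ρ‖)) * p.2) := by gcongr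
      _ = (p.1 ^ 2 * p.2) * (a * (τ ^ n / n.factorial * (‖L‖ ^ n * ‖ρ‖))) := by ring
      _ ≤ _ := by gcongr; exact hp.2
  rw [tsum_zero] at hlim
  refine hlim.congr' ?_
  filter_upwards [eventually_mem_weakCoupling τ] with p hp
  have h1 : HasSum (fun n : ℕ => ∫ s in (0 : ℝ)..p.2,
      ((p.1 ^ 2 * s) ^ n / n.factorial : ℝ) • A s ((L ^ n) ρ))
      (∫ s in (0 : ℝ)..p.2, A s (NormedSpace.exp (((p.1 ^ 2 * s : ℝ) : ℂ) • L) ρ)) := by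
    refine intervalIntegral.hasSum_integral_of_dominated_convergence
      (fun n _ => a * (τ ^ n / n.factorial * (‖L‖ ^ n * ‖ρ‖)))
      (fun n => (hc p n).aestronglyMeasurable) (fun n => ae_of_all _ fun s hs => ?_)
      (ae_of_all _ fun s _ => hsum) (by simp) (ae_of_all _ fun s _ => ?_)
    · rw [Set.uIoc_of_le hp.1.le] at hs
      exact hbd p hp.1 hp.2 n s hs
    · have h2 := (exp_smul_apply_hasSum L (p.1 ^ 2 * s) ρ).mapL ((A s).restrictScalars ℝ)
      simpa using h2
  exact (h1.const_smul (p.1 ^ 2)).tsum_eq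

end WeakCouplingAverage

/-! ### Markov approximation for equations with an integrable memory kernel. -/

section MemoryKernel

variable {E : Type*} [NormedAddCommGroup E] [NormedSpace ℂ E] [CompleteSpace E]

/-- A memory kernel `𝒦(s, u)`, dominated by an integrable function of `s - u`. -/
structure IsMemoryKernel (𝒦 : ℝ → ℝ → E →L[ℂ] E) (k : ℝ → ℝ) : Prop where
  nonneg : ∀ v, 0 ≤ k v
  eq_zero : ∀ v, v ≤ 0 → k v = 0
  integrable : Integrable k
  bound : ∀ s u, u < s → ‖𝒦 s u‖ ≤ k (s - u)
  continuous : ∀ (x : ℝ → E) (s : ℝ), Continuous x → Continuous fun u => 𝒦 s u (x u)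
  continuous_integral : ∀ x : ℝ → E, Continuous x →
    Continuous fun s => ∫ u in (0 : ℝ)..s, 𝒦 s u (x u)

variable {𝒦 : ℝ → ℝ → E →L[ℂ] E} {k : ℝ → ℝ}

lemma IsMemoryKernel.intervalIntegral_le (hk : IsMemoryKernel 𝒦 k) {s : ℝ} (hs : 0 ≤ s) :
    ∫ v in (0 : ℝ)..s, k v ≤ ∫ v, k v := by
  rw [intervalIntegral.integral_of_le hs]
  exact setIntegral_le_integral hk.integrable (ae_of_all _ hk.nonneg)

lemma IsMemoryKernel.norm_integral_le (hk : IsMemoryKernel 𝒦 k) {x : ℝ → E} {s : ℝ} (hs : 0 ≤ s) {B : ℝ}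
    (hB : ∀ u ∈ Set.Icc 0 s, ‖x u‖ ≤ B) :
    ‖∫ u in (0 : ℝ)..s, 𝒦 s u (x u)‖ ≤ (∫ v, k v) * B := by
  have hB0 : 0 ≤ B := (norm_nonneg _).trans (hB 0 ⟨le_rfl, hs⟩)
  refine (intervalIntegral.norm_integral_le_of_norm_le hs (g := fun u => k (s - u) * B) ?_
    ((hk.integrable.comp_sub_left s).mul_const B).intervalIntegrable).trans ?_
  · have : ∀ᵐ u : ℝ, u ≠ s := by simp [ae_iff]
    filter_upwards [this] with u hu hus
    exact (𝒦 s u).le_of_opNorm_le_of_le (hk.bound s u (lt_of_le_of_ne hus.2 hu))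
      (hB u ⟨hus.1.le, hus.2⟩)
  · rw [intervalIntegral.integral_mul_const, intervalIntegral.integral_comp_sub_left (fun v => k v),
      sub_self, sub_zero]
    exact mul_le_mul_of_nonneg_right (hk.intervalIntegral_le hs) hB0

/-- A Gronwall type estimate for the integro-differential equation with a memory kernel. -/
lemma IsMemoryKernel.norm_le (hk : IsMemoryKernel 𝒦 k) {d F : ℝ → E} (hd : Continuous d) {a f t : ℝ}
    (ha : 0 ≤ a) (ht : 0 ≤ t)
    (h : ∀ s ∈ Set.Icc 0 t, d s = a • (∫ r in (0 : ℝ)..s, ∫ u in (0 : ℝ)..r, 𝒦 r u (d u)) + F s)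
    (hF : ∀ s ∈ Set.Icc 0 t, ‖F s‖ ≤ f) : ‖d t‖ ≤ 2 * f * Real.exp (2 * (a * ∫ v, k v) * t) := by
  set c := a * ∫ v, k v with hc
  have hf0 : 0 ≤ f := (norm_nonneg _).trans (hF 0 ⟨le_rfl, ht⟩)
  have hk0 : 0 ≤ ∫ v, k v := integral_nonneg hk.nonneg
  have hc0 : 0 ≤ c := mul_nonneg ha hk0
  -- Maximize the norm with the weight `exp(-2 c u)`. The rate is twice the constant `c`, so at the
  -- maximum the integral term takes up at most half of the left side and can be absorbed.
  obtain ⟨u₀, hu₀, hmax⟩ := isCompact_Icc.exists_isMaxOn (Set.nonempty_Icc.2 ht)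
    (f := fun u => Real.exp (-(2 * c * u)) * ‖d u‖)
    (Continuous.continuousOn (by fun_prop))
  set N := Real.exp (-(2 * c * u₀)) * ‖d u₀‖ with hN
  have hN0 : 0 ≤ N := by positivity
  have hdN : ∀ u ∈ Set.Icc 0 t, ‖d u‖ ≤ N * Real.exp (2 * c * u) := by
    intro u hu
    have h1 : Real.exp (-(2 * c * u)) * ‖d u‖ ≤ N := hmax hu
    rw [Real.exp_neg, inv_mul_le_iff₀ (Real.exp_pos _)] at h1
    linarith
  have hint : ‖∫ r in (0 : ℝ)..u₀, ∫ u in (0 : ℝ)..r, 𝒦 r u (d u)‖ ≤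
      ∫ r in (0 : ℝ)..u₀, (∫ v, k v) * (N * Real.exp (2 * c * r)) := by
    refine intervalIntegral.norm_integral_le_of_norm_le hu₀.1 (ae_of_all _ fun r hr => ?_)
      (Continuous.intervalIntegrable (by fun_prop) _ _)
    refine hk.norm_integral_le hr.1.le fun u hu => (hdN u ⟨hu.1, hu.2.trans (hr.2.trans hu₀.2)⟩).trans ?_
    have := hu.2
    gcongr
  have hexp : a * ∫ r in (0 : ℝ)..u₀, (∫ v, k v) * (N * Real.exp (2 * c * r)) =
      N * (Real.exp (2 * c * u₀) - 1) / 2 := by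
    rw [← intervalIntegral.integral_const_mul]
    have hd : ∀ r : ℝ, HasDerivAt (fun r => N * Real.exp (2 * c * r) / 2)
        (a * ((∫ v, k v) * (N * Real.exp (2 * c * r)))) r := fun r => by
      refine ((((hasDerivAt_id r).const_mul (2 * c)).exp.const_mul N).div_const 2).congr_deriv ?_
      rw [hc]
      simp only [id]
      ring
    rw [intervalIntegral.integral_eq_sub_of_hasDerivAt (fun r _ => hd r)
      (Continuous.intervalIntegrable (by fun_prop) _ _), mul_zero, Real.exp_zero]
    ring
  have h1 : ‖d u₀‖ ≤ N * (Real.exp (2 * c * u₀) - 1) / 2 + f := by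
    rw [h u₀ hu₀, ← hexp]
    refine (norm_add_le _ _).trans (add_le_add ?_ (hF u₀ hu₀))
    rw [norm_smul, Real.norm_of_nonneg ha]
    exact mul_le_mul_of_nonneg_left hint ha
  have h2 : ‖d u₀‖ = N * Real.exp (2 * c * u₀) := by
    rw [hN, Real.exp_neg]
    have := Real.exp_ne_zero (2 * c * u₀)
    field_simp
  have h3 : 1 ≤ Real.exp (2 * c * u₀) := Real.one_le_exp (by have := hu₀.1; positivity)
  have h4 : N ≤ 2 * f := by nlinarith
  exact (hdN t ⟨ht, le_rfl⟩).trans (by gcongr)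

/-- The Markovian generator obtained by neglecting the memory. -/
structure IsMarkovField (𝒦 : ℝ → ℝ → E →L[ℂ] E) (B : ℝ → E →L[ℂ] E) (C : ℝ) : Prop where
  field : IsOperatorField B C
  apply : ∀ s ξ, B s ξ = ∫ v in Set.Ioi (0 : ℝ), 𝒦 s (s - v) ξ

/-- Two errors: replacing `z (s - v)` by `z s` inside the memory, controlled by the modulus `m`; and
extending the memory from `[0,s]` to the whole half-line, which costs the tail of `k`. -/
lemma IsMemoryKernel.norm_integral_sub_le (hk : IsMemoryKernel 𝒦 k) {B : ℝ → E →L[ℂ] E} {C : ℝ}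
    (hB : IsMarkovField 𝒦 B C) {z : ℝ → E} (hz : Continuous z) {s Z : ℝ} {m : ℝ → ℝ} (hs : 0 ≤ s) (hZ : 0 ≤ Z)
    (hm : Continuous m) (hm0 : ∀ v, 0 ≤ m v) (hm2 : ∀ v, m v ≤ 2)
    (hzm : ∀ v ∈ Set.Icc 0 s, ‖z (s - v) - z s‖ ≤ Z * m v) (hzs : ‖z s‖ ≤ Z) :
    ‖(∫ u in (0 : ℝ)..s, 𝒦 s u (z u)) - B s (z s)‖ ≤
      Z * (∫ v, k v * m v) + Z * ((∫ v, k v) - ∫ v in (0 : ℝ)..s, k v) := by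
  have hkm : Integrable fun v => k v * m v := by
    refine (hk.integrable.mul_const 2).mono' (hk.integrable.aestronglyMeasurable.mul hm.aestronglyMeasurable)
      (ae_of_all _ fun v => ?_)
    rw [Real.norm_of_nonneg (mul_nonneg (hk.nonneg v) (hm0 v))]
    exact mul_le_mul_of_nonneg_left (hm2 v) (hk.nonneg v)
  have hsub : ∫ u in (0 : ℝ)..s, 𝒦 s u (z u) = ∫ v in Set.Ioc 0 s, 𝒦 s (s - v) (z (s - v)) := by
    have := intervalIntegral.integral_comp_sub_left (a := 0) (b := s) (fun u => 𝒦 s u (z u)) s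
    rw [sub_self, sub_zero] at this
    rw [← this, intervalIntegral.integral_of_le hs]
  have hc : Continuous fun v => 𝒦 s (s - v) (z s) :=
    (hk.continuous (fun _ => z s) s continuous_const).comp (continuous_const.sub continuous_id)
  have hc' : Continuous fun v => 𝒦 s (s - v) (z (s - v)) :=
    (hk.continuous z s hz).comp (continuous_const.sub continuous_id)
  have hbz : ∀ v ∈ Set.Ioi (0 : ℝ), ‖𝒦 s (s - v) (z s)‖ ≤ k v * Z := fun v hv =>
    (𝒦 s (s - v)).le_of_opNorm_le_of_le (by
      simpa using hk.bound s (s - v) (by linarith [Set.mem_Ioi.1 hv])) hzs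
  have hI : IntegrableOn (fun v => 𝒦 s (s - v) (z s)) (Set.Ioi 0) :=
    Integrable.mono' (hk.integrable.mul_const Z).integrableOn hc.aestronglyMeasurable
      ((ae_restrict_mem measurableSet_Ioi).mono hbz)
  have hsplit : ∫ v in Set.Ioi (0 : ℝ), 𝒦 s (s - v) (z s) =
      (∫ v in Set.Ioc 0 s, 𝒦 s (s - v) (z s)) + ∫ v in Set.Ioi s, 𝒦 s (s - v) (z s) := by
    rw [← setIntegral_union (by
      rw [Set.disjoint_left]; intro v h1 h2; exact absurd h1.2 (not_le.2 h2)) measurableSet_Ioi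
      (hI.mono_set Set.Ioc_subset_Ioi_self) (hI.mono_set (Set.Ioi_subset_Ioi hs)),
      Set.Ioc_union_Ioi_eq_Ioi hs]
  have hIoc : ∀ {f : ℝ → E}, Continuous f → IntegrableOn f (Set.Ioc 0 s) := fun hf =>
    (hf.integrableOn_Icc).mono_set Set.Ioc_subset_Icc_self
  rw [hB.apply, hsub, hsplit, ← sub_sub, ← integral_sub (hIoc hc') (hIoc hc)]
  refine (norm_sub_le _ _).trans (add_le_add ?_ ?_)
  · have h1 : ∀ᵐ v ∂volume.restrict (Set.Ioc 0 s),
        ‖𝒦 s (s - v) (z (s - v)) - 𝒦 s (s - v) (z s)‖ ≤ Z * (k v * m v) := by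
      filter_upwards [ae_restrict_mem measurableSet_Ioc] with v hv
      rw [← map_sub]
      refine ((𝒦 s (s - v)).le_of_opNorm_le_of_le (by
        simpa using hk.bound s (s - v) (by linarith [hv.1])) (hzm v ⟨hv.1.le, hv.2⟩)).trans
        (le_of_eq (by ring))
    refine (norm_integral_le_of_norm_le (hkm.const_mul Z).integrableOn h1).trans ?_
    rw [integral_const_mul]
    exact mul_le_mul_of_nonneg_left (setIntegral_le_integral hkm
      (ae_of_all _ fun v => mul_nonneg (hk.nonneg v) (hm0 v))) hZ
  · have h1 : ∀ᵐ v ∂volume.restrict (Set.Ioi s), ‖𝒦 s (s - v) (z s)‖ ≤ k v * Z :=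
      (ae_restrict_mem measurableSet_Ioi).mono fun v hv => hbz v (hs.trans_lt hv)
    refine (norm_integral_le_of_norm_le (hk.integrable.mul_const Z).integrableOn h1).trans ?_
    rw [integral_mul_const, mul_comm]
    refine mul_le_mul_of_nonneg_left ?_ hZ
    rw [intervalIntegral.integral_of_le hs, le_sub_iff_add_le, add_comm, ← setIntegral_union (by
      rw [Set.disjoint_left]; intro v h1 h2; exact absurd h1.2 (not_le.2 h2)) measurableSet_Ioi
      hk.integrable.integrableOn hk.integrable.integrableOn]
    exact setIntegral_le_integral hk.integrable (ae_of_all _ hk.nonneg)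

lemma hasDerivAt_exp_smul_apply (L : E →L[ℂ] E) (a : ℝ) (ρ : E) (s : ℝ) :
    HasDerivAt (fun s : ℝ => NormedSpace.exp (((a * s : ℝ) : ℂ) • L) ρ)
      (a • L (NormedSpace.exp (((a * s : ℝ) : ℂ) • L) ρ)) s := by
  have h1 := (hasDerivAt_exp_sub_smul L 0 (a * s)).scomp s
    (((hasDerivAt_id s).const_mul a))
  simp only [sub_zero, mul_one] at h1
  exact (((ContinuousLinearMap.apply ℂ E ρ).restrictScalars ℝ).hasFDerivAt.comp_hasDerivAt s h1)

/-- `k` need not have a first moment. Truncating the Lipschitz modulus at 2 supplies the majorant `2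
k` for dominated convergence. -/
lemma tendsto_integral_mul_min (hk : IsMemoryKernel 𝒦 k) {l : ℝ} (hl : 0 ≤ l) :
    Tendsto (fun a : ℝ => ∫ v, k v * min (|a| * |v| * l) 2) (𝓝 0) (𝓝 0) := by
  have h0 : ∀ v, Tendsto (fun a : ℝ => k v * min (|a| * |v| * l) 2) (𝓝 0) (𝓝 0) := fun v => by
    have h1 : Continuous fun a : ℝ => k v * min (|a| * |v| * l) 2 := by fun_prop
    simpa using h1.tendsto 0
  have h2 := tendsto_integral_filter_of_dominated_convergence (μ := volume) (l := 𝓝 (0 : ℝ))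
    (F := fun a v => k v * min (|a| * |v| * l) 2) (f := fun _ => 0) (fun v => k v * 2)
    (Eventually.of_forall fun a => hk.integrable.aestronglyMeasurable.mul
      (Continuous.aestronglyMeasurable (by fun_prop))) ?_ (hk.integrable.mul_const _)
    (ae_of_all _ h0)
  · simpa using h2
  · refine Eventually.of_forall fun a => ae_of_all _ fun v => ?_
    rw [norm_mul, Real.norm_of_nonneg (hk.nonneg v), Real.norm_of_nonneg
      (le_min (by positivity) zero_le_two)]
    exact mul_le_mul_of_nonneg_left (min_le_right _ _) (hk.nonneg v)

/-- **The Markov approximation in the weak-coupling limit**, for an abstract memory kernel. -/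
theorem IsMemoryKernel.tendsto_weakCoupling (hk : IsMemoryKernel 𝒦 k) {B : ℝ → E →L[ℂ] E} {C : ℝ}
    (hB : IsMarkovField 𝒦 B C) {L : E →L[ℂ] E} (hL : ∀ ξ, HasMean (fun s => B s ξ) (L ξ))
    {ρ : E} {x e : ℝ → ℝ → E} (hx : ∀ lam, Continuous (x lam))
    (hxe : ∀ lam, ∀ t, x lam t = ρ + (lam ^ 2) •
      (∫ s in (0 : ℝ)..t, ∫ u in (0 : ℝ)..s, 𝒦 s u (x lam u)) + e lam t) (he0 : ∀ lam, e lam 0 = 0) {τ : ℝ}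
    (he : Tendsto (fun p : ℝ × ℝ => e p.1 p.2) (weakCoupling τ) (𝓝 0)) :
    Tendsto (fun p : ℝ × ℝ => x p.1 p.2 - NormedSpace.exp (((p.1 ^ 2 * p.2 : ℝ) : ℂ) • L) ρ)
      (weakCoupling τ) (𝓝 0) := by
  obtain ⟨Z, hZ⟩ := (isCompact_Icc (a := (0 : ℝ)) (b := τ)).exists_bound_of_continuousOn
    (f := fun r : ℝ => NormedSpace.exp ((r : ℂ) • L) ρ) (by
      have h1 : Continuous fun r : ℝ => NormedSpace.exp (((1 * r : ℝ) : ℂ) • L) ρ :=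
        continuous_iff_continuousAt.2 fun r => (hasDerivAt_exp_smul_apply L 1 ρ r).continuousAt
      simpa using h1.continuousOn)
  set z : ℝ → ℝ → E := fun lam s => NormedSpace.exp (((lam ^ 2 * s : ℝ) : ℂ) • L) ρ with hz
  have hzd : ∀ lam s, HasDerivAt (z lam) (lam ^ 2 • L (z lam s)) s := fun lam s =>
    hasDerivAt_exp_smul_apply L (lam ^ 2) ρ s
  have hzc : ∀ lam, Continuous (z lam) := fun lam =>
    continuous_iff_continuousAt.2 fun s => (hzd lam s).continuousAt
  have hz0 : ∀ lam, z lam 0 = ρ := fun lam => by simp [hz]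
  have hLz : ∀ lam, Continuous fun s => L (z lam s) := fun lam => L.continuous.comp (hzc lam)
  have hzi : ∀ lam t, z lam t = ρ + lam ^ 2 • ∫ s in (0 : ℝ)..t, L (z lam s) := fun lam t => by
    rw [← intervalIntegral.integral_smul, intervalIntegral.integral_eq_sub_of_hasDerivAt
      (fun s _ => hzd lam s) (((hLz lam).const_smul _).intervalIntegrable _ _), hz0, add_sub_cancel]
  -- The comparison function `z` solves the averaged equation. `F` collects its defect in the memory
  -- equation, together with `e`; it is the inhomogeneity in the equation for `x - z`.
  set F : ℝ → ℝ → E := fun lam s => lam ^ 2 • (∫ r in (0 : ℝ)..s,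
    ((∫ u in (0 : ℝ)..r, 𝒦 r u (z lam u)) - L (z lam r))) + e lam s with hF
  have hKz : ∀ (lam : ℝ) (s : ℝ), IntervalIntegrable (fun r => ∫ u in (0 : ℝ)..r, 𝒦 r u (z lam u))
      volume 0 s := fun lam s => (hk.continuous_integral _ (hzc lam)).intervalIntegrable _ _
  have hKx : ∀ (lam : ℝ) (s : ℝ), IntervalIntegrable (fun r => ∫ u in (0 : ℝ)..r, 𝒦 r u (x lam u))
      volume 0 s := fun lam s => (hk.continuous_integral _ (hx lam)).intervalIntegrable _ _
  have hdF : ∀ lam s, x lam s - z lam s = lam ^ 2 • (∫ r in (0 : ℝ)..s, ∫ u in (0 : ℝ)..r,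
      𝒦 r u (x lam u - z lam u)) + F lam s := by
    intro lam s
    have h1 : ∀ r, ∫ u in (0 : ℝ)..r, 𝒦 r u (x lam u - z lam u) =
        (∫ u in (0 : ℝ)..r, 𝒦 r u (x lam u)) - ∫ u in (0 : ℝ)..r, 𝒦 r u (z lam u) := fun r => by
      simp only [map_sub]
      exact intervalIntegral.integral_sub ((hk.continuous _ r (hx lam)).intervalIntegrable _ _)
        ((hk.continuous _ r (hzc lam)).intervalIntegrable _ _)
    simp only [h1, hF]
    rw [intervalIntegral.integral_sub (hKx lam s) (hKz lam s), intervalIntegral.integral_sub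
      (hKz lam s) ((hLz lam).intervalIntegrable _ _), hxe lam s, hzi lam s, smul_sub, smul_sub]
    abel
  set κ : ℝ → ℝ := fun s => (∫ v, k v) - ∫ v in (0 : ℝ)..s, k v with hκ
  have hκc : Continuous κ := continuous_const.sub
    (intervalIntegral.continuous_primitive (fun _ _ => hk.integrable.intervalIntegrable) 0)
  set G : ℝ → ℝ := fun a => ∫ v, k v * min (|a| * |v| * ‖L‖) 2 with hG
  -- Four sources of error: variation of `z` over the memory time, truncation of the memory at the
  -- initial time, averaging of `B` to `L`, and the higher orders `e`.
  set Φ : ℝ → ℝ → ℝ := fun lam s => (lam ^ 2 * s) * (Z * G (lam ^ 2)) +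
    Z * (lam ^ 2 * ∫ r in (0 : ℝ)..s, κ r) +
    ‖lam ^ 2 • ∫ r in (0 : ℝ)..s, (B r - L) (z lam r)‖ + ‖e lam s‖ with hΦ
  have hFΦ : ∀ lam s, 0 < s → lam ^ 2 * s ≤ τ → ‖F lam s‖ ≤ Φ lam s := by
    intro lam s hs hsτ
    have hZ0 : 0 ≤ Z := (norm_nonneg _).trans (hZ 0 ⟨le_rfl, le_trans (by positivity) hsτ⟩)
    have hzZ : ∀ r ∈ Set.Icc 0 s, ‖z lam r‖ ≤ Z := fun r hr =>
      hZ _ ⟨mul_nonneg (sq_nonneg _) hr.1, le_trans (by gcongr; exact hr.2) hsτ⟩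
    have hlip : ∀ r ∈ Set.Icc 0 s, ∀ v ∈ Set.Icc 0 r, ‖z lam (r - v) - z lam r‖ ≤
        Z * min (|lam ^ 2| * |v| * ‖L‖) 2 := by
      intro r hr v hv
      rw [mul_min_of_nonneg _ _ hZ0]
      have hr1 : r - v ∈ Set.Icc 0 s := ⟨by linarith [hv.2], by linarith [hv.1, hr.2]⟩
      refine le_min ?_ ?_
      · have h1 := Convex.norm_image_sub_le_of_norm_hasDerivWithin_le (s := Set.Icc 0 s) (f := z lam)
          (C := lam ^ 2 * (‖L‖ * Z)) (fun u _ => (hzd lam u).hasDerivWithinAt) (fun u hu => by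
            rw [norm_smul, Real.norm_of_nonneg (sq_nonneg _)]
            gcongr
            exact L.le_opNorm_of_le (hzZ u hu)) (convex_Icc 0 s) hr hr1
        refine h1.trans (le_of_eq ?_)
        rw [show r - v - r = -v by ring, norm_neg, Real.norm_eq_abs, abs_of_nonneg (sq_nonneg lam)]
        ring
      · refine (_root_.norm_sub_le _ _).trans ?_
        linarith [hzZ _ hr1, hzZ _ hr]
    have hBz : Continuous fun r => B r (z lam r) := hB.field.continuous_apply (hzc lam)
    have hsplit : ∫ r in (0 : ℝ)..s, ((∫ u in (0 : ℝ)..r, 𝒦 r u (z lam u)) - L (z lam r)) =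
        (∫ r in (0 : ℝ)..s, ((∫ u in (0 : ℝ)..r, 𝒦 r u (z lam u)) - B r (z lam r))) +
        ∫ r in (0 : ℝ)..s, (B r - L) (z lam r) := by
      simp only [sub_apply]
      rw [intervalIntegral.integral_sub (hKz lam s) ((hLz lam).intervalIntegrable _ _),
        intervalIntegral.integral_sub (hKz lam s) (hBz.intervalIntegrable _ _),
        intervalIntegral.integral_sub (hBz.intervalIntegrable _ _) ((hLz lam).intervalIntegrable _ _),
        sub_add_sub_cancel]
    have h1 : ‖∫ r in (0 : ℝ)..s, ((∫ u in (0 : ℝ)..r, 𝒦 r u (z lam u)) - B r (z lam r))‖ ≤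
        s * (Z * G (lam ^ 2)) + Z * ∫ r in (0 : ℝ)..s, κ r := by
      refine (intervalIntegral.norm_integral_le_of_norm_le hs.le
        (g := fun r => Z * G (lam ^ 2) + Z * κ r) (ae_of_all _ fun r hr => ?_)
        (Continuous.intervalIntegrable (by fun_prop) _ _)).trans (le_of_eq ?_)
      · have hrI : r ∈ Set.Icc 0 s := ⟨hr.1.le, hr.2⟩
        exact hk.norm_integral_sub_le hB (hzc lam) hr.1.le hZ0 (by fun_prop)
          (fun v => le_min (by positivity) zero_le_two) (fun v => min_le_right _ _) (hlip r hrI) (hzZ r hrI)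
      · rw [intervalIntegral.integral_add (by simp) (Continuous.intervalIntegrable (by fun_prop) _ _),
          intervalIntegral.integral_const, intervalIntegral.integral_const_mul, sub_zero, smul_eq_mul]
    simp only [hF, hΦ]
    rw [hsplit, smul_add]
    refine (norm_add_le _ _).trans (add_le_add ((norm_add_le _ _).trans (add_le_add ?_ le_rfl)) le_rfl)
    rw [norm_smul, Real.norm_of_nonneg (sq_nonneg _)]
    refine (mul_le_mul_of_nonneg_left h1 (sq_nonneg _)).trans (le_of_eq (by ring))
  have hΦ0 : Tendsto (fun p : ℝ × ℝ => Φ p.1 p.2) (weakCoupling τ) (𝓝 0) := by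
    have hfst : Tendsto (fun p : ℝ × ℝ => p.1 ^ 2) (weakCoupling τ) (𝓝 0) := by
      have h1 : Tendsto (fun p : ℝ × ℝ => p.1) (weakCoupling τ) (𝓝 0) :=
        (tendsto_comap.mono_left inf_le_left).mono_right nhdsWithin_le_nhds
      simpa using h1.pow 2
    have h1 : Tendsto (fun p : ℝ × ℝ => (p.1 ^ 2 * p.2) * (Z * G (p.1 ^ 2))) (weakCoupling τ) (𝓝 0) := by
      have h2 : Tendsto (fun p : ℝ × ℝ => Z * G (p.1 ^ 2)) (weakCoupling τ) (𝓝 0) := by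
        have h3 := ((tendsto_integral_mul_min hk (norm_nonneg L)).comp hfst).const_mul Z
        rw [mul_zero] at h3
        exact h3
      refine squeeze_zero_norm' (a := fun p => τ * ‖Z * G (p.1 ^ 2)‖) ?_ (by simpa using h2.norm.const_mul τ)
      filter_upwards [eventually_mem_weakCoupling τ] with p hp
      have := hp.1.le
      rw [norm_mul, Real.norm_of_nonneg (by positivity)]
      gcongr
      exact hp.2
    have h2 : Tendsto (fun p : ℝ × ℝ => Z * (p.1 ^ 2 * ∫ r in (0 : ℝ)..p.2, κ r)) (weakCoupling τ) (𝓝 0) := by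
      have hκ0 : Tendsto κ atTop (𝓝 0) := by
        have h3 := intervalIntegral_tendsto_integral_Ioi 0 hk.integrable.integrableOn tendsto_id
        have h4 : ∫ v, k v = ∫ v in Set.Ioi 0, k v :=
          (setIntegral_eq_integral_of_forall_compl_eq_zero fun v hv => hk.eq_zero v (not_lt.1 hv)).symm
        have h5 := h3.const_sub (∫ v, k v)
        rw [← h4, sub_self] at h5
        exact h5
      -- `κ` is regarded as complex-valued because the averaging lemma is about complex spaces.
      have h3 : Tendsto (fun s => (κ s : ℂ)) atTop (𝓝 0) := by
        have h4 := (Complex.continuous_ofReal.tendsto 0).comp hκ0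
        rw [ofReal_zero] at h4
        exact h4
      have hκb : ∀ s, ‖(κ s : ℂ)‖ ≤ 2 * ∫ v, k v := fun s => by
        have h5 : ‖∫ v in (0 : ℝ)..s, k v‖ ≤ ∫ v, k v := by
          refine intervalIntegral.norm_integral_le_integral_norm_uIoc.trans ?_
          simp only [Real.norm_of_nonneg (hk.nonneg _)]
          exact setIntegral_le_integral hk.integrable (ae_of_all _ hk.nonneg)
        rw [norm_real]
        refine (_root_.norm_sub_le _ _).trans ?_
        rw [Real.norm_of_nonneg (integral_nonneg hk.nonneg)]
        linarith
      have h4 := tendsto_weakCoupling_integral (C := 2 * ∫ v, k v) (f := fun s => (κ s : ℂ)) hκb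
        (hasMean_zero_of_tendsto (Complex.continuous_ofReal.comp hκc) h3) τ
      have h5 := ((Complex.continuous_re.tendsto 0).comp h4).const_mul Z
      rw [zero_re, mul_zero] at h5
      refine h5.congr fun p => ?_
      rw [Function.comp_apply, intervalIntegral.integral_ofReal, Complex.smul_re, ofReal_re, smul_eq_mul]
    have h3 : Tendsto (fun p : ℝ × ℝ => ‖p.1 ^ 2 • ∫ r in (0 : ℝ)..p.2, (B r - L) (z p.1 r)‖)
        (weakCoupling τ) (𝓝 0) := by
      have hA : IsOperatorField (fun r => B r - L) (C + ‖L‖) := ⟨fun r =>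
        (_root_.norm_sub_le _ _).trans (by gcongr; exact hB.field.bound r),
        fun ξ => (hB.field.continuous ξ).sub continuous_const⟩
      have h4 := tendsto_weakCoupling_integral_exp hA (fun ξ => by
        have := (hL ξ).sub (hasMean_const (L ξ)) (hB.field.continuous ξ) continuous_const
        rw [sub_self] at this
        exact this) L ρ τ
      have h5 := h4.norm
      rw [norm_zero] at h5
      exact h5
    have h4 := ((h1.add h2).add h3).add he.norm
    simpa only [add_zero, norm_zero] using h4
  refine (tendsto_weakCoupling_iff (F := fun lam t => x lam t - z lam t)).2 fun ε hε => ?_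
  set c := ∫ v, k v with hc
  have hc0 : 0 ≤ c := integral_nonneg hk.nonneg
  obtain ⟨l, hl, hl'⟩ := (tendsto_weakCoupling_iff (F := Φ)).1 hΦ0
    (ε / (2 * Real.exp (2 * c * |τ|))) (by positivity)
  refine ⟨l, hl, fun lam h0 hlam t ht htτ => ?_⟩
  have h1 := hk.norm_le ((hx lam).sub (hzc lam)) (sq_nonneg lam) ht.le (fun s _ => hdF lam s)
    (F := F lam) (f := ε / (2 * Real.exp (2 * c * |τ|))) (fun s hs => by
      -- `weakCoupling` only contains strictly positive times; at time 0 the inhomogeneity vanishes.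
      rcases hs.1.eq_or_lt with h2 | h2
      · have : F lam s = 0 := by simp [hF, ← h2, he0]
        rw [this, norm_zero]
        positivity
      · have h3 : lam ^ 2 * s ≤ τ := le_trans (by gcongr; exact hs.2) htτ
        exact (hFΦ lam s h2 h3).trans ((le_abs_self _).trans (hl' lam h0 hlam s h2 h3)))
  refine h1.trans ?_
  have h2 : Real.exp (2 * (lam ^ 2 * c) * t) ≤ Real.exp (2 * c * |τ|) := by
    refine Real.exp_le_exp.2 ?_
    have : lam ^ 2 * t ≤ |τ| := htτ.trans (le_abs_self _)
    calc _ = 2 * c * (lam ^ 2 * t) := by ring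
      _ ≤ _ := by gcongr
  calc _ ≤ 2 * (ε / (2 * Real.exp (2 * c * |τ|))) * Real.exp (2 * c * |τ|) := by gcongr
    _ = ε := by field_simp

end MemoryKernel

/-! ### The second-order memory kernel of the composite system. -/

section CompositeKernel

variable {H K : Type*} [NormedAddCommGroup H] [InnerProductSpace ℂ H] [CompleteSpace H]
  [NormedAddCommGroup K] [InnerProductSpace ℂ K] [CompleteSpace K]
  {HR : K →ₗ.[ℂ] K} {V : ℝ → Op K} {HS : ℝ → Op H} {t₀ : ℝ}
  {ι : Type*} {S : ι → Op H} {R : ι → Op K} {ω : TraceClass K}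

/-- The memory kernel of the Nakajima-Zwanzig equation, in second order. -/
def memoryKernel (HS : ℝ → Op H) (V : ℝ → Op K) (t₀ : ℝ) (S : ι → Op H) (R : ι → Op K)
    (ω : TraceClass K) (s u : ℝ) : TraceClass H →L[ℂ] TraceClass H :=
  ptr H K ∘L liouvillian (interactionField HS V t₀ S R s) ∘L irrelevantPart H ω ∘L
    liouvillian (interactionField HS V t₀ S R u) ∘L tensL ω

/-- The contribution of a pair of couplings to the memory kernel. -/
def kernelTerm (HS : ℝ → Op H) (V : ℝ → Op K) (t₀ : ℝ) (S : ι → Op H) (R : ι → Op K)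
    (ω : TraceClass K) (p : ι × ι) (s u : ℝ) : TraceClass H →L[ℂ] TraceClass H :=
  star (correlation V R ω p.1 p.2 (s - u)) • (commutator (interactionPicture HS t₀ (S p.1) s) ∘L
      branchL false (interactionPicture HS t₀ (S p.2) u)) -
    correlation V R ω p.1 p.2 (s - u) • (commutator (interactionPicture HS t₀ (S p.1) s) ∘L
      branchL true (interactionPicture HS t₀ (S p.2) u))

lemma norm_interactionPicture_le (hu : ∀ t, propagator HS t₀ t ∈ unitary (Op H)) (A : Op H) (s : ℝ) :
    ‖interactionPicture HS t₀ A s‖ ≤ ‖A‖ := norm_star_mul_mul_le (hu _)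

lemma norm_kernelTerm_le (hu : ∀ t, propagator HS t₀ t ∈ unitary (Op H)) (p : ι × ι) (s u : ℝ) :
    ‖kernelTerm HS V t₀ S R ω p s u‖ ≤
      16 * (‖S p.1‖ * ‖S p.2‖ * ‖correlation V R ω p.1 p.2 (s - u)‖) := by
  have h1 : ∀ e, ‖commutator (interactionPicture HS t₀ (S p.1) s) ∘L
      branchL e (interactionPicture HS t₀ (S p.2) u)‖ ≤ 8 * (‖S p.1‖ * ‖S p.2‖) := fun e => by
    refine (ContinuousLinearMap.opNorm_comp_le _ _).trans ?_
    refine (mul_le_mul ((norm_commutator_le _).trans (mul_le_mul_of_nonneg_left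
      (norm_interactionPicture_le hu _ _) (by norm_num))) ((norm_branchL_le _ _).trans
      (mul_le_mul_of_nonneg_left (norm_interactionPicture_le hu _ _) (by norm_num)))
      (norm_nonneg _) (by positivity)).trans (le_of_eq (by ring))
  refine (norm_sub_le _ _).trans ?_
  rw [norm_smul, norm_smul, norm_star]
  have := norm_nonneg (correlation V R ω p.1 p.2 (s - u))
  nlinarith [h1 true, h1 false, mul_le_mul_of_nonneg_left (h1 true) this,
    mul_le_mul_of_nonneg_left (h1 false) this]

variable (hV : IsUnitaryGroupOf HR V) (hu : ∀ t, propagator HS t₀ t ∈ unitary (Op H))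
  (hUc : Continuous (propagator HS t₀)) (hSR : Summable fun α => ‖S α‖ * ‖R α‖)
  (hS : ∀ α, IsSelfAdjoint (S α)) (hR : ∀ α, IsSelfAdjoint (R α))
  (hω : ω.op.IsPositive) (hωV : ∀ t, Commute ω.op (V t)) (hcen : ∀ α, trace (ω.op * R α) = 0)

include hSR in
lemma hasSum_ptr_liouvillian_tensL (s : ℝ) (X : TraceClass K) (ξ : TraceClass H) :
    HasSum (fun α => trace (X.op * freeEvolve V (R α) s) •
        liouvillian (interactionPicture HS t₀ (S α) s) ξ)
      (ptr H K (liouvillian (interactionField HS V t₀ S R s) (tensL X ξ))) := by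
  have h1 : ∀ e, HasSum (fun α => trace (X.op * freeEvolve V (R α) s) •
      branchL e (interactionPicture HS t₀ (S α) s) ξ)
      (ptr H K (branchL e (interactionField HS V t₀ S R s) (tensL X ξ))) := by
    intro e
    have h2 := ((hasSum_interactionField (HS := HS) (V := V) (t₀ := t₀) hSR s).mapL (branchL e))
    have h3 := (h2.mapL (ContinuousLinearMap.apply ℂ _ (tensL X ξ))).mapL (ptr H K)
    simpa only [ContinuousLinearMap.apply_apply, branchL_opTensor_tensL, ptr_tensL,
      trace_branchL] using h3
  have h2 := ((h1 true).const_smul (-I)).add ((h1 false).const_smul I)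
  rw [liouvillian_eq, add_apply, smul_apply, smul_apply, map_add, map_smul, map_smul]
  refine h2.congr_fun fun α => ?_
  rw [liouvillian_eq, add_apply, smul_apply, smul_apply, smul_add, smul_comm (-I), smul_comm I]

include hV hωV hcen hSR in
-- Each summand carries `tr(ω R_α(s))`, which vanishes by stationarity and centring. This is the
-- relation `p h i = 0` of the expansion.
lemma ptr_liouvillian_state (s : ℝ) (ξ : TraceClass H) :
    ptr H K (liouvillian (interactionField HS V t₀ S R s) (tensL ω ξ)) = 0 := by
  have h1 := hasSum_ptr_liouvillian_tensL (HS := HS) (V := V) (t₀ := t₀) hSR s ω ξ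
  refine h1.unique ?_
  have h2 : ∀ α, trace (ω.op * freeEvolve V (R α) s) = 0 := fun α => by
    rw [freeEvolve, trace_op_mul_conj hV hωV, hcen]
  simpa only [h2, zero_smul] using hasSum_zero

include hV hωV hω hR in
lemma trace_branch_state_mul (α β : ι) (s u : ℝ) :
    trace ((branchL true (freeEvolve V (R β) u) ω).op * freeEvolve V (R α) s) =
      correlation V R ω α β (s - u) ∧
    trace ((branchL false (freeEvolve V (R β) u) ω).op * freeEvolve V (R α) s) =
      star (correlation V R ω α β (s - u)) := by
  constructor
  · have h1 : ω.op * freeEvolve V (R α) s = (sandwich 1 (freeEvolve V (R α) s) ω).op := by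
      rw [sandwich_op, one_mul]
    rw [branchL_true, sandwich_op, mul_one, mul_assoc, h1, trace_mul_op, sandwich_op, one_mul,
      mul_assoc, trace_freeEvolve_mul_freeEvolve hV hωV, correlation_eq]
  · rw [branchL_false, sandwich_op, one_mul, mul_assoc, trace_freeEvolve_mul_freeEvolve hV hωV,
      star_correlation hV hω hωV hR, correlation_eq, neg_sub]

include hV hu hSR hωV hω hR hcen in
-- Centring makes the projection between the two Liouvillians act trivially. Left multiplication by
-- the earlier reservoir operator then contributes the correlation function, and right
-- multiplication its complex conjugate.
lemma hasSum_kernelTerm (s u : ℝ) (ξ : TraceClass H) :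
    HasSum (fun p : ι × ι => kernelTerm HS V t₀ S R ω p s u ξ) (memoryKernel HS V t₀ S R ω s u ξ) := by
  have hsum : Summable fun p : ι × ι => kernelTerm HS V t₀ S R ω p s u ξ := by
    refine Summable.of_norm_bounded ((hSR.mul_of_nonneg hSR (fun _ => by positivity)
      (fun _ => by positivity)).mul_left (32 * ‖ω‖ * ‖ξ‖)) fun p => ?_
    refine ((kernelTerm HS V t₀ S R ω p s u).le_of_opNorm_le (norm_kernelTerm_le hu p s u) ξ).trans ?_
    calc _ ≤ 16 * (‖S p.1‖ * ‖S p.2‖ * (2 * ‖ω‖ * (‖R p.1‖ * ‖R p.2‖))) * ‖ξ‖ := by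
          gcongr
          exact norm_correlation_le hV _ _ _
      _ = _ := by ring
  set D : TraceClass (HTensor H K) →L[ℂ] TraceClass H :=
    ptr H K ∘L liouvillian (interactionField HS V t₀ S R s) with hD
  have h0 : memoryKernel HS V t₀ S R ω s u ξ =
      D (liouvillian (interactionField HS V t₀ S R u) (tensL ω ξ)) := by
    change D (irrelevantPart H ω (liouvillian (interactionField HS V t₀ S R u) (tensL ω ξ))) = _
    congr 1
    change _ - tensL ω (ptr H K _) = _
    rw [ptr_liouvillian_state hV hSR hωV hcen, map_zero, sub_zero]
    rfl
  have h1 : ∀ e, HasSum (fun β => D (tensL (branchL e (freeEvolve V (R β) u) ω)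
      (branchL e (interactionPicture HS t₀ (S β) u) ξ)))
      (D (branchL e (interactionField HS V t₀ S R u) (tensL ω ξ))) := by
    intro e
    have h2 := ((hasSum_interactionField (HS := HS) (V := V) (t₀ := t₀) hSR u).mapL (branchL e))
    have h3 := (h2.mapL (ContinuousLinearMap.apply ℂ _ (tensL ω ξ))).mapL D
    simpa only [ContinuousLinearMap.apply_apply, branchL_opTensor_tensL] using h3
  have h2 := ((h1 true).const_smul (-I)).add ((h1 false).const_smul I)
  have h3 : memoryKernel HS V t₀ S R ω s u ξ = -I • D (branchL true (interactionField HS V t₀ S R u)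
      (tensL ω ξ)) + I • D (branchL false (interactionField HS V t₀ S R u) (tensL ω ξ)) := by
    rw [h0, liouvillian_eq, add_apply, smul_apply, smul_apply, map_add, map_smul, map_smul]
  rw [← h3] at h2
  have h4 := (((Equiv.prodComm ι ι).hasSum_iff.2 hsum.hasSum)).prod_fiberwise (g := fun β =>
    (-I) • D (tensL (branchL true (freeEvolve V (R β) u) ω)
      (branchL true (interactionPicture HS t₀ (S β) u) ξ)) + I • D (tensL
      (branchL false (freeEvolve V (R β) u) ω)
      (branchL false (interactionPicture HS t₀ (S β) u) ξ))) (fun β => by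
    have h5 : ∀ e, HasSum _ _ := fun e => hasSum_ptr_liouvillian_tensL (HS := HS) (V := V) (t₀ := t₀) hSR s
      (branchL e (freeEvolve V (R β) u) ω) (branchL e (interactionPicture HS t₀ (S β) u) ξ)
    refine (((h5 true).const_smul (-I)).add ((h5 false).const_smul I)).congr_fun fun α => ?_
    obtain ⟨h6, h7⟩ := trace_branch_state_mul (R := R) hV hR hω hωV α β s u
    rw [h6, h7]
    simp only [Function.comp_apply, Equiv.prodComm_apply, Prod.swap_prod_mk, kernelTerm, sub_apply,
      smul_apply, ContinuousLinearMap.comp_apply, liouvillian]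
    have hI : I * I = -1 := I_mul_I
    have e1 : -I * correlation V R ω α β (s - u) * -I = -correlation V R ω α β (s - u) := by
      linear_combination (correlation V R ω α β (s - u)) * hI
    have e2 : I * star (correlation V R ω α β (s - u)) * -I =
        star (correlation V R ω α β (s - u)) := by
      linear_combination (-star (correlation V R ω α β (s - u))) * hI
    rw [smul_smul, smul_smul, smul_smul, smul_smul, e1, e2, neg_smul]
    abel)
  rw [← h4.unique h2]
  exact hsum.hasSum

/-- The integrable majorant of the memory kernel. -/
def kernelMajorant (V : ℝ → Op K) (S : ι → Op H) (R : ι → Op K) (ω : TraceClass K) (v : ℝ) : ℝ :=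
  (Set.Ioi (0 : ℝ)).indicator (fun v => ∑' p : ι × ι,
    16 * (‖S p.1‖ * ‖S p.2‖ * ‖correlation V R ω p.1 p.2 v‖)) v

include hV hSR in
lemma summable_kernelMajorant (v : ℝ) : Summable fun p : ι × ι =>
    16 * (‖S p.1‖ * ‖S p.2‖ * ‖correlation V R ω p.1 p.2 v‖) := by
  refine Summable.of_nonneg_of_le (fun _ => by positivity) (fun p => ?_)
    ((hSR.mul_of_nonneg hSR (fun _ => by positivity) (fun _ => by positivity)).mul_left (32 * ‖ω‖))
  calc _ ≤ 16 * (‖S p.1‖ * ‖S p.2‖ * (2 * ‖ω‖ * (‖R p.1‖ * ‖R p.2‖))) := by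
        gcongr
        exact norm_correlation_le hV _ _ _
    _ = _ := by ring

include hV hu hSR hωV hω hR hcen in
lemma norm_memoryKernel_le {s u : ℝ} (hsu : u < s) :
    ‖memoryKernel HS V t₀ S R ω s u‖ ≤ kernelMajorant V S R ω (s - u) := by
  have h0 : kernelMajorant V S R ω (s - u) = ∑' p : ι × ι,
      16 * (‖S p.1‖ * ‖S p.2‖ * ‖correlation V R ω p.1 p.2 (s - u)‖) :=
    Set.indicator_of_mem (Set.mem_Ioi.2 (sub_pos.2 hsu)) _
  have hsum := summable_kernelMajorant (ω := ω) hV hSR (s - u)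
  rw [h0]
  refine ContinuousLinearMap.opNorm_le_bound _ (tsum_nonneg fun _ => by positivity) fun ξ => ?_
  rw [← (hasSum_kernelTerm hV hu hSR hR hω hωV hcen s u ξ).tsum_eq]
  exact tsum_of_norm_bounded (hsum.hasSum.mul_right ‖ξ‖) fun p =>
    (kernelTerm HS V t₀ S R ω p s u).le_of_opNorm_le (norm_kernelTerm_le hu p s u) ξ

include hV hcen in
-- By centring the projection subtracts nothing, so the irreducible two-time function is the
-- ordinary one.
lemma irreducibleCorrelation_pair (a b : ι) (s : ℝ) :
    irreducibleCorrelation V R ω [(true, a, s), (true, b, 0)] = correlation V R ω a b s := by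
  rw [irreducibleCorrelation_eq]
  simp only [irreducibleWord, freeEvolve_zero hV]
  have h0 : traceL K (branchL true (R b) ω) = 0 := by rw [trace_branchL, hcen]
  rw [h0, zero_smul, sub_zero, trace_branchL, branchL_true, sandwich_op, mul_one,
    mul_assoc]
  have h1 : ω.op * freeEvolve V (R a) s = (sandwich 1 (freeEvolve V (R a) s) ω).op := by
    rw [sandwich_op, one_mul]
  rw [h1, trace_mul_op, sandwich_op, one_mul, mul_assoc, correlation_eq]

include hV hω hωV in
-- Davies' bound for `n = 1` is uniform in the time, because its exponent `(n-1)/2` is zero. Keeping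
-- only the words with two left multiplications gives the integrability of the whole double series,
-- which integrability of the single correlation functions would not.
lemma lintegral_correlation_le [Countable ι] (hres : IsWeakCouplingReservoir V S R ω) :
    ∫⁻ v in Set.Ioi (0 : ℝ), ∑' p : ι × ι, ‖S p.1‖ₑ * ‖S p.2‖ₑ *
      ‖correlation V R ω p.1 p.2 v‖ₑ < ⊤ := by
  obtain ⟨c, -, hc⟩ := hres.bound
  have h1 : ∀ n : ℕ, ∫⁻ v in Set.Ioc (0 : ℝ) n, ∑' p : ι × ι, ‖S p.1‖ₑ * ‖S p.2‖ₑ *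
      ‖correlation V R ω p.1 p.2 v‖ₑ ≤ ENNReal.ofReal (c 1) := by
    intro n
    rcases n.eq_zero_or_pos with rfl | hn
    · simp
    have h2 := hc 1 le_rfl n (by exact_mod_cast hn)
    rw [Nat.cast_one, sub_self, zero_div, Real.rpow_zero, mul_one] at h2
    refine le_trans ?_ h2
    have hmeas : Measurable fun v : Fin 1 → ℝ => memoryWeight V S R ω 2 (Fin.snoc v 0) := by
      refine (measurable_memoryWeight hV S R ω 2).comp (measurable_pi_lambda _ fun i => ?_)
      refine Fin.lastCases ?_ (fun i => ?_) i
      · simp only [Fin.snoc_last]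
        exact measurable_const
      · simp only [Fin.snoc_castSucc]
        exact measurable_pi_apply i
    have h3 : memoryIntegral V S R ω 1 n = iteratedLIntegral 1 (fun v : Fin 1 → ℝ =>
        memoryWeight V S R ω 2 (Fin.snoc v 0)) n := (iteratedLIntegral_eq hmeas n).symm
    rw [h3]
    refine setLIntegral_mono' measurableSet_Ioc fun v _ => ?_
    change _ ≤ memoryWeight V S R ω 2 (Fin.snoc (Fin.cons v Fin.elim0 : Fin 1 → ℝ) 0)
    rw [memoryWeight, ← (finTwoArrowEquiv ι).symm.tsum_eq]
    refine ENNReal.tsum_le_tsum fun p => ?_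
    refine le_trans (le_of_eq ?_) (Finset.single_le_sum (fun _ _ => zero_le)
      (Finset.mem_univ (fun _ : Fin 2 => true)))
    rw [← irreducibleCorrelation_pair hV hres.centred]
    simp [finTwoArrowEquiv, Fin.prod_univ_two, List.ofFn_succ, Fin.snoc]
  have h2 : (Set.Ioi (0 : ℝ)) = ⋃ n : ℕ, Set.Ioc (0 : ℝ) n := by
    ext x
    simp only [Set.mem_Ioi, Set.mem_iUnion, Set.mem_Ioc, exists_and_left, iff_self_and]
    exact fun _ => exists_nat_ge x
  rw [h2, setLIntegral_iUnion_of_directed _ (Monotone.directed_le fun i j hij =>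
    Set.Ioc_subset_Ioc_right (by exact_mod_cast hij))]
  exact (iSup_le h1).trans_lt ENNReal.ofReal_lt_top

include hV hSR hω hωV in
lemma integrable_kernelMajorant [Countable ι] (hres : IsWeakCouplingReservoir V S R ω) :
    Integrable (kernelMajorant V S R ω) := by
  have hm : Measurable fun v => ∑' p : ι × ι, 16 * (‖S p.1‖ * ‖S p.2‖ *
      ‖correlation V R ω p.1 p.2 v‖) := by
    refine Continuous.measurable ?_
    refine continuous_tsum (fun p => ?_)
      ((hSR.mul_of_nonneg hSR (fun _ => by positivity) (fun _ => by positivity)).mul_left (32 * ‖ω‖))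
      fun p v => ?_
    · exact continuous_const.mul (continuous_const.mul (continuous_correlation hV hω _ _).norm)
    · rw [Real.norm_of_nonneg (by positivity)]
      calc _ ≤ 16 * (‖S p.1‖ * ‖S p.2‖ * (2 * ‖ω‖ * (‖R p.1‖ * ‖R p.2‖))) := by
            gcongr
            exact norm_correlation_le hV _ _ _
        _ = _ := by ring
  refine (integrable_indicator_iff measurableSet_Ioi).2 ⟨hm.aestronglyMeasurable, ?_⟩
  rw [hasFiniteIntegral_iff_enorm]
  have h1 : ∀ v, ‖∑' p : ι × ι, 16 * (‖S p.1‖ * ‖S p.2‖ * ‖correlation V R ω p.1 p.2 v‖)‖ₑ ≤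
      16 * ∑' p : ι × ι, ‖S p.1‖ₑ * ‖S p.2‖ₑ * ‖correlation V R ω p.1 p.2 v‖ₑ := by
    intro v
    rw [← ENNReal.tsum_mul_left]
    refine enorm_tsum_le_tsum_enorm.trans (ENNReal.tsum_le_tsum fun p => le_of_eq ?_)
    rw [enorm_mul, enorm_mul, enorm_mul, enorm_norm, enorm_norm, enorm_norm]
    congr 1
    rw [← ofReal_norm]
    simp
  refine (lintegral_mono h1).trans_lt ?_
  rw [lintegral_const_mul' _ _ (by simp)]
  exact ENNReal.mul_lt_top (by simp) (lintegral_correlation_le hV hω hωV hres)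

include hV hu hUc hSR hS hR in
lemma continuous_memoryKernel_apply (s : ℝ) {x : ℝ → TraceClass H} (hx : Continuous x) :
    Continuous fun u => memoryKernel HS V t₀ S R ω s u (x u) :=
  (ptr H K ∘L liouvillian (interactionField HS V t₀ S R s) ∘L irrelevantPart H ω).continuous.comp
    ((isHamiltonianField_interactionField hV hu hUc hSR hS hR).continuous_liouvillian_apply
      ((tensL ω).continuous.comp hx))

include hV hu hUc hSR hS hR in
lemma isOperatorField_liouvillian :
    IsOperatorField (fun s => liouvillian (interactionField HS V t₀ S R s))
      (4 * ∑' α, ‖S α‖ * ‖R α‖) where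
  bound := (isHamiltonianField_interactionField hV hu hUc hSR hS hR).norm_liouvillian_le
  continuous := (isHamiltonianField_interactionField hV hu hUc hSR hS hR).continuous_liouvillian

lemma integral_memoryKernel (hh : IsOperatorField (fun s => liouvillian (interactionField HS V t₀ S R s))
      (4 * ∑' α, ‖S α‖ * ‖R α‖)) {x : ℝ → TraceClass H} (f : C(ℝ, TraceClass (HTensor H K)))
    (hf : ∀ s, f s = tensL ω (x s)) (s : ℝ) :
    ptr H K (liouvillian (interactionField HS V t₀ S R s) (volterra (comp_isOperatorField hh
      (ContinuousLinearMap.id ℂ _ - tensL ω ∘L ptr H K)) f s)) =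
      ∫ u in (0 : ℝ)..s, memoryKernel HS V t₀ S R ω s u (x u) := by
  rw [volterra_apply]
  have h1 := (ptr H K ∘L liouvillian (interactionField HS V t₀ S R s)).intervalIntegral_comp_comm
    (((comp_isOperatorField hh (ContinuousLinearMap.id ℂ _ - tensL ω ∘L ptr H K)).continuous_apply
      f.continuous).intervalIntegrable (μ := volume) 0 s)
  refine h1.symm.trans (intervalIntegral.integral_congr fun u _ => ?_)
  simp only [hf]
  rfl

include hV hu hUc hSR hS hR hω hωV in
lemma isMemoryKernel_memoryKernel [Countable ι] (hres : IsWeakCouplingReservoir V S R ω) :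
    IsMemoryKernel (memoryKernel HS V t₀ S R ω) (kernelMajorant V S R ω) where
  nonneg v := Set.indicator_nonneg (fun _ _ => tsum_nonneg fun _ => by positivity) _
  eq_zero v hv := Set.indicator_of_notMem (not_lt.2 hv) _
  integrable := integrable_kernelMajorant hV hSR hω hωV hres
  bound s u hsu := norm_memoryKernel_le hV hu hSR hR hω hωV hres.centred hsu
  continuous x s hx := continuous_memoryKernel_apply hV hu hUc hSR hS hR s hx
  continuous_integral x hx := by
    have hh := isOperatorField_liouvillian hV hu hUc hSR hS hR
    let f : C(ℝ, TraceClass (HTensor H K)) := ⟨fun s => tensL ω (x s), (tensL ω).continuous.comp hx⟩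
    simp only [← integral_memoryKernel hh f (fun s => rfl)]
    exact (ptr H K).continuous.comp (hh.continuous_apply (ContinuousMap.continuous _))

end CompositeKernel

/-! ### The equation of motion of the reduced state. -/

section ReducedEquation

variable {H K : Type*} [NormedAddCommGroup H] [InnerProductSpace ℂ H] [CompleteSpace H]
  [NormedAddCommGroup K] [InnerProductSpace ℂ K] [CompleteSpace K]
  {HR : K →ₗ.[ℂ] K} {V : ℝ → Op K} {HS : ℝ → Op H} {t₀ : ℝ}
  {ι : Type*} {S : ι → Op H} {R : ι → Op K} {ω : TraceClass K}

variable (hV : IsUnitaryGroupOf HR V) (hu : ∀ t, propagator HS t₀ t ∈ unitary (Op H))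
  (hUc : Continuous (propagator HS t₀)) (hSR : Summable fun α => ‖S α‖ * ‖R α‖)
  (hS : ∀ α, IsSelfAdjoint (S α)) (hR : ∀ α, IsSelfAdjoint (R α))
  (hωV : ∀ t, Commute ω.op (V t))

include hV hωV in
lemma iteratedLIntegral_const_mul_memoryWeight_le [Countable ι] (c : ℝ≥0∞) (n : ℕ) (t : ℝ) :
    iteratedLIntegral (n + 1) (fun s => c * memoryWeight V S R ω (n + 1) s) t ≤
      c * (ENNReal.ofReal t * memoryIntegral V S R ω n t) := by
  have h := measurable_memoryWeight hV S R ω (n + 1)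
  rw [iteratedLIntegral_eq (h.const_mul c), lintegral_const_mul c h, ← iteratedLIntegral_eq h]
  gcongr
  exact iteratedLIntegral_memoryWeight_le hV hωV S R n t

/-- The reduced state in the interaction picture. -/
def reducedState (ω : TraceClass K) (Z : ℝ → Op (HTensor H K)) (ρ : TraceClass H) (t : ℝ) :
    TraceClass H := ptr H K (sandwich (Z t) (star (Z t)) (tensL ω ρ))

include hV hu hUc hSR hS hR in
lemma continuous_reducedState {lam : ℝ} {Z : ℝ → Op (HTensor H K)} (hZ0 : Z 0 = 1)
    (hZ : ∀ x, IsSchroedingerSolution (interactionField HS V t₀ S R) lam fun t => Z t x)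
    (ρ : TraceClass H) : Continuous (reducedState ω Z ρ) :=
  (ptr H K).continuous.comp ((isHamiltonianField_interactionField hV hu hUc hSR hS hR).continuous_sandwich
    hZ0 hZ (tensL ω ρ))

include hV hu hUc hSR hS hR hωV in
/-- The reduced state satisfies the memory kernel equation, up to terms of higher order. -/
lemma enorm_reducedState_sub_le [Countable ι] (hres : IsWeakCouplingReservoir V S R ω)
    (hω1 : traceL K ω = 1) {lam : ℝ} {Z : ℝ → Op (HTensor H K)} (hZ0 : Z 0 = 1)
    (hZ : ∀ x, IsSchroedingerSolution (interactionField HS V t₀ S R) lam fun t => Z t x)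
    (ρ : TraceClass H) {t τ : ℝ} (ht : 0 < t) (htτ : lam ^ 2 * t ≤ τ) :
    ‖reducedState ω Z ρ t - ρ - lam ^ 2 • ∫ s in (0 : ℝ)..t, ∫ u in (0 : ℝ)..s,
      memoryKernel HS V t₀ S R ω s u (reducedState ω Z ρ u)‖ₑ ≤
      ENNReal.ofReal τ * ENNReal.ofReal (4 * ‖tensL (H := H) ω ρ‖) * ∑' n : ℕ, 2 ^ (n + 3) *
        (‖lam‖ₑ ^ (n + 1) * memoryIntegral V S R ω (n + 2) t) := by
  have hF := isHamiltonianField_interactionField hV hu hUc hSR hS hR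
  have hh := isOperatorField_liouvillian hV hu hUc hSR hS hR
  have hXc := hF.continuous_sandwich hZ0 hZ (tensL ω ρ)
  have hxc := continuous_reducedState (ω := ω) hV hu hUc hSR hS hR hZ0 hZ ρ
  set X : C(ℝ, TraceClass (HTensor H K)) := ⟨_, hXc⟩ with hX
  set f : C(ℝ, TraceClass (HTensor H K)) := ⟨fun s => tensL ω (reducedState ω Z ρ s),
    (tensL ω).continuous.comp hxc⟩ with hf
  have hXM : ∀ s, ‖X s‖ ≤ 2 * ‖tensL (H := H) ω ρ‖ := fun s =>
    (sandwich (Z s) (star (Z s))).le_of_opNorm_le (norm_sandwich_isometry_le (hF.star_mul_self hZ0 hZ s)) _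
  have h1 := enorm_sub_nzTerm_one_le hh (p := ptr H K) (i := tensL ω)
    (fun ξ => by rw [ptr_tensL, hω1, one_smul])
    (fun s ξ => ptr_liouvillian_state hV hSR hωV hres.centred s ξ) (X := X) (ρ := ρ) (lam := lam)
    (fun t => hF.sandwich_eq_add_integral hZ0 hZ (tensL ω ρ) t) hXM (f := f) (fun _ => rfl) ht.le
  have h2 : nzTerm hh (ptr H K) (tensL ω) f 1 t = ∫ s in (0 : ℝ)..t, ∫ u in (0 : ℝ)..s,
      memoryKernel HS V t₀ S R ω s u (reducedState ω Z ρ u) := by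
    rw [nzTerm]
    refine intervalIntegral.integral_congr fun s _ => ?_
    simp only [pow_one]
    exact integral_memoryKernel hh f (fun _ => rfl) s
  rw [h2, Complex.coe_smul] at h1
  refine h1.trans ?_
  rw [← ENNReal.tsum_mul_left]
  refine ENNReal.tsum_le_tsum fun n => ?_
  have hxm : ∀ s ∈ Set.Icc 0 t, ‖reducedState ω Z ρ s‖ₑ ≤ ENNReal.ofReal (4 * ‖tensL (H := H) ω ρ‖) := by
    intro s _
    rw [← ofReal_norm]
    refine ENNReal.ofReal_le_ofReal ?_
    refine ((ptr H K).le_of_opNorm_le_of_le norm_ptr_le (hXM s)).trans (le_of_eq (by ring))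
  have h3 := nzTerm_enorm_le hh (ptr H K) (tensL ω) (x := reducedState ω Z ρ) (f := f) (fun _ => rfl) (n + 2)
    (w := fun s => 2 ^ (n + 3) * memoryWeight V S R ω (n + 3) s) (fun s v ξ => by
      have := enorm_ptr_word_le (V := V) (R := R) hu hSR ω (Fin.cons s v : Fin (n + 3) → ℝ) ξ
      simp only [Fin.cons_zero, Fin.cons_succ] at this
      exact this) ENNReal.ofReal_ne_top hxm ht.le
  have h4 := iteratedLIntegral_const_mul_memoryWeight_le (S := S) (R := R) hV hωV (2 ^ (n + 3)) (n + 2) t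
  -- Two of the `n+3` powers of `lam` compensate the factor `t` produced by stationarity.
  have h5 : ‖lam‖ₑ ^ 2 * ENNReal.ofReal t ≤ ENNReal.ofReal τ := by
    rw [← ofReal_norm, ← ENNReal.ofReal_pow (norm_nonneg _), ← ENNReal.ofReal_mul (by positivity)]
    refine ENNReal.ofReal_le_ofReal ?_
    rwa [Real.norm_eq_abs, sq_abs]
  set m := ENNReal.ofReal (4 * ‖tensL (H := H) ω ρ‖)
  calc _ ≤ ‖lam‖ₑ ^ (n + 3) * (2 ^ (n + 3) * (ENNReal.ofReal t * memoryIntegral V S R ω (n + 2) t) * m) := by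
        gcongr
        exact h3.trans (by gcongr)
    _ = (‖lam‖ₑ ^ 2 * ENNReal.ofReal t) * m * (2 ^ (n + 3) *
        (‖lam‖ₑ ^ (n + 1) * memoryIntegral V S R ω (n + 2) t)) := by ring
    _ ≤ _ := by gcongr

include hV hu hUc hSR hS hR hωV in
/-- The reduced dynamics in the weak-coupling limit, given the mean of the Markovian generator. -/
lemma tendsto_reducedState [Countable ι] (hω : IsDensity ω) (hres : IsWeakCouplingReservoir V S R ω)
    {B : ℝ → TraceClass H →L[ℂ] TraceClass H} {C : ℝ}
    (hB : IsMarkovField (memoryKernel HS V t₀ S R ω) B C)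
    {L : TraceClass H →L[ℂ] TraceClass H} (hL : ∀ ξ, HasMean (fun s => B s ξ) (L ξ))
    {Z : ℝ → ℝ → Op (HTensor H K)} (hZ0 : ∀ lam, Z lam 0 = 1)
    (hZ : ∀ lam x, IsSchroedingerSolution (interactionField HS V t₀ S R) lam fun t => Z lam t x)
    (ρ : TraceClass H) (τ : ℝ) :
    Tendsto (fun p : ℝ × ℝ => reducedState ω (Z p.1) ρ p.2 -
      NormedSpace.exp (((p.1 ^ 2 * p.2 : ℝ) : ℂ) • L) ρ) (weakCoupling τ) (𝓝 0) := by
  have hω1 : traceL K ω = 1 := by rw [traceL_apply]; exact hω.2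
  have hk := isMemoryKernel_memoryKernel hV hu hUc hSR hS hR hω.1 hωV hres
  set e : ℝ → ℝ → TraceClass H := fun lam t => reducedState ω (Z lam) ρ t - ρ -
    lam ^ 2 • ∫ s in (0 : ℝ)..t, ∫ u in (0 : ℝ)..s,
      memoryKernel HS V t₀ S R ω s u (reducedState ω (Z lam) ρ u) with he
  refine hk.tendsto_weakCoupling hB hL (x := fun lam => reducedState ω (Z lam) ρ) (e := e)
    (fun lam => continuous_reducedState hV hu hUc hSR hS hR (hZ0 lam) (hZ lam) ρ) (fun lam t => ?_)
    (fun lam => ?_) ?_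
  · change _ = _ + (_ - _ - _)
    rw [sub_sub, add_sub_cancel]
  · have h0 : reducedState ω (Z lam) ρ 0 = ρ := by
      rw [reducedState, hZ0, star_one, sandwich_one_one, one_apply_eq_self, ptr_tensL, hω1, one_smul]
    simp [he, h0]
  · rw [tendsto_zero_iff_norm_tendsto_zero]
    have h1 := ENNReal.Tendsto.const_mul (a := ENNReal.ofReal τ * ENNReal.ofReal (4 * ‖tensL (H := H) ω ρ‖))
      (tendsto_tsum_memoryIntegral hres τ) (Or.inr (ENNReal.mul_ne_top ENNReal.ofReal_ne_top
        ENNReal.ofReal_ne_top))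
    rw [mul_zero] at h1
    have h2 : Tendsto (fun p : ℝ × ℝ => ‖e p.1 p.2‖ₑ) (weakCoupling τ) (𝓝 0) := by
      refine tendsto_of_tendsto_of_tendsto_of_le_of_le' tendsto_const_nhds h1
        (Eventually.of_forall fun _ => zero_le) ?_
      filter_upwards [eventually_mem_weakCoupling τ] with p hp
      exact enorm_reducedState_sub_le hV hu hUc hSR hS hR hωV hres hω1 (hZ0 p.1) (hZ p.1) ρ hp.1 hp.2
    have h3 := (ENNReal.tendsto_toReal ENNReal.zero_ne_top).comp h2
    rw [ENNReal.toReal_zero] at h3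
    refine h3.congr fun p => ?_
    rw [Function.comp_apply, toReal_enorm]

end ReducedEquation

/-! ### Strongly convergent series of operators. -/

section StrongSum

variable {E G : Type*} [NormedAddCommGroup E] [NormedSpace ℂ E] [NormedAddCommGroup G]
  [NormedSpace ℂ G]

/-- The series `∑ F i` converges strongly to `T`, with uniformly bounded partial sums. -/
structure HasStrongSum {α : Type*} (F : α → E →L[ℂ] G) (T : E →L[ℂ] G) : Prop where
  hasSum : ∀ x, HasSum (fun i => F i x) (T x)
  bounded : ∃ C, ∀ t : Finset α, ‖∑ i ∈ t, F i‖ ≤ C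

/-- Strong summability of a double family follows from summability on a dense set and summable
bounds on the partial inner sums. -/
lemma exists_hasStrongSum_prod [CompleteSpace G] {α β : Type*} {F : α × β → E →L[ℂ] G} {c : α → ℝ}
    (hc : Summable c) {s : Set E} (hs : (Submodule.span ℂ s).topologicalClosure = ⊤)
    (hb : ∀ a (t : Finset β), ‖∑ j ∈ t, F (a, j)‖ ≤ c a)
    (hsum : ∀ a, ∀ x ∈ s, Summable fun j => F (a, j) x) : ∃ T, HasStrongSum F T := by
  classical
  have hc0 : ∀ a, 0 ≤ c a := fun a => (norm_nonneg _).trans (hb a ∅)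
  have hbd : ∀ t : Finset (α × β), ‖∑ p ∈ t, F p‖ ≤ ∑' a, c a := by
    intro t
    let fib : α → Finset β := fun i => t.preimage (fun j => (i, j)) (Prod.mk_right_injective i).injOn
    have h1 : ∑ p ∈ t, F p = ∑ i ∈ t.image Prod.fst, ∑ j ∈ fib i, F (i, j) := by
      rw [Finset.sum_sigma']
      refine Finset.sum_bij' (fun p _ => ⟨p.1, p.2⟩) (fun q _ => (q.1, q.2)) ?_ ?_ ?_ ?_ ?_ <;>
        simp [fib] <;> tauto
    rw [h1]
    exact (norm_sum_le _ _).trans ((Finset.sum_le_sum fun i _ => hb i _).trans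
      (hc.sum_le_tsum _ fun i _ => hc0 i))
  have hdense : ∀ x ∈ s, Summable fun p => F p x := by
    intro x hx
    refine (hasSum_prod_of_bound (f := fun a j => F (a, j) x) (hc.mul_right ‖x‖)
      (fun a => (hsum a x hx).hasSum) fun a t => ?_).summable
    rw [← sum_apply]
    exact (∑ j ∈ t, F (a, j)).le_of_opNorm_le (hb a t) x
  have hall : ∀ x, Summable fun p => F p x := by
    let M : Submodule ℂ E :=
      { carrier := {x | Summable fun p => F p x}
        zero_mem' := by simp
        add_mem' := fun {x y} hx hy => by simpa using hx.add hy
        smul_mem' := fun c x hx => by simpa using hx.const_smul c }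
    -- The uniform bound on partial sums lets the Cauchy criterion pass from nearby vectors to their
    -- limits.
    have hM : IsClosed (M : Set E) := by
      refine isClosed_of_closure_subset fun x hx => ?_
      change Summable fun p => F p x
      have hC0 : 0 ≤ ∑' a, c a := tsum_nonneg hc0
      refine summable_iff_vanishing_norm.2 fun δ hδ => ?_
      obtain ⟨y, hy, hxy⟩ := Metric.mem_closure_iff.1 hx (δ / (2 * (∑' a, c a) + 2)) (by positivity)
      obtain ⟨t₀, ht₀⟩ := summable_iff_vanishing_norm.1 (show Summable fun p => F p y from hy)
        (δ / 2) (by positivity)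
      refine ⟨t₀, fun t ht => ?_⟩
      have h1 := ht₀ t ht
      have h2 : ∑ p ∈ t, F p x = (∑ p ∈ t, F p) (x - y) + ∑ p ∈ t, F p y := by
        rw [map_sub, sum_apply, sum_apply, sub_add_cancel]
      have h3 := (∑ p ∈ t, F p).le_of_opNorm_le (hbd t) (x - y)
      rw [dist_eq_norm] at hxy
      have h4 : (∑' a, c a) * ‖x - y‖ ≤ δ / 2 := by
        calc _ ≤ (∑' a, c a) * (δ / (2 * (∑' a, c a) + 2)) := by gcongr
          _ ≤ δ / 2 := by
            rw [← mul_div_assoc, div_le_div_iff₀ (by positivity) (by positivity)]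
            nlinarith
      rw [h2]
      exact (norm_add_le _ _).trans_lt (by linarith)
    have h1 : (Submodule.span ℂ s).topologicalClosure ≤ M :=
      Submodule.topologicalClosure_minimal _ (Submodule.span_le.2 hdense) hM
    rw [hs, top_le_iff] at h1
    intro x
    have : x ∈ M := by rw [h1]; trivial
    exact this
  refine ⟨LinearMap.mkContinuous
    { toFun := fun x => ∑' p, F p x
      map_add' := fun x y => by simp only [map_add]; exact (hall x).tsum_add (hall y)
      map_smul' := fun k x => by
        simp only [map_smul, RingHom.id_apply]; exact (hall x).tsum_const_smul k } (∑' a, c a) ?_,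
    fun x => (hall x).hasSum, _, hbd⟩
  intro x
  refine le_of_tendsto (hall x).hasSum.norm (Eventually.of_forall fun t => ?_)
  rw [← sum_apply]
  exact (∑ p ∈ t, F p).le_of_opNorm_le (hbd t) x

variable {H : Type*} [NormedAddCommGroup H] [InnerProductSpace ℂ H] [CompleteSpace H]

lemma norm_le_of_dyad {T : TraceClass H →L[ℂ] G} {c : ℝ} (hc : 0 ≤ c)
    (h : ∀ x y, ‖T (dyad x y)‖ ≤ c * (‖x‖ * ‖y‖)) : ‖T‖ ≤ 2 * c := by
  refine ContinuousLinearMap.opNorm_le_bound _ (by positivity) fun ρ => ?_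
  obtain ⟨J, x, y, h1, h2, h3⟩ := exists_nuclear ρ
  refine ((h3.mapL T).norm_le_of_bounded (h1.hasSum.mul_left c) fun i => h _ _).trans ?_
  nlinarith

lemma span_range_dyad_dense : (Submodule.span ℂ {ρ : TraceClass H | ∃ x y, ρ = dyad x y}).topologicalClosure
    = ⊤ := by
  have h := span_dyad_dense (H := H) (s := Set.univ) (by
    rw [Submodule.span_univ, top_le_iff.1 (Submodule.le_topologicalClosure _)])
  simpa using h

/-- Taking adjoints is only weakly continuous, so strong convergence of the adjoint series is
assumed separately; its sum is then identified weakly. -/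
lemma HasStrongSum.star_eq {α : Type*} {F : α → Op H} {T T' : Op H} (h : HasStrongSum F T)
    (h' : HasStrongSum (fun i => star (F i)) T') : T' = star T := by
  refine ContinuousLinearMap.ext fun x => ext_inner_left ℂ fun y => ?_
  have h1 := (h'.hasSum x).mapL (innerSL ℂ y)
  have h2 := ((h.hasSum y).mapL (innerSL ℂ x)).star
  have h3 : innerSL ℂ y (star T x) = star (innerSL ℂ x (T y)) := by
    rw [innerSL_apply_apply, innerSL_apply_apply, ContinuousLinearMap.star_eq_adjoint,
      ContinuousLinearMap.adjoint_inner_right, RCLike.star_def, inner_conj_symm]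
  change innerSL ℂ y (T' x) = innerSL ℂ y (star T x)
  rw [h3]
  refine h1.unique (h2.congr_fun fun i => ?_)
  rw [innerSL_apply_apply, innerSL_apply_apply, ContinuousLinearMap.star_eq_adjoint,
    ContinuousLinearMap.adjoint_inner_right, RCLike.star_def, inner_conj_symm]

/-- On `|x⟩⟨y|` the multiplied series is the strongly convergent series applied to `x`. Uniform
bounds on the partial sums extend trace-norm convergence to all of `B₁`. -/
lemma HasStrongSum.sandwich_left {α : Type*} {F : α → Op H} {T : Op H} (h : HasStrongSum F T)
    (ρ : TraceClass H) : HasSum (fun i => sandwich (F i) 1 ρ) (sandwich T 1 ρ) := by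
  obtain ⟨C, hC⟩ := h.bounded
  have h1 : ∀ t : Finset α, ∑ i ∈ t, sandwich (F i) 1 = sandwich (∑ i ∈ t, F i) 1 := fun t =>
    (map_sum (branchL (H := H) true) F t).symm
  have h2 := tendsto_of_span_dense (l := atTop)
    (T := fun t : Finset α => ((∑ i ∈ t, sandwich (F i) 1 : TraceClass H →L[ℂ] TraceClass H) :
      TraceClass H →ₗ[ℂ] TraceClass H)) (T₀ := sandwich T 1) (C := 2 * C) span_range_dyad_dense
    (Eventually.of_forall fun t x => ?_) ?_ ρ
  · refine h2.congr fun t => ?_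
    rw [ContinuousLinearMap.coe_coe, sum_apply]
  · rw [ContinuousLinearMap.coe_coe, h1]
    exact (branchL true _).le_of_opNorm_le ((norm_branchL_le true _).trans (by gcongr; exact hC t)) x
  · rintro _ ⟨x, y, rfl⟩
    have h3 := (h.hasSum x).mapL (dyadL y)
    simp only [dyadL_apply] at h3
    rw [sandwich_dyad, star_one, one_apply_eq_self]
    refine Tendsto.congr (fun t => ?_) h3
    rw [ContinuousLinearMap.coe_coe, sum_apply]
    refine Finset.sum_congr rfl fun i _ => ?_
    rw [sandwich_dyad, star_one, one_apply_eq_self]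

lemma HasStrongSum.sandwich_right {α : Type*} {F : α → Op H} {T : Op H} (h : HasStrongSum F T)
    (ρ : TraceClass H) : HasSum (fun i => sandwich 1 (star (F i)) ρ) (sandwich 1 (star T) ρ) := by
  obtain ⟨C, hC⟩ := h.bounded
  have h1 : ∀ t : Finset α, ∑ i ∈ t, sandwich 1 (star (F i)) = sandwich 1 (star (∑ i ∈ t, F i)) :=
    fun t => by rw [star_sum]; exact (map_sum (branchL (H := H) false) (fun i => star (F i)) t).symm
  have h2 := tendsto_of_span_dense (l := atTop)
    (T := fun t : Finset α => ((∑ i ∈ t, sandwich 1 (star (F i)) : TraceClass H →L[ℂ] TraceClass H) :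
      TraceClass H →ₗ[ℂ] TraceClass H)) (T₀ := sandwich 1 (star T)) (C := 2 * C)
      span_range_dyad_dense (Eventually.of_forall fun t x => ?_) ?_ ρ
  · refine h2.congr fun t => ?_
    rw [ContinuousLinearMap.coe_coe, sum_apply]
  · rw [ContinuousLinearMap.coe_coe, h1]
    refine (branchL false _).le_of_opNorm_le ((norm_branchL_le false _).trans ?_) x
    rw [norm_star]
    gcongr
    exact hC t
  · rintro _ ⟨x, y, rfl⟩
    have h3 := (h.hasSum y).map
      ((isBoundedBilinearMap_dyad (H := H)).toContinuousLinearMap x) (ContinuousLinearMap.continuous _)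
    rw [sandwich_dyad, star_star, one_apply_eq_self]
    refine Tendsto.congr (fun t => ?_) h3
    rw [ContinuousLinearMap.coe_coe, sum_apply]
    refine Finset.sum_congr rfl fun i _ => ?_
    rw [sandwich_dyad, star_star, one_apply_eq_self]
    rfl

end StrongSum

/-! ### Mean values of products of almost periodic operators. -/

section BohrSums

variable {H : Type*} [NormedAddCommGroup H] [InnerProductSpace ℂ H] [CompleteSpace H]
  {α : Type*} {X Y : α → ℝ → Op H} {C D : α → ℝ}

/-- The mean value of `∑ X_i(s)† Y_i(s)`. -/
lemma exists_hasStrongSum_star_mul [Countable α] (hX : ∀ i, IsAPOp (X i) (C i)) (hY : ∀ i, IsAPOp (Y i) (D i))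
    (hCD : Summable fun i => C i * D i) :
    ∃ T : Op H, HasStrongSum (fun q : α × ℝ => star ((hX q.1).bohrOp q.2) * (hY q.1).bohrOp q.2) T ∧
      ∀ x, HasMean (fun s => ∑' i, star (X i s) (Y i s x)) (T x) := by
  have hm : ∀ i x, ∃ m, HasMean (fun s => star (X i s) (Y i s x)) m ∧
      HasSum (fun ν => (star ((hX i).bohrOp ν) * (hY i).bohrOp ν) x) m := fun i x =>
    (hX i).exists_hasMean_star_apply ((hY i).ap x)
  have hC := fun i => (hX i).nonneg
  have hD := fun i => (hY i).nonneg
  -- Bessel's inequality bounds the sums over frequencies uniformly, and the bounds are summable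
  -- over the couplings.
  have hb : ∀ i (t : Finset ℝ), ‖∑ ν ∈ t, star ((hX i).bohrOp ν) * (hY i).bohrOp ν‖ ≤ C i * D i := by
    intro i t
    refine ContinuousLinearMap.opNorm_le_bound _ (mul_nonneg (hC i) (hD i)) fun x => ?_
    rw [sum_apply, mul_assoc]
    exact (hX i).norm_sum_star_le ((hY i).ap x) ((hY i).norm_apply_le x) t
  obtain ⟨T, hT⟩ := exists_hasStrongSum_prod
    (F := fun q : α × ℝ => star ((hX q.1).bohrOp q.2) * (hY q.1).bohrOp q.2) (s := Set.univ) hCD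
    (by rw [Submodule.span_univ, top_le_iff.1 (Submodule.le_topologicalClosure _)]) hb
    fun i x _ => by obtain ⟨m, -, h⟩ := hm i x; exact h.summable
  · refine ⟨T, hT, fun x => ?_⟩
    choose m hm1 hm2 using hm
    have h1 := (hT.hasSum x).prod_fiberwise fun i => hm2 i x
    rw [← h1.tsum_eq]
    refine hasMean_tsum (hCD.mul_right ‖x‖) (fun i => ?_) (fun i s => ?_) fun i => hm1 i x
    · exact (hX i).continuous.star.clm_apply ((hY i).ap x).continuous
    · rw [mul_assoc]
      refine (star (X i s)).le_of_opNorm_le_of_le ?_ ((hY i).norm_apply_le x s)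
      rw [norm_star]
      exact (hX i).bound s

/-- The mean value of `∑ X_i(s) ρ Y_i(s)†`. -/
lemma exists_hasStrongSum_sandwich [Countable α] (hX : ∀ i, IsAPOp (X i) (C i)) (hY : ∀ i, IsAPOp (Y i) (D i))
    (hCD : Summable fun i => C i * D i) :
    ∃ J : TraceClass H →L[ℂ] TraceClass H, HasStrongSum (fun q : α × ℝ =>
        sandwich ((hX q.1).bohrOp q.2) (star ((hY q.1).bohrOp q.2))) J ∧
      ∀ x y, HasMean (fun s => ∑' i, dyad (X i s x) (Y i s y)) (J (dyad x y)) := by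
  have hm : ∀ i x y, ∃ m, HasMean (fun s => dyad (X i s x) (Y i s y)) m ∧
      HasSum (fun ν => sandwich ((hX i).bohrOp ν) (star ((hY i).bohrOp ν)) (dyad x y)) m := by
    intro i x y
    obtain ⟨m, h1, h2⟩ := ((hX i).ap x).exists_hasMean_dyad ((hY i).ap y)
    refine ⟨m, h1, h2.congr_fun fun ν => ?_⟩
    rw [sandwich_dyad, star_star]
    rfl
  have hC := fun i => (hX i).nonneg
  have hD := fun i => (hY i).nonneg
  have hb : ∀ i (t : Finset ℝ), ‖∑ ν ∈ t, sandwich ((hX i).bohrOp ν) (star ((hY i).bohrOp ν))‖ ≤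
      2 * (C i * D i) := by
    intro i t
    refine norm_le_of_dyad (mul_nonneg (hC i) (hD i)) fun x y => ?_
    rw [sum_apply]
    refine (norm_sum_le _ _).trans ?_
    calc _ ≤ ∑ ν ∈ t, ‖bohrCoeff (fun s => X i s x) ν‖ * ‖bohrCoeff (fun s => Y i s y) ν‖ := by
          refine Finset.sum_le_sum fun ν _ => ?_
          rw [sandwich_dyad, star_star]
          exact norm_dyad_le _ _
      _ ≤ (C i * ‖x‖) * (D i * ‖y‖) := ((hX i).ap x).sum_norm_mul_norm_bohrCoeff_le ((hY i).ap y)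
          ((hX i).norm_apply_le x) ((hY i).norm_apply_le y) t
      _ = _ := by ring
  obtain ⟨J, hJ⟩ := exists_hasStrongSum_prod
    (F := fun q : α × ℝ => sandwich ((hX q.1).bohrOp q.2) (star ((hY q.1).bohrOp q.2)))
    (hCD.mul_left 2) span_range_dyad_dense hb
    (by rintro i _ ⟨x, y, rfl⟩; obtain ⟨m, -, h⟩ := hm i x y; exact h.summable)
  · refine ⟨J, hJ, fun x y => ?_⟩
    choose m hm1 hm2 using hm
    have h1 := (hJ.hasSum (dyad x y)).prod_fiberwise fun i => hm2 i x y
    rw [← h1.tsum_eq]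
    refine hasMean_tsum (hCD.mul_right (‖x‖ * ‖y‖)) (fun i => ?_) (fun i s => ?_) fun i => hm1 i x y
    · exact continuous_dyad.comp (((hX i).ap x).continuous.prodMk ((hY i).ap y).continuous)
    · refine (norm_dyad_le _ _).trans ?_
      calc _ ≤ (C i * ‖x‖) * (D i * ‖y‖) := mul_le_mul ((hX i).norm_apply_le x s)
            ((hY i).norm_apply_le y s) (norm_nonneg _) (mul_nonneg (hC i) (norm_nonneg _))
        _ = _ := by ring

end BohrSums

/-! ### Mean values from a dense set. -/

section MeanDense

variable {E F : Type*} [NormedAddCommGroup E] [NormedSpace ℂ E] [NormedAddCommGroup F]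
  [NormedSpace ℂ F]

lemma IsOperatorField.hasMean_of_span_dense {B : ℝ → E →L[ℂ] F} {C : ℝ} (hB : IsOperatorField B C)
    {L : E →L[ℂ] F} {s : Set E} (hs : (Submodule.span ℂ s).topologicalClosure = ⊤)
    (h : ∀ x ∈ s, HasMean (fun t => B t x) (L x)) (x : E) : HasMean (fun t => B t x) (L x) := by
  let M : Submodule ℂ E :=
    { carrier := {x | HasMean (fun t => B t x) (L x)}
      zero_mem' := by
        change HasMean (fun t => B t 0) (L 0)
        simp only [map_zero]
        unfold HasMean
        simp
      add_mem' := fun {x y} hx hy => by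
        change HasMean (fun t => B t (x + y)) (L (x + y))
        simp only [map_add]
        exact HasMean.add hx hy (hB.continuous x) (hB.continuous y)
      smul_mem' := fun c x hx => by
        change HasMean (fun t => B t (c • x)) (L (c • x))
        simp only [map_smul]
        exact HasMean.const_smul hx c }
  have hM : IsClosed (M : Set E) := by
    refine isClosed_of_closure_subset fun x hx => ?_
    change HasMean (fun t => B t x) (L x)
    have hC := hB.nonneg
    refine hasMean_of_approx (hB.continuous x) fun δ hδ => ?_
    obtain ⟨y, hy, hxy⟩ := Metric.mem_closure_iff.1 hx (δ / (C + ‖L‖ + 1)) (by positivity)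
    rw [dist_eq_norm, lt_div_iff₀ (by positivity)] at hxy
    have h0 := norm_nonneg (x - y)
    have h1 := norm_nonneg L
    refine ⟨_, _, hB.continuous y, hy, fun t => ?_, ?_⟩
    · rw [← map_sub]
      refine ((B t).le_of_opNorm_le (hB.bound t) _).trans ?_
      nlinarith
    · rw [← map_sub]
      refine (L.le_opNorm _).trans ?_
      rw [norm_sub_rev]
      nlinarith
  have h1 : (Submodule.span ℂ s).topologicalClosure ≤ M :=
    Submodule.topologicalClosure_minimal _ (Submodule.span_le.2 h) hM
  rw [hs, top_le_iff] at h1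
  have : x ∈ M := by rw [h1]; trivial
  exact this

end MeanDense

/-! ### The time average of the Markovian generator. -/

section Generator

variable {H : Type*} [NormedAddCommGroup H] [InnerProductSpace ℂ H] [CompleteSpace H]
  {ι : Type*} {A : ι → ℝ → Op H} {n : ι → ℝ} {r : ι × ι → ℝ → ℂ}

/-- The convolution of `A_b` with the correlation function `r_{ab}`. -/
def dressedOp (A : ι → ℝ → Op H) (r : ι × ι → ℝ → ℂ) (p : ι × ι) (s : ℝ) : Op H :=
  ∫ v in Set.Ioi (0 : ℝ), r p v • A p.2 (s - v)

/-- The contribution of a pair of couplings to the Markovian generator. -/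
def markovTerm (A : ι → ℝ → Op H) (r : ι × ι → ℝ → ℂ) (p : ι × ι) (s : ℝ) :
    TraceClass H →L[ℂ] TraceClass H :=
  commutator (A p.1 s) ∘L (branchL false (star (dressedOp A r p s)) - branchL true (dressedOp A r p s))

/-- The time-dependent Markovian generator. -/
def markovField (A : ι → ℝ → Op H) (r : ι × ι → ℝ → ℂ) (s : ℝ) :
    TraceClass H →L[ℂ] TraceClass H := ∑' p, markovTerm A r p s

variable (hA : ∀ a, IsAPOp (A a) (n a)) (hAs : ∀ a s, star (A a s) = A a s)
  (hr : ∀ p, IntegrableOn (r p) (Set.Ioi 0))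
  (hsum : Summable fun p : ι × ι => n p.1 * ((∫ v in Set.Ioi (0 : ℝ), ‖r p v‖) * n p.2))

include hA hr in
lemma isAPOp_dressedOp (p : ι × ι) :
    IsAPOp (dressedOp A r p) ((∫ v in Set.Ioi (0 : ℝ), ‖r p v‖) * n p.2) :=
  (hA p.2).integral_comp_sub (hr p)

lemma bohrOp_dressedOp (p : ι × ι) (ν : ℝ) : (isAPOp_dressedOp hA hr p).bohrOp ν =
    (∫ v in Set.Ioi (0 : ℝ), chi (-ν) v * r p v) • (hA p.2).bohrOp ν :=
  (hA p.2).bohrOp_integral_comp_sub (hr p) ν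

include hA hr in
lemma norm_markovTerm_le (p : ι × ι) (s : ℝ) : ‖markovTerm A r p s‖ ≤
    16 * (n p.1 * ((∫ v in Set.Ioi (0 : ℝ), ‖r p v‖) * n p.2)) := by
  have hb := (isAPOp_dressedOp hA hr p).bound s
  have h1 := (norm_branchL_le false (star (dressedOp A r p s)))
  have h2 := (norm_branchL_le true (dressedOp A r p s))
  rw [norm_star] at h1
  have h3 := (norm_commutator_le (A p.1 s)).trans
    (mul_le_mul_of_nonneg_left ((hA p.1).bound s) (by norm_num : (0 : ℝ) ≤ 4))
  refine (ContinuousLinearMap.opNorm_comp_le _ _).trans ?_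
  refine (mul_le_mul h3 ((_root_.norm_sub_le _ _).trans (add_le_add (h1.trans
    (mul_le_mul_of_nonneg_left hb zero_le_two)) (h2.trans (mul_le_mul_of_nonneg_left hb zero_le_two))))
    (norm_nonneg _) (mul_nonneg (by norm_num) (hA p.1).nonneg)).trans (le_of_eq (by ring))

include hA hr in
lemma continuous_markovTerm (p : ι × ι) : Continuous (markovTerm A r p) := by
  have hb := (isAPOp_dressedOp hA hr p).continuous
  have h1 : Continuous fun s => commutator (A p.1 s) :=
    (((branchL true).continuous.comp (hA p.1).continuous).sub
      ((branchL false).continuous.comp (hA p.1).continuous))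
  exact h1.clm_comp (((branchL false).continuous.comp hb.star).sub ((branchL true).continuous.comp hb))

include hA hr hsum in
lemma hasSum_markovTerm (s : ℝ) : HasSum (fun p => markovTerm A r p s) (markovField A r s) :=
  (Summable.of_norm_bounded (hsum.mul_left 16) fun p => norm_markovTerm_le hA hr p s).hasSum

include hA hr hsum in
lemma isOperatorField_markovField : IsOperatorField (markovField A r)
    (∑' p : ι × ι, 16 * (n p.1 * ((∫ v in Set.Ioi (0 : ℝ), ‖r p v‖) * n p.2))) where
  bound s := tsum_of_norm_bounded (hsum.mul_left 16).hasSum fun p => norm_markovTerm_le hA hr p s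
  continuous ξ := by
    have h : Continuous (markovField A r) :=
      continuous_tsum (continuous_markovTerm hA hr) (hsum.mul_left 16) (norm_markovTerm_le hA hr)
    exact h.clm_apply continuous_const

include hAs in
lemma markovTerm_dyad (p : ι × ι) (s : ℝ) (x y : H) : markovTerm A r p s (dyad x y) =
    dyad (A p.1 s x) (dressedOp A r p s y) - dyad x (star (A p.1 s) (dressedOp A r p s y)) -
      (dyad (star (A p.1 s) (dressedOp A r p s x)) y - dyad (dressedOp A r p s x) (A p.1 s y)) := by
  rw [markovTerm, ContinuousLinearMap.comp_apply, sub_apply, branchL_dyad, branchL_dyad, map_sub]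
  simp only [if_true, Bool.false_eq_true, if_false, star_star, commutator_dyad, hAs]

include hAs hr hsum in
/-- The time average of the Markovian generator, as a sum over the Fourier–Bohr frequencies. -/
lemma exists_hasMean_markovField [Countable ι] : ∃ (T : Op H) (J J' : TraceClass H →L[ℂ] TraceClass H),
    HasStrongSum (fun q : (ι × ι) × ℝ => (∫ v in Set.Ioi (0 : ℝ), chi (-q.2) v * r q.1 v) •
      (star ((hA q.1.1).bohrOp q.2) * (hA q.1.2).bohrOp q.2)) T ∧
    HasStrongSum (fun q : (ι × ι) × ℝ => star (∫ v in Set.Ioi (0 : ℝ), chi (-q.2) v * r q.1 v) •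
      (star ((hA q.1.2).bohrOp q.2) * (hA q.1.1).bohrOp q.2)) (star T) ∧
    HasStrongSum (fun q : (ι × ι) × ℝ => (∫ v in Set.Ioi (0 : ℝ), chi (-q.2) v * r q.1 v) •
      sandwich ((hA q.1.2).bohrOp q.2) (star ((hA q.1.1).bohrOp q.2))) J ∧
    HasStrongSum (fun q : (ι × ι) × ℝ => star (∫ v in Set.Ioi (0 : ℝ), chi (-q.2) v * r q.1 v) •
      sandwich ((hA q.1.1).bohrOp q.2) (star ((hA q.1.2).bohrOp q.2))) J' ∧
    ∀ ξ, HasMean (fun s => markovField A r s ξ) ((J + J' - sandwich T 1 - sandwich 1 (star T)) ξ) := by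
  have hb := isAPOp_dressedOp hA hr
  have hsum' : Summable fun p : ι × ι => (∫ v in Set.Ioi (0 : ℝ), ‖r p v‖) * n p.2 * n p.1 :=
    hsum.congr fun p => mul_comm _ _
  obtain ⟨T, hT, hTm⟩ := exists_hasStrongSum_star_mul (fun p : ι × ι => hA p.1) hb hsum
  -- Exchanging the two families gives strong convergence of the adjoint series, which that of the
  -- series for `T` does not imply.
  obtain ⟨T', hT', -⟩ := exists_hasStrongSum_star_mul hb (fun p : ι × ι => hA p.1) hsum'
  obtain ⟨J, hJ, hJm⟩ := exists_hasStrongSum_sandwich hb (fun p : ι × ι => hA p.1) hsum'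
  obtain ⟨J', hJ', hJm'⟩ := exists_hasStrongSum_sandwich (fun p : ι × ι => hA p.1) hb hsum
  have hTT : T' = star T := hT.star_eq (by simpa only [star_mul, star_star] using hT')
  subst hTT
  simp only [hb, bohrOp_dressedOp hA hr, star_smul, sandwich_smul_left, sandwich_smul_right,
    smul_mul_assoc, mul_smul_comm] at hT hT' hJ hJ'
  refine ⟨T, J, J', hT, hT', hJ, hJ', ?_⟩
  have hB := isOperatorField_markovField hA hr hsum
  refine hB.hasMean_of_span_dense span_range_dyad_dense ?_
  rintro _ ⟨x, y, rfl⟩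
  have hc : ∀ p : ι × ι, ∀ x, Continuous fun s => star (A p.1 s) (dressedOp A r p s x) := fun p x =>
    (hA p.1).continuous.star.clm_apply ((hb p).ap x).continuous
  have hle : ∀ p : ι × ι, ∀ x s, ‖star (A p.1 s) (dressedOp A r p s x)‖ ≤
      n p.1 * ((∫ v in Set.Ioi (0 : ℝ), ‖r p v‖) * n p.2) * ‖x‖ := fun p x s => by
    rw [mul_assoc]
    refine (star (A p.1 s)).le_of_opNorm_le_of_le ?_ ((hb p).norm_apply_le x s)
    rw [norm_star]
    exact (hA p.1).bound s
  have hd1 : ∀ p : ι × ι, ∀ x y s, ‖dyad (A p.1 s x) (dressedOp A r p s y)‖ ≤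
      n p.1 * ((∫ v in Set.Ioi (0 : ℝ), ‖r p v‖) * n p.2) * (‖x‖ * ‖y‖) := fun p x y s =>
    (norm_dyad_le _ _).trans ((mul_le_mul ((hA p.1).norm_apply_le x s) ((hb p).norm_apply_le y s)
      (norm_nonneg _) (mul_nonneg (hA p.1).nonneg (norm_nonneg _))).trans (le_of_eq (by ring)))
  have hd2 : ∀ p : ι × ι, ∀ x y s, ‖dyad (dressedOp A r p s x) (A p.1 s y)‖ ≤
      n p.1 * ((∫ v in Set.Ioi (0 : ℝ), ‖r p v‖) * n p.2) * (‖x‖ * ‖y‖) := fun p x y s =>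
    (norm_dyad_le _ _).trans ((mul_le_mul ((hb p).norm_apply_le x s) ((hA p.1).norm_apply_le y s)
      (norm_nonneg _) (mul_nonneg (hb p).nonneg (norm_nonneg _))).trans (le_of_eq (by ring)))
  have hs1 : ∀ x s, Summable fun p : ι × ι => star (A p.1 s) (dressedOp A r p s x) := fun x s =>
    Summable.of_norm_bounded (hsum.mul_right ‖x‖) fun p => hle p x s
  have hct : ∀ x, Continuous fun s => ∑' p : ι × ι, star (A p.1 s) (dressedOp A r p s x) := fun x =>
    continuous_tsum (fun p => hc p x) (hsum.mul_right ‖x‖) fun p s => hle p x s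
  have hcd1 : Continuous fun s => ∑' p : ι × ι, dyad (A p.1 s x) (dressedOp A r p s y) :=
    continuous_tsum (fun p => continuous_dyad.comp (((hA p.1).ap x).continuous.prodMk
      ((hb p).ap y).continuous)) (hsum.mul_right _) fun p s => hd1 p x y s
  have hcd2 : Continuous fun s => ∑' p : ι × ι, dyad (dressedOp A r p s x) (A p.1 s y) :=
    continuous_tsum (fun p => continuous_dyad.comp (((hb p).ap x).continuous.prodMk
      ((hA p.1).ap y).continuous)) (hsum.mul_right _) fun p s => hd2 p x y s
  have e1 : ∀ s, markovField A r s (dyad x y) =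
      (∑' p : ι × ι, dyad (A p.1 s x) (dressedOp A r p s y)) -
        dyad x (∑' p : ι × ι, star (A p.1 s) (dressedOp A r p s y)) -
      (dyad (∑' p : ι × ι, star (A p.1 s) (dressedOp A r p s x)) y -
        ∑' p : ι × ι, dyad (dressedOp A r p s x) (A p.1 s y)) := by
    intro s
    have h0 := (hasSum_markovTerm hA hr hsum s).mapL (ContinuousLinearMap.apply ℂ _ (dyad x y))
    simp only [ContinuousLinearMap.apply_apply, markovTerm_dyad hAs] at h0
    refine h0.unique ?_
    have h1 := (Summable.of_norm_bounded (hsum.mul_right _) fun p => hd1 p x y s).hasSum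
    have h2 := (Summable.of_norm_bounded (hsum.mul_right _) fun p => hd2 p x y s).hasSum
    have h3 := (hs1 x s).hasSum.mapL (dyadL y)
    have h4 := (hs1 y s).hasSum.map
      ((isBoundedBilinearMap_dyad (H := H)).toContinuousLinearMap x) (ContinuousLinearMap.continuous _)
    exact (h1.sub h4).sub (h3.sub h2)
  have e2 : (J + J' - sandwich T 1 - sandwich 1 (star T)) (dyad x y) =
      J' (dyad x y) - dyad x (T y) - (dyad (T x) y - J (dyad x y)) := by
    rw [sub_apply, sub_apply, add_apply, sandwich_dyad, sandwich_dyad, star_star, star_one,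
      one_apply_eq_self, one_apply_eq_self]
    abel
  simp only [e1, e2]
  have m1 := (hTm x).map (hct x) ((dyadL y).restrictScalars ℝ)
  have m2 := (hTm y).map (hct y) ((isBoundedBilinearMap_dyad (H := H)).toContinuousLinearMap x)
  have hcx : Continuous fun z => dyad z y := (dyadL y).continuous
  have hcy : Continuous fun z => dyad x z :=
    ((isBoundedBilinearMap_dyad (H := H)).toContinuousLinearMap x).continuous
  exact ((hJm' x y).sub m2 hcd1 (hcy.comp (hct y))).sub
    (HasMean.sub m1 (hJm x y) (hcx.comp (hct x)) hcd2) (hcd1.sub (hcy.comp (hct y)))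
    ((hcx.comp (hct x)).sub hcd2)

end Generator

/-! ### Identification of the Markovian generator of the composite system. -/

section MarkovField

variable {H K : Type*} [NormedAddCommGroup H] [InnerProductSpace ℂ H] [CompleteSpace H]
  [NormedAddCommGroup K] [InnerProductSpace ℂ K] [CompleteSpace K]
  {HR : K →ₗ.[ℂ] K} {V : ℝ → Op K} {HS : ℝ → Op H} {t₀ : ℝ}
  {ι : Type*} {S : ι → Op H} {R : ι → Op K} {ω : TraceClass K}

variable (hV : IsUnitaryGroupOf HR V) (hu : ∀ t, propagator HS t₀ t ∈ unitary (Op H))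
  (hSR : Summable fun α => ‖S α‖ * ‖R α‖) (hS : ∀ α, IsSelfAdjoint (S α))
  (hR : ∀ α, IsSelfAdjoint (R α)) (hω : ω.op.IsPositive) (hωV : ∀ t, Commute ω.op (V t))

include hV hω hωV in
lemma summable_norm_mul_integral_correlation [Countable ι] (hres : IsWeakCouplingReservoir V S R ω) :
    Summable fun p : ι × ι => ‖S p.1‖ *
      ((∫ v in Set.Ioi (0 : ℝ), ‖correlation V R ω p.1 p.2 v‖) * ‖S p.2‖) := by
  have h := lintegral_correlation_le hV hω hωV hres
  have hm : ∀ p : ι × ι, Measurable fun v => ‖S p.1‖ₑ * ‖S p.2‖ₑ * ‖correlation V R ω p.1 p.2 v‖ₑ :=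
    fun p => (continuous_correlation hV hω p.1 p.2).measurable.enorm.const_mul _
  rw [lintegral_tsum fun p => (hm p).aemeasurable] at h
  refine (ENNReal.summable_toReal h.ne).congr fun p => ?_
  rw [lintegral_const_mul _ (continuous_correlation hV hω p.1 p.2).measurable.enorm,
    ENNReal.toReal_mul, ENNReal.toReal_mul, toReal_enorm, toReal_enorm,
    integral_norm_eq_lintegral_enorm (continuous_correlation hV hω p.1 p.2).aestronglyMeasurable]
  ring

/-- The Markovian generator of the reduced dynamics in the interaction picture. -/
def interactionGenerator (HS : ℝ → Op H) (V : ℝ → Op K) (t₀ : ℝ) (S : ι → Op H) (R : ι → Op K)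
    (ω : TraceClass K) : ℝ → TraceClass H →L[ℂ] TraceClass H :=
  markovField (fun a => interactionPicture HS t₀ (S a)) fun p => correlation V R ω p.1 p.2

lemma integral_smul_branchL {X : ℝ → Op H} {C : ℝ} (hX : Continuous X) (hC : ∀ s, ‖X s‖ ≤ C)
    {f : ℝ → ℂ} {A : Set ℝ} (hf : IntegrableOn f A) (e : Bool) (D : TraceClass H →L[ℂ] TraceClass H)
    (s : ℝ) (ξ : TraceClass H) :
    Integrable (fun v => f v • D (branchL e (X (s - v)) ξ)) (volume.restrict A) ∧
    ∫ v in A, f v • D (branchL e (X (s - v)) ξ) = D (branchL e (∫ v in A, f v • X (s - v)) ξ) := by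
  have hi : Integrable (fun v => f v • X (s - v)) (volume.restrict A) :=
    hf.smul_of_top_left (memLp_top_of_bound
      (Continuous.aestronglyMeasurable (by fun_prop)) C (ae_of_all _ fun v => hC _))
  let Λ : Op H →L[ℂ] TraceClass H := D ∘L ContinuousLinearMap.apply ℂ (TraceClass H) ξ ∘L branchL e
  have h1 : ∀ v, f v • D (branchL e (X (s - v)) ξ) = Λ (f v • X (s - v)) := fun v => by
    rw [map_smul]; rfl
  simp only [h1]
  exact ⟨Λ.integrable_comp hi, Λ.integral_comp_comm hi⟩

include hV hu hSR hS hR hω hωV in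
-- Integrating a single kernel term over the past convolves the earlier system operator with its
-- correlation function, which is `dressedOp`. Sum and integral are interchanged by the summability
-- of the norms of the correlation functions.
lemma isMarkovField_interactionGenerator [Countable ι] (hres : IsWeakCouplingReservoir V S R ω)
    (hA : ∀ a, IsAPOp (interactionPicture HS t₀ (S a)) ‖S a‖) :
    ∃ C, IsMarkovField (memoryKernel HS V t₀ S R ω) (interactionGenerator HS V t₀ S R ω) C := by
  have hr : ∀ p : ι × ι, IntegrableOn (correlation V R ω p.1 p.2) (Set.Ioi 0) := fun p =>
    (hres.integrable p.1 p.2).integrableOn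
  have hrs : ∀ p : ι × ι, IntegrableOn (fun v => star (correlation V R ω p.1 p.2 v)) (Set.Ioi 0) :=
    fun p => ((conjCLE : ℂ ≃L[ℝ] ℂ) : ℂ →L[ℝ] ℂ).integrable_comp (hr p)
  have hsum := summable_norm_mul_integral_correlation hV hω hωV hres
  refine ⟨_, isOperatorField_markovField hA hr hsum, fun s ξ => ?_⟩
  have key : ∀ p : ι × ι,
      Integrable (fun v => kernelTerm HS V t₀ S R ω p s (s - v) ξ) (volume.restrict (Set.Ioi 0)) ∧
      ∫ v in Set.Ioi (0 : ℝ), kernelTerm HS V t₀ S R ω p s (s - v) ξ =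
        markovTerm (fun a => interactionPicture HS t₀ (S a)) (fun p => correlation V R ω p.1 p.2) p s ξ := by
    intro p
    set A := fun a => interactionPicture HS t₀ (S a) with hAdef
    have h1 := integral_smul_branchL (hA p.2).continuous (hA p.2).bound (hr p) true
      (commutator (A p.1 s)) s ξ
    have h2 := integral_smul_branchL (hA p.2).continuous (hA p.2).bound (hrs p) false
      (commutator (A p.1 s)) s ξ
    have h3 : ∀ v, kernelTerm HS V t₀ S R ω p s (s - v) ξ =
        star (correlation V R ω p.1 p.2 v) • commutator (A p.1 s) (branchL false (A p.2 (s - v)) ξ) -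
        correlation V R ω p.1 p.2 v • commutator (A p.1 s) (branchL true (A p.2 (s - v)) ξ) := by
      intro v
      rw [kernelTerm, sub_sub_cancel]
      rfl
    have h4 : star (dressedOp A (fun p => correlation V R ω p.1 p.2) p s) =
        ∫ v in Set.Ioi (0 : ℝ), star (correlation V R ω p.1 p.2 v) • A p.2 (s - v) := by
      rw [dressedOp]
      refine ((starL' ℝ : Op H ≃L[ℝ] Op H).integral_comp_comm _).symm.trans ?_
      refine integral_congr_ae (ae_of_all _ fun v => ?_)
      change star (_ • _) = _
      rw [star_smul, hAdef, star_interactionPicture (hS p.2)]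
    simp only [h3]
    refine ⟨h2.1.sub h1.1, ?_⟩
    rw [integral_sub h2.1 h1.1, h1.2, h2.2, markovTerm, ContinuousLinearMap.comp_apply, sub_apply,
      map_sub, h4]
    rfl
  have h0 := (hasSum_markovTerm hA hr hsum s).mapL (ContinuousLinearMap.apply ℂ _ ξ)
  simp only [ContinuousLinearMap.apply_apply, ← (key _).2] at h0
  have h1 := hasSum_integral_of_summable_integral_norm (fun p => (key p).1) (by
    refine Summable.of_nonneg_of_le (fun p => integral_nonneg fun _ => norm_nonneg _) (fun p => ?_)
      ((hsum.mul_left 16).mul_right ‖ξ‖)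
    have h2 : ∀ v, ‖kernelTerm HS V t₀ S R ω p s (s - v) ξ‖ ≤
        16 * (‖S p.1‖ * ‖S p.2‖ * ‖correlation V R ω p.1 p.2 v‖) * ‖ξ‖ := fun v => by
      have := norm_kernelTerm_le (V := V) (S := S) (R := R) (ω := ω) hu p s (s - v)
      rw [sub_sub_cancel] at this
      exact (kernelTerm HS V t₀ S R ω p s (s - v)).le_of_opNorm_le this ξ
    refine (integral_mono (key p).1.norm ((((hr p).norm.const_mul _).const_mul 16).mul_const ‖ξ‖) h2).trans
      (le_of_eq ?_)
    rw [integral_mul_const, integral_const_mul, integral_const_mul]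
    ring)
  rw [interactionGenerator, h0.unique h1]
  exact integral_congr_ae (ae_of_all _ fun v =>
    (hasSum_kernelTerm hV hu hSR hR hω hωV hres.centred s (s - v) ξ).tsum_eq)

end MarkovField

/-! ### The GKLS form of the averaged generator. -/

section GKLS

variable {H K : Type*} [NormedAddCommGroup H] [InnerProductSpace ℂ H] [CompleteSpace H]
  [NormedAddCommGroup K] [InnerProductSpace ℂ K] [CompleteSpace K]
  {HR : K →ₗ.[ℂ] K} {V : ℝ → Op K} {HS : ℝ → Op H} {t₀ : ℝ}
  {ι κ : Type*} {S : ι → Op H} {R : ι → Op K} {ω : TraceClass K}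

lemma halfDensity_eq (α β : ι) (x : ℝ) : halfDensity V R ω α β x =
    ∫ v in Set.Ioi (0 : ℝ), chi (-x) v * correlation V R ω α β v := by
  simp only [halfDensity, exp_eq_chi]

lemma commutator_apply (A : Op H) (ρ : TraceClass H) :
    commutator A ρ = sandwich A 1 ρ - sandwich 1 A ρ := rfl

lemma gklsTerm_apply (A B : Op H) (ρ : TraceClass H) : gklsTerm A B ρ = sandwich B (star A) ρ -
    (1 / 2 : ℂ) • (sandwich (star A * B) 1 ρ + sandwich 1 (star A * B) ρ) := rfl

lemma gklsTerm_zero : gklsTerm (0 : Op H) 0 = 0 := by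
  ext1 ρ
  rw [gklsTerm_apply, star_zero, mul_zero, ← branchL_true, ← branchL_false, map_zero, map_zero,
    ← zero_smul ℂ (0 : Op H), sandwich_smul_left]
  simp

lemma HasSum.swap_fst {E α β : Type*} [AddCommMonoid E] [TopologicalSpace E] {f : (α × α) × β → E}
    {m : E} (h : HasSum f m) : HasSum (fun q : (α × α) × β => f ((q.1.2, q.1.1), q.2)) m :=
  ((Equiv.prodComm α α).prodCongr (Equiv.refl β)).hasSum_iff.2 h

variable (hV : IsUnitaryGroupOf HR V) (hR : ∀ α, IsSelfAdjoint (R α))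
  (hω : ω.op.IsPositive) (hωV : ∀ t, Commute ω.op (V t))

include hV hR hω hωV in
/-- The mean of the Markovian generator in GKLS form, as a sum over all frequencies. -/
lemma exists_lambShift_gkls [Countable ι] (hres : IsWeakCouplingReservoir V S R ω)
    (hA : ∀ a, IsAPOp (interactionPicture HS t₀ (S a)) ‖S a‖) (hS : ∀ α, IsSelfAdjoint (S α)) :
    ∃ (δH : Op H) (L : TraceClass H →L[ℂ] TraceClass H), IsSelfAdjoint δH ∧
      (∀ ψ, HasSum (fun q : (ι × ι) × ℝ => lambShift V R ω q.1.1 q.1.2 q.2 •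
        star ((hA q.1.1).bohrOp q.2) ((hA q.1.2).bohrOp q.2 ψ)) (δH ψ)) ∧
      (∀ ρ, HasSum (fun q : (ι × ι) × ℝ => spectralDensity V R ω q.1.1 q.1.2 q.2 •
        gklsTerm ((hA q.1.1).bohrOp q.2) ((hA q.1.2).bohrOp q.2) ρ) (L ρ + I • commutator δH ρ)) ∧
      ∀ ξ, HasMean (fun s => interactionGenerator HS V t₀ S R ω s ξ) (L ξ) := by
  have hsum := summable_norm_mul_integral_correlation hV hω hωV hres
  obtain ⟨T, J, J', hT, hT', hJ, hJ', hL⟩ := exists_hasMean_markovField hA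
    (fun a s => star_interactionPicture (hS a) s)
    (fun p : ι × ι => (hres.integrable p.1 p.2).integrableOn) hsum
  simp only [← halfDensity_eq] at hT hT' hJ hJ'
  have t1 : ∀ ψ, HasSum (fun q : (ι × ι) × ℝ => halfDensity V R ω q.1.1 q.1.2 q.2 •
      star ((hA q.1.1).bohrOp q.2) ((hA q.1.2).bohrOp q.2 ψ)) (T ψ) := fun ψ =>
    (hT.hasSum ψ).congr_fun fun q => by rw [smul_apply, mul_apply_eq_comp]
  have t2 : ∀ ψ, HasSum (fun q : (ι × ι) × ℝ => star (halfDensity V R ω q.1.2 q.1.1 q.2) •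
      star ((hA q.1.1).bohrOp q.2) ((hA q.1.2).bohrOp q.2 ψ)) (star T ψ) := fun ψ =>
    (HasSum.swap_fst (hT'.hasSum ψ)).congr_fun fun q => by rw [smul_apply, mul_apply_eq_comp]
  have l1 := hT.sandwich_left
  have l2 : ∀ ρ, HasSum (fun q : (ι × ι) × ℝ => sandwich (star (halfDensity V R ω q.1.2 q.1.1 q.2) •
      (star ((hA q.1.1).bohrOp q.2) * (hA q.1.2).bohrOp q.2)) 1 ρ) (sandwich (star T) 1 ρ) := fun ρ =>
    (HasSum.swap_fst (hT'.sandwich_left ρ)).congr_fun fun q => rfl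
  have r1 := hT'.sandwich_right
  have r2 : ∀ ρ, HasSum (fun q : (ι × ι) × ℝ => sandwich 1 (star (halfDensity V R ω q.1.2 q.1.1 q.2 •
      (star ((hA q.1.2).bohrOp q.2) * (hA q.1.1).bohrOp q.2))) ρ) (sandwich 1 (star T) ρ) := fun ρ =>
    (HasSum.swap_fst (hT.sandwich_right ρ)).congr_fun fun q => rfl
  have j1 : ∀ ρ, HasSum (fun q : (ι × ι) × ℝ => halfDensity V R ω q.1.1 q.1.2 q.2 •
      sandwich ((hA q.1.2).bohrOp q.2) (star ((hA q.1.1).bohrOp q.2)) ρ) (J ρ) := fun ρ =>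
    (hJ.hasSum ρ).congr_fun fun q => by rw [smul_apply]
  have j2 : ∀ ρ, HasSum (fun q : (ι × ι) × ℝ => star (halfDensity V R ω q.1.2 q.1.1 q.2) •
      sandwich ((hA q.1.2).bohrOp q.2) (star ((hA q.1.1).bohrOp q.2)) ρ) (J' ρ) := fun ρ =>
    (HasSum.swap_fst (hJ'.hasSum ρ)).congr_fun fun q => by rw [smul_apply]
  -- The Lamb shift is the imaginary part of `T`; its real part yields the anticommutator.
  have hsa : IsSelfAdjoint ((1 / (2 * I) : ℂ) • (T - star T)) := by
    rw [IsSelfAdjoint, star_smul, star_sub, star_star, ← neg_sub T, smul_neg, ← neg_smul]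
    congr 1
    rw [RCLike.star_def, map_div₀, map_mul, map_one, conj_I, map_ofNat, mul_neg, div_neg, neg_neg]
  have hlamb : ∀ ψ, HasSum (fun q : (ι × ι) × ℝ => lambShift V R ω q.1.1 q.1.2 q.2 •
      star ((hA q.1.1).bohrOp q.2) ((hA q.1.2).bohrOp q.2 ψ))
      (((1 / (2 * I) : ℂ) • (T - star T)) ψ) := by
    intro ψ
    have h := ((t1 ψ).sub (t2 ψ)).const_smul (1 / (2 * I) : ℂ)
    rw [smul_apply, sub_apply]
    refine h.congr_fun fun q => ?_
    rw [lambShift, ← sub_smul, smul_smul]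
    congr 1
    ring
  have hgkls : ∀ ρ, HasSum (fun q : (ι × ι) × ℝ => spectralDensity V R ω q.1.1 q.1.2 q.2 •
      gklsTerm ((hA q.1.1).bohrOp q.2) ((hA q.1.2).bohrOp q.2) ρ)
      ((J + J' - sandwich T 1 - sandwich 1 (star T)) ρ +
        I • commutator ((1 / (2 * I) : ℂ) • (T - star T)) ρ) := by
    intro ρ
    have h := ((j1 ρ).add (j2 ρ)).sub ((((l1 ρ).add (l2 ρ)).add ((r1 ρ).add (r2 ρ))).const_smul
      (1 / 2 : ℂ))
    -- With `T = ½ (T + T†) + i δH`, the loss terms `-Tρ - ρT†` are minus half the anticommutator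
    -- with `T + T†`, plus `-i[δH, ρ]`. The jump terms `J` and `J'` combine `Γ` and its conjugate
    -- transpose into the spectral density.
    have hv : (J ρ + J' ρ) - (1 / 2 : ℂ) • ((sandwich T 1 ρ + sandwich (star T) 1 ρ) +
        (sandwich 1 (star (star T)) ρ + sandwich 1 (star T) ρ)) =
        (J + J' - sandwich T 1 - sandwich 1 (star T)) ρ +
          I • commutator ((1 / (2 * I) : ℂ) • (T - star T)) ρ := by
      have hI : I * (1 / (2 * I)) = 1 / 2 := by
        field_simp
      have h1 : commutator ((1 / (2 * I) : ℂ) • (T - star T)) ρ = (1 / (2 * I) : ℂ) •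
          ((sandwich T 1 ρ - sandwich (star T) 1 ρ) - (sandwich 1 T ρ - sandwich 1 (star T) ρ)) := by
        rw [commutator_apply, ← branchL_true, ← branchL_false, map_smul, map_smul, map_sub, map_sub]
        rw [smul_apply, smul_apply, sub_apply, sub_apply, ← smul_sub]
        rfl
      rw [h1, smul_smul, hI, star_star, sub_apply, sub_apply, add_apply]
      module
    rw [hv] at h
    refine h.congr_fun fun q => ?_
    rw [spectralDensity_eq hV hω hωV hR hres.integrable, gklsTerm_apply]
    simp only [sandwich_smul_left, sandwich_smul_right, star_smul, star_mul, star_star, smul_apply]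
    module
  exact ⟨_, _, hsa, hlamb, hgkls, hL⟩

end GKLS

/-! ### Reindexing real frequencies by quasifrequencies and harmonics. -/

section Floquet

variable {H K : Type*} [NormedAddCommGroup H] [InnerProductSpace ℂ H] [CompleteSpace H]
  {HS : ℝ → Op H} {t₀ T : ℝ} {Hbar : Op H}
  {ι κ : Type*} {φ : HilbertBasis κ ℂ H} {ε : κ → ℝ}

lemma HilbertBasis.op_eq_zero {A : Op H} (h : ∀ k l, inner ℂ (φ k) (A (φ l)) = 0) : A = 0 := by
  refine ContinuousLinearMap.ext_on (s := Set.range φ)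
    (Submodule.dense_iff_topologicalClosure_eq_top.2 φ.dense_span) ?_
  rintro _ ⟨l, rfl⟩
  refine φ.repr.injective ?_
  ext k
  rw [φ.repr_apply_apply, h, zero_apply, map_zero]
  rfl

variable (ε T) in
/-- The frequency `w + q Ω`. -/
def floquetIndex (i : ι × ι × quasifrequencies ε × ℤ) : (ι × ι) × ℝ :=
  ((i.1, i.2.1), i.2.2.1 + i.2.2.2 * (2 * Real.pi / T))

/-- Non-resonance: if two frequencies `w + qΩ` agree, then so do the quasifrequencies, and then the
harmonics because `Ω ≠ 0`. -/
lemma injective_floquetIndex (hT : 0 < T)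
    (hnr : ∀ w ∈ quasifrequencies ε, ∀ w' ∈ quasifrequencies ε, w ≠ w' →
      ∀ m : ℤ, w - w' + m * (2 * Real.pi / T) ≠ 0) :
    Function.Injective (floquetIndex (ι := ι) T ε) := by
  rintro ⟨a, b, ⟨w, hw⟩, q⟩ ⟨a', b', ⟨w', hw'⟩, q'⟩ h
  simp only [floquetIndex, Prod.mk.injEq] at h
  obtain ⟨⟨rfl, rfl⟩, h⟩ := h
  have hww : w = w' := by
    by_contra hne
    refine hnr w hw w' hw' hne (q - q') ?_
    push_cast
    linarith
  subst hww
  have hΩ : 2 * Real.pi / T ≠ 0 := by positivity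
  have hq := mul_right_cancel₀ hΩ (add_left_cancel h)
  have hqq : q = q' := by exact_mod_cast hq
  rw [hqq]

variable {D : Set ℝ} (hHS : ∀ t, IsSelfAdjoint (HS t)) (hD : D.Countable)
    (hc : ∀ t ∉ D, ContinuousAt HS t) (hper : Function.Periodic HS T) (hT : 0 < T)
    (hU : IsFundamentalSolution (fun t => (-I) • HS t) t₀ (propagator HS t₀))
    (hFl : IsAveragedHamiltonian HS t₀ T Hbar φ ε)

open Classical in
/-- The components `S(w, q)` of an almost periodic operator. -/
def floquetComponent {A : ℝ → Op H} {C : ℝ} (hA : IsAPOp A C) (ε : κ → ℝ) (T w : ℝ) (q : ℤ) : Op H :=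
  if w ∈ quasifrequencies ε then hA.bohrOp (w + q * (2 * Real.pi / T)) else 0

include hHS hD hc hper hT hU hFl in
-- A matrix element survives at frequency `w + qΩ` only if `ε k - ε l` differs from `w` by a
-- multiple of `Ω`, and by non-resonance only if they are equal. When `w` is not a quasifrequency
-- the zero operator has the required matrix elements.
lemma isBohrComponent_floquetComponent {S : Op H} (hA : IsAPOp (interactionPicture HS t₀ S) ‖S‖)
    (hnr : ∀ w ∈ quasifrequencies ε, ∀ w' ∈ quasifrequencies ε, w ≠ w' →
      ∀ m : ℤ, w - w' + m * (2 * Real.pi / T) ≠ 0) (w : ℝ) (q : ℤ) :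
    IsBohrComponent φ ε (fourierComponent HS t₀ T Hbar S q) w (floquetComponent hA ε T w q) := by
  refine ⟨fun k l hkl => ?_, fun k l hkl => ?_⟩
  · rw [floquetComponent, if_pos ⟨k, l, hkl.symm⟩]
    exact inner_bohrOp_eq_fourierComponent hHS hD hc hper hT hU hFl hA (by rw [hkl])
  · rw [floquetComponent]
    split_ifs with hw
    · refine inner_bohrOp_eq_zero hHS hD hc hper hT hU hFl hA fun q' hq' => ?_
      refine hnr w hw _ ⟨k, l, rfl⟩ (Ne.symm hkl) (q - q') ?_
      push_cast
      linarith
    · rw [zero_apply, inner_zero_right]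

include hHS hD hc hper hT hU hFl in
lemma bohrOp_eq_zero_of_notMem {S : Op H} (hA : IsAPOp (interactionPicture HS t₀ S) ‖S‖) {ν : ℝ}
    (hν : ∀ w ∈ quasifrequencies ε, ∀ q : ℤ, ν ≠ w + q * (2 * Real.pi / T)) : hA.bohrOp ν = 0 :=
  HilbertBasis.op_eq_zero (φ := φ) fun k l => inner_bohrOp_eq_zero hHS hD hc hper hT hU hFl hA
    fun q => hν _ ⟨k, l, rfl⟩ q

include hHS hD hc hper hT hU hFl in
-- The indexing map is injective, and components at frequencies outside its range vanish, so both
-- series have the same nonzero terms.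
lemma hasSum_floquetIndex_iff {S : ι → Op H} (hA : ∀ a, IsAPOp (interactionPicture HS t₀ (S a)) ‖S a‖)
    (hnr : ∀ w ∈ quasifrequencies ε, ∀ w' ∈ quasifrequencies ε, w ≠ w' →
      ∀ m : ℤ, w - w' + m * (2 * Real.pi / T) ≠ 0) {E : Type*} [AddCommMonoid E] [TopologicalSpace E]
    {F : ι → ι → ℝ → Op H → Op H → E} (hF : ∀ a b x, F a b x 0 0 = 0) {m : E} :
    HasSum (fun i : ι × ι × quasifrequencies ε × ℤ => F i.1 i.2.1
      (i.2.2.1 + i.2.2.2 * (2 * Real.pi / T)) (floquetComponent (hA i.1) ε T i.2.2.1 i.2.2.2)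
      (floquetComponent (hA i.2.1) ε T i.2.2.1 i.2.2.2)) m ↔
    HasSum (fun q : (ι × ι) × ℝ => F q.1.1 q.1.2 q.2 ((hA q.1.1).bohrOp q.2)
      ((hA q.1.2).bohrOp q.2)) m := by
  rw [← (injective_floquetIndex (ι := ι) hT hnr).hasSum_iff]
  · refine iff_of_eq (congrArg (HasSum · m) (funext fun i => ?_))
    rw [floquetComponent, floquetComponent, if_pos i.2.2.1.2, if_pos i.2.2.1.2]
    rfl
  · rintro ⟨⟨a, b⟩, ν⟩ hν
    have h : ∀ a, (hA a).bohrOp ν = 0 := fun c =>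
      bohrOp_eq_zero_of_notMem hHS hD hc hper hT hU hFl (hA c) fun w hw q hq =>
        hν ⟨(a, b, ⟨w, hw⟩, q), by rw [hq]; rfl⟩
    simp only [h, hF]

end Floquet

/-! ### Weak-coupling limit, complete positivity, reduced dynamics. -/

section Limit

variable {H K : Type*} [NormedAddCommGroup H] [InnerProductSpace ℂ H] [CompleteSpace H]
  [NormedAddCommGroup K] [InnerProductSpace ℂ K] [CompleteSpace K]
  {HR : K →ₗ.[ℂ] K} {V : ℝ → Op K} {HS : ℝ → Op H} {t₀ : ℝ}
  {ι : Type*} {S : ι → Op H} {R : ι → Op K} {ω : TraceClass K}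

lemma isCPTP_one : IsCPTP (1 : TraceClass H →L[ℂ] TraceClass H) :=
  ⟨fun _ _ hX ψ => hX ψ, fun _ => rfl⟩

/-- Along this path `lam² t` stays equal to `s`, so the limit of the reduced dynamics is the
semigroup at the fixed time `s`. -/
lemma tendsto_prodMk_div_sq_weakCoupling {s : ℝ} (hs : 0 < s) :
    Tendsto (fun lam : ℝ => (lam, s / lam ^ 2)) (𝓝[≠] 0) (weakCoupling s) := by
  refine tendsto_inf.2 ⟨tendsto_comap_iff.2 tendsto_id, tendsto_principal.2 ?_⟩
  filter_upwards [self_mem_nhdsWithin] with lam hlam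
  have h : 0 < lam ^ 2 := by
    have : lam ≠ 0 := hlam
    positivity
  exact ⟨div_pos hs h, (mul_div_cancel₀ s h.ne').le⟩

variable (hV : IsUnitaryGroupOf HR V) (hu : ∀ t, propagator HS t₀ t ∈ unitary (Op H))
  (hUc : Continuous (propagator HS t₀)) (hSR : Summable fun α => ‖S α‖ * ‖R α‖)
  (hS : ∀ α, IsSelfAdjoint (S α)) (hR : ∀ α, IsSelfAdjoint (R α))
  (hωV : ∀ t, Commute ω.op (V t))

include hV hu hUc hSR hS hR hωV in
/-- The semigroup of the weak-coupling limit is completely positive and trace preserving. -/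
lemma isCPTP_exp [Countable ι] (hω : IsDensity ω) (hres : IsWeakCouplingReservoir V S R ω)
    {B : ℝ → TraceClass H →L[ℂ] TraceClass H} {C : ℝ}
    (hB : IsMarkovField (memoryKernel HS V t₀ S R ω) B C)
    {L : TraceClass H →L[ℂ] TraceClass H} (hL : ∀ ξ, HasMean (fun s => B s ξ) (L ξ))
    {s : ℝ} (hs : 0 ≤ s) : IsCPTP (NormedSpace.exp ((s : ℂ) • L)) := by
  rcases hs.eq_or_lt with rfl | hs
  · rw [ofReal_zero, zero_smul, NormedSpace.exp_zero]
    exact isCPTP_one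
  have hF := isHamiltonianField_interactionField hV hu hUc hSR hS hR
  choose Z hZ0 hZ using hF.exists_evolution
  -- The semigroup is a strong limit of reduced dynamics, which are completely positive and trace
  -- preserving. The GKLS form and the sign of the spectral density are not used.
  refine IsCPTP.of_tendsto (l := 𝓝[≠] (0 : ℝ)) (Φ := fun lam => reducedMap (Z lam (s / lam ^ 2)) ω)
    (fun ρ => ?_) (Eventually.of_forall fun lam =>
      isCPTP_reducedMap (hF.star_mul_self (hZ0 lam) (hZ lam) _) hω)
  have h := (tendsto_reducedState hV hu hUc hSR hS hR hωV hω hres hB hL hZ0 hZ ρ s).comp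
    (tendsto_prodMk_div_sq_weakCoupling hs)
  refine tendsto_sub_nhds_zero_iff.1 (h.congr' ?_)
  filter_upwards [self_mem_nhdsWithin] with lam hlam
  have h2 : lam ^ 2 ≠ 0 := pow_ne_zero 2 hlam
  rw [Function.comp_apply, mul_div_cancel₀ s h2]
  rfl

include hV hu in
-- Of the free flow, the reservoir factor disappears under the partial trace and the system factor
-- acts as conjugation by the propagator.
lemma reducedMap_eq_conjBy_reducedState (W : ℝ → Op (HTensor H K)) (s : ℝ) (ρ : TraceClass H) :
    reducedMap (W (t₀ + s)) ω ρ = conjBy (propagator HS t₀ (t₀ + s))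
      (reducedState ω (interactionEvolution HS V t₀ W) ρ s) := by
  have h1 := eq_freeFlow_mul_interactionEvolution hV hu W s
  rw [reducedMap, ContinuousLinearMap.comp_apply, ContinuousLinearMap.comp_apply, h1, star_mul,
    ← sandwich_sandwich, freeFlow_eq, star_opTensor,
    ptr_sandwich_opTensor _ _ (Unitary.mem_iff.1 (hV.unitary s)).1]
  rfl

include hV hu in
lemma star_mul_self_compositeEvolution {W : ℝ → Op (HTensor H K)} {s : ℝ}
    (h : star (interactionEvolution HS V t₀ W s) * interactionEvolution HS V t₀ W s = 1) :
    star (W (t₀ + s)) * W (t₀ + s) = 1 := by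
  rw [eq_freeFlow_mul_interactionEvolution hV hu W s, star_mul, mul_assoc,
    ← mul_assoc (star (freeFlow HS V t₀ s)), (Unitary.mem_iff.1 (freeFlow_mem_unitary hV hu s)).1,
    one_mul, h]

include hV hu hUc hSR hS hR hωV in
/-- The weak-coupling limit of the reduced dynamics. -/
lemma exists_reducedDynamics [Countable ι] (hω : IsDensity ω) (hres : IsWeakCouplingReservoir V S R ω)
    (hU0 : propagator HS t₀ t₀ = 1) {B : ℝ → TraceClass H →L[ℂ] TraceClass H} {C : ℝ}
    (hB : IsMarkovField (memoryKernel HS V t₀ S R ω) B C)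
    {L : TraceClass H →L[ℂ] TraceClass H} (hL : ∀ ξ, HasMean (fun s => B s ξ) (L ξ))
    {W : ℝ → ℝ → Op (HTensor H K)}
    (hW : ∀ lam, IsCompositeEvolution HS V (interaction S R) t₀ lam (W lam)) :
    ∃ Φ : ℝ → ℝ → TraceClass H →L[ℂ] TraceClass H,
      (∀ lam t, t₀ ≤ t → IsCPTP (Φ lam t) ∧ ∀ ρ : TraceClass H, (Φ lam t ρ).op =
        partialTrace (W lam t * opTensor ρ.op ω.op * star (W lam t))) ∧
      ∀ (ρ : TraceClass H) (τ δ : ℝ), 0 < δ → ∃ lam₀ : ℝ, 0 < lam₀ ∧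
        ∀ lam : ℝ, lam ≠ 0 → |lam| < lam₀ → ∀ t, t₀ ≤ t → lam ^ 2 * (t - t₀) ≤ τ →
          ‖Φ lam t ρ - dynamicalMap HS t₀ (((lam ^ 2 : ℝ) : ℂ) • L) t ρ‖ ≤ δ := by
  have hF := isHamiltonianField_interactionField hV hu hUc hSR hS hR
  have hZ0 : ∀ lam, interactionEvolution HS V t₀ (W lam) 0 = 1 := fun lam =>
    interactionEvolution_zero hV hU0 (hW lam).1
  have hZ : ∀ lam x, IsSchroedingerSolution (interactionField HS V t₀ S R) lam
      fun t => interactionEvolution HS V t₀ (W lam) t x := fun lam x =>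
    isSchroedingerSolution_interactionEvolution hV hu (hW lam) x
  refine ⟨fun lam t => reducedMap (W lam t) ω, fun lam t _ => ⟨isCPTP_reducedMap ?_ hω,
    reducedMap_op _ _⟩, fun ρ τ δ hδ => ?_⟩
  · have h := star_mul_self_compositeEvolution hV hu (hF.star_mul_self (hZ0 lam) (hZ lam) (t - t₀))
    rwa [add_sub_cancel] at h
  have h := tendsto_reducedState hV hu hUc hSR hS hR hωV hω hres hB hL hZ0 hZ ρ τ
  obtain ⟨lam₀, hlam₀, h1⟩ := (tendsto_weakCoupling_iff (F := fun lam t =>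
    reducedState ω (interactionEvolution HS V t₀ (W lam)) ρ t -
      NormedSpace.exp (((lam ^ 2 * t : ℝ) : ℂ) • L) ρ)).1 h δ hδ
  refine ⟨lam₀, hlam₀, fun lam hlam hlt t ht htτ => ?_⟩
  obtain ⟨s, rfl⟩ : ∃ s, t = t₀ + s := ⟨t - t₀, by ring⟩
  rw [add_sub_cancel_left] at htτ
  have h2 : dynamicalMap HS t₀ (((lam ^ 2 : ℝ) : ℂ) • L) (t₀ + s) ρ =
      conjBy (propagator HS t₀ (t₀ + s)) (NormedSpace.exp (((lam ^ 2 * s : ℝ) : ℂ) • L) ρ) := by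
    rw [dynamicalMap, mul_apply_eq_comp, add_sub_cancel_left, smul_smul, ← ofReal_mul, mul_comm s]
  rw [reducedMap_eq_conjBy_reducedState hV hu, h2, ← map_sub]
  refine ((conjBy _).le_of_opNorm_le (norm_conjBy_le (hu _)) _).trans ?_
  rw [one_mul]
  -- The initial time is not covered by `weakCoupling`; there both evolutions are the identity.
  rcases (by linarith : 0 ≤ s).eq_or_lt with rfl | hs
  · have h3 : reducedState ω (interactionEvolution HS V t₀ (W lam)) ρ 0 = ρ := by
      rw [reducedState, hZ0, star_one, sandwich_one_one, one_apply_eq_self, ptr_tensL, traceL_apply,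
        hω.2, one_smul]
    rw [h3, mul_zero, ofReal_zero, zero_smul, NormedSpace.exp_zero, one_apply_eq_self, sub_self,
      norm_zero]
    exact hδ.le
  · exact h1 lam hlam hlt s hs htτ

end Limit

end OpenFloquet

end

/-! ### The theorem. -/

open OpenFloquet in
theorem theorem2
    {H K : Type*} [NormedAddCommGroup H] [InnerProductSpace ℂ H] [CompleteSpace H]
    [NormedAddCommGroup K] [InnerProductSpace ℂ K] [CompleteSpace K]
    {ι κ : Type*} [Countable ι]
    -- the coupling
    (S : ι → Op H) (R : ι → Op K)
    (hS : ∀ α, IsSelfAdjoint (S α)) (hR : ∀ α, IsSelfAdjoint (R α))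
    (hSR : Summable fun α => ‖S α‖ * ‖R α‖)
    -- the reservoir
    (HR : K →ₗ.[ℂ] K) (hHR : IsSelfAdjoint HR)
    (V : ℝ → Op K) (hV : IsUnitaryGroupOf HR V)
    (ω : TraceClass K) (hω : IsDensity ω) (hωV : ∀ t, Commute ω.op (V t))
    (hres : IsWeakCouplingReservoir V S R ω)
    -- the driven system
    (T : ℝ) (hT : 0 < T) (HS : ℝ → Op H) (hHS : ∀ t, IsSelfAdjoint (HS t))
    (hper : Function.Periodic HS T) (hpc : PiecewiseContinuous HS)
    (t₀ : ℝ) (Hbar : Op H) (φ : HilbertBasis κ ℂ H) (ε : κ → ℝ)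
    (hFl : IsAveragedHamiltonian HS t₀ T Hbar φ ε)
    (hnr : ∀ w ∈ quasifrequencies ε, ∀ w' ∈ quasifrequencies ε, w ≠ w' →
      ∀ m : ℤ, w - w' + m * (2 * Real.pi / T) ≠ 0) :
    -- the propagator is well defined and unitary
    IsFundamentalSolution (fun t => (-I) • HS t) t₀ (propagator HS t₀) ∧
    (∀ t, propagator HS t₀ t ∈ unitary (Op H)) ∧
    ∃ (SF : ι → ℝ → ℤ → Op H) (δH : Op H) (L : TraceClass H →L[ℂ] TraceClass H),
      -- the time-independent generator `L`, in GKLS form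
      (∀ α w q, IsBohrComponent φ ε (fourierComponent HS t₀ T Hbar (S α) q) w (SF α w q)) ∧
      (∀ x : ℝ, (Matrix.of fun α β => spectralDensity V R ω α β x).PosSemidef) ∧
      IsSelfAdjoint δH ∧
      (∀ ψ : H, HasSum
        (fun i : ι × ι × quasifrequencies ε × ℤ =>
          lambShift V R ω i.1 i.2.1 (i.2.2.1 + i.2.2.2 * (2 * Real.pi / T)) •
            star (SF i.1 i.2.2.1 i.2.2.2) (SF i.2.1 i.2.2.1 i.2.2.2 ψ))
        (δH ψ)) ∧
      (∀ ρ : TraceClass H, HasSum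
        (fun i : ι × ι × quasifrequencies ε × ℤ =>
          spectralDensity V R ω i.1 i.2.1 (i.2.2.1 + i.2.2.2 * (2 * Real.pi / T)) •
            gklsTerm (SF i.1 i.2.2.1 i.2.2.2) (SF i.2.1 i.2.2.1 i.2.2.2) ρ)
        (L ρ + I • commutator δH ρ)) ∧
      (∀ s : ℝ, 0 ≤ s → IsCPTP (NormedSpace.exp ((s : ℂ) • L))) ∧
      -- the dynamical map generated by `L_t`, at coupling strength `lam`
      (∀ (lam : ℝ) (Λ : ℝ → TraceClass H →L[ℂ] TraceClass H),
        IsFundamentalSolution (lindbladian HS t₀ (((lam ^ 2 : ℝ) : ℂ) • L)) t₀ Λ ↔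
          ∀ t, Λ t = dynamicalMap HS t₀ (((lam ^ 2 : ℝ) : ℂ) • L) t) ∧
      -- the weak-coupling limit of the reduced dynamics
      (∀ lam : ℝ, ∃ W, IsCompositeEvolution HS V (interaction S R) t₀ lam W) ∧
      ∀ W : ℝ → ℝ → Op (HTensor H K),
        (∀ lam, IsCompositeEvolution HS V (interaction S R) t₀ lam (W lam)) →
        ∃ Φ : ℝ → ℝ → TraceClass H →L[ℂ] TraceClass H,
          (∀ lam t, t₀ ≤ t → IsCPTP (Φ lam t) ∧ ∀ ρ : TraceClass H, (Φ lam t ρ).op =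
            partialTrace (W lam t * opTensor ρ.op ω.op * star (W lam t))) ∧
          ∀ (ρ : TraceClass H) (τ δ : ℝ), 0 < δ → ∃ lam₀ : ℝ, 0 < lam₀ ∧
            ∀ lam : ℝ, lam ≠ 0 → |lam| < lam₀ → ∀ t, t₀ ≤ t → lam ^ 2 * (t - t₀) ≤ τ →
              ‖Φ lam t ρ - dynamicalMap HS t₀ (((lam ^ 2 : ℝ) : ℂ) • L) t ρ‖ ≤ δ := by
  obtain ⟨D, hD, hc⟩ := hpc.exists_countable
  obtain ⟨C, hC⟩ := hpc.exists_bound hT hper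
  have hU := isFundamentalSolution_propagator (t₀ := t₀) hD hc hC
  have hu := mem_unitary_of_isFundamentalSolution hHS hD hc hU
  have hA := fun a => isAPOp_interactionPicture hHS hD hc hper hT hU hu hFl (hS a)
  -- One and the same field provides the Markov approximation here and, through its mean `L` in the
  -- next line, the GKLS form. This links the explicit generator to the limit of the reduced
  -- dynamics.
  obtain ⟨C', hB⟩ := isMarkovField_interactionGenerator hV hu hSR hS hR hω.1 hωV hres hA
  obtain ⟨δH, L, hδH, hlamb, hgkls, hL⟩ := exists_lambShift_gkls hV hR hω.1 hωV hres hA hS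
  refine ⟨hU, hu, fun a w q => floquetComponent (hA a) ε T w q, δH, L,
    fun a w q => isBohrComponent_floquetComponent hHS hD hc hper hT hU hFl (hA a) hnr w q,
    posSemidef_spectralDensity hV hω.1 hωV hR hres.integrable, hδH, fun ψ => ?_, fun ρ => ?_,
    fun s hs => isCPTP_exp hV hu hU.1 hSR hS hR hωV hω hres hB hL hs,
    fun lam Λ => isFundamentalSolution_lindbladian_iff hHS hD hc hC _ Λ,
    exists_isCompositeEvolution hV hu hU.1 hSR hS hR hU.2.1,
    fun W hW => exists_reducedDynamics hV hu hU.1 hSR hS hR hωV hω hres hU.2.1 hB hL hW⟩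
  · exact (hasSum_floquetIndex_iff hHS hD hc hper hT hU hFl hA hnr
      (F := fun a b x A B => lambShift V R ω a b x • star A (B ψ)) (fun a b x => by simp)).2 (hlamb ψ)
  · exact (hasSum_floquetIndex_iff hHS hD hc hper hT hU hFl hA hnr
      (F := fun a b x A B => spectralDensity V R ω a b x • gklsTerm A B ρ) (fun a b x => by
        rw [gklsTerm_zero, zero_apply, smul_zero])).2 (hgkls ρ)
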